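/- Let $L,h,\nu,\alpha,f>0$, $\mathbb T=\mathbb R/L\mathbb Z$, $\Omega=\mathbb T\times(0,h)$ with coordinates $(x,z)$, $\nabla=(\partial_x,\partial_z)$, $\Delta=\partial_x^2+\partial_z^2$. Let $\delta,\Psi\in C^2(\overline\Omega)$ be real-valued with $\Delta\Psi=0$ in $\Omega$, let $a_0,a_1\in\mathbb R$, and let $\rho_s\in C^1(\overline\Omega)$, $p_s\in C^2(\overline\Omega)$ satisfy $$\nabla\rho_s=\delta\nabla\Psi,\qquad \Delta p_s=-\delta|\nabla\Psi|^2,\qquad v_s=a_0x+a_1,\qquad p_0=\tfrac{fa_0}{2}x^2+fa_1x,$$ $$fv_s-\partial_x(p_s+p_0)=\rho_s\,\partial_x\Psi,\qquad -\partial_z(p_s+p_0)=\rho_s\,\partial_z\Psi ,$$ so that $(\rho_s,v_s,\mathbf 0,p_s+p_0)$ is a steady state of the two-dimensional rotating Boussinesq system with viscosity $\nu$ in the $(x,z)$-velocity $\mathbf u=(u,w)$ and no viscosity in $v$. Its linearization at this state is $$\partial_t\rho=-\delta\,\mathbf u\cdot\nabla\Psi,\quad \partial_t v=-(f+a_0)u,\quad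 \partial_t\mathbf u=\nu\Delta\mathbf u+fv\,\mathbf e_1-\nabla p-\rho\nabla\Psi,\quad \nabla\cdot\mathbf u=0\qquad\text{in }\Omega,\tag{1}$$ $$\partial_zu=w=0\ \text{ on } z=h,\qquad \alpha u-\partial_zu=w=0\ \text{ on } z=0 .\tag{2}$$ A normal mode with eigenvalue $\lambda$ consists of fields $\rho,v,u,w\in C^1(\overline\Omega)$ with $u,w\in C^2(\Omega)$, and $p\in C^1(\Omega)\cap C(\overline\Omega)$, that satisfy (2), have $\mathbf u\not\equiv0$, and satisfy (1) with $\partial_t$ replaced by multiplication by $\lambda$. 1. If $\delta(x_0,z_0)>0$ at some point $(x_0,z_0)\in\Omega$ and $f+a_0\le0$ (and, in the case $f+a_0=0$, $\Psi$ is not constant), then the steady state is linearly unstable: there is a real-valued normal mode with a real eigenvalue $\lambda>0$. 2. If $\delta<\delta_0$ in $\Omega$ for some constant $\delta_0<0$, and $f+a_0>0$, then the steady state is linearly stable: every eigenvalue $\lambda\in\mathbb C$ of a complex-valued normal mode satisfies $\operatorname{Re}\lambda<0$ (in particular all real eigenvalues are negative), and there is a constant $C$ such that every real classical solution of (1)–(2)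 on $[0,\infty)$ satisfies, for all $t\ge0$, $$\|(\rho,v,\mathbf u)(t)\|_{L^2(\Omega)}^2\le C\,\|(\rho,v,\mathbf u)(0)\|_{L^2(\Omega)}^2 .$$ Here a classical solution has $\rho,v,u,w\in C^1([0,\infty)\times\overline\Omega)$ and, for each $t>0$, $u,w\in C^2(\Omega)$ and $p\in C^1(\Omega)\cap C(\overline\Omega)$. -/

import Mathlib

open Set

noncomputable section

namespace RotatingBoussinesq

/-- The physical constants: the length `L` of the torus `𝕋 = ℝ / Lℤ` in the zonal variable `x`,
the height `h` of the layer, the viscosity `ν = ν₁ = ν₃` (while `ν₂ = 0`), the Navier-slip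
coefficient `α` and the Coriolis parameter `f`. -/
structure Params where
  (L h ν α f : ℝ)
  L_pos : 0 < L
  h_pos : 0 < h
  ν_pos : 0 < ν
  α_pos : 0 < α
  f_pos : 0 < f

/-- The domain `Ω = 𝕋 × (0,h)`, seen on its universal cover: the points `(x,z)` with `0 < z < h`.
Functions on `Ω` are functions on this strip that are `L`-periodic in `x`. -/
def Params.strip (P : Params) : Set (ℝ × ℝ) := univ ×ˢ Ioo 0 P.h

/-- The closure of `Ω`, on the universal cover. -/
def Params.closedStrip (P : Params) : Set (ℝ × ℝ) := univ ×ˢ Icc 0 P.h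

section Operators

variable {F : Type*} [NormedAddCommGroup F] [NormedSpace ℝ F]

/-- `g` is `L`-periodic in `x` on the closed strip. -/
def Params.PeriodicX (P : Params) (g : ℝ × ℝ → F) : Prop :=
  ∀ x : ℝ, ∀ z ∈ Icc 0 P.h, g (x + P.L, z) = g (x, z)

/-- `∂g/∂x`. -/
def Params.dx (_P : Params) (g : ℝ × ℝ → F) (q : ℝ × ℝ) : F :=
  deriv (fun x => g (x, q.2)) q.1

/-- `∂g/∂z`: the usual derivative for `0 < z < h`, the one-sided one from inside the domain at
`z = 0` and at `z = h`. -/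
def Params.dz (P : Params) (g : ℝ × ℝ → F) (q : ℝ × ℝ) : F :=
  derivWithin (fun z => g (q.1, z)) (Icc 0 P.h) q.2

/-- The Laplacian `∂²g/∂x² + ∂²g/∂z²`; it is only used at points of the open strip. -/
def Params.lap (P : Params) (g : ℝ × ℝ → F) (q : ℝ × ℝ) : F :=
  P.dx (P.dx g) q + P.dz (P.dz g) q

/-- The boundary conditions for the velocity `(u,w)`: stress-free and impermeable at `z = h`,
Navier-slip and impermeable at `z = 0`. -/
structure Params.BoundaryConditions (P : Params) (u w : ℝ × ℝ → F) : Prop where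
  slip_top : ∀ x : ℝ, P.dz u (x, P.h) = 0
  imp_top : ∀ x : ℝ, w (x, P.h) = 0
  slip_bot : ∀ x : ℝ, P.α • u (x, 0) - P.dz u (x, 0) = 0
  imp_bot : ∀ x : ℝ, w (x, 0) = 0

end Operators

/-- The meridional velocity `v_s = a₀ x + a₁` of the steady state. -/
def steadyV (a₀ a₁ : ℝ) (q : ℝ × ℝ) : ℝ := a₀ * q.1 + a₁

/-- The pressure `p₀ = (f a₀ / 2) x² + f a₁ x`. -/
def Params.steadyP (P : Params) (a₀ a₁ : ℝ) (q : ℝ × ℝ) : ℝ :=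
  P.f * a₀ / 2 * q.1 ^ 2 + P.f * a₁ * q.1

/-- `(ρ, v, (u,w), p) = (ρ_s, a₀ x + a₁, 0, p_s + p₀)` is a steady state with
`∇ρ_s = δ ∇Ψ` and `Δp_s = - δ |∇Ψ|²`. At zero velocity `(u,w)` the steady equations are the
geostrophic and the hydrostatic balance. -/
structure Params.IsSteadyState (P : Params) (Ψ δ : ℝ × ℝ → ℝ) (a₀ a₁ : ℝ)
    (ρs ps : ℝ × ℝ → ℝ) : Prop where
  ρs_smooth : ContDiffOn ℝ 1 ρs P.closedStrip
  ps_smooth : ContDiffOn ℝ 2 ps P.closedStrip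
  ρs_periodic : P.PeriodicX ρs
  ps_periodic : P.PeriodicX ps
  grad_ρs_x : ∀ q ∈ P.strip, P.dx ρs q = δ q * P.dx Ψ q
  grad_ρs_z : ∀ q ∈ P.strip, P.dz ρs q = δ q * P.dz Ψ q
  poisson : ∀ q ∈ P.strip, P.lap ps q = - δ q * (P.dx Ψ q ^ 2 + P.dz Ψ q ^ 2)
  geostrophic : ∀ q ∈ P.strip,
    P.f * steadyV a₀ a₁ q - P.dx (fun y => ps y + P.steadyP a₀ a₁ y) q = ρs q * P.dx Ψ q
  hydrostatic : ∀ q ∈ P.strip,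
    - P.dz (fun y => ps y + P.steadyP a₀ a₁ y) q = ρs q * P.dz Ψ q

/-- `(ρ, v, (u,w), p)` is a classical solution of the eigenvalue problem with eigenvalue `lam` for
the linearization, at the steady state `(ρs, vs, 0)`, of the rotating Boussinesq system with
`ν₂ = 0`. For `𝕜 = ℝ` the eigenvalue and the fields are real, for `𝕜 = ℂ` they are complex. -/
structure Params.IsNormalMode (P : Params) (𝕜 : Type) [RCLike 𝕜] (Ψ ρs vs : ℝ × ℝ → ℝ)
    (lam : 𝕜) (ρ v u w p : ℝ × ℝ → 𝕜) : Prop where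
  ρ_smooth : ContDiffOn ℝ 1 ρ P.closedStrip
  v_smooth : ContDiffOn ℝ 1 v P.closedStrip
  u_smooth : ContDiffOn ℝ 1 u P.closedStrip
  w_smooth : ContDiffOn ℝ 1 w P.closedStrip
  p_cont : ContinuousOn p P.closedStrip
  u_smooth_int : ContDiffOn ℝ 2 u P.strip
  w_smooth_int : ContDiffOn ℝ 2 w P.strip
  p_smooth_int : ContDiffOn ℝ 1 p P.strip
  ρ_periodic : P.PeriodicX ρ
  v_periodic : P.PeriodicX v
  u_periodic : P.PeriodicX u
  w_periodic : P.PeriodicX w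
  p_periodic : P.PeriodicX p
  eq_ρ : ∀ q ∈ P.strip, lam * ρ q = - (P.dx ρs q • u q + P.dz ρs q • w q)
  eq_v : ∀ q ∈ P.strip,
    lam * v q = - (P.dx vs q • u q + P.dz vs q • w q) - P.f • u q
  eq_u : ∀ q ∈ P.strip,
    lam * u q = P.ν • P.lap u q + P.f • v q - P.dx p q - P.dx Ψ q • ρ q
  eq_w : ∀ q ∈ P.strip,
    lam * w q = P.ν • P.lap w q - P.dz p q - P.dz Ψ q • ρ q
  div_free : ∀ q ∈ P.strip, P.dx u q + P.dz w q = 0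
  bc : P.BoundaryConditions u w

/-- `(ρ, v, (u,w), p)` is a classical solution, on the time interval `[0,∞)`, of the linearization
at the steady state `(ρs, vs, 0)` of the rotating Boussinesq system with `ν₂ = 0`. -/
structure Params.IsLinearSolution (P : Params) (Ψ ρs vs : ℝ × ℝ → ℝ)
    (ρ v u w p : ℝ → ℝ × ℝ → ℝ) : Prop where
  ρ_smooth : ContDiffOn ℝ 1 (fun y : ℝ × (ℝ × ℝ) => ρ y.1 y.2) (Ici 0 ×ˢ P.closedStrip)
  v_smooth : ContDiffOn ℝ 1 (fun y : ℝ × (ℝ × ℝ) => v y.1 y.2) (Ici 0 ×ˢ P.closedStrip)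
  u_smooth : ContDiffOn ℝ 1 (fun y : ℝ × (ℝ × ℝ) => u y.1 y.2) (Ici 0 ×ˢ P.closedStrip)
  w_smooth : ContDiffOn ℝ 1 (fun y : ℝ × (ℝ × ℝ) => w y.1 y.2) (Ici 0 ×ˢ P.closedStrip)
  p_cont : ∀ t > 0, ContinuousOn (p t) P.closedStrip
  u_smooth_int : ∀ t > 0, ContDiffOn ℝ 2 (u t) P.strip
  w_smooth_int : ∀ t > 0, ContDiffOn ℝ 2 (w t) P.strip
  p_smooth_int : ∀ t > 0, ContDiffOn ℝ 1 (p t) P.strip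
  ρ_periodic : ∀ t ≥ 0, P.PeriodicX (ρ t)
  v_periodic : ∀ t ≥ 0, P.PeriodicX (v t)
  u_periodic : ∀ t ≥ 0, P.PeriodicX (u t)
  w_periodic : ∀ t ≥ 0, P.PeriodicX (w t)
  p_periodic : ∀ t > 0, P.PeriodicX (p t)
  eq_ρ : ∀ t > 0, ∀ q ∈ P.strip,
    deriv (fun τ => ρ τ q) t = - (P.dx ρs q * u t q + P.dz ρs q * w t q)
  eq_v : ∀ t > 0, ∀ q ∈ P.strip,
    deriv (fun τ => v τ q) t = - (P.dx vs q * u t q + P.dz vs q * w t q) - P.f * u t q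
  eq_u : ∀ t > 0, ∀ q ∈ P.strip,
    deriv (fun τ => u τ q) t
      = P.ν * P.lap (u t) q + P.f * v t q - P.dx (p t) q - P.dx Ψ q * ρ t q
  eq_w : ∀ t > 0, ∀ q ∈ P.strip,
    deriv (fun τ => w τ q) t = P.ν * P.lap (w t) q - P.dz (p t) q - P.dz Ψ q * ρ t q
  div_free : ∀ t > 0, ∀ q ∈ P.strip, P.dx (u t) q + P.dz (w t) q = 0
  bc : ∀ t > 0, P.BoundaryConditions (u t) (w t)

/-- The squared `L²(Ω)` norm of `(ρ, v, u, w)`. -/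
def Params.normSq (P : Params) (ρ v u w : ℝ × ℝ → ℝ) : ℝ :=
  ∫ x in (0 : ℝ)..P.L, ∫ z in (0 : ℝ)..P.h,
    (ρ (x, z) ^ 2 + v (x, z) ^ 2 + u (x, z) ^ 2 + w (x, z) ^ 2)

/-- Linear instability: there is a growing mode, that is, a real eigenvalue `lam > 0` of the
linearization with a real eigenfunction whose velocity `(u,w)` does not vanish. -/
def Params.LinearlyUnstable (P : Params) (Ψ ρs vs : ℝ × ℝ → ℝ) : Prop :=
  ∃ lam : ℝ, 0 < lam ∧ ∃ ρ v u w p : ℝ × ℝ → ℝ,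
    P.IsNormalMode ℝ Ψ ρs vs lam ρ v u w p ∧ ∃ q ∈ P.strip, u q ≠ 0 ∨ w q ≠ 0

/-- Spectral stability: every complex eigenvalue of the linearization that has an eigenfunction
with non-zero velocity `(u,w)` has negative real part. -/
def Params.SpectrallyStable (P : Params) (Ψ ρs vs : ℝ × ℝ → ℝ) : Prop :=
  ∀ (lam : ℂ) (ρ v u w p : ℝ × ℝ → ℂ),
    P.IsNormalMode ℂ Ψ ρs vs lam ρ v u w p → (∃ q ∈ P.strip, u q ≠ 0 ∨ w q ≠ 0) → lam.re < 0

/-- Lyapunov stability of the linearized evolution in `L²(Ω)`. -/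
def Params.LyapunovStable (P : Params) (Ψ ρs vs : ℝ × ℝ → ℝ) : Prop :=
  ∃ C : ℝ, ∀ ρ v u w p : ℝ → ℝ × ℝ → ℝ, P.IsLinearSolution Ψ ρs vs ρ v u w p →
    ∀ t ≥ 0, P.normSq (ρ t) (v t) (u t) (w t) ≤ C * P.normSq (ρ 0) (v 0) (u 0) (w 0)

/-- Linear stability: the eigenvalues lie in the open left half plane, and the solutions of the
linearized problem are controlled by their initial data for all times. -/
def Params.LinearlyStable (P : Params) (Ψ ρs vs : ℝ × ℝ → ℝ) : Prop :=
  P.SpectrallyStable Ψ ρs vs ∧ P.LyapunovStable Ψ ρs vs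

end RotatingBoussinesq

end

/-! Instability. For λ > 0 the first two equations give ρ = -δ(u·∇Ψ)/λ and v = -(f+a₀)u/λ, so a
growing mode is a solenoidal velocity with λ²u = λ(νΔu - ∇p) + Bu, where B = δ ∇Ψ⊗∇Ψ + κ e₁⊗e₁ and κ
= -f(f+a₀) ≥ 0. Its weak form is symmetric, with quadratic form λ²‖u‖² + λν(dissipation + boundary
friction) - ⟨Bu,u⟩. If some test field has ⟨Bu,u⟩ > 0, this form takes negative values for small λ;
for large λ it takes none. At the supremum of the λ for which it takes negative values it is
nonnegative and, by compactness, has a kernel (`exists_pencil_kernel`). The kernel vector is a weak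
mode.

No Sobolev space is used. The unknown is the sequence of coefficients of the vorticity ω = ∂ₓw - ∂_z
u in the basis sin(βz)τ(x), together with one coefficient for the uniform zonal flow. In ℓ² of these
coefficients the dissipation is the identity minus a rank-one projection, the velocity is a compact
function of the coefficients, and the friction on z = 0 is K K* with K built from the trace
functionals (`exists_trace`).

Regularity. Tested against the basis, the weak equation becomes ν c + να (trace term) = G/ev, where
G are the sine coefficients of the curl of F = (B/λ - λ)u. Since curl F is in L² whenever the
vorticity is (`exists_curl_operator`), G is square summable. Hence ω is an absolutely convergent
Dirichlet sine series plus a lift carrying the slip condition ω = -αu on z = 0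
(`IsWeakMode.exists_expansion`). A spare weight |κ|^{1/4} in the summability makes ∇u Hölder
continuous in x. The x-Fourier coefficients of curl F then decay, and explicit bounds for the
equations Y'' = κ²Y + g away from the boundary give velocities of class C² inside
(`IsForcedVorticity.exists_interior`). The pressure is assembled mode by mode; its zero mode exists
because the mean zonal momentum balances (`mean_balance`, `exists_pressure`).

Test field. ⟨Bu,u⟩ is the integral of δ(∇Ψ·u)² + κu₁², so a velocity supported where δ > 0 serves,
as long as κ > 0 or ∇Ψ ≠ 0 at the centre of the support. When κ = 0, analyticity of the harmonic
function Ψ supplies such a centre. The stream function is a product of bumps, approximated in C¹ by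
trigonometric sums (`exists_positive_field`).

Stability. With δ < 0 and f+a₀ > 0 the energy density |u|² + f/(f+a₀)|v|² + |ρ|²/(-δ) makes all
exchange terms cancel, leaving only viscous dissipation and friction (`stokes_energy`). For a mode
this reads Re λ · E + ν D + να ∫|u(x,0)|² = 0, which for Re λ ≥ 0 forces the velocity to vanish. For
a solution E is nonincreasing, and E is comparable to the squared L² norm. -/

namespace RotatingBoussinesq

open Filter Topology

/-! ### Series along orthogonal families in Hilbert space. -/

section Synthesis

variable {ι E : Type*} [NormedAddCommGroup E] [InnerProductSpace ℝ E]

theorem norm_sq_sum_of_pairwise_orthogonal {f : ι → E}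
    (hf : Pairwise fun i j => inner ℝ (f i) (f j) = 0) (c : ι → ℝ) (s : Finset ι) :
    ‖∑ i ∈ s, c i • f i‖ ^ 2 = ∑ i ∈ s, c i ^ 2 * ‖f i‖ ^ 2 := by
  classical
  rw [← real_inner_self_eq_norm_sq, sum_inner]
  refine Finset.sum_congr rfl fun i hi => ?_
  rw [inner_sum, Finset.sum_eq_single i]
  · rw [real_inner_smul_left, real_inner_smul_right, real_inner_self_eq_norm_sq]; ring
  · intro j _ hj
    rw [real_inner_smul_left, real_inner_smul_right, hf hj.symm]; simp
  · intro h; exact absurd hi h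

theorem lp_two_summable_sq (c : lp (fun _ : ι => ℝ) 2) : Summable fun i => c i ^ 2 := by
  have := (lp.memℓp c).summable (by norm_num)
  simpa using this

theorem lp_two_norm_sq (c : lp (fun _ : ι => ℝ) 2) : ‖c‖ ^ 2 = ∑' i, c i ^ 2 := by
  rw [← real_inner_self_eq_norm_sq, lp.inner_eq_tsum]
  simp [pow_two]

theorem lp_two_sum_sq_le (c : lp (fun _ : ι => ℝ) 2) (s : Finset ι) :
    ∑ i ∈ s, c i ^ 2 ≤ ‖c‖ ^ 2 := by
  rw [lp_two_norm_sq]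
  exact (lp_two_summable_sq c).sum_le_tsum s fun i _ => sq_nonneg _

theorem norm_sq_sum_le {f : ι → E}
    (hf : Pairwise fun i j => inner ℝ (f i) (f j) = 0) {C : ℝ} (hC : ∀ i, ‖f i‖ ≤ C)
    (c : ι → ℝ) (s : Finset ι) :
    ‖∑ i ∈ s, c i • f i‖ ^ 2 ≤ C ^ 2 * ∑ i ∈ s, c i ^ 2 := by
  rw [norm_sq_sum_of_pairwise_orthogonal hf, Finset.mul_sum]
  refine Finset.sum_le_sum fun i _ => ?_
  rw [mul_comm (C ^ 2)]
  have := hC i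
  gcongr

theorem summable_synthesis [CompleteSpace E] {f : ι → E}
    (hf : Pairwise fun i j => inner ℝ (f i) (f j) = 0) {C : ℝ} (hC : ∀ i, ‖f i‖ ≤ C)
    (c : lp (fun _ : ι => ℝ) 2) : Summable fun i => c i • f i := by
  rw [summable_iff_vanishing_norm]
  intro ε hε
  obtain ⟨s, hs⟩ := (summable_iff_vanishing_norm.1 (lp_two_summable_sq c)) (ε ^ 2 / (C ^ 2 + 1))
    (by positivity)
  refine ⟨s, fun t ht => ?_⟩
  have h1 := norm_sq_sum_le hf hC c t
  have h2 := hs t ht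
  rw [Real.norm_of_nonneg (Finset.sum_nonneg fun i _ => sq_nonneg _),
    lt_div_iff₀ (by positivity)] at h2
  have h3 : 0 ≤ ∑ i ∈ t, c i ^ 2 := Finset.sum_nonneg fun i _ => sq_nonneg _
  refine lt_of_pow_lt_pow_left₀ 2 hε.le ?_
  nlinarith

/-- The synthesis operator of a bounded family of pairwise orthogonal vectors. -/
theorem exists_synthesis [CompleteSpace E] {f : ι → E}
    (hf : Pairwise fun i j => inner ℝ (f i) (f j) = 0) {C : ℝ} (hC0 : 0 ≤ C)
    (hC : ∀ i, ‖f i‖ ≤ C) :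
    ∃ J : lp (fun _ : ι => ℝ) 2 →L[ℝ] E,
      (∀ c, HasSum (fun i => c i • f i) (J c)) ∧ ‖J‖ ≤ C := by
  have hs := summable_synthesis hf hC
  let J : lp (fun _ : ι => ℝ) 2 →ₗ[ℝ] E :=
    { toFun := fun c => ∑' i, c i • f i
      map_add' := fun c d => by
        rw [← (hs c).tsum_add (hs d)]
        simp [add_smul]
      map_smul' := fun a c => by
        simp only [RingHom.id_apply]
        rw [← (hs c).tsum_const_smul]
        simp [mul_smul] }
  have hb : ∀ c, ‖J c‖ ≤ C * ‖c‖ := by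
    intro c
    refine le_of_tendsto (hs c).hasSum.norm (Eventually.of_forall fun s => ?_)
    refine le_of_sq_le_sq ?_ (by positivity)
    calc _ ≤ C ^ 2 * ∑ i ∈ s, c i ^ 2 := norm_sq_sum_le hf hC c s
      _ ≤ C ^ 2 * ‖c‖ ^ 2 := by gcongr; exact lp_two_sum_sq_le c s
      _ = _ := by ring
  refine ⟨J.mkContinuous C hb, fun c => ?_, J.mkContinuous_norm_le hC0 hb⟩
  exact (hs c).hasSum

/-- The finite truncations have finite rank and converge in operator norm: by orthogonality the tail
is bounded by the largest ‖f i‖ left out. -/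
theorem isCompactOperator_of_synthesis [CompleteSpace E] {f : ι → E}
    (hf : Pairwise fun i j => inner ℝ (f i) (f j) = 0)
    (hlim : Tendsto (fun i => ‖f i‖) cofinite (𝓝 0))
    (J : lp (fun _ : ι => ℝ) 2 →L[ℝ] E) (hJ : ∀ c, HasSum (fun i => c i • f i) (J c)) :
    IsCompactOperator J := by
  classical
  let G : Finset ι → (lp (fun _ : ι => ℝ) 2 →L[ℝ] E) := fun s =>
    ∑ i ∈ s, (innerSL ℝ (lp.single 2 i (1 : ℝ))).smulRight (f i)
  have hG : ∀ s c, G s c = ∑ i ∈ s, c i • f i := by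
    intro s c
    simp [G, lp.inner_single_left]
  have hcomp : ∀ s, IsCompactOperator (G s) := by
    intro s
    simp only [G]
    induction s using Finset.induction_on with
    | empty => simpa using isCompactOperator_zero
    | insert a s ha ih =>
      rw [Finset.sum_insert ha]
      refine IsCompactOperator.add ?_ ih
      have : ((innerSL ℝ (lp.single 2 a (1 : ℝ) : lp (fun _ : ι => ℝ) 2)).smulRight (f a) :
          lp (fun _ : ι => ℝ) 2 →L[ℝ] E) = (ContinuousLinearMap.toSpanSingleton ℝ (f a)).comp
          (innerSL ℝ (lp.single 2 a (1 : ℝ) : lp (fun _ : ι => ℝ) 2)) := by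
        ext c; simp
      rw [this]
      exact (isCompactOperator_of_locallyCompactSpace_rng
        (ContinuousLinearMap.toSpanSingleton ℝ (f a))).comp_clm _
  refine isCompactOperator_of_tendsto (F := G) (l := atTop) ?_ (Eventually.of_forall hcomp)
  rw [Metric.tendsto_atTop]
  intro ε hε
  have hfin : {i | ¬ ‖f i‖ < ε / 2}.Finite := by
    have := hlim.eventually (gt_mem_nhds (half_pos hε))
    exact this
  refine ⟨hfin.toFinset, fun s hs => ?_⟩
  rw [dist_eq_norm]
  refine lt_of_le_of_lt (ContinuousLinearMap.opNorm_le_bound _ (half_pos hε).le fun c => ?_)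
    (half_lt_self hε)
  rw [← norm_neg]
  -- The remainder is itself the synthesis of an orthogonal family, namely f with the entries in s
  -- replaced by zero, so the same Bessel-type bound applies with ε/2.
  have h1 : HasSum (fun i => c i • (if i ∈ s then 0 else f i)) (-((G s - J) c)) := by
    have h2 := (hJ c).sub (hasSum_sum_of_ne_finset_zero (s := s)
      (f := fun i => c i • (if i ∈ s then f i else 0)) (by
        intro i hi; simp [hi]))
    convert h2 using 1
    · ext i; by_cases hi : i ∈ s <;> simp [hi]
    · simp only [sub_apply, neg_sub, hG]
      congr 1
      exact Finset.sum_congr rfl fun i hi => by simp [hi]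
  refine le_of_tendsto h1.norm (Eventually.of_forall fun t => ?_)
  refine le_of_sq_le_sq ?_ (by positivity)
  have h3 : Pairwise fun i j => inner ℝ ((fun i => if i ∈ s then (0 : E) else f i) i)
      ((fun i => if i ∈ s then (0 : E) else f i) j) = 0 := by
    intro i j hij
    by_cases hi : i ∈ s <;> by_cases hj : j ∈ s <;> simp [hi, hj, hf hij]
  have h4 : ∀ i, ‖(fun i => if i ∈ s then (0 : E) else f i) i‖ ≤ ε / 2 := by
    intro i
    by_cases hi : i ∈ s
    · simpa [hi] using (half_pos hε).le
    · have : i ∉ hfin.toFinset := fun h => hi (hs h)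
      simp only [Finite.mem_toFinset, mem_ofPred_eq, not_not] at this
      simpa [hi] using this.le
  calc _ ≤ (ε / 2) ^ 2 * ∑ i ∈ t, c i ^ 2 := norm_sq_sum_le h3 h4 c t
    _ ≤ (ε / 2) ^ 2 * ‖c‖ ^ 2 := by gcongr; exact lp_two_sum_sq_le c t
    _ = _ := by ring

end Synthesis

/-! ### Kernel of a self-adjoint quadratic pencil. -/

section Spectral

variable {V : Type*} [NormedAddCommGroup V] [InnerProductSpace ℝ V]

/-- Positivity is tested at Kx - Qx with K = ‖Q‖ + 1. The consequence needed is that ⟨Qxₙ,xₙ⟩ → 0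
implies Qxₙ → 0. -/
theorem norm_sq_apply_le_of_nonneg (Q : V →L[ℝ] V)
    (hsymm : ∀ x y, inner ℝ (Q x) y = inner ℝ x (Q y)) (hpos : ∀ x, 0 ≤ inner ℝ (Q x) x) (x : V) :
    ‖Q x‖ ^ 2 ≤ (‖Q‖ + 1) * inner ℝ (Q x) x := by
  have hK : 0 < ‖Q‖ + 1 := by positivity
  have h := hpos ((‖Q‖ + 1) • x - Q x)
  have h1 : inner ℝ (Q (Q x)) (Q x) ≤ ‖Q‖ * ‖Q x‖ ^ 2 := by
    calc _ ≤ ‖Q (Q x)‖ * ‖Q x‖ := real_inner_le_norm _ _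
      _ ≤ (‖Q‖ * ‖Q x‖) * ‖Q x‖ := by gcongr; exact Q.le_opNorm _
      _ = _ := by ring
  rw [map_sub, map_smul, inner_sub_left, inner_sub_right, inner_sub_right, real_inner_smul_left,
    real_inner_smul_left, real_inner_smul_right, real_inner_smul_right, hsymm (Q x) x,
    real_inner_self_eq_norm_sq] at h
  have h2 : (‖Q‖ + 1) * (‖Q x‖ ^ 2) ≤ (‖Q‖ + 1) * ((‖Q‖ + 1) * inner ℝ (Q x) x) := by
    nlinarith [sq_nonneg ‖Q x‖]
  exact le_of_mul_le_mul_left h2 hK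

/-- A growing mode for a self-adjoint quadratic operator pencil. -/
theorem exists_pencil_kernel [CompleteSpace V] (S T Pr N : V →L[ℝ] V)
    (hS : ∀ x y, inner ℝ (S x) y = inner ℝ x (S y))
    (hT : ∀ x y, inner ℝ (T x) y = inner ℝ x (T y))
    (hP : ∀ x y, inner ℝ (Pr x) y = inner ℝ x (Pr y))
    (hN : ∀ x y, inner ℝ (N x) y = inner ℝ x (N y))
    (hSc : IsCompactOperator S) (hTc : IsCompactOperator T) (hPc : IsCompactOperator Pr)
    (hN0 : ∀ x, 0 ≤ inner ℝ (N x) x) (hP0 : ∀ x, 0 ≤ inner ℝ (Pr x) x)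
    (hPS : ∀ x, inner ℝ (Pr x) x ≤ inner ℝ (S x) x)
    (hP1 : ∀ x, inner ℝ (Pr x) x ≤ ‖x‖ ^ 2)
    {ν : ℝ} (hν : 0 < ν) (x₀ : V) (hx₀ : 0 < inner ℝ (T x₀) x₀) :
    ∃ lam : ℝ, 0 < lam ∧ ∃ x : V, x ≠ 0 ∧
      (lam ^ 2) • S x + (lam * ν) • (x - Pr x + N x) - T x = 0 := by
  let Q : ℝ → V →L[ℝ] V := fun l =>
    (l ^ 2) • S + (l * ν) • (ContinuousLinearMap.id ℝ V - Pr + N) - T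
  have hQ : ∀ l x, Q l x = (l ^ 2) • S x + (l * ν) • (x - Pr x + N x) - T x := by
    intro l x; simp [Q]
  have hQi : ∀ l x, inner ℝ (Q l x) x = l ^ 2 * inner ℝ (S x) x
      + l * ν * (‖x‖ ^ 2 - inner ℝ (Pr x) x + inner ℝ (N x) x) - inner ℝ (T x) x := by
    intro l x
    rw [hQ, inner_sub_left, inner_add_left, real_inner_smul_left, real_inner_smul_left,
      inner_add_left, inner_sub_left, real_inner_self_eq_norm_sq]
  have hQs : ∀ l x y, inner ℝ (Q l x) y = inner ℝ x (Q l y) := by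
    intro l x y
    simp only [hQ, inner_sub_left, inner_add_left, real_inner_smul_left, inner_sub_right,
      inner_add_right, real_inner_smul_right, hS, hT, hP, hN]
  have hQcont : Continuous Q := by
    simp only [Q]; fun_prop
  have hQix : ∀ x, Continuous fun l => inner ℝ (Q l x) x := by
    intro x; simp only [hQi]; fun_prop
  -- The eigenvalue is the supremum of Λ. Small l belong to Λ because the form at l = 0 is -⟨Tx,x⟩,
  -- which is negative at x₀.
  let Λ : Set ℝ := {l | 0 < l ∧ ∃ x, inner ℝ (Q l x) x < 0}
  -- nonempty
  have hne : ∃ l ∈ Λ, 0 < l := by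
    have h0 : inner ℝ (Q 0 x₀) x₀ < 0 := by rw [hQi]; simp; exact hx₀
    have := ((hQix x₀).tendsto 0).eventually (gt_mem_nhds h0)
    have h2 : ∀ᶠ l in 𝓝[>] (0 : ℝ), inner ℝ (Q l x₀) x₀ < 0 := nhdsWithin_le_nhds this
    obtain ⟨l, hl, hl0⟩ := (h2.and self_mem_nhdsWithin).exists
    exact ⟨l, ⟨hl0, x₀, hl⟩, hl0⟩
  -- The term I - Pr + N alone does not see the range of Pr; there the term l²S takes over, because
  -- Pr ≤ S. Once l² and lν both exceed ‖T‖ + 1, the sum of the two dominates (‖T‖ + 1)‖x‖². The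
  -- bound 1 in the maximum serves to get l ≤ l².
  have hbdd : BddAbove Λ := by
    refine ⟨max 1 (max ν⁻¹ 1 * (‖T‖ + 1)) , ?_⟩
    rintro l ⟨hl, x, hx⟩
    by_contra! hlt
    have hl1 : 1 < l := lt_of_le_of_lt (le_max_left _ _) hlt
    have hl2 : ν⁻¹ * (‖T‖ + 1) < l := by
      refine lt_of_le_of_lt ?_ (lt_of_le_of_lt (le_max_right _ _) hlt)
      gcongr; exact le_max_left _ _
    have hl3 : (‖T‖ + 1) < l := by
      refine lt_of_le_of_lt ?_ (lt_of_le_of_lt (le_max_right _ _) hlt)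
      have : (1 : ℝ) ≤ max ν⁻¹ 1 := le_max_right _ _
      nlinarith [norm_nonneg T]
    have hl4 : ‖T‖ + 1 < l * ν := by
      rw [inv_mul_lt_iff₀ hν] at hl2; linarith
    rw [hQi] at hx
    have hT1 : inner ℝ (T x) x ≤ ‖T‖ * ‖x‖ ^ 2 := by
      calc _ ≤ ‖T x‖ * ‖x‖ := real_inner_le_norm _ _
        _ ≤ (‖T‖ * ‖x‖) * ‖x‖ := by gcongr; exact T.le_opNorm _
        _ = _ := by ring
    have a1 := hPS x
    have a2 := hP1 x
    have a3 := hP0 x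
    have a4 := hN0 x
    set p := inner ℝ (Pr x) x
    set s := inner ℝ (S x) x
    set n := inner ℝ (N x) x
    have b1 : (‖T‖ + 1) * p ≤ l ^ 2 * s := by
      have : l ≤ l ^ 2 := by nlinarith
      calc _ ≤ l ^ 2 * p := by gcongr; linarith
        _ ≤ _ := by gcongr
    have b2 : (‖T‖ + 1) * (‖x‖ ^ 2 - p + n) ≤ l * ν * (‖x‖ ^ 2 - p + n) := by
      have : 0 ≤ ‖x‖ ^ 2 - p + n := by linarith
      gcongr
    nlinarith [norm_nonneg T, sq_nonneg ‖x‖, mul_nonneg (norm_nonneg T) a4]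
  obtain ⟨l₁, hl₁, hl₁0⟩ := hne
  set lam := sSup Λ
  have hlam : 0 < lam := lt_of_lt_of_le hl₁0 (le_csSup hbdd hl₁)
  -- A negative value at the supremum would persist for slightly larger parameters.
  have hpos : ∀ x, 0 ≤ inner ℝ (Q lam x) x := by
    intro x
    by_contra! hlt
    have := ((hQix x).tendsto lam).eventually (gt_mem_nhds hlt)
    have h2 : ∀ᶠ l in 𝓝[>] lam, inner ℝ (Q l x) x < 0 := nhdsWithin_le_nhds this
    obtain ⟨l, hl, hl0⟩ := (h2.and self_mem_nhdsWithin).exists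
    have hl0' : lam < l := hl0
    exact absurd (le_csSup hbdd ⟨hlam.trans hl0', x, hl⟩) (not_le.2 hl0')
  obtain ⟨ls, -, hls, hlsΛ⟩ := exists_seq_tendsto_sSup ⟨l₁, hl₁⟩ hbdd
  have hx : ∀ n, ∃ x : V, ‖x‖ = 1 ∧ inner ℝ (Q (ls n) x) x < 0 := by
    intro n
    obtain ⟨-, x, hx⟩ := hlsΛ n
    have hx0 : x ≠ 0 := by rintro rfl; simp at hx
    refine ⟨‖x‖⁻¹ • x, norm_smul_inv_norm hx0, ?_⟩
    rw [map_smul, real_inner_smul_left, real_inner_smul_right]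
    have : 0 < ‖x‖⁻¹ := by positivity
    nlinarith [mul_pos this this]
  choose xs hxs1 hxs2 using hx
  -- The form at xₙ is negative for the parameter lsₙ and nonnegative for lam, and the two
  -- parameters converge to each other.
  have hlim0 : Tendsto (fun n => inner ℝ (Q lam (xs n)) (xs n)) atTop (𝓝 0) := by
    have h1 : Tendsto (fun n => ‖Q lam - Q (ls n)‖) atTop (𝓝 0) := by
      have := ((hQcont.tendsto lam).comp hls).const_sub (Q lam)
      simpa using this.norm
    refine squeeze_zero (fun n => hpos _) (fun n => ?_) h1
    have h2 : inner ℝ (Q lam (xs n)) (xs n)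
        = inner ℝ ((Q lam - Q (ls n)) (xs n)) (xs n) + inner ℝ (Q (ls n) (xs n)) (xs n) := by
      rw [← inner_add_left]; simp
    rw [h2]
    have h3 : inner ℝ ((Q lam - Q (ls n)) (xs n)) (xs n) ≤ ‖Q lam - Q (ls n)‖ := by
      calc _ ≤ ‖(Q lam - Q (ls n)) (xs n)‖ * ‖xs n‖ := real_inner_le_norm _ _
        _ ≤ (‖Q lam - Q (ls n)‖ * ‖xs n‖) * ‖xs n‖ := by
          gcongr; exact ContinuousLinearMap.le_opNorm _ _
        _ = _ := by rw [hxs1]; ring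
    linarith [hxs2 n]
  have hQ0 : Tendsto (fun n => Q lam (xs n)) atTop (𝓝 0) := by
    rw [tendsto_zero_iff_norm_tendsto_zero]
    have h1 : Tendsto (fun n => (‖Q lam‖ + 1) * inner ℝ (Q lam (xs n)) (xs n)) atTop (𝓝 0) := by
      simpa using hlim0.const_mul (‖Q lam‖ + 1)
    have h2 : Tendsto (fun n => ‖Q lam (xs n)‖ ^ 2) atTop (𝓝 0) :=
      squeeze_zero (fun n => by positivity)
        (fun n => norm_sq_apply_le_of_nonneg (Q lam) (hQs lam) hpos (xs n)) h1
    have h3 := h2.sqrt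
    simpa using h3
  -- the compact part
  let K : V →L[ℝ] V := T - (lam ^ 2) • S + (lam * ν) • Pr
  have hK : IsCompactOperator K := by
    have := (hTc.sub (hSc.smul (lam ^ 2))).add (hPc.smul (lam * ν))
    exact this
  have hKQ : ∀ x, (lam * ν) • (x + N x) = Q lam x + K x := by
    intro x
    rw [hQ]; simp only [K, add_apply, sub_apply,
      smul_apply, smul_add, smul_sub]
    abel
  obtain ⟨B, hB, hsub⟩ := hK.image_closedBall_subset_compact 1
  have hmem : ∀ n, K (xs n) ∈ B := fun n => hsub ⟨xs n, by simp [hxs1], rfl⟩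
  obtain ⟨y, -, φ, hφ, hy⟩ := hB.tendsto_subseq hmem
  have hA : Tendsto (fun n => (lam * ν) • (xs (φ n) + N (xs (φ n)))) atTop (𝓝 y) := by
    simp only [hKQ]
    simpa using (hQ0.comp hφ.tendsto_atTop).add hy
  have hlν : 0 < lam * ν := mul_pos hlam hν
  -- N is nonnegative but need not be compact, so it stays with the identity. Coercivity of I + N
  -- turns convergence of the images into convergence of the unit vectors themselves, which keeps
  -- the limit nonzero.
  have hcoer : ∀ x, lam * ν * ‖x‖ ≤ ‖(lam * ν) • (x + N x)‖ := by
    intro x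
    rw [norm_smul, Real.norm_of_nonneg hlν.le]
    gcongr
    by_cases hx : x = 0
    · simp [hx]
    have hx' : 0 < ‖x‖ := norm_pos_iff.2 hx
    refine le_of_mul_le_mul_right ?_ hx'
    calc ‖x‖ * ‖x‖ ≤ inner ℝ (x + N x) x := by
          rw [inner_add_left, real_inner_self_eq_norm_sq]; nlinarith [hN0 x]
      _ ≤ _ := real_inner_le_norm _ _
  have hcau : CauchySeq fun n => xs (φ n) := by
    have h1 := hA.cauchySeq
    rw [Metric.cauchySeq_iff] at h1 ⊢
    intro ε hε
    obtain ⟨n₀, hn₀⟩ := h1 (lam * ν * ε) (by positivity)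
    refine ⟨n₀, fun m hm n hn => ?_⟩
    have h2 := hn₀ m hm n hn
    rw [dist_eq_norm] at h2 ⊢
    have h3 := hcoer (xs (φ m) - xs (φ n))
    have h4 : (lam * ν) • (xs (φ m) - xs (φ n) + N (xs (φ m) - xs (φ n)))
        = (lam * ν) • (xs (φ m) + N (xs (φ m))) - (lam * ν) • (xs (φ n) + N (xs (φ n))) := by
      rw [map_sub, ← smul_sub]; congr 1; abel
    rw [h4] at h3
    exact lt_of_mul_lt_mul_left (h3.trans_lt h2) hlν.le
  obtain ⟨x, hx⟩ := cauchySeq_tendsto_of_complete hcau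
  refine ⟨lam, hlam, x, ?_, ?_⟩
  · have h1 := hx.norm
    simp only [hxs1] at h1
    have := tendsto_nhds_unique h1 tendsto_const_nhds
    intro h; simp [h] at this
  · rw [← hQ]
    exact tendsto_nhds_unique (((Q lam).continuous.tendsto x).comp hx) (hQ0.comp hφ.tendsto_atTop)

end Spectral

end RotatingBoussinesq

/-! ### Calculus on strips: partial and total derivatives. -/

namespace RotatingBoussinesq

open Filter Topology

section ProductStrip

variable {F : Type*} [NormedAddCommGroup F] [NormedSpace ℝ F]

theorem uniqueDiffOn_univ_prod {I : Set ℝ} (hI : UniqueDiffOn ℝ I) :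
    UniqueDiffOn ℝ ((univ : Set ℝ) ×ˢ I) :=
  uniqueDiffOn_univ.prod hI

theorem hasDerivAt_slice_fst {I : Set ℝ} {g : ℝ × ℝ → F} {g' : ℝ × ℝ →L[ℝ] F} {q : ℝ × ℝ}
    (hq : q.2 ∈ I) (h : HasFDerivWithinAt g g' (univ ×ˢ I) q) :
    HasDerivAt (fun x => g (x, q.2)) (g' (1, 0)) q.1 := by
  have h1 : HasDerivWithinAt (fun x : ℝ => (x, q.2)) ((1 : ℝ), (0 : ℝ)) univ q.1 :=
    ((hasDerivAt_id q.1).prodMk (hasDerivAt_const q.1 q.2)).hasDerivWithinAt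
  have h2 := HasFDerivWithinAt.comp_hasDerivWithinAt (x := q.1) (f := fun x : ℝ => (x, q.2))
    (t := univ ×ˢ I) h h1 (fun x _ => ⟨mem_univ _, hq⟩)
  exact h2.hasDerivAt univ_mem

theorem hasDerivWithinAt_slice_snd {I : Set ℝ} {g : ℝ × ℝ → F} {g' : ℝ × ℝ →L[ℝ] F} {q : ℝ × ℝ}
    (h : HasFDerivWithinAt g g' (univ ×ˢ I) q) :
    HasDerivWithinAt (fun z => g (q.1, z)) (g' (0, 1)) I q.2 := by
  have h1 : HasDerivWithinAt (fun z : ℝ => (q.1, z)) ((0 : ℝ), (1 : ℝ)) I q.2 :=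
    ((hasDerivAt_const q.2 q.1).prodMk (hasDerivAt_id q.2)).hasDerivWithinAt
  exact HasFDerivWithinAt.comp_hasDerivWithinAt (x := q.2) (f := fun z : ℝ => (q.1, z))
    (t := univ ×ˢ I) h h1 (fun z hz => ⟨mem_univ _, hz⟩)

/-- A function on a strip with continuous partial derivatives is differentiable. -/
theorem hasFDerivWithinAt_of_partial {I : Set ℝ} (hIc : Convex ℝ I) {f fx fz : ℝ × ℝ → F}
    (hx : ∀ q ∈ (univ : Set ℝ) ×ˢ I, HasDerivAt (fun x => f (x, q.2)) (fx q) q.1)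
    (hz : ∀ q ∈ (univ : Set ℝ) ×ˢ I, HasDerivWithinAt (fun z => f (q.1, z)) (fz q) I q.2)
    (cx : ContinuousOn fx (univ ×ˢ I)) (cz : ContinuousOn fz (univ ×ˢ I))
    {q : ℝ × ℝ} (hq : q ∈ (univ : Set ℝ) ×ˢ I) :
    HasFDerivWithinAt f ((ContinuousLinearMap.fst ℝ ℝ ℝ).smulRight (fx q)
      + (ContinuousLinearMap.snd ℝ ℝ ℝ).smulRight (fz q)) (univ ×ˢ I) q := by
  refine .of_isLittleO (Asymptotics.isLittleO_iff.2 fun ε hε => ?_)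
  have e1 := Metric.continuousWithinAt_iff.1 (cx q hq) (ε / 2) (half_pos hε)
  have e2 := Metric.continuousWithinAt_iff.1 (cz q hq) (ε / 2) (half_pos hε)
  obtain ⟨d1, hd1, e1⟩ := e1
  obtain ⟨d2, hd2, e2⟩ := e2
  have : ∀ᶠ y in 𝓝[univ ×ˢ I] q, dist y q < min d1 d2 ∧ y ∈ (univ : Set ℝ) ×ˢ I :=
    Filter.Eventually.and
      (mem_nhdsWithin_of_mem_nhds (Metric.ball_mem_nhds q (lt_min hd1 hd2))) self_mem_nhdsWithin
  filter_upwards [this] with y ⟨hy, hyI⟩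
  have hyI2 : y.2 ∈ I := hyI.2
  have hqI2 : q.2 ∈ I := hq.2
  have hdx : dist y.1 q.1 ≤ dist y q := le_max_left _ _
  have hdz : dist y.2 q.2 ≤ dist y q := le_max_right _ _
  have hy1 : dist y q < d1 := hy.trans_le (min_le_left _ _)
  have hy2 : dist y q < d2 := hy.trans_le (min_le_right _ _)
  -- The increment is split along a path that goes horizontally at height y.2 and then vertically
  -- above q.1; both pieces stay in the strip because I is convex. The mean value inequality is
  -- applied to f minus its linear part on each piece.
  have key1 : ‖(f (y.1, y.2) - y.1 • fx q) - (f (q.1, y.2) - q.1 • fx q)‖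
      ≤ ε / 2 * ‖y.1 - q.1‖ := by
    refine Convex.norm_image_sub_le_of_norm_hasDerivWithin_le
      (f := fun x => f (x, y.2) - x • fx q) (f' := fun x => fx (x, y.2) - fx q)
      (s := uIcc q.1 y.1) ?_ ?_ (convex_uIcc _ _) left_mem_uIcc right_mem_uIcc
    · intro x _
      have h1 := hx (x, y.2) ⟨mem_univ _, hyI2⟩
      have h2 : HasDerivAt (fun x : ℝ => x • fx q) (fx q) x := by
        simpa using (hasDerivAt_id x).smul_const (fx q)
      exact (h1.sub h2).hasDerivWithinAt
    · intro x hxm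
      rw [← dist_eq_norm]
      refine (e1 (x := (x, y.2)) ⟨mem_univ _, hyI2⟩ ?_).le
      refine lt_of_le_of_lt ?_ hy1
      refine max_le ?_ hdz
      refine le_trans ?_ hdx
      rw [dist_comm, dist_comm y.1]
      exact Real.dist_left_le_of_mem_uIcc hxm
  have key2 : ‖(f (q.1, y.2) - y.2 • fz q) - (f (q.1, q.2) - q.2 • fz q)‖
      ≤ ε / 2 * ‖y.2 - q.2‖ := by
    have hsub : uIcc q.2 y.2 ⊆ I := by
      rw [← segment_eq_uIcc]; exact hIc.segment_subset hqI2 hyI2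
    refine Convex.norm_image_sub_le_of_norm_hasDerivWithin_le
      (f := fun z => f (q.1, z) - z • fz q) (f' := fun z => fz (q.1, z) - fz q)
      (s := uIcc q.2 y.2) ?_ ?_ (convex_uIcc _ _) left_mem_uIcc right_mem_uIcc
    · intro z hzm
      have h1 := (hz (q.1, z) ⟨mem_univ _, hsub hzm⟩).mono hsub
      have h2 : HasDerivAt (fun x : ℝ => x • fz q) (fz q) z := by
        simpa using (hasDerivAt_id z).smul_const (fz q)
      exact h1.sub h2.hasDerivWithinAt
    · intro z hzm
      rw [← dist_eq_norm]
      refine (e2 (x := (q.1, z)) ⟨mem_univ _, hsub hzm⟩ ?_).le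
      refine lt_of_le_of_lt ?_ hy2
      refine max_le (by simp) ?_
      refine le_trans ?_ hdz
      rw [dist_comm, dist_comm y.2]
      exact Real.dist_left_le_of_mem_uIcc hzm
  have hn1 : ‖y.1 - q.1‖ ≤ ‖y - q‖ := norm_fst_le (y - q)
  have hn2 : ‖y.2 - q.2‖ ≤ ‖y - q‖ := norm_snd_le (y - q)
  calc _ = ‖((f (y.1, y.2) - y.1 • fx q) - (f (q.1, y.2) - q.1 • fx q))
        + ((f (q.1, y.2) - y.2 • fz q) - (f (q.1, q.2) - q.2 • fz q))‖ := by
        congr 1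
        simp only [add_apply, ContinuousLinearMap.smulRight_apply, ContinuousLinearMap.coe_fst',
          ContinuousLinearMap.coe_snd', Prod.fst_sub, Prod.snd_sub, sub_smul]
        abel
    _ ≤ ε / 2 * ‖y.1 - q.1‖ + ε / 2 * ‖y.2 - q.2‖ := (norm_add_le _ _).trans (add_le_add key1 key2)
    _ ≤ ε / 2 * ‖y - q‖ + ε / 2 * ‖y - q‖ := by gcongr
    _ = ε * ‖y - q‖ := by ring

/-- This is how smoothness of a Fourier series is read off its termwise partial derivatives. Only
derivatives within I are asked for in z, so the closed strip and its interior slabs are treated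
alike. -/
theorem contDiffOn_succ_of_partial {I : Set ℝ} (hIc : Convex ℝ I) (hIu : UniqueDiffOn ℝ I) {n : ℕ}
    {f fx fz : ℝ × ℝ → F}
    (hx : ∀ q ∈ (univ : Set ℝ) ×ˢ I, HasDerivAt (fun x => f (x, q.2)) (fx q) q.1)
    (hz : ∀ q ∈ (univ : Set ℝ) ×ˢ I, HasDerivWithinAt (fun z => f (q.1, z)) (fz q) I q.2)
    (cx : ContDiffOn ℝ n fx (univ ×ˢ I)) (cz : ContDiffOn ℝ n fz (univ ×ˢ I)) :
    ContDiffOn ℝ (n + 1) f (univ ×ˢ I) := by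
  have hu := uniqueDiffOn_univ_prod hIu
  have hf : ∀ q ∈ (univ : Set ℝ) ×ˢ I, HasFDerivWithinAt f
      ((ContinuousLinearMap.fst ℝ ℝ ℝ).smulRight (fx q)
      + (ContinuousLinearMap.snd ℝ ℝ ℝ).smulRight (fz q)) (univ ×ˢ I) q := fun q hq =>
    hasFDerivWithinAt_of_partial hIc hx hz cx.continuousOn cz.continuousOn hq
  rw [contDiffOn_succ_iff_fderivWithin hu]
  refine ⟨fun q hq => (hf q hq).differentiableWithinAt, by simp, ?_⟩
  have : ContDiffOn ℝ n (fun q => (ContinuousLinearMap.fst ℝ ℝ ℝ).smulRight (fx q)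
      + (ContinuousLinearMap.snd ℝ ℝ ℝ).smulRight (fz q)) (univ ×ˢ I) := by
    exact (contDiffOn_const.smulRight cx).add (contDiffOn_const.smulRight cz)
  exact this.congr fun q hq => (hf q hq).fderivWithin (hu q hq)

end ProductStrip

namespace Params

variable (P : Params) {F : Type*} [NormedAddCommGroup F] [NormedSpace ℝ F]

theorem uniqueDiffOn_Icc_h : UniqueDiffOn ℝ (Icc 0 P.h) := uniqueDiffOn_Icc P.h_pos

theorem uniqueDiffOn_closedStrip : UniqueDiffOn ℝ P.closedStrip :=
  uniqueDiffOn_univ_prod P.uniqueDiffOn_Icc_h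

theorem isOpen_strip : IsOpen P.strip := isOpen_univ.prod isOpen_Ioo

theorem strip_subset : P.strip ⊆ P.closedStrip := prod_mono_right Ioo_subset_Icc_self

variable {P} {g : ℝ × ℝ → F} {q : ℝ × ℝ}

theorem hasDerivAt_dx (hg : ContDiffOn ℝ 1 g P.closedStrip) (hq : q ∈ P.closedStrip) :
    HasDerivAt (fun x => g (x, q.2)) (P.dx g q) q.1 := by
  have h := (hg.differentiableOn one_ne_zero q hq).hasFDerivWithinAt
  have := hasDerivAt_slice_fst hq.2 h
  exact this.differentiableAt.hasDerivAt

theorem hasDerivWithinAt_dz (hg : ContDiffOn ℝ 1 g P.closedStrip) (hq : q ∈ P.closedStrip) :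
    HasDerivWithinAt (fun z => g (q.1, z)) (P.dz g q) (Icc 0 P.h) q.2 := by
  have h := (hg.differentiableOn one_ne_zero q hq).hasFDerivWithinAt
  have := hasDerivWithinAt_slice_snd h
  exact this.differentiableWithinAt.hasDerivWithinAt

theorem dx_eq_fderivWithin (hg : ContDiffOn ℝ 1 g P.closedStrip) (hq : q ∈ P.closedStrip) :
    P.dx g q = fderivWithin ℝ g P.closedStrip q (1, 0) :=
  (hasDerivAt_slice_fst hq.2
    (hg.differentiableOn one_ne_zero q hq).hasFDerivWithinAt).deriv

theorem dz_eq_fderivWithin (hg : ContDiffOn ℝ 1 g P.closedStrip) (hq : q ∈ P.closedStrip) :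
    P.dz g q = fderivWithin ℝ g P.closedStrip q (0, 1) :=
  (hasDerivWithinAt_slice_snd
    (hg.differentiableOn one_ne_zero q hq).hasFDerivWithinAt).derivWithin
    (P.uniqueDiffOn_Icc_h _ hq.2)

theorem contDiffOn_dx {n : ℕ} (hg : ContDiffOn ℝ (n + 1) g P.closedStrip) :
    ContDiffOn ℝ n (P.dx g) P.closedStrip := by
  have h1 : ContDiffOn ℝ 1 g P.closedStrip := hg.of_le (by norm_cast; omega)
  have h2 : ContDiffOn ℝ n (fun q => fderivWithin ℝ g P.closedStrip q (1, 0)) P.closedStrip :=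
    ((contDiffOn_succ_iff_fderivWithin P.uniqueDiffOn_closedStrip).1 hg).2.2.clm_apply
      contDiffOn_const
  exact h2.congr fun q hq => dx_eq_fderivWithin h1 hq

theorem contDiffOn_dz {n : ℕ} (hg : ContDiffOn ℝ (n + 1) g P.closedStrip) :
    ContDiffOn ℝ n (P.dz g) P.closedStrip := by
  have h1 : ContDiffOn ℝ 1 g P.closedStrip := hg.of_le (by norm_cast; omega)
  have h2 : ContDiffOn ℝ n (fun q => fderivWithin ℝ g P.closedStrip q (0, 1)) P.closedStrip :=
    ((contDiffOn_succ_iff_fderivWithin P.uniqueDiffOn_closedStrip).1 hg).2.2.clm_apply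
      contDiffOn_const
  exact h2.congr fun q hq => dz_eq_fderivWithin h1 hq

theorem continuousOn_dx (hg : ContDiffOn ℝ 1 g P.closedStrip) :
    ContinuousOn (P.dx g) P.closedStrip :=
  (contDiffOn_dx (n := 0) (by simpa using hg)).continuousOn

theorem continuousOn_dz (hg : ContDiffOn ℝ 1 g P.closedStrip) :
    ContinuousOn (P.dz g) P.closedStrip :=
  (contDiffOn_dz (n := 0) (by simpa using hg)).continuousOn

theorem dz_eq_deriv (hq : q ∈ P.strip) : P.dz g q = deriv (fun z => g (q.1, z)) q.2 :=
  derivWithin_of_mem_nhds (Icc_mem_nhds hq.2.1 hq.2.2)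

theorem hasFDerivAt_strip (hg : ContDiffOn ℝ 1 g P.strip) (hq : q ∈ P.strip) :
    HasFDerivAt g (fderiv ℝ g q) q :=
  ((hg.contDiffAt (P.isOpen_strip.mem_nhds hq)).differentiableAt one_ne_zero).hasFDerivAt

theorem hasDerivAt_dx_strip (hg : ContDiffOn ℝ 1 g P.strip) (hq : q ∈ P.strip) :
    HasDerivAt (fun x => g (x, q.2)) (P.dx g q) q.1 :=
  (hasDerivAt_slice_fst hq.2 (hasFDerivAt_strip hg hq).hasFDerivWithinAt).differentiableAt.hasDerivAt

theorem hasDerivAt_dz_strip (hg : ContDiffOn ℝ 1 g P.strip) (hq : q ∈ P.strip) :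
    HasDerivAt (fun z => g (q.1, z)) (P.dz g q) q.2 := by
  rw [dz_eq_deriv hq]
  exact (((hasDerivWithinAt_slice_snd (I := Ioo 0 P.h)
    (hasFDerivAt_strip hg hq).hasFDerivWithinAt)).hasDerivAt
    (Ioo_mem_nhds hq.2.1 hq.2.2)).differentiableAt.hasDerivAt

theorem dx_eq_fderiv (hg : ContDiffOn ℝ 1 g P.strip) (hq : q ∈ P.strip) :
    P.dx g q = fderiv ℝ g q (1, 0) :=
  (hasDerivAt_slice_fst hq.2 (hasFDerivAt_strip hg hq).hasFDerivWithinAt).deriv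

theorem dz_eq_fderiv (hg : ContDiffOn ℝ 1 g P.strip) (hq : q ∈ P.strip) :
    P.dz g q = fderiv ℝ g q (0, 1) := by
  rw [dz_eq_deriv hq]
  exact (((hasDerivWithinAt_slice_snd (I := Ioo 0 P.h)
    (hasFDerivAt_strip hg hq).hasFDerivWithinAt)).hasDerivAt
    (Ioo_mem_nhds hq.2.1 hq.2.2)).deriv

theorem contDiffOn_dx_strip {n : ℕ} (hg : ContDiffOn ℝ (n + 1) g P.strip) :
    ContDiffOn ℝ n (P.dx g) P.strip := by
  have h1 : ContDiffOn ℝ 1 g P.strip := hg.of_le (by norm_cast; omega)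
  have h2 : ContDiffOn ℝ n (fun q => fderiv ℝ g q (1, 0)) P.strip :=
    ((contDiffOn_succ_iff_fderiv_of_isOpen P.isOpen_strip).1 hg).2.2.clm_apply contDiffOn_const
  exact h2.congr fun q hq => dx_eq_fderiv h1 hq

theorem contDiffOn_dz_strip {n : ℕ} (hg : ContDiffOn ℝ (n + 1) g P.strip) :
    ContDiffOn ℝ n (P.dz g) P.strip := by
  have h1 : ContDiffOn ℝ 1 g P.strip := hg.of_le (by norm_cast; omega)
  have h2 : ContDiffOn ℝ n (fun q => fderiv ℝ g q (0, 1)) P.strip :=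
    ((contDiffOn_succ_iff_fderiv_of_isOpen P.isOpen_strip).1 hg).2.2.clm_apply contDiffOn_const
  exact h2.congr fun q hq => dz_eq_fderiv h1 hq

theorem continuousOn_dx_strip (hg : ContDiffOn ℝ 1 g P.strip) : ContinuousOn (P.dx g) P.strip :=
  (contDiffOn_dx_strip (n := 0) (by simpa using hg)).continuousOn

theorem continuousOn_dz_strip (hg : ContDiffOn ℝ 1 g P.strip) : ContinuousOn (P.dz g) P.strip :=
  (contDiffOn_dz_strip (n := 0) (by simpa using hg)).continuousOn

theorem contDiffOn_one_dx (hg : ContDiffOn ℝ 2 g P.closedStrip) :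
    ContDiffOn ℝ 1 (P.dx g) P.closedStrip := by
  have h : ((1 : ℕ) : WithTop ℕ∞) + 1 = 2 := by norm_num
  exact_mod_cast contDiffOn_dx (n := 1) (by rwa [h])

theorem contDiffOn_one_dz (hg : ContDiffOn ℝ 2 g P.closedStrip) :
    ContDiffOn ℝ 1 (P.dz g) P.closedStrip := by
  have h : ((1 : ℕ) : WithTop ℕ∞) + 1 = 2 := by norm_num
  exact_mod_cast contDiffOn_dz (n := 1) (by rwa [h])

theorem contDiffOn_one_dx_strip (hg : ContDiffOn ℝ 2 g P.strip) :
    ContDiffOn ℝ 1 (P.dx g) P.strip := by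
  have h : ((1 : ℕ) : WithTop ℕ∞) + 1 = 2 := by norm_num
  exact_mod_cast contDiffOn_dx_strip (n := 1) (by rwa [h])

theorem contDiffOn_one_dz_strip (hg : ContDiffOn ℝ 2 g P.strip) :
    ContDiffOn ℝ 1 (P.dz g) P.strip := by
  have h : ((1 : ℕ) : WithTop ℕ∞) + 1 = 2 := by norm_num
  exact_mod_cast contDiffOn_dz_strip (n := 1) (by rwa [h])

theorem PeriodicX.dx (hg : P.PeriodicX g) : P.PeriodicX (P.dx g) := by
  intro x z hz
  have h : (fun x => g (x, z)) = fun x => g (x + P.L, z) := funext fun x => (hg x z hz).symm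
  show deriv (fun x => g (x, z)) (x + P.L) = deriv (fun x => g (x, z)) x
  conv_rhs => rw [h]
  rw [deriv_comp_add_const (fun x => g (x, z)) P.L]

theorem PeriodicX.dz (hg : P.PeriodicX g) : P.PeriodicX (P.dz g) := by
  intro x z hz
  show derivWithin (fun z => g (x + P.L, z)) (Icc 0 P.h) z
    = derivWithin (fun z => g (x, z)) (Icc 0 P.h) z
  exact derivWithin_congr (fun y hy => hg x y hy) (hg x z hz)

end Params

end RotatingBoussinesq

/-! ### Integrals over a period cell and the energy identity of the Stokes system. -/

namespace RotatingBoussinesq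

open Filter Topology MeasureTheory

section Parametric

theorem hasDerivAt_setIntegral_of_continuousOn {α : Type*} [TopologicalSpace α] [T2Space α]
    [MeasurableSpace α] [OpensMeasurableSpace α] [SecondCountableTopologyEither α ℝ]
    {μ : Measure α} [IsFiniteMeasureOnCompacts μ] {K : Set α} (hK : IsCompact K) {a b t : ℝ}
    (ht : t ∈ Ioo a b)
    {f f' : ℝ → α → ℝ} (hf : ∀ s ∈ Ioo a b, ContinuousOn (f s) K)
    (hf' : ContinuousOn (fun y : ℝ × α => f' y.1 y.2) (Ioo a b ×ˢ K))
    (hd : ∀ s ∈ Ioo a b, ∀ x ∈ K, HasDerivAt (fun s => f s x) (f' s x) s) :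
    HasDerivAt (fun s => ∫ x in K, f s x ∂μ) (∫ x in K, f' t x ∂μ) t := by
  obtain ⟨c, hc⟩ := exists_between ht.1
  obtain ⟨d, hd'⟩ := exists_between ht.2
  have hsub : Icc c d ⊆ Ioo a b := fun s hs => ⟨hc.1.trans_le hs.1, hs.2.trans_lt hd'.2⟩
  have hcomp : IsCompact (Icc c d ×ˢ K) := isCompact_Icc.prod hK
  obtain ⟨C, hC⟩ := hcomp.exists_bound_of_continuousOn (hf'.mono (prod_mono_left hsub))
  have hm : MeasurableSet K := hK.isClosed.measurableSet
  refine (hasDerivAt_integral_of_dominated_loc_of_deriv_le (μ := μ.restrict K) (F := f) (F' := f')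
    (bound := fun _ => C) (s := Icc c d) (Icc_mem_nhds hc.2 hd'.1) ?_ ?_ ?_ ?_ ?_ ?_).2
  · filter_upwards [Icc_mem_nhds hc.2 hd'.1] with s hs
    exact (hf s (hsub hs)).aestronglyMeasurable_of_isCompact hK hm
  · exact (hf t ht).integrableOn_compact hK
  · have : ContinuousOn (f' t) K := by
      refine hf'.comp (f := fun x => (t, x)) (by fun_prop) fun x hx => ⟨ht, hx⟩
    exact this.aestronglyMeasurable_of_isCompact hK hm
  · refine (ae_restrict_iff' hm).2 (Eventually.of_forall fun x hx s hs => hC (s, x) ⟨hs, hx⟩)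
  · have : IsFiniteMeasure (μ.restrict K) := ⟨by simpa using hK.measure_lt_top⟩
    exact integrable_const C
  · refine (ae_restrict_iff' hm).2 (Eventually.of_forall fun x hx s hs => hd s (hsub hs) x hx)

theorem intervalIntegral_eq_setIntegral_Icc {a b : ℝ} (h : a ≤ b) (f : ℝ → ℝ) :
    ∫ x in a..b, f x = ∫ x in Icc a b, f x := by
  rw [intervalIntegral.integral_of_le h, integral_Icc_eq_integral_Ioc]

theorem hasDerivAt_intervalIntegral_of_continuousOn {l : ℝ} (hl : 0 ≤ l) {a b t : ℝ}
    (ht : t ∈ Ioo a b) {f f' : ℝ × ℝ → ℝ} (hf : ContinuousOn f (univ ×ˢ Ioo a b))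
    (hf' : ContinuousOn f' (univ ×ˢ Ioo a b))
    (hd : ∀ q ∈ (univ : Set ℝ) ×ˢ Ioo a b, HasDerivAt (fun s => f (q.1, s)) (f' q) q.2) :
    HasDerivAt (fun s => ∫ x in (0 : ℝ)..l, f (x, s)) (∫ x in (0 : ℝ)..l, f' (x, t)) t := by
  simp only [intervalIntegral_eq_setIntegral_Icc hl]
  refine hasDerivAt_setIntegral_of_continuousOn (f := fun s x => f (x, s))
    (f' := fun s x => f' (x, s)) isCompact_Icc ht ?_ ?_ ?_
  · intro s hs
    exact hf.comp (f := fun x => (x, s)) (by fun_prop) fun x _ => ⟨mem_univ _, hs⟩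
  · exact hf'.comp (f := fun y : ℝ × ℝ => (y.2, y.1)) (by fun_prop) fun y hy => ⟨mem_univ _, hy.1⟩
  · intro s hs x _
    exact hd (x, s) ⟨mem_univ _, hs⟩

/-- Clamping z extends a function on the closed strip continuously to the plane, so that statements
about globally continuous integrands become available. -/
theorem continuous_comp_clamp {a b : ℝ} (hab : a ≤ b) {f : ℝ × ℝ → ℝ}
    (hf : ContinuousOn f (univ ×ˢ Icc a b)) :
    Continuous fun q : ℝ × ℝ => f (q.1, max a (min b q.2)) := by
  refine hf.comp_continuous (f := fun q : ℝ × ℝ => (q.1, max a (min b q.2))) (by fun_prop) ?_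
  intro q
  exact ⟨mem_univ _, le_max_left _ _, max_le hab (min_le_left _ _)⟩

theorem clamp_eq {a b z : ℝ} (hz : z ∈ Icc a b) : max a (min b z) = z := by
  rw [min_eq_right hz.2, max_eq_right hz.1]

theorem continuousOn_intervalIntegral_fst {a b l : ℝ} {f : ℝ × ℝ → ℝ}
    (hf : ContinuousOn f (univ ×ˢ Icc a b)) :
    ContinuousOn (fun z => ∫ x in (0 : ℝ)..l, f (x, z)) (Icc a b) := by
  by_cases hab : a ≤ b
  · have h1 : Continuous fun z => ∫ x in (0 : ℝ)..l, f (x, max a (min b z)) := by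
      have := continuous_comp_clamp hab hf
      exact intervalIntegral.continuous_parametric_intervalIntegral_of_continuous'
        (f := fun z x => f (x, max a (min b z))) (this.comp continuous_swap) 0 l
    refine h1.continuousOn.congr fun z hz => ?_
    simp only [clamp_eq hz]
  · simp [Icc_eq_empty hab]

theorem integral_deriv_periodic {l : ℝ} {f f' : ℝ → ℝ} (hd : ∀ x, HasDerivAt f (f' x) x)
    (hc : Continuous f') (hp : f l = f 0) : ∫ x in (0 : ℝ)..l, f' x = 0 := by
  rw [intervalIntegral.integral_eq_sub_of_hasDerivAt (fun x _ => hd x)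
    (hc.intervalIntegrable _ _), hp, sub_self]

end Parametric

namespace Params

variable (P : Params)

/-- A fundamental domain of the closed strip. -/
def cell : Set (ℝ × ℝ) := Icc 0 P.L ×ˢ Icc 0 P.h

theorem isCompact_cell : IsCompact P.cell := isCompact_Icc.prod isCompact_Icc

theorem cell_subset : P.cell ⊆ P.closedStrip := prod_mono_left (subset_univ _)

variable {P}

theorem integral_cell {f : ℝ × ℝ → ℝ} (hf : ContinuousOn f P.closedStrip) :
    ∫ q in P.cell, f q = ∫ x in (0 : ℝ)..P.L, ∫ z in (0 : ℝ)..P.h, f (x, z) := by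
  have hi : IntegrableOn f (Icc 0 P.L ×ˢ Icc 0 P.h) :=
    (hf.mono P.cell_subset).integrableOn_compact P.isCompact_cell
  rw [cell, Measure.volume_eq_prod, setIntegral_prod _ hi,
    intervalIntegral_eq_setIntegral_Icc P.L_pos.le]
  simp only [intervalIntegral_eq_setIntegral_Icc P.h_pos.le]

theorem integral_cell_swap {f : ℝ × ℝ → ℝ} (hf : ContinuousOn f P.closedStrip) :
    ∫ q in P.cell, f q = ∫ z in (0 : ℝ)..P.h, ∫ x in (0 : ℝ)..P.L, f (x, z) := by
  have hi : IntegrableOn f (Icc 0 P.L ×ˢ Icc 0 P.h) :=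
    (hf.mono P.cell_subset).integrableOn_compact P.isCompact_cell
  rw [IntegrableOn, Measure.volume_eq_prod, ← Measure.prod_restrict] at hi
  rw [cell, Measure.volume_eq_prod, ← Measure.prod_restrict, integral_prod_symm _ hi,
    intervalIntegral_eq_setIntegral_Icc P.h_pos.le]
  simp only [intervalIntegral_eq_setIntegral_Icc P.L_pos.le]

theorem PeriodicX.apply_L {F : Type*} [NormedAddCommGroup F] [NormedSpace ℝ F] {g : ℝ × ℝ → F}
    (hg : P.PeriodicX g) {z : ℝ} (hz : z ∈ Icc 0 P.h) : g (P.L, z) = g (0, z) := by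
  simpa using hg 0 z hz

/-- The momentum equations are multiplied by the velocity and integrated by parts. Second
derivatives of the velocity and first derivatives of the pressure need not extend to the boundary,
so the integration by parts is done on x-averages: the average over a period of the vertical flux φ
is continuous on [0,h] and differentiable inside. Its derivative is the average of D, which is
continuous up to the boundary. -/
theorem stokes_energy {u w p H₁ H₂ : ℝ × ℝ → ℝ}
    (hu : ContDiffOn ℝ 1 u P.closedStrip) (hw : ContDiffOn ℝ 1 w P.closedStrip)
    (hp : ContinuousOn p P.closedStrip)
    (hu2 : ContDiffOn ℝ 2 u P.strip) (hw2 : ContDiffOn ℝ 2 w P.strip)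
    (hp1 : ContDiffOn ℝ 1 p P.strip)
    (pu : P.PeriodicX u) (pw : P.PeriodicX w) (pp : P.PeriodicX p)
    (hH₁ : ContinuousOn H₁ P.closedStrip) (hH₂ : ContinuousOn H₂ P.closedStrip)
    (e₁ : ∀ q ∈ P.strip, P.ν * P.lap u q - P.dx p q = H₁ q)
    (e₂ : ∀ q ∈ P.strip, P.ν * P.lap w q - P.dz p q = H₂ q)
    (hdiv : ∀ q ∈ P.strip, P.dx u q + P.dz w q = 0)
    (bc : P.BoundaryConditions u w) :
    (∫ q in P.cell, (H₁ q * u q + H₂ q * w q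
      + P.ν * (P.dx u q ^ 2 + P.dz u q ^ 2 + P.dx w q ^ 2 + P.dz w q ^ 2)))
      + P.ν * P.α * ∫ x in (0 : ℝ)..P.L, u (x, 0) ^ 2 = 0 := by
  have cu := hu.continuousOn
  have cw := hw.continuousOn
  have cux := continuousOn_dx hu
  have cuz := continuousOn_dz hu
  have cwx := continuousOn_dx hw
  have cwz := continuousOn_dz hw
  have hu1 : ContDiffOn ℝ 1 u P.strip := hu.mono P.strip_subset
  have hw1 : ContDiffOn ℝ 1 w P.strip := hw.mono P.strip_subset
  have hux : ContDiffOn ℝ 1 (P.dx u) P.strip := contDiffOn_one_dx_strip hu2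
  have huz : ContDiffOn ℝ 1 (P.dz u) P.strip := contDiffOn_one_dz_strip hu2
  have hwx : ContDiffOn ℝ 1 (P.dx w) P.strip := contDiffOn_one_dx_strip hw2
  have hwz : ContDiffOn ℝ 1 (P.dz w) P.strip := contDiffOn_one_dz_strip hw2
  set D : ℝ × ℝ → ℝ := fun q => H₁ q * u q + H₂ q * w q
      + P.ν * (P.dx u q ^ 2 + P.dz u q ^ 2 + P.dx w q ^ 2 + P.dz w q ^ 2) with hD
  have cD : ContinuousOn D P.closedStrip := by fun_prop
  let φ : ℝ × ℝ → ℝ := fun q => P.ν * P.dz u q * u q + P.ν * P.dz w q * w q - p q * w q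
  have cφ : ContinuousOn φ P.closedStrip := by fun_prop
  let φ' : ℝ × ℝ → ℝ := fun q => P.ν * P.dz (P.dz u) q * u q + P.ν * P.dz u q * P.dz u q
    + (P.ν * P.dz (P.dz w) q * w q + P.ν * P.dz w q * P.dz w q)
    - (P.dz p q * w q + p q * P.dz w q)
  let ξ : ℝ × ℝ → ℝ := fun q => P.ν * P.dx u q * u q + P.ν * P.dx w q * w q - p q * u q
  let ξ' : ℝ × ℝ → ℝ := fun q => P.ν * P.dx (P.dx u) q * u q + P.ν * P.dx u q * P.dx u q
    + (P.ν * P.dx (P.dx w) q * w q + P.ν * P.dx w q * P.dx w q)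
    - (P.dx p q * u q + p q * P.dx u q)
  have sub := P.strip_subset
  have cφ' : ContinuousOn φ' P.strip := by
    have := continuousOn_dz_strip huz
    have := continuousOn_dz_strip hwz
    have := continuousOn_dz_strip hp1
    have := cu.mono sub
    have := cw.mono sub
    have := cuz.mono sub
    have := cwz.mono sub
    have := hp.mono sub
    fun_prop
  have cξ' : ContinuousOn ξ' P.strip := by
    have := continuousOn_dx_strip hux
    have := continuousOn_dx_strip hwx
    have := continuousOn_dx_strip hp1
    have := cu.mono sub
    have := cw.mono sub
    have := cux.mono sub
    have := cwx.mono sub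
    have := hp.mono sub
    fun_prop
  have dφ : ∀ q ∈ P.strip, HasDerivAt (fun z => φ (q.1, z)) (φ' q) q.2 := by
    intro q hq
    exact ((((hasDerivAt_dz_strip huz hq).const_mul P.ν).mul (hasDerivAt_dz_strip hu1 hq)).add
      (((hasDerivAt_dz_strip hwz hq).const_mul P.ν).mul (hasDerivAt_dz_strip hw1 hq))).sub
      ((hasDerivAt_dz_strip hp1 hq).mul (hasDerivAt_dz_strip hw1 hq))
  have dξ : ∀ q ∈ P.strip, HasDerivAt (fun x => ξ (x, q.2)) (ξ' q) q.1 := by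
    intro q hq
    exact ((((hasDerivAt_dx_strip hux hq).const_mul P.ν).mul (hasDerivAt_dx_strip hu1 hq)).add
      (((hasDerivAt_dx_strip hwx hq).const_mul P.ν).mul (hasDerivAt_dx_strip hw1 hq))).sub
      ((hasDerivAt_dx_strip hp1 hq).mul (hasDerivAt_dx_strip hu1 hq))
  -- The horizontal flux ξ is periodic, so it drops out of the average over x.
  have hξ0 : ∀ z ∈ Ioo 0 P.h, ∫ x in (0 : ℝ)..P.L, ξ' (x, z) = 0 := by
    intro z hz
    have hz' : z ∈ Icc 0 P.h := Ioo_subset_Icc_self hz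
    refine integral_deriv_periodic (f := fun x => ξ (x, z))
      (fun x => dξ (x, z) ⟨mem_univ _, hz⟩) ?_ ?_
    · exact cξ'.comp_continuous (by fun_prop) fun x => ⟨mem_univ _, hz⟩
    · simp only [ξ, pu.dx.apply_L hz', pw.dx.apply_L hz', pu.apply_L hz', pw.apply_L hz',
        pp.apply_L hz']
  -- The divergence of the flux (ξ, φ) is D: the equations remove the second derivatives and the
  -- pressure gradient, and incompressibility removes the term p div u.
  have hsum : ∀ q ∈ P.strip, φ' q = D q - ξ' q := by
    intro q hq
    have h1 := e₁ q hq
    have h2 := e₂ q hq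
    have h3 := hdiv q hq
    simp only [lap] at h1 h2
    simp only [φ', ξ', hD, ← h1, ← h2]
    have h4 : P.dz w q = - P.dx u q := by linarith
    rw [h4]; ring
  have hder : ∀ z ∈ Ioo 0 P.h, HasDerivAt (fun z => ∫ x in (0 : ℝ)..P.L, φ (x, z))
      (∫ x in (0 : ℝ)..P.L, D (x, z)) z := by
    intro z hz
    have h1 := hasDerivAt_intervalIntegral_of_continuousOn P.L_pos.le hz (cφ.mono sub) cφ' dφ
    convert h1 using 1
    have h2 : ∀ x, φ' (x, z) = D (x, z) - ξ' (x, z) := fun x => hsum _ ⟨mem_univ _, hz⟩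
    simp only [h2]
    rw [intervalIntegral.integral_sub, hξ0 z hz, sub_zero]
    · exact ((cD.mono sub).comp_continuous (f := fun x : ℝ => (x, z)) (by fun_prop)
        fun x => ⟨mem_univ _, hz⟩).intervalIntegrable _ _
    · exact (cξ'.comp_continuous (f := fun x : ℝ => (x, z)) (by fun_prop)
        fun x => ⟨mem_univ _, hz⟩).intervalIntegrable _ _
  have hftc := intervalIntegral.integral_eq_sub_of_hasDerivAt_of_le P.h_pos.le
    (continuousOn_intervalIntegral_fst (l := P.L) cφ) hder
    ((continuousOn_intervalIntegral_fst (l := P.L) cD).intervalIntegrable_of_Icc P.h_pos.le)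
  rw [integral_cell_swap cD, hftc]
  have htop : ∀ x, φ (x, P.h) = 0 := by
    intro x; simp [φ, bc.slip_top, bc.imp_top]
  -- The slip condition turns the flux through the bottom into friction; at the top the flux
  -- vanishes.
  have hbot : ∀ x, φ (x, 0) = P.ν * P.α * u (x, 0) ^ 2 := by
    intro x
    have := bc.slip_bot x
    simp only [smul_eq_mul] at this
    have h : P.dz u (x, 0) = P.α * u (x, 0) := by linarith
    simp only [φ, bc.imp_bot, h]; ring
  simp only [htop, hbot, intervalIntegral.integral_zero, intervalIntegral.integral_const_mul]
  ring

end Params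

end RotatingBoussinesq

/-! ### Spectral stability. -/

namespace RotatingBoussinesq

open Filter Topology MeasureTheory

namespace Params

variable {P : Params}

theorem closedStrip_subset_closure : P.closedStrip ⊆ closure P.strip := by
  rw [strip, closedStrip, closure_prod_eq, closure_Ioo P.h_pos.ne, closure_univ]

theorem eqOn_closedStrip {f g : ℝ × ℝ → ℝ} (hf : ContinuousOn f P.closedStrip)
    (hg : ContinuousOn g P.closedStrip) (h : ∀ q ∈ P.strip, f q = g q) :
    ∀ q ∈ P.closedStrip, f q = g q :=
  EqOn.of_subset_closure h hf hg P.strip_subset closedStrip_subset_closure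

theorem PeriodicX.eq_zero_of_cell {f : ℝ × ℝ → ℝ} (hf : P.PeriodicX f)
    (h : ∀ q ∈ P.cell, f q = 0) : ∀ q ∈ P.closedStrip, f q = 0 := by
  rintro ⟨x, z⟩ ⟨-, hz⟩
  have hp : Function.Periodic (fun x => f (x, z)) P.L := fun x => hf x z hz
  obtain ⟨y, hy, he⟩ := hp.exists_mem_Ico₀ P.L_pos x
  rw [show f (x, z) = f (y, z) from he]
  exact h (y, z) ⟨Ico_subset_Icc_self hy, hz⟩

theorem exists_bound_closedStrip {f : ℝ × ℝ → ℝ} (hp : P.PeriodicX f)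
    (hf : ContinuousOn f P.closedStrip) : ∃ C, 0 ≤ C ∧ ∀ q ∈ P.closedStrip, |f q| ≤ C := by
  obtain ⟨C, hC⟩ := P.isCompact_cell.exists_bound_of_continuousOn (hf.mono P.cell_subset)
  refine ⟨max C 0, le_max_right _ _, ?_⟩
  rintro ⟨x, z⟩ ⟨-, hz⟩
  have hp : Function.Periodic (fun x => f (x, z)) P.L := fun x => hp x z hz
  obtain ⟨y, hy, he⟩ := hp.exists_mem_Ico₀ P.L_pos x
  rw [show f (x, z) = f (y, z) from he]
  exact (hC (y, z) ⟨Ico_subset_Icc_self hy, hz⟩).trans (le_max_left _ _)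

theorem cell_subset_closure_interior : P.cell ⊆ closure (interior P.cell) := by
  rw [cell, interior_prod_eq, interior_Icc, interior_Icc, closure_prod_eq,
    closure_Ioo P.L_pos.ne, closure_Ioo P.h_pos.ne]

theorem eq_zero_of_integral_cell_eq_zero {f : ℝ × ℝ → ℝ} (hf : ContinuousOn f P.cell)
    (h0 : ∀ q ∈ P.cell, 0 ≤ f q) (hi : ∫ q in P.cell, f q = 0) : ∀ q ∈ P.cell, f q = 0 := by
  have hm : MeasurableSet P.cell := P.isCompact_cell.isClosed.measurableSet
  have h1 := (setIntegral_eq_zero_iff_of_nonneg_ae ((ae_restrict_iff' hm).2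
    (Eventually.of_forall h0)) (hf.integrableOn_compact P.isCompact_cell)).1 hi
  exact Measure.eqOn_of_ae_eq h1 hf continuousOn_const cell_subset_closure_interior

theorem eq_zero_of_intervalIntegral_eq_zero {l : ℝ} (hl : 0 < l) {f : ℝ → ℝ}
    (hf : ContinuousOn f (Icc 0 l))
    (h0 : ∀ x ∈ Icc 0 l, 0 ≤ f x) (hi : ∫ x in (0 : ℝ)..l, f x = 0) : ∀ x ∈ Icc 0 l, f x = 0 := by
  rw [intervalIntegral_eq_setIntegral_Icc hl.le] at hi
  have h1 := (setIntegral_eq_zero_iff_of_nonneg_ae ((ae_restrict_iff' measurableSet_Icc).2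
    (Eventually.of_forall h0)) (hf.integrableOn_compact isCompact_Icc)).1 hi
  refine Measure.eqOn_of_ae_eq h1 hf continuousOn_const ?_
  rw [interior_Icc, closure_Ioo hl.ne]

section Parts

variable {F : Type*} [NormedAddCommGroup F] [NormedSpace ℝ F] (ℓ : F →L[ℝ] ℝ) {g : ℝ × ℝ → F}
  {q : ℝ × ℝ}

/-- This and the following lemmas let a complex mode be handled through its real and imaginary
parts, each of which solves a real Stokes system. -/
theorem dx_clm_comp (hg : ContDiffOn ℝ 1 g P.closedStrip) (hq : q ∈ P.closedStrip) :
    P.dx (fun y => ℓ (g y)) q = ℓ (P.dx g q) :=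
  (ℓ.hasFDerivAt.comp_hasDerivAt _ (hasDerivAt_dx hg hq)).deriv

theorem dz_clm_comp (hg : ContDiffOn ℝ 1 g P.closedStrip) (hq : q ∈ P.closedStrip) :
    P.dz (fun y => ℓ (g y)) q = ℓ (P.dz g q) :=
  (ℓ.hasFDerivAt.comp_hasDerivWithinAt _ (hasDerivWithinAt_dz hg hq)).derivWithin
    (P.uniqueDiffOn_Icc_h _ hq.2)

theorem dx_clm_comp_strip (hg : ContDiffOn ℝ 1 g P.strip) (hq : q ∈ P.strip) :
    P.dx (fun y => ℓ (g y)) q = ℓ (P.dx g q) :=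
  (ℓ.hasFDerivAt.comp_hasDerivAt _ (hasDerivAt_dx_strip hg hq)).deriv

theorem dz_clm_comp_strip (hg : ContDiffOn ℝ 1 g P.strip) (hq : q ∈ P.strip) :
    P.dz (fun y => ℓ (g y)) q = ℓ (P.dz g q) := by
  rw [dz_eq_deriv hq]
  exact (ℓ.hasFDerivAt.comp_hasDerivAt _ (hasDerivAt_dz_strip hg hq)).deriv

theorem dx_congr_strip {g₁ g₂ : ℝ × ℝ → F} (h : ∀ q ∈ P.strip, g₁ q = g₂ q) (hq : q ∈ P.strip) :
    P.dx g₁ q = P.dx g₂ q := by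
  have : (fun x => g₁ (x, q.2)) = fun x => g₂ (x, q.2) := funext fun x => h _ ⟨mem_univ _, hq.2⟩
  simp only [dx, this]

theorem dz_congr_strip {g₁ g₂ : ℝ × ℝ → F} (h : ∀ q ∈ P.strip, g₁ q = g₂ q) (hq : q ∈ P.strip) :
    P.dz g₁ q = P.dz g₂ q := by
  rw [dz_eq_deriv hq, dz_eq_deriv hq]
  refine Filter.EventuallyEq.deriv_eq ?_
  filter_upwards [Ioo_mem_nhds hq.2.1 hq.2.2] with z hz using h _ ⟨mem_univ _, hz⟩

theorem lap_clm_comp (hg : ContDiffOn ℝ 2 g P.strip) (hq : q ∈ P.strip) :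
    P.lap (fun y => ℓ (g y)) q = ℓ (P.lap g q) := by
  have hg1 : ContDiffOn ℝ 1 g P.strip := hg.of_le (by norm_num)
  rw [lap, lap, map_add]
  congr 1
  · rw [← dx_clm_comp_strip ℓ (contDiffOn_one_dx_strip hg) hq]
    exact dx_congr_strip (fun y hy => dx_clm_comp_strip ℓ hg1 hy) hq
  · rw [← dz_clm_comp_strip ℓ (contDiffOn_one_dz_strip hg) hq]
    exact dz_congr_strip (fun y hy => dz_clm_comp_strip ℓ hg1 hy) hq

theorem PeriodicX.clm_comp (hg : P.PeriodicX g) : P.PeriodicX fun y => ℓ (g y) := fun x z hz => by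
  simp only [hg x z hz]

end Parts

theorem dx_steadyV (a₀ a₁ : ℝ) (q : ℝ × ℝ) : P.dx (steadyV a₀ a₁) q = a₀ := by
  have : HasDerivAt (fun x : ℝ => a₀ * x + a₁) a₀ q.1 := by
    simpa using ((hasDerivAt_id q.1).const_mul a₀).add_const a₁
  exact this.deriv

theorem dz_steadyV (a₀ a₁ : ℝ) (q : ℝ × ℝ) : P.dz (steadyV a₀ a₁) q = 0 := by
  simp [dz, steadyV]

section SpectralStability

variable {Ψ δ ρs ps : ℝ × ℝ → ℝ} {a₀ a₁ δ₀ : ℝ}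

/-- The energy identity for one of the real components of a normal mode. -/
theorem normalMode_component_energy {lam : ℂ} {ρ v u w p : ℝ × ℝ → ℂ}
    (hΨ : ContDiffOn ℝ 2 Ψ P.closedStrip)
    (hm : P.IsNormalMode ℂ Ψ ρs (steadyV a₀ a₁) lam ρ v u w p) (ℓ : ℂ →L[ℝ] ℝ) :
    (∫ q in P.cell, ((ℓ (lam * u q) - P.f * ℓ (v q) + P.dx Ψ q * ℓ (ρ q)) * ℓ (u q)
      + (ℓ (lam * w q) + P.dz Ψ q * ℓ (ρ q)) * ℓ (w q)
      + P.ν * (ℓ (P.dx u q) ^ 2 + ℓ (P.dz u q) ^ 2 + ℓ (P.dx w q) ^ 2 + ℓ (P.dz w q) ^ 2)))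
      + P.ν * P.α * ∫ x in (0 : ℝ)..P.L, ℓ (u (x, 0)) ^ 2 = 0 := by
  have hΨ1 : ContDiffOn ℝ 1 Ψ P.closedStrip := hΨ.of_le (by norm_num)
  have cΨx := continuousOn_dx hΨ1
  have cΨz := continuousOn_dz hΨ1
  have cu := hm.u_smooth.continuousOn
  have cw := hm.w_smooth.continuousOn
  have cv := hm.v_smooth.continuousOn
  have cρ := hm.ρ_smooth.continuousOn
  have hc : ∀ {n : WithTop ℕ∞} {g : ℝ × ℝ → ℂ} {s : Set (ℝ × ℝ)}, ContDiffOn ℝ n g s →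
      ContDiffOn ℝ n (fun y => ℓ (g y)) s := fun h => ℓ.contDiff.comp_contDiffOn h
  have key := stokes_energy (P := P) (u := fun y => ℓ (u y)) (w := fun y => ℓ (w y))
    (p := fun y => ℓ (p y))
    (H₁ := fun q => ℓ (lam * u q) - P.f * ℓ (v q) + P.dx Ψ q * ℓ (ρ q))
    (H₂ := fun q => ℓ (lam * w q) + P.dz Ψ q * ℓ (ρ q))
    (hc hm.u_smooth) (hc hm.w_smooth) (ℓ.continuous.comp_continuousOn hm.p_cont)
    (hc hm.u_smooth_int) (hc hm.w_smooth_int) (hc hm.p_smooth_int)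
    (hm.u_periodic.clm_comp ℓ) (hm.w_periodic.clm_comp ℓ) (hm.p_periodic.clm_comp ℓ)
    (by fun_prop) (by fun_prop) ?_ ?_ ?_ ?_
  · refine Eq.trans ?_ key
    congr 1
    refine setIntegral_congr_fun P.isCompact_cell.isClosed.measurableSet fun q hq => ?_
    have hq' := P.cell_subset hq
    simp only [dx_clm_comp ℓ hm.u_smooth hq', dz_clm_comp ℓ hm.u_smooth hq',
      dx_clm_comp ℓ hm.w_smooth hq', dz_clm_comp ℓ hm.w_smooth hq']
  · intro q hq
    rw [lap_clm_comp ℓ hm.u_smooth_int hq, dx_clm_comp_strip ℓ hm.p_smooth_int hq, hm.eq_u q hq]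
    simp only [map_sub, map_add, map_smul, smul_eq_mul]
    ring
  · intro q hq
    rw [lap_clm_comp ℓ hm.w_smooth_int hq, dz_clm_comp_strip ℓ hm.p_smooth_int hq, hm.eq_w q hq]
    simp only [map_sub, map_smul, smul_eq_mul]
    ring
  · intro q hq
    have hq' := P.strip_subset hq
    rw [dx_clm_comp ℓ hm.u_smooth hq', dz_clm_comp ℓ hm.w_smooth hq', ← map_add, hm.div_free q hq,
      map_zero]
  · have h0 : (0 : ℝ) ∈ Icc 0 P.h := left_mem_Icc.2 P.h_pos.le
    have hh : P.h ∈ Icc 0 P.h := right_mem_Icc.2 P.h_pos.le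
    refine ⟨fun x => ?_, fun x => ?_, fun x => ?_, fun x => ?_⟩
    · rw [dz_clm_comp ℓ hm.u_smooth ⟨mem_univ _, hh⟩, hm.bc.slip_top, map_zero]
    · simp only [hm.bc.imp_top, map_zero]
    · rw [dz_clm_comp ℓ hm.u_smooth ⟨mem_univ _, h0⟩, ← map_smul, ← map_sub, hm.bc.slip_bot,
        map_zero]
    · simp only [hm.bc.imp_bot, map_zero]

theorem eq_zero_of_dz_eq_zero {g : ℝ × ℝ → ℂ} (hg : ContDiffOn ℝ 1 g P.closedStrip)
    (hd : ∀ q ∈ P.closedStrip, P.dz g q = 0) (h0 : ∀ x, g (x, 0) = 0) :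
    ∀ q ∈ P.closedStrip, g q = 0 := by
  rintro ⟨x, z⟩ hq
  have h := (convex_Icc (0 : ℝ) P.h).norm_image_sub_le_of_norm_hasDerivWithin_le
    (f := fun z => g (x, z)) (f' := fun z => P.dz g (x, z)) (C := 0)
    (fun y hy => hasDerivWithinAt_dz hg (q := (x, y)) ⟨mem_univ _, hy⟩)
    (fun y hy => by rw [hd (x, y) ⟨mem_univ _, hy⟩, norm_zero])
    (left_mem_Icc.2 P.h_pos.le) hq.2
  simpa [h0] using h

/-- The energy identities of the real and imaginary parts add up to Re λ ∫En + ν ∫Dis + να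
∫|u(x,0)|² = 0. If Re λ ≥ 0, all three terms are nonnegative, hence zero; then ∇u and ∇w vanish, and
so does the velocity at the bottom. -/
theorem spectrallyStable (hΨ : ContDiffOn ℝ 2 Ψ P.closedStrip) (hδ : ContinuousOn δ P.closedStrip)
    (hs : P.IsSteadyState Ψ δ a₀ a₁ ρs ps) (hδ₀ : δ₀ < 0) (hδlt : ∀ q ∈ P.strip, δ q < δ₀)
    (hf : 0 < P.f + a₀) : P.SpectrallyStable Ψ ρs (steadyV a₀ a₁) := by
  intro lam ρ v u w p hm hne
  by_contra! hre
  have hΨ1 : ContDiffOn ℝ 1 Ψ P.closedStrip := hΨ.of_le (by norm_num)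
  have cΨx := continuousOn_dx hΨ1
  have cΨz := continuousOn_dz hΨ1
  have cu := hm.u_smooth.continuousOn
  have cw := hm.w_smooth.continuousOn
  have cv := hm.v_smooth.continuousOn
  have cρ := hm.ρ_smooth.continuousOn
  have cux := continuousOn_dx hm.u_smooth
  have cuz := continuousOn_dz hm.u_smooth
  have cwx := continuousOn_dx hm.w_smooth
  have cwz := continuousOn_dz hm.w_smooth
  -- The gap δ₀ survives passage to the closure, so that 1/(-δ) is continuous up to the boundary.
  have hδ' : ∀ q ∈ P.closedStrip, δ q < 0 := by
    intro q hq
    have : δ q ≤ δ₀ := le_on_closure (f := δ) (g := fun _ => δ₀) (fun y hy => (hδlt y hy).le)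
      (hδ.mono (by
        rw [strip, closure_prod_eq, closure_Ioo P.h_pos.ne, closure_univ]; rfl))
      continuousOn_const (closedStrip_subset_closure hq)
    linarith
  have hδne : ∀ q ∈ P.closedStrip, δ q ≠ 0 := fun q hq => (hδ' q hq).ne
  have k1 := normalMode_component_energy hΨ hm Complex.reCLM
  have k2 := normalMode_component_energy hΨ hm Complex.imCLM
  simp only [Complex.reCLM_apply, Complex.imCLM_apply] at k1 k2
  set Dis : ℝ × ℝ → ℝ := fun q => ‖P.dx u q‖ ^ 2 + ‖P.dz u q‖ ^ 2 + ‖P.dx w q‖ ^ 2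
    + ‖P.dz w q‖ ^ 2 with hDis
  -- The weights of |v|² and |ρ|² are the ones for which the Coriolis and the buoyancy work cancel
  -- against the equations for v and ρ.
  set En : ℝ × ℝ → ℝ := fun q => ‖u q‖ ^ 2 + ‖w q‖ ^ 2 + P.f / (P.f + a₀) * ‖v q‖ ^ 2
    + ‖ρ q‖ ^ 2 / (- δ q) with hEn
  have hpos : ∀ q ∈ P.closedStrip, 0 ≤ En q := by
    intro q hq
    have := hδ' q hq
    have : 0 < - δ q := by linarith
    have := P.f_pos
    positivity
  have hDis0 : ∀ q, 0 ≤ Dis q := fun q => by positivity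
  have cEn : ContinuousOn En P.closedStrip := by
    have : ContinuousOn (fun q => ‖ρ q‖ ^ 2 / (- δ q)) P.closedStrip :=
      (by fun_prop : ContinuousOn (fun q => ‖ρ q‖ ^ 2) P.closedStrip).div hδ.neg
        fun q hq => neg_ne_zero.2 (hδne q hq)
    fun_prop
  have cDis : ContinuousOn Dis P.closedStrip := by fun_prop
  have hk : (∫ q in P.cell, (lam.re * En q + P.ν * Dis q))
      + P.ν * P.α * ∫ x in (0 : ℝ)..P.L, ‖u (x, 0)‖ ^ 2 = 0 := by
    have hsum := congrArg₂ (· + ·) k1 k2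
    simp only [add_zero] at hsum
    refine Eq.trans ?_ hsum
    rw [add_add_add_comm, ← integral_add, ← mul_add, ← intervalIntegral.integral_add]
    · congr 1
      · refine setIntegral_congr_fun P.isCompact_cell.isClosed.measurableSet fun q hq => ?_
        -- The equations hold only inside the strip; the identity of the two continuous integrands
        -- extends to the closed cell by density.
        refine eqOn_closedStrip (f := fun q => lam.re * En q + P.ν * Dis q) (g := fun a =>
          ((lam * u a).re - P.f * (v a).re + P.dx Ψ a * (ρ a).re) * (u a).re +
            ((lam * w a).re + P.dz Ψ a * (ρ a).re) * (w a).re +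
            P.ν * ((P.dx u a).re ^ 2 + (P.dz u a).re ^ 2 + (P.dx w a).re ^ 2 + (P.dz w a).re ^ 2) +
          (((lam * u a).im - P.f * (v a).im + P.dx Ψ a * (ρ a).im) * (u a).im +
            ((lam * w a).im + P.dz Ψ a * (ρ a).im) * (w a).im +
            P.ν * ((P.dx u a).im ^ 2 + (P.dz u a).im ^ 2 + (P.dx w a).im ^ 2 + (P.dz w a).im ^ 2)))
          (by fun_prop) (by fun_prop) (fun q hq => ?_) q (P.cell_subset hq)
        have e1 := hm.eq_ρ q hq
        have e2 := hm.eq_v q hq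
        rw [hs.grad_ρs_x q hq, hs.grad_ρs_z q hq] at e1
        rw [dx_steadyV, dz_steadyV] at e2
        have e1r := congrArg Complex.re e1
        have e1i := congrArg Complex.im e1
        have e2r := congrArg Complex.re e2
        have e2i := congrArg Complex.im e2
        simp only [Complex.mul_re, Complex.mul_im, Complex.neg_re, Complex.neg_im, Complex.add_re,
          Complex.add_im, Complex.sub_re, Complex.sub_im, Complex.smul_re, Complex.smul_im,
          smul_eq_mul, zero_mul] at e1r e1i e2r e2i
        have hδq := hδne q (P.strip_subset hq)
        simp only [hEn, hDis, ← Complex.normSq_eq_norm_sq, Complex.normSq_apply, Complex.mul_re,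
          Complex.mul_im]
        have a1 : lam.re * (((ρ q).re * (ρ q).re + (ρ q).im * (ρ q).im) / (- δ q))
            = (P.dx Ψ q * (u q).re + P.dz Ψ q * (w q).re) * (ρ q).re
              + (P.dx Ψ q * (u q).im + P.dz Ψ q * (w q).im) * (ρ q).im := by
          rw [← mul_div_assoc, div_eq_iff (neg_ne_zero.2 hδq)]
          linear_combination (ρ q).re * e1r + (ρ q).im * e1i
        have a2 : lam.re * (P.f / (P.f + a₀) * ((v q).re * (v q).re + (v q).im * (v q).im))
            = - P.f * ((u q).re * (v q).re + (u q).im * (v q).im) := by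
          rw [div_mul_eq_mul_div, ← mul_div_assoc, div_eq_iff hf.ne']
          linear_combination P.f * (v q).re * e2r + P.f * (v q).im * e2i
        linear_combination a1 + a2
      · congr 1
        refine intervalIntegral.integral_congr fun x _ => ?_
        simp only [← Complex.normSq_eq_norm_sq, Complex.normSq_apply]; ring
    · have c0 : Continuous fun x : ℝ => u (x, 0) := cu.comp_continuous (by fun_prop)
        fun x => ⟨mem_univ _, left_mem_Icc.2 P.h_pos.le⟩
      exact ((Complex.continuous_re.comp c0).pow 2).intervalIntegrable _ _
    · have c0 : Continuous fun x : ℝ => u (x, 0) := cu.comp_continuous (by fun_prop)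
        fun x => ⟨mem_univ _, left_mem_Icc.2 P.h_pos.le⟩
      exact ((Complex.continuous_im.comp c0).pow 2).intervalIntegrable _ _
    · refine ContinuousOn.integrableOn_compact P.isCompact_cell (ContinuousOn.mono ?_ P.cell_subset)
      fun_prop
    · refine ContinuousOn.integrableOn_compact P.isCompact_cell (ContinuousOn.mono ?_ P.cell_subset)
      fun_prop
  have hT0 : ∀ q ∈ P.cell, 0 ≤ lam.re * En q + P.ν * Dis q := fun q hq => by
    have := hpos q (P.cell_subset hq)
    have := hDis0 q
    have := P.ν_pos
    positivity
  have hI1 : 0 ≤ ∫ q in P.cell, (lam.re * En q + P.ν * Dis q) :=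
    setIntegral_nonneg P.isCompact_cell.isClosed.measurableSet hT0
  have hI2 : 0 ≤ ∫ x in (0 : ℝ)..P.L, ‖u (x, 0)‖ ^ 2 :=
    intervalIntegral.integral_nonneg P.L_pos.le fun x _ => by positivity
  have hνα := mul_pos P.ν_pos P.α_pos
  have hz1 : ∫ q in P.cell, (lam.re * En q + P.ν * Dis q) = 0 := by
    nlinarith [mul_nonneg hνα.le hI2]
  have hz2 : ∫ x in (0 : ℝ)..P.L, ‖u (x, 0)‖ ^ 2 = 0 := by
    have : P.ν * P.α * ∫ x in (0 : ℝ)..P.L, ‖u (x, 0)‖ ^ 2 = 0 := by linarith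
    exact (mul_eq_zero.1 this).resolve_left hνα.ne'
  have hv1 := eq_zero_of_integral_cell_eq_zero
    (ContinuousOn.mono (by fun_prop) P.cell_subset) hT0 hz1
  have hDisz : ∀ q ∈ P.cell, Dis q = 0 := by
    intro q hq
    have h1 := hv1 q hq
    have h2 := mul_nonneg hre (hpos q (P.cell_subset hq))
    have h3 := hDis0 q
    have h4 := P.ν_pos
    have : P.ν * Dis q = 0 := le_antisymm (by linarith) (by positivity)
    exact (mul_eq_zero.1 this).resolve_left h4.ne'
  have hDisp : P.PeriodicX Dis := by
    intro x z hz
    simp only [hDis, hm.u_periodic.dx x z hz, hm.u_periodic.dz x z hz, hm.w_periodic.dx x z hz,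
      hm.w_periodic.dz x z hz]
  have hDisz' := hDisp.eq_zero_of_cell hDisz
  have hub : ∀ x, u (x, 0) = 0 := by
    have h0 : (0 : ℝ) ∈ Icc 0 P.h := left_mem_Icc.2 P.h_pos.le
    intro x
    have hp : Function.Periodic (fun x => u (x, 0)) P.L := fun x => hm.u_periodic x 0 h0
    obtain ⟨y, hy, he⟩ := hp.exists_mem_Ico₀ P.L_pos x
    rw [show u (x, 0) = u (y, 0) from he]
    have c0 : Continuous fun x : ℝ => u (x, 0) := cu.comp_continuous (by fun_prop)
        fun x => ⟨mem_univ _, h0⟩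
    have := eq_zero_of_intervalIntegral_eq_zero P.L_pos
      (f := fun x => ‖u (x, 0)‖ ^ 2) (c0.norm.pow 2).continuousOn (fun x _ => by positivity) hz2 y
      (Ico_subset_Icc_self hy)
    simpa using this
  obtain ⟨q, hq, hne⟩ := hne
  have hq' := P.strip_subset hq
  -- The z-derivatives suffice: u vanishes at z = 0 by the friction term and w by impermeability.
  have hdz : ∀ q ∈ P.closedStrip, P.dz u q = 0 ∧ P.dz w q = 0 := by
    intro q hq
    have := hDisz' q hq
    simp only [hDis] at this
    have h1 := sq_nonneg (‖P.dx u q‖)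
    have h2 := sq_nonneg (‖P.dz u q‖)
    have h3 := sq_nonneg (‖P.dx w q‖)
    have h4 := sq_nonneg (‖P.dz w q‖)
    have a1 : ‖P.dz u q‖ ^ 2 = 0 := by linarith
    have a2 : ‖P.dz w q‖ ^ 2 = 0 := by linarith
    exact ⟨by simpa using a1, by simpa using a2⟩
  rcases hne with h | h
  · exact h (eq_zero_of_dz_eq_zero hm.u_smooth (fun q hq => (hdz q hq).1) hub q hq')
  · exact h (eq_zero_of_dz_eq_zero hm.w_smooth (fun q hq => (hdz q hq).2) hm.bc.imp_bot q hq')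

end SpectralStability

end Params

end RotatingBoussinesq

/-! ### Lyapunov stability of the linearized evolution. -/

namespace RotatingBoussinesq

open Filter Topology MeasureTheory

section TimeDerivative

theorem hasDerivAt_time_slice {S : Set (ℝ × ℝ)} {g : ℝ → ℝ × ℝ → ℝ}
    (hg : ContDiffOn ℝ 1 (fun y : ℝ × (ℝ × ℝ) => g y.1 y.2) (Ici 0 ×ˢ S)) {t : ℝ} (ht : 0 < t)
    {q : ℝ × ℝ} (hq : q ∈ S) :
    HasDerivAt (fun τ => g τ q)
      (fderivWithin ℝ (fun y : ℝ × (ℝ × ℝ) => g y.1 y.2) (Ici 0 ×ˢ S) (t, q) (1, 0)) t := by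
  have h := (hg.differentiableOn one_ne_zero (t, q) ⟨ht.le, hq⟩).hasFDerivWithinAt
  have h1 : HasDerivWithinAt (fun τ : ℝ => (τ, q)) ((1 : ℝ), (0 : ℝ × ℝ)) (Ici 0) t :=
    ((hasDerivAt_id t).prodMk (hasDerivAt_const t q)).hasDerivWithinAt
  exact (HasFDerivWithinAt.comp_hasDerivWithinAt (x := t) (f := fun τ : ℝ => (τ, q))
    (t := Ici 0 ×ˢ S) h h1 (fun τ hτ => ⟨hτ, hq⟩)).hasDerivAt (Ici_mem_nhds ht)

theorem continuousOn_time_deriv {S : Set (ℝ × ℝ)} (hS : UniqueDiffOn ℝ S) {g : ℝ → ℝ × ℝ → ℝ}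
    (hg : ContDiffOn ℝ 1 (fun y : ℝ × (ℝ × ℝ) => g y.1 y.2) (Ici 0 ×ˢ S)) :
    ContinuousOn (fun y : ℝ × (ℝ × ℝ) => deriv (fun τ => g τ y.2) y.1) (Ioi 0 ×ˢ S) := by
  have h1 : ContinuousOn (fun y : ℝ × (ℝ × ℝ) => fderivWithin ℝ
      (fun y : ℝ × (ℝ × ℝ) => g y.1 y.2) (Ici 0 ×ˢ S) y (1, 0)) (Ici 0 ×ˢ S) :=
    (hg.continuousOn_fderivWithin ((uniqueDiffOn_Ici 0).prod hS) le_rfl).clm_apply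
      continuousOn_const
  refine (h1.mono (prod_mono_left Ioi_subset_Ici_self)).congr fun y hy => ?_
  exact (hasDerivAt_time_slice hg hy.1 hy.2).deriv

theorem contDiffOn_time_slice {S : Set (ℝ × ℝ)} {g : ℝ → ℝ × ℝ → ℝ}
    (hg : ContDiffOn ℝ 1 (fun y : ℝ × (ℝ × ℝ) => g y.1 y.2) (Ici 0 ×ˢ S)) {t : ℝ} (ht : 0 ≤ t) :
    ContDiffOn ℝ 1 (g t) S :=
  hg.comp (f := fun q => (t, q)) (by fun_prop) fun q hq => ⟨ht, hq⟩

end TimeDerivative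

namespace Params

variable {P : Params}

theorem normSq_eq {ρ v u w : ℝ × ℝ → ℝ} (hρ : ContinuousOn ρ P.closedStrip)
    (hv : ContinuousOn v P.closedStrip) (hu : ContinuousOn u P.closedStrip)
    (hw : ContinuousOn w P.closedStrip) :
    P.normSq ρ v u w = ∫ q in P.cell, (ρ q ^ 2 + v q ^ 2 + u q ^ 2 + w q ^ 2) := by
  rw [integral_cell (by fun_prop), normSq]

theorem clamp_mem_closedStrip (q : ℝ × ℝ) : (q.1, max 0 (min P.h q.2)) ∈ P.closedStrip :=
  ⟨mem_univ _, le_max_left _ _, max_le P.h_pos.le (min_le_left _ _)⟩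

theorem continuousOn_time_integral {G : ℝ → ℝ × ℝ → ℝ}
    (hG : ContinuousOn (fun y : ℝ × (ℝ × ℝ) => G y.1 y.2) (Ici 0 ×ˢ P.closedStrip)) :
    ContinuousOn (fun t => ∫ q in P.cell, G t q) (Ici 0) := by
  have h1 : Continuous fun y : ℝ × (ℝ × ℝ) => G (max 0 y.1) (y.2.1, max 0 (min P.h y.2.2)) := by
    refine hG.comp_continuous
      (f := fun y : ℝ × (ℝ × ℝ) => (max 0 y.1, (y.2.1, max 0 (min P.h y.2.2)))) (by fun_prop) ?_
    intro y
    exact ⟨mem_Ici.2 (le_max_left _ _), clamp_mem_closedStrip _⟩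
  have h2 := continuous_parametric_integral_of_continuous (μ := volume)
    (f := fun t (q : ℝ × ℝ) => G (max 0 t) (q.1, max 0 (min P.h q.2))) h1 P.isCompact_cell
  refine h2.continuousOn.congr fun t ht => ?_
  refine setIntegral_congr_fun P.isCompact_cell.isClosed.measurableSet fun q hq => ?_
  simp only [clamp_eq hq.2, max_eq_right (mem_Ici.1 ht)]

/-- The weighted energy used for the spectrum is nonincreasing along solutions and is equivalent to
the squared L² norm, because -δ lies between two positive constants; C is the ratio M/m of the
equivalence constants. -/
theorem lyapunovStable {Ψ δ ρs ps : ℝ × ℝ → ℝ} {a₀ a₁ δ₀ : ℝ}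
    (hΨ : ContDiffOn ℝ 2 Ψ P.closedStrip) (hδ : ContinuousOn δ P.closedStrip)
    (hδp : P.PeriodicX δ)
    (hs : P.IsSteadyState Ψ δ a₀ a₁ ρs ps) (hδ₀ : δ₀ < 0) (hδlt : ∀ q ∈ P.strip, δ q < δ₀)
    (hf : 0 < P.f + a₀) : P.LyapunovStable Ψ ρs (steadyV a₀ a₁) := by
  have hΨ1 : ContDiffOn ℝ 1 Ψ P.closedStrip := hΨ.of_le (by norm_num)
  have cΨx := continuousOn_dx hΨ1
  have cΨz := continuousOn_dz hΨ1
  have hδ' : ∀ q ∈ P.closedStrip, δ q ≤ δ₀ := by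
    intro q hq
    exact le_on_closure (f := δ) (g := fun _ => δ₀) (fun y hy => (hδlt y hy).le)
      (hδ.mono (by
        rw [strip, closure_prod_eq, closure_Ioo P.h_pos.ne, closure_univ]; rfl))
      continuousOn_const (closedStrip_subset_closure hq)
  obtain ⟨B, hB0, hB⟩ := exists_bound_closedStrip hδp hδ
  have hγ : ∀ q ∈ P.closedStrip, 0 < - δ q := fun q hq => by linarith [hδ' q hq]
  set b := P.f / (P.f + a₀) with hb
  have hb0 : 0 < b := div_pos P.f_pos hf
  -- m and M bound the weights 1/(-δ), b and 1 from below and above. B + 1 in place of B keeps the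
  -- denominator visibly positive.
  set m := min (1 / (B + 1)) (min b 1) with hm
  have hm0 : 0 < m := by positivity
  set M := max (1 / (-δ₀)) (max b 1) with hM
  have hM0 : 0 < M := lt_max_of_lt_right (lt_max_of_lt_left hb0)
  refine ⟨M / m, ?_⟩
  intro ρ v u w p h t ht
  let G : ℝ → ℝ × ℝ → ℝ := fun t q => ρ t q ^ 2 / (- δ q) + b * v t q ^ 2 + u t q ^ 2 + w t q ^ 2
  let E : ℝ → ℝ := fun t => ∫ q in P.cell, G t q
  have hslice : ∀ {g : ℝ → ℝ × ℝ → ℝ}, ContDiffOn ℝ 1 (fun y : ℝ × (ℝ × ℝ) => g y.1 y.2)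
      (Ici 0 ×ˢ P.closedStrip) → ∀ t ≥ 0, ContinuousOn (g t) P.closedStrip := fun hg t ht =>
    (contDiffOn_time_slice hg ht).continuousOn
  have cG : ∀ t ≥ 0, ContinuousOn (G t) P.closedStrip := by
    intro t ht
    have := hslice h.ρ_smooth t ht
    have := hslice h.v_smooth t ht
    have := hslice h.u_smooth t ht
    have := hslice h.w_smooth t ht
    have : ContinuousOn (fun q => ρ t q ^ 2 / (- δ q)) P.closedStrip :=
      (by fun_prop : ContinuousOn (fun q => ρ t q ^ 2) P.closedStrip).div hδ.neg
        fun q hq => (hγ q hq).ne'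
    fun_prop
  have hcompare : ∀ t ≥ 0, m * P.normSq (ρ t) (v t) (u t) (w t) ≤ E t ∧
      E t ≤ M * P.normSq (ρ t) (v t) (u t) (w t) := by
    intro t ht
    have c1 := hslice h.ρ_smooth t ht
    have c2 := hslice h.v_smooth t ht
    have c3 := hslice h.u_smooth t ht
    have c4 := hslice h.w_smooth t ht
    have hint : ∀ {f : ℝ × ℝ → ℝ}, ContinuousOn f P.closedStrip → IntegrableOn f P.cell :=
      fun hf => (hf.mono P.cell_subset).integrableOn_compact P.isCompact_cell
    have hms := P.isCompact_cell.isClosed.measurableSet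
    rw [normSq_eq c1 c2 c3 c4, ← integral_const_mul, ← integral_const_mul]
    constructor
    · refine setIntegral_mono_on (hint (by fun_prop)) (hint (cG t ht)) hms fun q hq => ?_
      have hq' := P.cell_subset hq
      have h1 : m ≤ 1 / (- δ q) := by
        refine (min_le_left _ _).trans (one_div_le_one_div_of_le (hγ q hq') ?_)
        linarith [neg_le_abs (δ q), hB q hq']
      have h2 : m ≤ b := (min_le_right _ _).trans (min_le_left _ _)
      have h3 : m ≤ 1 := (min_le_right _ _).trans (min_le_right _ _)
      have e : G t q = 1 / (- δ q) * ρ t q ^ 2 + b * v t q ^ 2 + 1 * u t q ^ 2 + 1 * w t q ^ 2 := by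
        simp only [G]; ring
      rw [e]
      simp only [mul_add]
      gcongr
    · refine setIntegral_mono_on (hint (cG t ht)) (hint (by fun_prop)) hms fun q hq => ?_
      have hq' := P.cell_subset hq
      have h1 : 1 / (- δ q) ≤ M := by
        refine le_trans (one_div_le_one_div_of_le (by linarith) ?_) (le_max_left _ _)
        linarith [hδ' q hq']
      have h2 : b ≤ M := (le_max_left _ _).trans (le_max_right _ _)
      have h3 : 1 ≤ M := (le_max_right _ _).trans (le_max_right _ _)
      have e : G t q = 1 / (- δ q) * ρ t q ^ 2 + b * v t q ^ 2 + 1 * u t q ^ 2 + 1 * w t q ^ 2 := by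
        simp only [G]; ring
      rw [e]
      simp only [mul_add]
      gcongr
  have cρ2 := h.ρ_smooth.continuousOn
  have cv2 := h.v_smooth.continuousOn
  have cu2 := h.u_smooth.continuousOn
  have cw2 := h.w_smooth.continuousOn
  have cδ2 : ContinuousOn (fun y : ℝ × (ℝ × ℝ) => - δ y.2) (Ici 0 ×ˢ P.closedStrip) :=
    (hδ.comp (f := fun y : ℝ × (ℝ × ℝ) => y.2) (by fun_prop) fun y hy => hy.2).neg
  have cE : ContinuousOn E (Ici 0) := by
    refine continuousOn_time_integral ?_
    have : ContinuousOn (fun y : ℝ × (ℝ × ℝ) => ρ y.1 y.2 ^ 2 / (- δ y.2))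
        (Ici 0 ×ˢ P.closedStrip) := (cρ2.pow 2).div cδ2 fun y hy => (hγ y.2 hy.2).ne'
    fun_prop
  let G' : ℝ → ℝ × ℝ → ℝ := fun t q => 2 * ρ t q * deriv (fun τ => ρ τ q) t / (- δ q)
    + b * (2 * v t q * deriv (fun τ => v τ q) t) + 2 * u t q * deriv (fun τ => u τ q) t
    + 2 * w t q * deriv (fun τ => w τ q) t
  have hdE : ∀ t > 0, HasDerivAt E (∫ q in P.cell, G' t q) t := by
    intro t ht
    refine hasDerivAt_setIntegral_of_continuousOn (a := 0) (b := t + 1) P.isCompact_cell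
      ⟨ht, lt_add_one t⟩ ?_ ?_ ?_
    · intro s hs
      exact (cG s hs.1.le).mono P.cell_subset
    · have hsub : Ioo 0 (t + 1) ×ˢ P.cell ⊆ Ioi 0 ×ˢ P.closedStrip :=
        prod_mono Ioo_subset_Ioi_self P.cell_subset
      have hsub2 : Ioo 0 (t + 1) ×ˢ P.cell ⊆ Ici 0 ×ˢ P.closedStrip :=
        hsub.trans (prod_mono_left Ioi_subset_Ici_self)
      have d1 := (continuousOn_time_deriv P.uniqueDiffOn_closedStrip h.ρ_smooth).mono hsub
      have d2 := (continuousOn_time_deriv P.uniqueDiffOn_closedStrip h.v_smooth).mono hsub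
      have d3 := (continuousOn_time_deriv P.uniqueDiffOn_closedStrip h.u_smooth).mono hsub
      have d4 := (continuousOn_time_deriv P.uniqueDiffOn_closedStrip h.w_smooth).mono hsub
      have c1 := cρ2.mono hsub2
      have c2 := cv2.mono hsub2
      have c3 := cu2.mono hsub2
      have c4 := cw2.mono hsub2
      have c5 := cδ2.mono hsub2
      have : ContinuousOn (fun y : ℝ × (ℝ × ℝ) => 2 * ρ y.1 y.2 *
          deriv (fun τ => ρ τ y.2) y.1 / (- δ y.2)) (Ioo 0 (t + 1) ×ˢ P.cell) :=
        ((continuousOn_const.mul c1).mul d1).div c5 fun y hy => (hγ y.2 (hsub hy).2).ne'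
      exact ((this.add (continuousOn_const.mul ((continuousOn_const.mul c2).mul d2))).add
        ((continuousOn_const.mul c3).mul d3)).add ((continuousOn_const.mul c4).mul d4)
    · intro s hs q hq
      have hq' := P.cell_subset hq
      have d1 := (hasDerivAt_time_slice h.ρ_smooth hs.1 hq').differentiableAt.hasDerivAt
      have d2 := (hasDerivAt_time_slice h.v_smooth hs.1 hq').differentiableAt.hasDerivAt
      have d3 := (hasDerivAt_time_slice h.u_smooth hs.1 hq').differentiableAt.hasDerivAt
      have d4 := (hasDerivAt_time_slice h.w_smooth hs.1 hq').differentiableAt.hasDerivAt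
      have := ((((d1.pow 2).div_const (- δ q)).add ((d2.pow 2).const_mul b)).add (d3.pow 2)).add
        (d4.pow 2)
      refine (this.congr_deriv ?_)
      simp [G']
  have hneg : ∀ t > 0, ∫ q in P.cell, G' t q ≤ 0 := by
    intro t ht
    have hsl : ∀ {g : ℝ → ℝ × ℝ → ℝ}, ContDiffOn ℝ 1 (fun y : ℝ × (ℝ × ℝ) => g y.1 y.2)
        (Ici 0 ×ˢ P.closedStrip) →
        ContinuousOn (fun q => deriv (fun τ => g τ q) t) P.closedStrip := fun hg =>
      (continuousOn_time_deriv P.uniqueDiffOn_closedStrip hg).comp (f := fun q => (t, q))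
        (by fun_prop) fun q hq => ⟨ht, hq⟩
    have d1 := hsl h.ρ_smooth
    have d2 := hsl h.v_smooth
    have d3 := hsl h.u_smooth
    have d4 := hsl h.w_smooth
    have c1 := hslice h.ρ_smooth t ht.le
    have c2 := hslice h.v_smooth t ht.le
    have c3 := hslice h.u_smooth t ht.le
    have c4 := hslice h.w_smooth t ht.le
    have s3 := contDiffOn_time_slice h.u_smooth ht.le
    have s4 := contDiffOn_time_slice h.w_smooth ht.le
    have key := stokes_energy (P := P) (u := u t) (w := w t) (p := p t)
      (H₁ := fun q => deriv (fun τ => u τ q) t - P.f * v t q + P.dx Ψ q * ρ t q)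
      (H₂ := fun q => deriv (fun τ => w τ q) t + P.dz Ψ q * ρ t q)
      s3 s4 (h.p_cont t ht) (h.u_smooth_int t ht)
      (h.w_smooth_int t ht) (h.p_smooth_int t ht) (h.u_periodic t ht.le) (h.w_periodic t ht.le)
      (h.p_periodic t ht) (by fun_prop) (by fun_prop)
      (fun q hq => by rw [h.eq_u t ht q hq]; ring) (fun q hq => by rw [h.eq_w t ht q hq]; ring)
      (h.div_free t ht) (h.bc t ht)
    have cux := continuousOn_dx s3
    have cuz := continuousOn_dz s3
    have cwx := continuousOn_dx s4
    have cwz := continuousOn_dz s4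
    -- Half the energy rate is the integral from the Stokes identity without its dissipation. By
    -- that identity it equals minus dissipation minus friction.
    have hGe : ∫ q in P.cell, G' t q = 2 * ((∫ q in P.cell,
        ((deriv (fun τ => u τ q) t - P.f * v t q + P.dx Ψ q * ρ t q) * u t q
        + (deriv (fun τ => w τ q) t + P.dz Ψ q * ρ t q) * w t q
        + P.ν * (P.dx (u t) q ^ 2 + P.dz (u t) q ^ 2 + P.dx (w t) q ^ 2 + P.dz (w t) q ^ 2)))
        - ∫ q in P.cell,
          P.ν * (P.dx (u t) q ^ 2 + P.dz (u t) q ^ 2 + P.dx (w t) q ^ 2 + P.dz (w t) q ^ 2)) := by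
      rw [← integral_sub, ← integral_const_mul]
      · refine setIntegral_congr_fun P.isCompact_cell.isClosed.measurableSet fun q hq => ?_
        have cq : ContinuousOn (fun q => 2 * ρ t q * deriv (fun τ => ρ τ q) t / (- δ q))
            P.closedStrip := (by fun_prop : ContinuousOn (fun q => 2 * ρ t q *
              deriv (fun τ => ρ τ q) t) P.closedStrip).div hδ.neg fun q hq => (hγ q hq).ne'
        refine eqOn_closedStrip (f := G' t) (g := fun q => 2 *
          ((deriv (fun τ => u τ q) t - P.f * v t q + P.dx Ψ q * ρ t q) * u t q
          + (deriv (fun τ => w τ q) t + P.dz Ψ q * ρ t q) * w t q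
          + P.ν * (P.dx (u t) q ^ 2 + P.dz (u t) q ^ 2 + P.dx (w t) q ^ 2 + P.dz (w t) q ^ 2)
          - P.ν * (P.dx (u t) q ^ 2 + P.dz (u t) q ^ 2 + P.dx (w t) q ^ 2 + P.dz (w t) q ^ 2)))
          (by fun_prop) (by fun_prop) (fun q hq => ?_) q (P.cell_subset hq)
        have hγq := hγ q (P.strip_subset hq)
        have hδq : δ q ≠ 0 := by intro h0; rw [h0] at hγq; simp at hγq
        simp only [G']
        rw [h.eq_ρ t ht q hq, h.eq_v t ht q hq, hs.grad_ρs_x q hq, hs.grad_ρs_z q hq, dx_steadyV,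
          dz_steadyV, hb]
        field_simp
        ring
      · refine ContinuousOn.integrableOn_compact P.isCompact_cell
          (ContinuousOn.mono ?_ P.cell_subset)
        fun_prop
      · refine ContinuousOn.integrableOn_compact P.isCompact_cell
          (ContinuousOn.mono ?_ P.cell_subset)
        fun_prop
    have hν := P.ν_pos
    have i1 : 0 ≤ ∫ q in P.cell,
        P.ν * (P.dx (u t) q ^ 2 + P.dz (u t) q ^ 2 + P.dx (w t) q ^ 2 + P.dz (w t) q ^ 2) :=
      integral_nonneg fun q => by positivity
    have i2 : 0 ≤ ∫ x in (0 : ℝ)..P.L, u t (x, 0) ^ 2 :=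
      intervalIntegral.integral_nonneg P.L_pos.le fun x _ => by positivity
    rw [hGe]
    nlinarith [mul_nonneg (mul_pos hν P.α_pos).le i2]
  -- The equations are available for t > 0 only; continuity of E at t = 0 brings in the initial
  -- data.
  have hanti : AntitoneOn E (Ici 0) := by
    refine antitoneOn_of_deriv_nonpos (convex_Ici 0) cE ?_ ?_
    · rw [interior_Ici]
      exact fun t ht => (hdE t ht).differentiableAt.differentiableWithinAt
    · rw [interior_Ici]
      intro t ht
      rw [(hdE t ht).deriv]
      exact hneg t ht
  have h1 := (hcompare t ht).1
  have h2 := (hcompare 0 le_rfl).2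
  have h3 := hanti (mem_Ici.2 le_rfl) ht ht
  rw [div_mul_eq_mul_div, le_div_iff₀ hm0]
  linarith

end Params

end RotatingBoussinesq

/-! ### Trigonometric bases in x and z, and their completeness. -/

namespace RotatingBoussinesq

open Filter Topology MeasureTheory

namespace Params

noncomputable section

variable (P : Params)

/-- The wave number in `x`. -/
def wx (k : ℤ) : ℝ := 2 * Real.pi / P.L * k

/-- The wave number in `z`. -/
def wz (n : ℕ) : ℝ := Real.pi / P.h * (n + 1)

/-- The Hartley basis of `L²(0,L)`. -/
def τ (k : ℤ) (x : ℝ) : ℝ := (Real.cos (P.wx k * x) + Real.sin (P.wx k * x)) / √P.L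

/-- The sine basis of `L²(0,h)`. -/
def sn (n : ℕ) (z : ℝ) : ℝ := √(2 / P.h) * Real.sin (P.wz n * z)

/-- The normalized cosines. -/
def cs (n : ℕ) (z : ℝ) : ℝ := √(2 / P.h) * Real.cos (P.wz n * z)

/-- The eigenvalue of `-Δ`. -/
def ev (n : ℕ) (k : ℤ) : ℝ := P.wz n ^ 2 + P.wx k ^ 2

theorem wx_neg (k : ℤ) : P.wx (-k) = - P.wx k := by simp [wx]

theorem wx_zero : P.wx 0 = 0 := by simp [wx]

theorem wz_pos (n : ℕ) : 0 < P.wz n := by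
  have := P.h_pos
  have := Real.pi_pos
  unfold wz; positivity

theorem wx_mul_L (k : ℤ) : P.wx k * P.L = k * (2 * Real.pi) := by
  have := P.L_pos.ne'
  unfold wx; field_simp

theorem wz_mul_h (n : ℕ) : P.wz n * P.h = (n + 1 : ℕ) * Real.pi := by
  have := P.h_pos.ne'
  unfold wz; push_cast; field_simp

theorem wx_ne_zero {k : ℤ} (hk : k ≠ 0) : P.wx k ≠ 0 := by
  have := P.L_pos.ne'
  have := Real.pi_ne_zero
  have : (k : ℝ) ≠ 0 := by exact_mod_cast hk
  unfold wx; positivity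

theorem ev_pos (n : ℕ) (k : ℤ) : 0 < P.ev n k := by
  have := P.wz_pos n
  unfold ev; positivity

/-- Differentiation reproduces cos + sin up to the reflection k ↦ -k. This is what makes one real
family indexed by ℤ convenient; the reflections of indices throughout come from here. -/
theorem hasDerivAt_τ (k : ℤ) (x : ℝ) : HasDerivAt (P.τ k) (P.wx k * P.τ (-k) x) x := by
  have h1 : HasDerivAt (fun x => P.wx k * x) (P.wx k) x := by
    simpa using (hasDerivAt_id x).const_mul (P.wx k)
  have h2 := (h1.cos.add h1.sin).div_const √P.L
  refine h2.congr_deriv ?_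
  simp only [τ, wx_neg, neg_mul, Real.cos_neg, Real.sin_neg]
  ring

theorem hasDerivAt_τ_neg (k : ℤ) (x : ℝ) : HasDerivAt (P.τ (-k)) (-(P.wx k * P.τ k x)) x := by
  have := P.hasDerivAt_τ (-k) x
  rw [neg_neg, wx_neg] at this
  simpa using this

theorem hasDerivAt_sn (n : ℕ) (z : ℝ) : HasDerivAt (P.sn n) (P.wz n * P.cs n z) z := by
  have h1 : HasDerivAt (fun x => P.wz n * x) (P.wz n) z := by
    simpa using (hasDerivAt_id z).const_mul (P.wz n)
  refine (h1.sin.const_mul √(2 / P.h)).congr_deriv ?_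
  simp only [cs]; ring

theorem hasDerivAt_cs (n : ℕ) (z : ℝ) : HasDerivAt (P.cs n) (-(P.wz n * P.sn n z)) z := by
  have h1 : HasDerivAt (fun x => P.wz n * x) (P.wz n) z := by
    simpa using (hasDerivAt_id z).const_mul (P.wz n)
  refine (h1.cos.const_mul √(2 / P.h)).congr_deriv ?_
  simp only [sn]; ring

@[fun_prop]
theorem continuous_τ (k : ℤ) : Continuous (P.τ k) := by
  unfold τ; fun_prop

@[fun_prop]
theorem continuous_sn (n : ℕ) : Continuous (P.sn n) := by
  unfold sn; fun_prop

@[fun_prop]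
theorem continuous_cs (n : ℕ) : Continuous (P.cs n) := by
  unfold cs; fun_prop

theorem τ_periodic (k : ℤ) : Function.Periodic (P.τ k) P.L := by
  intro x
  simp only [τ, mul_add, wx_mul_L, Real.cos_add_int_mul_two_pi, Real.sin_add_int_mul_two_pi]

/-- Comparing a function with its shift by half a wavelength yields the decay of its Fourier
coefficients. -/
theorem τ_half_period {k : ℤ} (hk : k ≠ 0) (x : ℝ) : P.τ k (x + Real.pi / P.wx k) = - P.τ k x := by
  have : P.wx k * (x + Real.pi / P.wx k) = P.wx k * x + Real.pi := by
    have := P.wx_ne_zero hk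
    field_simp
  simp only [τ, this, Real.cos_add_pi, Real.sin_add_pi]
  ring

theorem abs_τ_le (k : ℤ) (x : ℝ) : |P.τ k x| ≤ 2 / √P.L := by
  rw [τ, abs_div, abs_of_nonneg (Real.sqrt_nonneg _)]
  gcongr
  refine (abs_add_le _ _).trans ?_
  linarith [Real.abs_cos_le_one (P.wx k * x), Real.abs_sin_le_one (P.wx k * x)]

theorem abs_sn_le (n : ℕ) (z : ℝ) : |P.sn n z| ≤ √(2 / P.h) := by
  rw [sn, abs_mul, abs_of_nonneg (Real.sqrt_nonneg _)]
  exact mul_le_of_le_one_right (Real.sqrt_nonneg _) (Real.abs_sin_le_one _)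

theorem abs_cs_le (n : ℕ) (z : ℝ) : |P.cs n z| ≤ √(2 / P.h) := by
  rw [cs, abs_mul, abs_of_nonneg (Real.sqrt_nonneg _)]
  exact mul_le_of_le_one_right (Real.sqrt_nonneg _) (Real.abs_cos_le_one _)

theorem sn_zero (n : ℕ) : P.sn n 0 = 0 := by simp [sn]

theorem sn_h (n : ℕ) : P.sn n P.h = 0 := by
  rw [sn, wz_mul_h, Real.sin_nat_mul_pi, mul_zero]

theorem cs_zero (n : ℕ) : P.cs n 0 = √(2 / P.h) := by simp [cs]

theorem integral_cos_mul {c l : ℝ} (hc : c ≠ 0) :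
    ∫ x in (0 : ℝ)..l, Real.cos (c * x) = Real.sin (c * l) / c := by
  rw [intervalIntegral.integral_comp_mul_left (fun x => Real.cos x) hc]
  simp; ring

theorem integral_sin_mul {c l : ℝ} (hc : c ≠ 0) :
    ∫ x in (0 : ℝ)..l, Real.sin (c * x) = (1 - Real.cos (c * l)) / c := by
  rw [intervalIntegral.integral_comp_mul_left (fun x => Real.sin x) hc]
  simp; ring

theorem integral_cos_wx (m : ℤ) :
    ∫ x in (0 : ℝ)..P.L, Real.cos (P.wx m * x) = if m = 0 then P.L else 0 := by
  split_ifs with h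
  · subst h; simp [wx_zero]
  · rw [integral_cos_mul (P.wx_ne_zero h), wx_mul_L]
    have := Real.sin_add_int_mul_two_pi 0 m
    rw [zero_add, Real.sin_zero] at this
    simp [this]

theorem integral_sin_wx (m : ℤ) : ∫ x in (0 : ℝ)..P.L, Real.sin (P.wx m * x) = 0 := by
  by_cases h : m = 0
  · subst h; simp [wx_zero]
  · rw [integral_sin_mul (P.wx_ne_zero h), wx_mul_L]
    have := Real.cos_add_int_mul_two_pi 0 m
    rw [zero_add, Real.cos_zero] at this
    simp [this]

theorem integral_τ_mul_τ (j k : ℤ) :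
    ∫ x in (0 : ℝ)..P.L, P.τ j x * P.τ k x = if j = k then 1 else 0 := by
  have hL := P.L_pos
  have e : ∀ x, P.τ j x * P.τ k x
      = P.L⁻¹ * (Real.cos (P.wx (j - k) * x) + Real.sin (P.wx (j + k) * x)) := by
    intro x
    have e1 : P.wx (j - k) * x = P.wx j * x - P.wx k * x := by simp [wx]; ring
    have e2 : P.wx (j + k) * x = P.wx j * x + P.wx k * x := by simp [wx]; ring
    rw [e1, e2, Real.cos_sub, Real.sin_add, τ, τ, div_mul_div_comm, Real.mul_self_sqrt hL.le]
    ring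
  simp only [e]
  rw [intervalIntegral.integral_const_mul, intervalIntegral.integral_add, integral_cos_wx,
    integral_sin_wx]
  · simp only [sub_eq_zero]
    split_ifs <;> simp [hL.ne']
  · exact (by fun_prop : Continuous _).intervalIntegrable _ _
  · exact (by fun_prop : Continuous _).intervalIntegrable _ _

theorem integral_cos_int (m : ℤ) :
    ∫ z in (0 : ℝ)..P.h, Real.cos (Real.pi / P.h * m * z) = if m = 0 then P.h else 0 := by
  have hh := P.h_pos.ne'
  split_ifs with h
  · subst h; simp
  · have h2 : Real.pi / P.h * m ≠ 0 := by
      have := Real.pi_ne_zero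
      have : (m : ℝ) ≠ 0 := by exact_mod_cast h
      positivity
    rw [integral_cos_mul h2]
    have : Real.pi / P.h * m * P.h = m * Real.pi := by field_simp
    rw [this, Real.sin_int_mul_pi, zero_div]

theorem integral_sn_mul_sn (m n : ℕ) :
    ∫ z in (0 : ℝ)..P.h, P.sn m z * P.sn n z = if m = n then 1 else 0 := by
  have hh := P.h_pos
  have e : ∀ z, P.sn m z * P.sn n z = P.h⁻¹ * (Real.cos (Real.pi / P.h * ((m : ℤ) - n : ℤ) * z)
      - Real.cos (Real.pi / P.h * ((m : ℤ) + n + 2 : ℤ) * z)) := by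
    intro z
    have e1 : Real.pi / P.h * ((m : ℤ) - n : ℤ) * z = P.wz m * z - P.wz n * z := by
      simp [wz]; ring
    have e2 : Real.pi / P.h * ((m : ℤ) + n + 2 : ℤ) * z = P.wz m * z + P.wz n * z := by
      simp [wz]; ring
    rw [e1, e2, Real.cos_sub, Real.cos_add, sn, sn, mul_mul_mul_comm,
      Real.mul_self_sqrt (by positivity)]
    ring
  simp only [e]
  -- The index n stands for the wave number n + 1, so the sum of two wave numbers is m + n + 2 and
  -- never vanishes.
  rw [intervalIntegral.integral_const_mul, intervalIntegral.integral_sub, integral_cos_int,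
    integral_cos_int, if_neg (show (m : ℤ) + n + 2 ≠ 0 by omega)]
  · by_cases hmn : m = n
    · simp [hmn, hh.ne']
    · have : (m : ℤ) - n ≠ 0 := by omega
      simp [hmn, this]
  · exact (by fun_prop : Continuous _).intervalIntegrable _ _
  · exact (by fun_prop : Continuous _).intervalIntegrable _ _

theorem integral_cs_mul_cs (m n : ℕ) :
    ∫ z in (0 : ℝ)..P.h, P.cs m z * P.cs n z = if m = n then 1 else 0 := by
  have hh := P.h_pos
  have e : ∀ z, P.cs m z * P.cs n z = P.h⁻¹ * (Real.cos (Real.pi / P.h * ((m : ℤ) - n : ℤ) * z)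
      + Real.cos (Real.pi / P.h * ((m : ℤ) + n + 2 : ℤ) * z)) := by
    intro z
    have e1 : Real.pi / P.h * ((m : ℤ) - n : ℤ) * z = P.wz m * z - P.wz n * z := by
      simp [wz]; ring
    have e2 : Real.pi / P.h * ((m : ℤ) + n + 2 : ℤ) * z = P.wz m * z + P.wz n * z := by
      simp [wz]; ring
    rw [e1, e2, Real.cos_sub, Real.cos_add, cs, cs, mul_mul_mul_comm,
      Real.mul_self_sqrt (by positivity)]
    ring
  simp only [e]
  rw [intervalIntegral.integral_const_mul, intervalIntegral.integral_add, integral_cos_int,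
    integral_cos_int, if_neg (show (m : ℤ) + n + 2 ≠ 0 by omega)]
  · by_cases hmn : m = n
    · simp [hmn, hh.ne']
    · have : (m : ℤ) - n ≠ 0 := by omega
      simp [hmn, this]
  · exact (by fun_prop : Continuous _).intervalIntegrable _ _
  · exact (by fun_prop : Continuous _).intervalIntegrable _ _

theorem integral_cs (n : ℕ) : ∫ z in (0 : ℝ)..P.h, P.cs n z = 0 := by
  have e : ∀ z, P.cs n z = √(2 / P.h) * Real.cos (Real.pi / P.h * ((n : ℤ) + 1 : ℤ) * z) := by
    intro z; simp [cs, wz]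
  simp only [e]
  rw [intervalIntegral.integral_const_mul, integral_cos_int,
    if_neg (show (n : ℤ) + 1 ≠ 0 by omega), mul_zero]

section CosinePolynomials

/-- The span of the cosines is stable under multiplication by cos θ, by the product-to-sum formula,
and contains 1. -/
theorem cos_polynomial_mem_span (p : Polynomial ℝ) :
    (fun θ : ℝ => p.eval (Real.cos θ)) ∈
      Submodule.span ℝ (range fun (n : ℕ) (θ : ℝ) => Real.cos (n * θ)) := by
  set S := Submodule.span ℝ (range fun (n : ℕ) (θ : ℝ) => Real.cos (n * θ)) with hS
  have hmul : ∀ f ∈ S, (fun θ => Real.cos θ * f θ) ∈ S := by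
    intro f hf
    induction hf using Submodule.span_induction with
    | mem f hf =>
      obtain ⟨n, rfl⟩ := hf
      rcases n with _ | n
      · have : (fun θ : ℝ => Real.cos θ * Real.cos ((0 : ℕ) * θ)) = fun θ =>
            Real.cos ((1 : ℕ) * θ) := by ext; simp
        show (fun θ : ℝ => Real.cos θ * Real.cos ((0 : ℕ) * θ)) ∈ S
        rw [this]
        exact Submodule.subset_span ⟨1, rfl⟩
      · have : (fun θ : ℝ => Real.cos θ * Real.cos ((n + 1 : ℕ) * θ))
            = (1 / 2 : ℝ) • (fun θ : ℝ => Real.cos ((n + 2 : ℕ) * θ))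
              + (1 / 2 : ℝ) • (fun θ : ℝ => Real.cos (n * θ)) := by
          ext θ
          have e1 : ((n + 2 : ℕ) : ℝ) * θ = (n + 1 : ℕ) * θ + θ := by push_cast; ring
          have e2 : (n : ℝ) * θ = (n + 1 : ℕ) * θ - θ := by push_cast; ring
          simp only [Pi.add_apply, Pi.smul_apply, smul_eq_mul]
          rw [e1, e2, Real.cos_add, Real.cos_sub]; ring
        show (fun θ : ℝ => Real.cos θ * Real.cos ((n + 1 : ℕ) * θ)) ∈ S
        rw [this]
        exact S.add_mem (S.smul_mem _ (Submodule.subset_span ⟨n + 2, rfl⟩))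
          (S.smul_mem _ (Submodule.subset_span ⟨n, rfl⟩))
    | zero => convert S.zero_mem using 1; ext; simp
    | add f g _ _ hf hg =>
      have : (fun θ => Real.cos θ * (f + g) θ) = (fun θ => Real.cos θ * f θ)
        + fun θ => Real.cos θ * g θ := by ext; simp [mul_add]
      rw [this]; exact S.add_mem hf hg
    | smul a f _ hf =>
      have : (fun θ => Real.cos θ * (a • f) θ) = a • fun θ => Real.cos θ * f θ := by
        ext; simp; ring
      rw [this]; exact S.smul_mem _ hf
  have hpow : ∀ n : ℕ, (fun θ => Real.cos θ ^ n) ∈ S := by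
    intro n
    induction n with
    | zero => exact Submodule.subset_span ⟨0, by ext; simp⟩
    | succ n ih =>
      have := hmul _ ih
      simpa only [pow_succ'] using this
  induction p using Polynomial.induction_on' with
  | add p q hp hq => convert S.add_mem hp hq using 1; ext; simp
  | monomial n a =>
    have := S.smul_mem a (hpow n)
    convert this using 1; ext; simp [Polynomial.eval_monomial]

/-- By linearity it suffices to multiply single cosines by sin θ; 2 sin θ cos mθ is a difference of
two sines. -/
theorem sin_mul_cos_polynomial_mem_span (p : Polynomial ℝ) :
    (fun θ : ℝ => Real.sin θ * p.eval (Real.cos θ)) ∈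
      Submodule.span ℝ (range fun (n : ℕ) (θ : ℝ) => Real.sin ((n + 1) * θ)) := by
  set S := Submodule.span ℝ (range fun (n : ℕ) (θ : ℝ) => Real.sin ((n + 1) * θ)) with hS
  suffices ∀ c ∈ Submodule.span ℝ (range fun (n : ℕ) (θ : ℝ) => Real.cos (n * θ)),
      (fun θ => Real.sin θ * c θ) ∈ S from this _ (cos_polynomial_mem_span p)
  intro c hcos
  induction hcos using Submodule.span_induction with
  | mem f hf =>
    obtain ⟨n, rfl⟩ := hf
    rcases n with _ | _ | n
    · exact Submodule.subset_span ⟨0, by ext; simp⟩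
    · have : (fun θ : ℝ => Real.sin θ * Real.cos ((0 + 1 : ℕ) * θ))
          = (1 / 2 : ℝ) • (fun θ : ℝ => Real.sin (((1 : ℕ) + 1) * θ)) := by
        ext θ
        simp only [Pi.smul_apply, smul_eq_mul]
        have : (((1 : ℕ) : ℝ) + 1) * θ = 2 * θ := by push_cast; ring
        rw [this, Real.sin_two_mul]; simp
        ring
      show (fun θ : ℝ => Real.sin θ * Real.cos ((0 + 1 : ℕ) * θ)) ∈ S
      rw [this]
      exact S.smul_mem _ (Submodule.subset_span ⟨1, rfl⟩)
    · have : (fun θ : ℝ => Real.sin θ * Real.cos ((n + 1 + 1 : ℕ) * θ))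
          = (1 / 2 : ℝ) • (fun θ : ℝ => Real.sin (((n + 2 : ℕ) + 1) * θ))
            - (1 / 2 : ℝ) • (fun θ : ℝ => Real.sin ((n + 1) * θ)) := by
        ext θ
        simp only [Pi.sub_apply, Pi.smul_apply, smul_eq_mul]
        have e1 : (((n + 2 : ℕ) : ℝ) + 1) * θ = (n + 1 + 1 : ℕ) * θ + θ := by push_cast; ring
        have e2 : ((n : ℝ) + 1) * θ = (n + 1 + 1 : ℕ) * θ - θ := by push_cast; ring
        rw [e1, e2, Real.sin_add, Real.sin_sub]; ring
      show (fun θ : ℝ => Real.sin θ * Real.cos ((n + 1 + 1 : ℕ) * θ)) ∈ S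
      rw [this]
      exact S.sub_mem (S.smul_mem _ (Submodule.subset_span ⟨n + 2, rfl⟩))
        (S.smul_mem _ (Submodule.subset_span ⟨n, rfl⟩))
  | zero => convert S.zero_mem using 1; ext; simp
  | add f g _ _ hf hg =>
    have : (fun θ => Real.sin θ * (f + g) θ) = (fun θ => Real.sin θ * f θ)
      + fun θ => Real.sin θ * g θ := by ext; simp [mul_add]
    rw [this]; exact S.add_mem hf hg
  | smul a f _ hf =>
    have : (fun θ => Real.sin θ * (a • f) θ) = a • fun θ => Real.sin θ * f θ := by
      ext; simp; ring
    rw [this]; exact S.smul_mem _ hf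

/-- Weierstrass approximation by polynomials in `cos (π z / h)`. -/
theorem exists_cos_polynomial_near {f : ℝ → ℝ} (hf : ContinuousOn f (Icc 0 P.h)) {ε : ℝ}
    (hε : 0 < ε) : ∃ p : Polynomial ℝ, ∀ z ∈ Icc 0 P.h,
      |p.eval (Real.cos (Real.pi / P.h * z)) - f z| < ε := by
  have hh := P.h_pos
  have hpi := Real.pi_pos
  have hg : ContinuousOn (fun y => f (P.h / Real.pi * Real.arccos y)) (Icc (-1) 1) := by
    refine hf.comp (by fun_prop) fun y _ => ⟨by have := Real.arccos_nonneg y; positivity, ?_⟩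
    calc P.h / Real.pi * Real.arccos y ≤ P.h / Real.pi * Real.pi := by
          gcongr; exact Real.arccos_le_pi y
      _ = P.h := by field_simp
  obtain ⟨p, hp⟩ := exists_polynomial_near_of_continuousOn (-1) 1 _ hg ε hε
  refine ⟨p, fun z hz => ?_⟩
  have h1 := hp (Real.cos (Real.pi / P.h * z)) ⟨Real.neg_one_le_cos _, Real.cos_le_one _⟩
  rw [Real.arccos_cos] at h1
  · convert h1 using 4
    field_simp
  · have := hz.1; positivity
  · calc Real.pi / P.h * z ≤ Real.pi / P.h * P.h := by gcongr; exact hz.2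
      _ = Real.pi := by field_simp

end CosinePolynomials

/-- A continuous function whose sine coefficients all vanish is zero. -/
theorem eq_zero_of_sn_coeff {f : ℝ → ℝ} (hf : ContinuousOn f (Icc 0 P.h))
    (h0 : ∀ n, ∫ z in (0 : ℝ)..P.h, f z * P.sn n z = 0) : ∀ z ∈ Icc 0 P.h, f z = 0 := by
  have hh := P.h_pos
  have hpi := Real.pi_pos
  have hint : ∀ {g : ℝ → ℝ}, ContinuousOn g (Icc 0 P.h) → IntervalIntegrable g volume 0 P.h :=
    fun hg => hg.intervalIntegrable_of_Icc hh.le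
  have hspan : ∀ φ ∈ Submodule.span ℝ (range fun (n : ℕ) (θ : ℝ) => Real.sin ((n + 1) * θ)),
      Continuous φ ∧ ∫ z in (0 : ℝ)..P.h, f z * φ (Real.pi / P.h * z) = 0 := by
    intro φ hφ
    induction hφ using Submodule.span_induction with
    | mem φ hφ =>
      obtain ⟨n, rfl⟩ := hφ
      refine ⟨by fun_prop, ?_⟩
      have h1 := h0 n
      have h2 : ∀ z, f z * P.sn n z
          = √(2 / P.h) * (f z * Real.sin (((n : ℝ) + 1) * (Real.pi / P.h * z))) := by
        intro z
        simp only [sn, wz]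
        rw [show Real.pi / P.h * (n + 1) * z = ((n : ℝ) + 1) * (Real.pi / P.h * z) by ring]
        ring
      simp only [h2] at h1
      rw [intervalIntegral.integral_const_mul] at h1
      exact (mul_eq_zero.1 h1).resolve_left (by positivity)
    | zero => exact ⟨continuous_const, by simp⟩
    | add φ ψ _ _ h1 h2 =>
      have c1 := h1.1
      have c2 := h2.1
      refine ⟨c1.add c2, ?_⟩
      simp only [Pi.add_apply, mul_add]
      rw [intervalIntegral.integral_add (hint (by fun_prop)) (hint (by fun_prop)), h1.2, h2.2,
        add_zero]
    | smul a φ _ h1 =>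
      have c1 := h1.1
      refine ⟨c1.const_smul a, ?_⟩
      simp only [Pi.smul_apply, smul_eq_mul, mul_left_comm _ a]
      rw [intervalIntegral.integral_const_mul, h1.2, mul_zero]
  -- By hypothesis f is orthogonal to sin·p(cos) for every polynomial p, that is, g is orthogonal to
  -- p(cos). Approximating g itself uniformly by p(cos) gives ∫g² = 0; the sine has no zero inside
  -- the interval, so f vanishes there.
  set g : ℝ → ℝ := fun z => f z * Real.sin (Real.pi / P.h * z) with hg
  have cg : ContinuousOn g (Icc 0 P.h) := by fun_prop
  have hg2 : ∫ z in (0 : ℝ)..P.h, g z ^ 2 = 0 := by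
    obtain ⟨C, hC⟩ := isCompact_Icc.exists_bound_of_continuousOn cg
    have hnn : 0 ≤ ∫ z in (0 : ℝ)..P.h, g z ^ 2 :=
      intervalIntegral.integral_nonneg hh.le fun z _ => sq_nonneg _
    refine le_antisymm (le_of_forall_pos_le_add fun ε hε => ?_) hnn
    have hC0 : 0 ≤ C := (norm_nonneg _).trans (hC 0 (left_mem_Icc.2 hh.le))
    obtain ⟨p, hp⟩ := P.exists_cos_polynomial_near cg
      (show 0 < ε / ((C + 1) * P.h) by positivity)
    have hz := (hspan _ (sin_mul_cos_polynomial_mem_span p)).2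
    have cp : Continuous fun z => p.eval (Real.cos (Real.pi / P.h * z)) :=
      p.continuous.comp (by fun_prop)
    have e : ∫ z in (0 : ℝ)..P.h, g z ^ 2 = ∫ z in (0 : ℝ)..P.h,
        g z * (g z - p.eval (Real.cos (Real.pi / P.h * z))) := by
      have : ∀ z, g z * (g z - p.eval (Real.cos (Real.pi / P.h * z))) = g z ^ 2 - f z *
          (Real.sin (Real.pi / P.h * z) * p.eval (Real.cos (Real.pi / P.h * z))) := by
        intro z; simp only [hg]; ring
      simp only [this]
      rw [intervalIntegral.integral_sub (hint (by fun_prop)) (hint (by fun_prop)), hz, sub_zero]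
    rw [e, zero_add]
    have hb : ∀ z ∈ Icc 0 P.h, g z * (g z - p.eval (Real.cos (Real.pi / P.h * z))) ≤ ε / P.h := by
      intro z hz
      have h1 := hC z hz
      have h2 := hp z hz
      rw [abs_sub_comm] at h2
      calc _ ≤ |g z * (g z - p.eval (Real.cos (Real.pi / P.h * z)))| := le_abs_self _
        _ = |g z| * |g z - p.eval (Real.cos (Real.pi / P.h * z))| := abs_mul _ _
        _ ≤ (C + 1) * (ε / ((C + 1) * P.h)) := by
          gcongr
          exact h1.trans (by linarith)
        _ = _ := by field_simp
    calc _ ≤ ∫ z in (0 : ℝ)..P.h, ε / P.h := by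
          refine intervalIntegral.integral_mono_on hh.le (hint (by fun_prop)) (by simp) hb
      _ = ε := by simp; field_simp
  have h1 := eq_zero_of_intervalIntegral_eq_zero hh (cg.pow 2) (fun z _ => sq_nonneg _) hg2
  have h2 : EqOn f (fun _ => 0) (Ioo 0 P.h) := by
    intro z hz
    have h3 := h1 z (Ioo_subset_Icc_self hz)
    have h4 : 0 < Real.sin (Real.pi / P.h * z) := by
      refine Real.sin_pos_of_pos_of_lt_pi (by have := hz.1; positivity) ?_
      calc Real.pi / P.h * z < Real.pi / P.h * P.h := by gcongr; exact hz.2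
        _ = Real.pi := by field_simp
    simp only [hg] at h3
    exact (mul_eq_zero.1 (pow_eq_zero_iff two_ne_zero |>.1 h3)).resolve_right h4.ne'
  exact h2.of_subset_closure hf continuousOn_const Ioo_subset_Icc_self
    (by rw [closure_Ioo hh.ne])

/-- Trigonometric polynomials are dense in the continuous periodic functions. -/
theorem exists_τ_sum_near {f : ℝ → ℝ} (hf : Continuous f) (hp : Function.Periodic f P.L) {ε : ℝ}
    (hε : 0 < ε) : ∃ φ ∈ Submodule.span ℝ (range P.τ), ∀ x, |φ x - f x| < ε := by
  have : Fact (0 < P.L) := ⟨P.L_pos⟩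
  have hL := P.L_pos
  have hcont : Continuous (hp.lift : AddCircle P.L → ℝ) :=
    continuous_coinduced_dom.2 hf
  let F : C(AddCircle P.L, ℂ) := ⟨fun y => ((hp.lift y : ℝ) : ℂ), by fun_prop⟩
  have hF : F ∈ (Submodule.span ℂ (range (@fourier P.L))).topologicalClosure := by
    rw [span_fourier_closure_eq_top]; trivial
  obtain ⟨G, hG, hGF⟩ := Metric.mem_closure_iff.1 hF ε hε
  -- Real and imaginary parts are carried along together because complex scalars mix them.
  have hspan : ∀ G ∈ Submodule.span ℂ (range (@fourier P.L)),
      (fun x : ℝ => (G (x : AddCircle P.L)).re) ∈ Submodule.span ℝ (range P.τ) ∧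
      (fun x : ℝ => (G (x : AddCircle P.L)).im) ∈ Submodule.span ℝ (range P.τ) := by
    intro G hG
    induction hG using Submodule.span_induction with
    | mem G hG =>
      obtain ⟨k, rfl⟩ := hG
      have hτ : ∀ k, P.τ k ∈ Submodule.span ℝ (range P.τ) := fun k => Submodule.subset_span ⟨k, rfl⟩
      have e : ∀ x : ℝ, fourier k (x : AddCircle P.L) = Complex.exp ((P.wx k * x : ℝ) * Complex.I) := by
        intro x
        rw [fourier_coe_apply]
        congr 1
        simp only [wx]; push_cast; ring
      have hs : √P.L ≠ 0 := (Real.sqrt_pos.2 hL).ne'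
      constructor
      · have : (fun x : ℝ => (fourier k (x : AddCircle P.L)).re)
            = (√P.L / 2) • P.τ k + (√P.L / 2) • P.τ (-k) := by
          ext x
          simp only [e, Complex.exp_ofReal_mul_I_re, Pi.add_apply, Pi.smul_apply, smul_eq_mul, τ,
            wx_neg, neg_mul, Real.cos_neg, Real.sin_neg]
          field_simp; ring
        rw [this]
        exact Submodule.add_mem _ (Submodule.smul_mem _ _ (hτ _)) (Submodule.smul_mem _ _ (hτ _))
      · have : (fun x : ℝ => (fourier k (x : AddCircle P.L)).im)
            = (√P.L / 2) • P.τ k - (√P.L / 2) • P.τ (-k) := by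
          ext x
          simp only [e, Complex.exp_ofReal_mul_I_im, Pi.sub_apply, Pi.smul_apply, smul_eq_mul, τ,
            wx_neg, neg_mul, Real.cos_neg, Real.sin_neg]
          field_simp; ring
        rw [this]
        exact Submodule.sub_mem _ (Submodule.smul_mem _ _ (hτ _)) (Submodule.smul_mem _ _ (hτ _))
    | zero => 
      constructor <;>
      · convert Submodule.zero_mem (Submodule.span ℝ (range P.τ)) using 1; ext; simp
    | add G H _ _ h1 h2 =>
      constructor
      · convert Submodule.add_mem _ h1.1 h2.1 using 1; ext; simp
      · convert Submodule.add_mem _ h1.2 h2.2 using 1; ext; simp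
    | smul a G _ h1 =>
      constructor
      · have : (fun x : ℝ => ((a • G) (x : AddCircle P.L)).re)
            = a.re • (fun x : ℝ => (G (x : AddCircle P.L)).re)
              - a.im • (fun x : ℝ => (G (x : AddCircle P.L)).im) := by
          ext x; simp
        rw [this]
        exact Submodule.sub_mem _ (Submodule.smul_mem _ _ h1.1) (Submodule.smul_mem _ _ h1.2)
      · have : (fun x : ℝ => ((a • G) (x : AddCircle P.L)).im)
            = a.re • (fun x : ℝ => (G (x : AddCircle P.L)).im)
              + a.im • (fun x : ℝ => (G (x : AddCircle P.L)).re) := by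
          ext x; simp
        rw [this]
        exact Submodule.add_mem _ (Submodule.smul_mem _ _ h1.2) (Submodule.smul_mem _ _ h1.1)
  refine ⟨_, (hspan G hG).1, fun x => ?_⟩
  have h1 : ‖(F - G) (x : AddCircle P.L)‖ < ε := by
    refine (ContinuousMap.norm_coe_le_norm _ _).trans_lt ?_
    rwa [← dist_eq_norm]
  have h2 : |((F - G) (x : AddCircle P.L)).re| < ε := (Complex.abs_re_le_norm _).trans_lt h1
  rw [abs_sub_comm]
  simpa [F] using h2

/-- A continuous periodic function whose Fourier coefficients all vanish is zero. -/
theorem eq_zero_of_τ_coeff {f : ℝ → ℝ} (hf : Continuous f) (hp : Function.Periodic f P.L)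
    (h0 : ∀ k, ∫ x in (0 : ℝ)..P.L, f x * P.τ k x = 0) : ∀ x, f x = 0 := by
  have hL := P.L_pos
  have hspan : ∀ φ ∈ Submodule.span ℝ (range P.τ),
      Continuous φ ∧ ∫ x in (0 : ℝ)..P.L, f x * φ x = 0 := by
    intro φ hφ
    induction hφ using Submodule.span_induction with
    | mem φ hφ =>
      obtain ⟨n, rfl⟩ := hφ
      exact ⟨P.continuous_τ n, h0 n⟩
    | zero => exact ⟨continuous_const, by simp⟩
    | add φ ψ _ _ h1 h2 =>
      have c1 := h1.1
      have c2 := h2.1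
      refine ⟨c1.add c2, ?_⟩
      simp only [Pi.add_apply, mul_add]
      rw [intervalIntegral.integral_add
        ((by fun_prop : Continuous fun x => f x * φ x).intervalIntegrable _ _)
        ((by fun_prop : Continuous fun x => f x * ψ x).intervalIntegrable _ _), h1.2, h2.2, add_zero]
    | smul a φ _ h1 =>
      have c1 := h1.1
      refine ⟨c1.const_smul a, ?_⟩
      simp only [Pi.smul_apply, smul_eq_mul, mul_left_comm _ a]
      rw [intervalIntegral.integral_const_mul, h1.2, mul_zero]
  have hg2 : ∫ x in (0 : ℝ)..P.L, f x ^ 2 = 0 := by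
    obtain ⟨C, hC⟩ := isCompact_Icc.exists_bound_of_continuousOn (hf.continuousOn (s := Icc 0 P.L))
    have hnn : 0 ≤ ∫ x in (0 : ℝ)..P.L, f x ^ 2 :=
      intervalIntegral.integral_nonneg hL.le fun z _ => sq_nonneg _
    refine le_antisymm (le_of_forall_pos_le_add fun ε hε => ?_) hnn
    have hC0 : 0 ≤ C := (norm_nonneg _).trans (hC 0 (left_mem_Icc.2 hL.le))
    obtain ⟨φ, hφ, hφε⟩ := P.exists_τ_sum_near hf hp (show 0 < ε / ((C + 1) * P.L) by positivity)
    obtain ⟨cφ, hz⟩ := hspan φ hφ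
    have e : ∫ x in (0 : ℝ)..P.L, f x ^ 2 = ∫ x in (0 : ℝ)..P.L, f x * (f x - φ x) := by
      simp only [mul_sub, ← pow_two]
      rw [intervalIntegral.integral_sub
        ((by fun_prop : Continuous fun x => f x ^ 2).intervalIntegrable _ _)
        ((by fun_prop : Continuous fun x => f x * φ x).intervalIntegrable _ _), hz, sub_zero]
    rw [e, zero_add]
    have hb : ∀ x ∈ Icc 0 P.L, f x * (f x - φ x) ≤ ε / P.L := by
      intro x hx
      have h1 := hC x hx
      have h2 := hφε x
      rw [abs_sub_comm] at h2
      calc _ ≤ |f x * (f x - φ x)| := le_abs_self _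
        _ = |f x| * |f x - φ x| := abs_mul _ _
        _ ≤ (C + 1) * (ε / ((C + 1) * P.L)) := by
          gcongr
          exact h1.trans (by linarith)
        _ = _ := by field_simp
    calc _ ≤ ∫ x in (0 : ℝ)..P.L, ε / P.L := by
          refine intervalIntegral.integral_mono_on hL.le
            ((by fun_prop : Continuous _).intervalIntegrable _ _) (by simp) hb
      _ = ε := by simp; field_simp
  have h1 := eq_zero_of_intervalIntegral_eq_zero hL (f := fun x => f x ^ 2) (by fun_prop)
    (fun z _ => sq_nonneg _) hg2
  intro x
  obtain ⟨y, hy, he⟩ := hp.exists_mem_Ico₀ hL x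
  rw [he]
  simpa using h1 y (Ico_subset_Icc_self hy)

end

end Params

end RotatingBoussinesq

/-! ### Explicit bounds for the equations Y'' = c²Y + g of the Fourier modes. -/

namespace RotatingBoussinesq

open Filter Topology MeasureTheory

section FirstOrder

theorem antitoneOn_Icc_of_hasDerivWithinAt {a b : ℝ} {f f' : ℝ → ℝ}
    (hf : ∀ z ∈ Icc a b, HasDerivWithinAt f (f' z) (Icc a b) z) (h : ∀ z ∈ Icc a b, f' z ≤ 0) :
    AntitoneOn f (Icc a b) := by
  have hd : ∀ z ∈ Ioo a b, HasDerivAt f (f' z) z := fun z hz =>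
    (hf z (Ioo_subset_Icc_self hz)).hasDerivAt (Icc_mem_nhds hz.1 hz.2)
  refine antitoneOn_of_deriv_nonpos (convex_Icc a b)
    (fun z hz => (hf z hz).continuousWithinAt) ?_ ?_
  · rw [interior_Icc]
    exact fun z hz => (hd z hz).differentiableAt.differentiableWithinAt
  · rw [interior_Icc]
    intro z hz
    rw [(hd z hz).deriv]
    exact h z (Ioo_subset_Icc_self hz)

theorem monotoneOn_Icc_of_hasDerivWithinAt {a b : ℝ} {f f' : ℝ → ℝ}
    (hf : ∀ z ∈ Icc a b, HasDerivWithinAt f (f' z) (Icc a b) z) (h : ∀ z ∈ Icc a b, 0 ≤ f' z) :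
    MonotoneOn f (Icc a b) := by
  have := antitoneOn_Icc_of_hasDerivWithinAt (f := fun z => - f z) (f' := fun z => - f' z)
    (fun z hz => (hf z hz).neg) fun z hz => by linarith [h z hz]
  intro x hx y hy hxy
  have := this hx hy hxy
  simpa using this

variable {a b c G : ℝ} {Z g : ℝ → ℝ}

/-- With the integrating factor e^{-cz}, the functions Z + G/c and Z - G/c become monotone in
opposite senses. A growing equation is controlled from its right end, where the homogeneous part has
decayed least. -/
theorem abs_le_of_hasDerivWithinAt_growing (hc : 0 < c)
    (hZ : ∀ z ∈ Icc a b, HasDerivWithinAt Z (c * Z z + g z) (Icc a b) z)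
    (hg : ∀ z ∈ Icc a b, |g z| ≤ G) {z : ℝ} (hz : z ∈ Icc a b) :
    |Z z| ≤ Real.exp (-(c * (b - z))) * |Z b| + G / c := by
  have hb : b ∈ Icc a b := right_mem_Icc.2 (hz.1.trans hz.2)
  have he : ∀ y, HasDerivAt (fun z => Real.exp (-(c * z))) (Real.exp (-(c * y)) * (-c)) y := by
    intro y
    have : HasDerivAt (fun z : ℝ => -(c * z)) (-c) y := by
      simpa only [id, mul_one, neg_mul] using (hasDerivAt_id y).const_mul (-c)
    exact this.exp
  have hG0 : 0 ≤ G := (abs_nonneg _).trans (hg z hz)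
  have h1 := antitoneOn_Icc_of_hasDerivWithinAt
    (f := fun z => Real.exp (-(c * z)) * (Z z + G / c))
    (fun y hy => ((he y).hasDerivWithinAt.mul ((hZ y hy).add_const (G / c))))
    (fun y hy => by
      have e : Real.exp (-(c * y)) * (-c) * (Z y + G / c) + Real.exp (-(c * y)) * (c * Z y + g y)
          = Real.exp (-(c * y)) * (g y - G) := by field_simp; ring
      rw [e]
      exact mul_nonpos_of_nonneg_of_nonpos (Real.exp_pos _).le
        (by linarith [le_abs_self (g y), hg y hy])) hz hb hz.2
  have h2 := monotoneOn_Icc_of_hasDerivWithinAt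
    (f := fun z => Real.exp (-(c * z)) * (Z z - G / c))
    (fun y hy => ((he y).hasDerivWithinAt.mul ((hZ y hy).sub_const (G / c))))
    (fun y hy => by
      have e : Real.exp (-(c * y)) * (-c) * (Z y - G / c) + Real.exp (-(c * y)) * (c * Z y + g y)
          = Real.exp (-(c * y)) * (g y + G) := by field_simp; ring
      rw [e]
      exact mul_nonneg (Real.exp_pos _).le
        (by linarith [neg_abs_le (g y), hg y hy])) hz hb hz.2
  simp only at h1 h2
  have hGc : 0 ≤ G / c := by positivity
  set E := Real.exp (-(c * (b - z))) with hE
  have hE0 : 0 < E := Real.exp_pos _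
  have hexp : Real.exp (-(c * b)) = Real.exp (-(c * z)) * E := by
    rw [hE, ← Real.exp_add]; congr 1; ring
  rw [hexp, mul_assoc] at h1 h2
  have h1' := le_of_mul_le_mul_left h1 (Real.exp_pos _)
  have h2' := le_of_mul_le_mul_left h2 (Real.exp_pos _)
  have a1 : E * Z b ≤ E * |Z b| := by gcongr; exact le_abs_self _
  have a2 : -(E * |Z b|) ≤ E * Z b := by
    rw [← mul_neg]; gcongr; exact neg_abs_le _
  have a3 : 0 ≤ E * (G / c) := by positivity
  rw [abs_le]
  constructor <;> nlinarith

theorem abs_le_of_hasDerivWithinAt_decaying (hc : 0 < c)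
    (hZ : ∀ z ∈ Icc a b, HasDerivWithinAt Z (-(c * Z z) + g z) (Icc a b) z)
    (hg : ∀ z ∈ Icc a b, |g z| ≤ G) {z : ℝ} (hz : z ∈ Icc a b) :
    |Z z| ≤ Real.exp (-(c * (z - a))) * |Z a| + G / c := by
  have ha : a ∈ Icc a b := left_mem_Icc.2 (hz.1.trans hz.2)
  have he : ∀ y, HasDerivAt (fun z => Real.exp (c * z)) (Real.exp (c * y) * c) y := by
    intro y
    have : HasDerivAt (fun z : ℝ => c * z) c y := by
      simpa using (hasDerivAt_id y).const_mul c
    exact this.exp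
  have hG0 : 0 ≤ G := (abs_nonneg _).trans (hg z hz)
  have h1 := monotoneOn_Icc_of_hasDerivWithinAt
    (f := fun z => Real.exp (c * z) * (Z z + G / c))
    (fun y hy => ((he y).hasDerivWithinAt.mul ((hZ y hy).add_const (G / c))))
    (fun y hy => by
      have e : Real.exp (c * y) * c * (Z y + G / c) + Real.exp (c * y) * (-(c * Z y) + g y)
          = Real.exp (c * y) * (g y + G) := by field_simp; ring
      rw [e]
      exact mul_nonneg (Real.exp_pos _).le
        (by linarith [neg_abs_le (g y), hg y hy])) ha hz hz.1
  have h2 := antitoneOn_Icc_of_hasDerivWithinAt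
    (f := fun z => Real.exp (c * z) * (Z z - G / c))
    (fun y hy => ((he y).hasDerivWithinAt.mul ((hZ y hy).sub_const (G / c))))
    (fun y hy => by
      have e : Real.exp (c * y) * c * (Z y - G / c) + Real.exp (c * y) * (-(c * Z y) + g y)
          = Real.exp (c * y) * (g y - G) := by field_simp; ring
      rw [e]
      exact mul_nonpos_of_nonneg_of_nonpos (Real.exp_pos _).le
        (by linarith [le_abs_self (g y), hg y hy])) ha hz hz.1
  simp only at h1 h2
  have hGc : 0 ≤ G / c := by positivity
  set E := Real.exp (-(c * (z - a))) with hE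
  have hE0 : 0 < E := Real.exp_pos _
  have hexp : Real.exp (c * a) = Real.exp (c * z) * E := by
    rw [hE, ← Real.exp_add]; congr 1; ring
  rw [hexp, mul_assoc] at h1 h2
  have h1' := le_of_mul_le_mul_left h1 (Real.exp_pos _)
  have h2' := le_of_mul_le_mul_left h2 (Real.exp_pos _)
  have a1 : E * Z a ≤ E * |Z a| := by gcongr; exact le_abs_self _
  have a2 : -(E * |Z a|) ≤ E * Z a := by
    rw [← mul_neg]; gcongr; exact neg_abs_le _
  have a3 : 0 ≤ E * (G / c) := by positivity
  rw [abs_le]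
  constructor <;> nlinarith

end FirstOrder

/-- `Y'' = c² Y + g` on `[a,b]`, with `Y' = Y₁`. -/
structure IsODESolution (c a b : ℝ) (Y Y₁ g : ℝ → ℝ) : Prop where
  deriv_zero : ∀ z ∈ Icc a b, HasDerivWithinAt Y (Y₁ z) (Icc a b) z
  deriv_one : ∀ z ∈ Icc a b, HasDerivWithinAt Y₁ (c ^ 2 * Y z + g z) (Icc a b) z

namespace IsODESolution

variable {c a b G : ℝ} {Y Y₁ g Z Z₁ k : ℝ → ℝ}

theorem mono (h : IsODESolution c a b Y Y₁ g) {a' b' : ℝ} (hs : Icc a' b' ⊆ Icc a b) :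
    IsODESolution c a' b' Y Y₁ g :=
  ⟨fun z hz => (h.deriv_zero z (hs hz)).mono hs, fun z hz => (h.deriv_one z (hs hz)).mono hs⟩

theorem congr_right (h : IsODESolution c a b Y Y₁ g) (hk : ∀ z ∈ Icc a b, g z = k z) :
    IsODESolution c a b Y Y₁ k :=
  ⟨h.deriv_zero, fun z hz => by rw [← hk z hz]; exact h.deriv_one z hz⟩

theorem congr_left (h : IsODESolution c a b Y Y₁ g) (hZ : ∀ z ∈ Icc a b, Z z = Y z) :
    IsODESolution c a b Z Y₁ g :=
  ⟨fun z hz => (h.deriv_zero z hz).congr hZ (hZ z hz),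
    fun z hz => by rw [hZ z hz]; exact h.deriv_one z hz⟩

theorem add (h : IsODESolution c a b Y Y₁ g) (h' : IsODESolution c a b Z Z₁ k) :
    IsODESolution c a b (fun z => Y z + Z z) (fun z => Y₁ z + Z₁ z) fun z => g z + k z :=
  ⟨fun z hz => (h.deriv_zero z hz).add (h'.deriv_zero z hz),
    fun z hz => ((h.deriv_one z hz).add (h'.deriv_one z hz)).congr_deriv (by ring)⟩

theorem const_mul (h : IsODESolution c a b Y Y₁ g) (r : ℝ) :
    IsODESolution c a b (fun z => r * Y z) (fun z => r * Y₁ z) fun z => r * g z :=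
  ⟨fun z hz => (h.deriv_zero z hz).const_mul r,
    fun z hz => ((h.deriv_one z hz).const_mul r).congr_deriv (by ring)⟩

theorem abs_const (h : IsODESolution c a b Y Y₁ g) : IsODESolution |c| a b Y Y₁ g :=
  ⟨h.deriv_zero, by simpa only [sq_abs] using h.deriv_one⟩

theorem continuousOn (h : IsODESolution c a b Y Y₁ g) : ContinuousOn Y (Icc a b) :=
  fun z hz => (h.deriv_zero z hz).continuousWithinAt

theorem continuousOn_one (h : IsODESolution c a b Y Y₁ g) : ContinuousOn Y₁ (Icc a b) :=
  fun z hz => (h.deriv_one z hz).continuousWithinAt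

/-- The operator d²/dz² - c² factors, so Y' + cY and Y' - cY solve first-order equations, one
controlled from the right end and one from the left. -/
theorem growing (h : IsODESolution c a b Y Y₁ g) : ∀ z ∈ Icc a b,
    HasDerivWithinAt (fun z => Y₁ z + c * Y z) (c * (Y₁ z + c * Y z) + g z) (Icc a b) z :=
  fun z hz => ((h.deriv_one z hz).add ((h.deriv_zero z hz).const_mul c)).congr_deriv (by ring)

theorem decaying (h : IsODESolution c a b Y Y₁ g) : ∀ z ∈ Icc a b,
    HasDerivWithinAt (fun z => Y₁ z - c * Y z) (-(c * (Y₁ z - c * Y z)) + g z) (Icc a b) z :=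
  fun z hz => ((h.deriv_one z hz).sub ((h.deriv_zero z hz).const_mul c)).congr_deriv (by ring)

/-- Y' and cY are half the sum and half the difference of the two first-order quantities. The
exponentials record the distance to the ends, which later gives the interior decay. -/
theorem bounds (h : IsODESolution c a b Y Y₁ g) (hc : 0 < c) (hg : ∀ z ∈ Icc a b, |g z| ≤ G)
    {M : ℝ} (hMa : |Y₁ a - c * Y a| ≤ M) (hMb : |Y₁ b + c * Y b| ≤ M) {z : ℝ}
    (hz : z ∈ Icc a b) :
    |Y₁ z| ≤ (Real.exp (-(c * (b - z))) + Real.exp (-(c * (z - a)))) * M + G / c ∧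
    c * |Y z| ≤ (Real.exp (-(c * (b - z))) + Real.exp (-(c * (z - a)))) * M + G / c := by
  have h1 := abs_le_of_hasDerivWithinAt_growing hc h.growing hg hz
  have h2 := abs_le_of_hasDerivWithinAt_decaying hc h.decaying hg hz
  have hM0 : 0 ≤ M := (abs_nonneg _).trans hMa
  have e1 := Real.exp_pos (-(c * (b - z)))
  have e2 := Real.exp_pos (-(c * (z - a)))
  have h1' : |Y₁ z + c * Y z| ≤ Real.exp (-(c * (b - z))) * M + G / c :=
    h1.trans (by gcongr)
  have h2' : |Y₁ z - c * Y z| ≤ Real.exp (-(c * (z - a))) * M + G / c :=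
    h2.trans (by gcongr)
  have m1 := mul_nonneg e1.le hM0
  have m2 := mul_nonneg e2.le hM0
  rw [abs_le] at h1' h2'
  constructor
  · rw [abs_le]; constructor <;> nlinarith
  · rw [← abs_of_pos hc, ← abs_mul, abs_of_pos hc, abs_le]; constructor <;> nlinarith

/-- Each end slope is bounded by e^{-cb} times the other plus G/c, and e^{-cb} ≤ e^{-c₀b} < 1 closes
the system. The constant depends on the lower bound c₀ only, hence is uniform over the modes. -/
theorem dirichlet_bounds (h : IsODESolution c 0 b Y Y₁ g) (hb : 0 < b) {c₀ : ℝ} (hc₀ : 0 < c₀)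
    (hc : c₀ ≤ c) (hg : ∀ z ∈ Icc 0 b, |g z| ≤ G) (h0 : Y 0 = 0) (hb0 : Y b = 0) :
    ∀ z ∈ Icc 0 b, |Y₁ z| ≤ (1 + 4 / (1 - Real.exp (-(c₀ * b)))) * (G / c) ∧
      c * |Y z| ≤ (1 + 4 / (1 - Real.exp (-(c₀ * b)))) * (G / c) := by
  have hc' : 0 < c := hc₀.trans_le hc
  have m0 : (0 : ℝ) ∈ Icc 0 b := left_mem_Icc.2 hb.le
  have mb : b ∈ Icc 0 b := right_mem_Icc.2 hb.le
  have h1 := abs_le_of_hasDerivWithinAt_growing hc' h.growing hg m0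
  have h2 := abs_le_of_hasDerivWithinAt_decaying hc' h.decaying hg mb
  simp only [h0, hb0, mul_zero, add_zero, sub_zero] at h1 h2
  have hG0 : 0 ≤ G := (abs_nonneg _).trans (hg 0 m0)
  set e₀ := Real.exp (-(c₀ * b)) with he₀
  have he₀1 : e₀ < 1 := by
    rw [he₀, Real.exp_lt_one_iff]; nlinarith
  have he : Real.exp (-(c * b)) ≤ e₀ := by
    rw [he₀]; gcongr
  have hGc : 0 ≤ G / c := by positivity
  have h1' : |Y₁ 0| ≤ e₀ * |Y₁ b| + G / c := h1.trans (by gcongr)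
  have h2' : |Y₁ b| ≤ e₀ * |Y₁ 0| + G / c := h2.trans (by gcongr)
  have hS : |Y₁ 0| + |Y₁ b| ≤ 2 / (1 - e₀) * (G / c) := by
    rw [div_mul_eq_mul_div, le_div_iff₀ (by linarith)]
    nlinarith
  intro z hz
  have key := h.bounds hc' hg (M := 2 / (1 - e₀) * (G / c))
    (by simp only [h0, mul_zero, sub_zero]; linarith [abs_nonneg (Y₁ b)])
    (by simp only [hb0, mul_zero, add_zero]; linarith [abs_nonneg (Y₁ 0)]) hz
  have hM : 0 ≤ 2 / (1 - e₀) * (G / c) := le_trans (by positivity) hS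
  have e1 : Real.exp (-(c * (b - z))) ≤ 1 := by
    rw [Real.exp_le_one_iff]; nlinarith [hz.2]
  have e2 : Real.exp (-(c * (z - 0))) ≤ 1 := by
    rw [Real.exp_le_one_iff]; nlinarith [hz.1]
  have hfin : (Real.exp (-(c * (b - z))) + Real.exp (-(c * (z - 0)))) * (2 / (1 - e₀) * (G / c))
      + G / c ≤ (1 + 4 / (1 - e₀)) * (G / c) := by
    have : (Real.exp (-(c * (b - z))) + Real.exp (-(c * (z - 0)))) * (2 / (1 - e₀) * (G / c))
        ≤ 2 * (2 / (1 - e₀) * (G / c)) := by gcongr; linarith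
    have e3 : 2 * (2 / (1 - e₀) * (G / c)) = 4 / (1 - e₀) * (G / c) := by ring
    linarith
  exact ⟨key.1.trans hfin, key.2.trans hfin⟩

theorem dirichlet_bounds_zero (h : IsODESolution 0 0 b Y Y₁ g) (hb : 0 < b)
    (hg : ∀ z ∈ Icc 0 b, |g z| ≤ G) (h0 : Y 0 = 0) (hb0 : Y b = 0) :
    ∀ z ∈ Icc 0 b, |Y₁ z| ≤ G * b ∧ |Y z| ≤ G * b * b := by
  obtain ⟨ξ, hξ, hξ0⟩ := exists_hasDerivAt_eq_zero hb h.continuousOn (h0.trans hb0.symm)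
    fun z hz => (h.deriv_zero z (Ioo_subset_Icc_self hz)).hasDerivAt (Icc_mem_nhds hz.1 hz.2)
  have hG0 : 0 ≤ G := (abs_nonneg _).trans (hg 0 (left_mem_Icc.2 hb.le))
  have hd : ∀ z ∈ Icc 0 b, |Y₁ z| ≤ G * b := by
    intro z hz
    have := (convex_Icc (0 : ℝ) b).norm_image_sub_le_of_norm_hasDerivWithin_le
      (f := Y₁) (f' := g) (C := G) (fun y hy => (h.deriv_one y hy).congr_deriv (by simp))
      (fun y hy => hg y hy) (Ioo_subset_Icc_self hξ) hz
    rw [hξ0, sub_zero, Real.norm_eq_abs, Real.norm_eq_abs] at this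
    refine this.trans ?_
    gcongr
    rw [abs_le]; constructor <;> linarith [hz.1, hz.2, hξ.1, hξ.2]
  intro z hz
  refine ⟨hd z hz, ?_⟩
  have := (convex_Icc (0 : ℝ) b).norm_image_sub_le_of_norm_hasDerivWithin_le
    (f := Y) (f' := Y₁) (C := G * b) (fun y hy => h.deriv_zero y hy)
    (fun y hy => hd y hy) (left_mem_Icc.2 hb.le) hz
  rw [h0, sub_zero, Real.norm_eq_abs, Real.norm_eq_abs] at this
  refine this.trans ?_
  gcongr
  rw [abs_le]; constructor <;> linarith [hz.1, hz.2]

end IsODESolution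

/-- Solvability of the Dirichlet problem for `Y'' = c² Y + g` on `[0,b]`. -/
theorem exists_dirichlet_solution (c : ℝ) {b : ℝ} (hb : 0 < b) {g : ℝ → ℝ}
    (hg : ContinuousOn g (Icc 0 b)) :
    ∃ Y Y₁ : ℝ → ℝ, IsODESolution c 0 b Y Y₁ g ∧ Y 0 = 0 ∧ Y b = 0 := by
  let g' : ℝ → ℝ := fun z => g (max 0 (min b z))
  have hg' : Continuous g' := hg.comp_continuous (by fun_prop) fun z =>
    ⟨le_max_left _ _, max_le hb.le (min_le_left _ _)⟩
  let I : ℝ → ℝ := fun z => ∫ t in (0 : ℝ)..z, Real.exp (c * t) * g' t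
  have hI : ∀ z, HasDerivAt I (Real.exp (c * z) * g' z) z := fun z =>
    (by fun_prop : Continuous fun t => Real.exp (c * t) * g' t).integral_hasStrictDerivAt 0 z
      |>.hasDerivAt
  have cI : Continuous I := continuous_iff_continuousAt.2 fun z => (hI z).continuousAt
  let A := ∫ s in (0 : ℝ)..b, Real.exp (-(2 * c * s))
  have hA : 0 < A := intervalIntegral.intervalIntegral_pos_of_pos
    ((by fun_prop : Continuous fun s => Real.exp (-(2 * c * s))).intervalIntegrable _ _)
    (fun _ => Real.exp_pos _) hb
  -- The equation is solved in factored form, Z' = -cZ + g and then Y' = cY + Z with Y(0) = 0. The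
  -- free constant C = Z(0) is fixed by Y(b) = 0; its coefficient A is a positive integral for every
  -- c, including c = 0.
  let C := -(∫ s in (0 : ℝ)..b, Real.exp (-(2 * c * s)) * I s) / A
  let Z : ℝ → ℝ := fun s => Real.exp (-(c * s)) * (C + I s)
  have hem : ∀ y, HasDerivAt (fun z => Real.exp (-(c * z))) (Real.exp (-(c * y)) * (-c)) y := by
    intro y
    have : HasDerivAt (fun z : ℝ => -(c * z)) (-c) y := by
      simpa only [id, mul_one, neg_mul] using (hasDerivAt_id y).const_mul (-c)
    exact this.exp
  have hep : ∀ y, HasDerivAt (fun z => Real.exp (c * z)) (Real.exp (c * y) * c) y := by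
    intro y
    have : HasDerivAt (fun z : ℝ => c * z) c y := by
      simpa using (hasDerivAt_id y).const_mul c
    exact this.exp
  have hee : ∀ y, Real.exp (-(c * y)) * Real.exp (c * y) = 1 := fun y => by
    rw [← Real.exp_add]; simp
  have hZ : ∀ z, HasDerivAt Z (-(c * Z z) + g' z) z := by
    intro z
    refine ((hem z).mul ((hI z).const_add C)).congr_deriv ?_
    simp only [Z]
    linear_combination g' z * hee z
  have cZ : Continuous Z := continuous_iff_continuousAt.2 fun z => (hZ z).continuousAt
  let K : ℝ → ℝ := fun z => ∫ s in (0 : ℝ)..z, Real.exp (-(c * s)) * Z s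
  have hK : ∀ z, HasDerivAt K (Real.exp (-(c * z)) * Z z) z := fun z =>
    (by fun_prop : Continuous fun t => Real.exp (-(c * t)) * Z t).integral_hasStrictDerivAt 0 z
      |>.hasDerivAt
  let Y : ℝ → ℝ := fun z => Real.exp (c * z) * K z
  have hY : ∀ z, HasDerivAt Y (c * Y z + Z z) z := by
    intro z
    refine ((hep z).mul (hK z)).congr_deriv ?_
    simp only [Y]
    linear_combination Z z * hee z
  refine ⟨Y, fun z => c * Y z + Z z, ⟨fun z _ => (hY z).hasDerivWithinAt, fun z hz => ?_⟩, ?_, ?_⟩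
  · refine (((hY z).const_mul c).add (hZ z)).hasDerivWithinAt.congr_deriv ?_
    have : g' z = g z := by simp only [g', clamp_eq hz]
    rw [this]; ring
  · simp [Y, K]
  · have : K b = 0 := by
      have e : ∀ s, Real.exp (-(c * s)) * Z s
          = C * Real.exp (-(2 * c * s)) + Real.exp (-(2 * c * s)) * I s := by
        intro s
        have : Real.exp (-(2 * c * s)) = Real.exp (-(c * s)) * Real.exp (-(c * s)) := by
          rw [← Real.exp_add]; congr 1; ring
        simp only [Z, this]; ring
      simp only [K, e]
      rw [intervalIntegral.integral_add, intervalIntegral.integral_const_mul]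
      · show C * A + _ = 0
        simp only [C]
        field_simp
        simp
      · exact (by fun_prop : Continuous _).intervalIntegrable _ _
      · exact (by fun_prop : Continuous fun s => Real.exp (-(2 * c * s)) * I s).intervalIntegrable _ _
    simp [Y, this]

namespace Params

variable (P : Params)

/-- The weight `1 + |κ|`. -/
noncomputable def wt (k : ℤ) : ℝ := 1 + |P.wx k|

theorem one_le_wt (k : ℤ) : 1 ≤ P.wt k := by simp [wt]

theorem wt_pos (k : ℤ) : 0 < P.wt k := lt_of_lt_of_le one_pos (P.one_le_wt k)

theorem abs_wx_le_wt (k : ℤ) : |P.wx k| ≤ P.wt k := by simp [wt]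

theorem wt_neg (k : ℤ) : P.wt (-k) = P.wt k := by simp [wt, wx_neg]

theorem wx_one_pos : 0 < P.wx 1 := by
  have := P.L_pos
  have := Real.pi_pos
  unfold wx; positivity

theorem abs_wx_ge {k : ℤ} (hk : k ≠ 0) : P.wx 1 ≤ |P.wx k| := by
  have h1 : |P.wx k| = P.wx 1 * |(k : ℝ)| := by
    rw [← abs_of_pos P.wx_one_pos, ← abs_mul]; simp [wx]
  have h2 : (1 : ℝ) ≤ |(k : ℝ)| := by
    have := Int.one_le_abs hk
    exact_mod_cast this
  rw [h1]
  exact le_mul_of_one_le_right P.wx_one_pos.le h2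

/-- Uniform bounds for the Dirichlet problems of the Fourier modes. -/
theorem exists_dirichlet_bound : ∃ C : ℝ, 0 < C ∧ ∀ (k : ℤ) (Y Y₁ g : ℝ → ℝ) (G : ℝ),
    IsODESolution (P.wx k) 0 P.h Y Y₁ g → Y 0 = 0 → Y P.h = 0 → (∀ z ∈ Icc 0 P.h, |g z| ≤ G) →
    ∀ z ∈ Icc 0 P.h, P.wt k * |Y₁ z| ≤ C * G ∧ P.wt k ^ 2 * |Y z| ≤ C * G := by
  have hh := P.h_pos
  have hc₀ := P.wx_one_pos
  set c₀ := P.wx 1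
  set D := 1 + 4 / (1 - Real.exp (-(c₀ * P.h))) with hD
  have hD0 : 0 < D := by
    have : Real.exp (-(c₀ * P.h)) < 1 := by
      rw [Real.exp_lt_one_iff]; nlinarith
    have : 0 < 1 - Real.exp (-(c₀ * P.h)) := by linarith
    positivity
  -- For k ≠ 0 the weight 1 + |κ| is at most r|κ|. The mode k = 0 has no exponential decay and uses
  -- the bound obtained from Rolle's theorem.
  set r := 1 / c₀ + 1 with hr
  have hr0 : 0 < r := by positivity
  refine ⟨r ^ 2 * D + r * D + P.h + P.h * P.h, by positivity, ?_⟩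
  intro k Y Y₁ g G hY h0 hh0 hg z hz
  have hG0 : 0 ≤ G := (abs_nonneg _).trans (hg z hz)
  by_cases hk : k = 0
  · subst hk
    rw [wx_zero] at hY
    have := hY.dirichlet_bounds_zero hh hg h0 hh0 z hz
    have hw : P.wt 0 = 1 := by simp [wt, wx_zero]
    rw [hw]
    have p1 : 0 ≤ r ^ 2 * D * G := by positivity
    have p2 : 0 ≤ r * D * G := by positivity
    have p3 : 0 ≤ P.h * G := by positivity
    have p4 : 0 ≤ P.h * P.h * G := by positivity
    constructor <;> nlinarith
  · have hge := P.abs_wx_ge hk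
    set c := |P.wx k| with hc
    have hc0 : 0 < c := hc₀.trans_le hge
    have := hY.abs_const.dirichlet_bounds hh hc₀ hge hg h0 hh0 z hz
    have hw : P.wt k ≤ r * c := by
      have : 1 ≤ 1 / c₀ * c := by
        rw [one_div_mul_eq_div, one_le_div hc₀]; exact hge
      simp only [wt, ← hc, hr]; linarith
    have hwp := P.wt_pos k
    have p1 : 0 ≤ r ^ 2 * D * G := by positivity
    have p2 : 0 ≤ r * D * G := by positivity
    have p3 : 0 ≤ P.h * G := by positivity
    have p4 : 0 ≤ P.h * P.h * G := by positivity
    constructor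
    · calc P.wt k * |Y₁ z| ≤ (r * c) * (D * (G / c)) := by
            gcongr; exact this.1
        _ = r * D * G := by field_simp
        _ ≤ _ := by nlinarith
    · calc P.wt k ^ 2 * |Y z| ≤ (r * c) ^ 2 * |Y z| := by gcongr
        _ = r ^ 2 * c * (c * |Y z|) := by ring
        _ ≤ r ^ 2 * c * (D * (G / c)) := mul_le_mul_of_nonneg_left this.2 (by positivity)
        _ = r ^ 2 * D * G := by field_simp
        _ ≤ _ := by nlinarith

/-- Green's formula against an eigenfunction; as the sine vanishes at both ends and Y at the top,
the only boundary term left is Y(0). -/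
theorem integral_mul_sn {c : ℝ} {Y Y₁ g : ℝ → ℝ} (hY : IsODESolution c 0 P.h Y Y₁ g)
    (hg : ContinuousOn g (Icc 0 P.h)) (hh0 : Y P.h = 0) (n : ℕ) :
    (P.wz n ^ 2 + c ^ 2) * ∫ z in (0 : ℝ)..P.h, Y z * P.sn n z
      = P.wz n * √(2 / P.h) * Y 0 - ∫ z in (0 : ℝ)..P.h, g z * P.sn n z := by
  have hh := P.h_pos
  have cY := hY.continuousOn
  have cY₁ := hY.continuousOn_one
  have hint : ∀ {f : ℝ → ℝ}, ContinuousOn f (Icc 0 P.h) → IntervalIntegrable f volume 0 P.h :=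
    fun hf => hf.intervalIntegrable_of_Icc hh.le
  have key := intervalIntegral.integral_eq_sub_of_hasDerivAt_of_le hh.le
    (f := fun z => Y₁ z * P.sn n z - Y z * (P.wz n * P.cs n z))
    (f' := fun z => (P.wz n ^ 2 + c ^ 2) * (Y z * P.sn n z) + g z * P.sn n z)
    (by fun_prop) (fun z hz => by
      have hz' := Ioo_subset_Icc_self hz
      have d0 := (hY.deriv_zero z hz').hasDerivAt (Icc_mem_nhds hz.1 hz.2)
      have d1 := (hY.deriv_one z hz').hasDerivAt (Icc_mem_nhds hz.1 hz.2)
      refine ((d1.mul (P.hasDerivAt_sn n z)).sub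
        (d0.mul ((P.hasDerivAt_cs n z).const_mul (P.wz n)))).congr_deriv ?_
      ring) (hint (by fun_prop))
  rw [intervalIntegral.integral_add (hint (by fun_prop)) (hint (by fun_prop)),
    intervalIntegral.integral_const_mul, sn_h, sn_zero, hh0, cs_zero] at key
  linarith

/-- The decaying solution of `l'' = κ² l` with `l(0) = 1`, `l(h) = 0`. -/
theorem exists_lift : ∃ C : ℝ, 0 < C ∧ ∃ l l₁ : ℤ → ℝ → ℝ, ∀ k : ℤ,
    IsODESolution (P.wx k) 0 P.h (l k) (l₁ k) (fun _ => 0) ∧ l k 0 = 1 ∧ l k P.h = 0 ∧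
    ∀ z ∈ Icc 0 P.h, |l k z| ≤ C ∧ |l₁ k z| ≤ C * P.wt k := by
  obtain ⟨C, hC, hbound⟩ := P.exists_dirichlet_bound
  have hh := P.h_pos
  have key : ∀ k : ℤ, ∃ l l₁ : ℝ → ℝ, IsODESolution (P.wx k) 0 P.h l l₁ (fun _ => 0) ∧ l 0 = 1 ∧
      l P.h = 0 ∧ ∀ z ∈ Icc 0 P.h, |l z| ≤ 1 + 1 / P.h + C ∧
        |l₁ z| ≤ (1 + 1 / P.h + C) * P.wt k := by
    intro k
    -- The affine function 1 - z/h has the right boundary values; the correction Y solves a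
    -- Dirichlet problem whose forcing is at most wt², exactly what the Dirichlet bounds absorb.
    obtain ⟨Y, Y₁, hY, h0, hh0⟩ := exists_dirichlet_solution (P.wx k) hh
      (g := fun z => P.wx k ^ 2 * (1 - z / P.h)) (by fun_prop)
    have hg : ∀ z ∈ Icc 0 P.h, |1 - z / P.h| ≤ 1 := by
      intro z hz
      have h1 : 0 ≤ z / P.h := div_nonneg hz.1 hh.le
      have h2 : z / P.h ≤ 1 := (div_le_one hh).2 hz.2
      rw [abs_le]; constructor <;> linarith
    have hwk := P.wt_pos k
    have hb := hbound k Y Y₁ _ (P.wt k ^ 2) hY h0 hh0 (fun z hz => by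
      rw [abs_mul, abs_pow]
      calc _ ≤ P.wt k ^ 2 * 1 := by
            gcongr
            · exact P.abs_wx_le_wt k
            · exact hg z hz
        _ = _ := mul_one _)
    refine ⟨fun z => (1 - z / P.h) + Y z, fun z => - (1 / P.h) + Y₁ z, ⟨fun z hz => ?_, fun z hz => ?_⟩,
      by simp [h0], by simp [hh0, hh.ne'], fun z hz => ?_⟩
    · have : HasDerivAt (fun z => 1 - z / P.h) (-(1 / P.h)) z := by
        simpa using ((hasDerivAt_id z).div_const P.h).const_sub 1
      exact this.hasDerivWithinAt.add (hY.deriv_zero z hz)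
    · exact ((hY.deriv_one z hz).const_add _).congr_deriv (by ring)
    · have h1 := (hb z hz).1
      have h2 := (hb z hz).2
      have h1' : |Y₁ z| ≤ C * P.wt k := by
        refine le_of_mul_le_mul_left (h1.trans_eq ?_) hwk; ring
      have h2' : |Y z| ≤ C := by
        refine le_of_mul_le_mul_left (h2.trans_eq ?_) (pow_pos hwk 2); ring
      have hh1 : 0 < 1 / P.h := by positivity
      constructor
      · calc _ ≤ |1 - z / P.h| + |Y z| := abs_add_le _ _
          _ ≤ 1 + C := add_le_add (hg z hz) h2'
          _ ≤ _ := by linarith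
      · calc _ ≤ |-(1 / P.h)| + |Y₁ z| := abs_add_le _ _
          _ ≤ 1 / P.h + C * P.wt k := by
            rw [abs_neg, abs_of_pos hh1]; gcongr
          _ ≤ _ := by nlinarith [P.one_le_wt k]
  choose l l₁ h using key
  exact ⟨1 + 1 / P.h + C, by positivity, l, l₁, h⟩

end Params

end RotatingBoussinesq

/-! ### The L² space of a cell and the solenoidal basis fields. -/

namespace RotatingBoussinesq

open Filter Topology MeasureTheory

namespace Params

noncomputable section

variable (P : Params)

/-- Lebesgue measure on a period cell. -/
def cellMeasure : Measure (ℝ × ℝ) := volume.restrict P.cell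

instance : IsFiniteMeasure P.cellMeasure :=
  ⟨by simpa [cellMeasure] using P.isCompact_cell.measure_lt_top⟩

theorem measurableSet_cell : MeasurableSet P.cell := P.isCompact_cell.measurableSet

open Classical in
/-- The class in `L²` of a function on the closed strip. -/
def toL2 (f : ℝ × ℝ → ℝ) : Lp ℝ 2 P.cellMeasure :=
  if h : MemLp f 2 P.cellMeasure then h.toLp f else 0

variable {P}

theorem memLp_of_continuousOn {f : ℝ × ℝ → ℝ} (hf : ContinuousOn f P.closedStrip)
    (p : ENNReal) : MemLp f p P.cellMeasure := by
  have hf' := hf.mono P.cell_subset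
  obtain ⟨C, hC⟩ := P.isCompact_cell.exists_bound_of_continuousOn hf'
  exact MemLp.of_bound (hf'.aestronglyMeasurable P.measurableSet_cell) C
    ((ae_restrict_iff' P.measurableSet_cell).2 (.of_forall hC))

theorem coeFn_toL2 {f : ℝ × ℝ → ℝ} (hf : ContinuousOn f P.closedStrip) :
    P.toL2 f =ᵐ[P.cellMeasure] f := by
  rw [toL2, dif_pos (memLp_of_continuousOn hf 2)]
  exact MemLp.coeFn_toLp _

theorem inner_toL2 {f g : ℝ × ℝ → ℝ} (hf : ContinuousOn f P.closedStrip)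
    (hg : ContinuousOn g P.closedStrip) :
    inner ℝ (P.toL2 f) (P.toL2 g) = ∫ q in P.cell, f q * g q := by
  rw [L2.inner_def]
  refine integral_congr_ae ?_
  filter_upwards [coeFn_toL2 hf, coeFn_toL2 hg] with q h1 h2
  simp [h1, h2, mul_comm]

theorem toL2_add {f g : ℝ × ℝ → ℝ} (hf : ContinuousOn f P.closedStrip)
    (hg : ContinuousOn g P.closedStrip) :
    P.toL2 (fun q => f q + g q) = P.toL2 f + P.toL2 g := by
  ext1
  filter_upwards [coeFn_toL2 hf, coeFn_toL2 hg, coeFn_toL2 (hf.add hg),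
    Lp.coeFn_add (P.toL2 f) (P.toL2 g)] with q h1 h2 h3 h4
  rw [h4, Pi.add_apply, h1, h2]
  exact h3

theorem toL2_const_mul {f : ℝ × ℝ → ℝ} (hf : ContinuousOn f P.closedStrip) (a : ℝ) :
    P.toL2 (fun q => a * f q) = a • P.toL2 f := by
  ext1
  filter_upwards [coeFn_toL2 hf, coeFn_toL2 (hf.const_smul a),
    Lp.coeFn_smul a (P.toL2 f)] with q h1 h3 h4
  rw [h4, Pi.smul_apply, h1]
  exact h3

theorem toL2_zero : P.toL2 (fun _ => 0) = 0 := by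
  have := toL2_const_mul (P := P) (f := fun _ => 0) continuousOn_const 0
  simpa using this

theorem toL2_sum {ι : Type*} (s : Finset ι) {f : ι → ℝ × ℝ → ℝ}
    (hf : ∀ i, ContinuousOn (f i) P.closedStrip) (c : ι → ℝ) :
    P.toL2 (fun q => ∑ i ∈ s, c i * f i q) = ∑ i ∈ s, c i • P.toL2 (f i) := by
  classical
  induction s using Finset.induction_on with
  | empty => simpa using toL2_zero
  | insert i s hi ih =>
    simp only [Finset.sum_insert hi]
    rw [toL2_add (f := fun q => c i * f i q) ((hf i).const_smul (c i)) (continuousOn_finsetSum s fun i _ => by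
      exact (hf i).const_smul (c i)), toL2_const_mul (hf i), ih]

theorem norm_toL2_le {f : ℝ × ℝ → ℝ} (hf : ContinuousOn f P.closedStrip) {C : ℝ} (hC0 : 0 ≤ C)
    (hC : ∀ q ∈ P.cell, |f q| ≤ C) : ‖P.toL2 f‖ ≤ √(volume.real P.cell) * C := by
  refine abs_le_of_sq_le_sq' ?_ (by positivity) |>.2
  rw [← real_inner_self_eq_norm_sq, inner_toL2 hf hf, mul_pow, Real.sq_sqrt measureReal_nonneg]
  have hv : volume P.cell ≠ ⊤ := P.isCompact_cell.measure_lt_top.ne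
  calc _ ≤ ∫ q in P.cell, C ^ 2 := by
        refine setIntegral_mono_on ?_ 
          (integrableOn_const hv) P.measurableSet_cell fun q hq => ?_
        · exact ((hf.mul hf).mono P.cell_subset).integrableOn_compact P.isCompact_cell
        · rw [← pow_two, ← sq_abs (f q)]
          gcongr
          exact hC q hq
    _ = _ := by simp [mul_comm]

/-- A uniformly convergent series of continuous functions converges in `L²`. -/
theorem hasSum_toL2 {ι : Type*} {f : ι → ℝ × ℝ → ℝ} {g : ℝ × ℝ → ℝ}
    (hf : ∀ i, ContinuousOn (f i) P.closedStrip) (hg : ContinuousOn g P.closedStrip) {c B : ι → ℝ}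
    (hB : Summable B) (hfB : ∀ i, ∀ q ∈ P.cell, |c i * f i q| ≤ B i)
    (hs : ∀ q ∈ P.cell, HasSum (fun i => c i * f i q) (g q)) :
    HasSum (fun i => c i • P.toL2 (f i)) (P.toL2 g) := by
  rw [HasSum, Metric.tendsto_nhds]
  intro ε hε
  set V := √(volume.real P.cell) with hV
  have hV0 : 0 ≤ V := Real.sqrt_nonneg _
  have hu := tendstoUniformlyOn_tsum hB (s := P.cell) (f := fun i q => c i * f i q) hfB
  have := Metric.tendstoUniformlyOn_iff.1 hu (ε / (2 * (V + 1))) (by positivity)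
  filter_upwards [this] with s hs'
  rw [dist_eq_norm, ← toL2_sum s hf]
  have hc1 : ContinuousOn (fun q => ∑ i ∈ s, c i * f i q) P.closedStrip :=
    continuousOn_finsetSum s fun i _ => (hf i).const_smul (c i)
  have e : P.toL2 (fun q => ∑ i ∈ s, c i * f i q) - P.toL2 g
      = P.toL2 fun q => (∑ i ∈ s, c i * f i q) + (-1) * g q := by
    rw [toL2_add (g := fun q => -1 * g q) hc1 (hg.const_smul (-1 : ℝ)), toL2_const_mul hg, neg_one_smul, sub_eq_add_neg]
  rw [e]
  refine (norm_toL2_le (hc1.add (hg.const_smul (-1 : ℝ))) (C := ε / (2 * (V + 1))) (by positivity)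
    fun q hq => ?_).trans_lt ?_
  · have := (hs' q hq).le
    rw [(hs q hq).tsum_eq, Real.dist_eq, abs_sub_comm] at this
    simpa [sub_eq_add_neg] using this
  · calc V * (ε / (2 * (V + 1))) ≤ (V + 1) * (ε / (2 * (V + 1))) := by gcongr; linarith
      _ = ε / 2 := by field_simp
      _ < ε := by linarith

/-- Multiplication by a function that is continuous on the closed strip. -/
theorem exists_mulL2 {m : ℝ × ℝ → ℝ} (hm : ContinuousOn m P.closedStrip) :
    ∃ A : Lp ℝ 2 P.cellMeasure →L[ℝ] Lp ℝ 2 P.cellMeasure,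
      (∀ f, ContinuousOn f P.closedStrip → A (P.toL2 f) = P.toL2 fun q => m q * f q) ∧
      ∀ x y, inner ℝ (A x) y = inner ℝ x (A y) := by
  let m' : Lp ℝ ⊤ P.cellMeasure := (memLp_of_continuousOn hm ⊤).toLp m
  have hm' : m' =ᵐ[P.cellMeasure] m := MemLp.coeFn_toLp _
  let A := (ContinuousLinearMap.mul ℝ ℝ).holderL P.cellMeasure ⊤ 2 2 m'
  have hA : ∀ x, A x =ᵐ[P.cellMeasure] fun q => m q * x q := by
    intro x
    have := ContinuousLinearMap.coeFn_holder (r := 2) (ContinuousLinearMap.mul ℝ ℝ) m' x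
    filter_upwards [this, hm'] with q h1 h2
    exact h1.trans (by simp [h2])
  refine ⟨A, fun f hf => ?_, fun x y => ?_⟩
  · ext1
    filter_upwards [hA (P.toL2 f), coeFn_toL2 hf, coeFn_toL2 (hm.mul hf)] with q h1 h2 h3
    rw [h1, h2]
    exact h3.symm
  · rw [L2.inner_def, L2.inner_def]
    refine integral_congr_ae ?_
    filter_upwards [hA x, hA y] with q h1 h2
    simp [h1, h2]
    ring

theorem inner_toL2_prod {A C B D : ℝ → ℝ} (hA : Continuous A) (hB : Continuous B)
    (hC : Continuous C) (hD : Continuous D) :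
    inner ℝ (P.toL2 fun q => A q.2 * B q.1) (P.toL2 fun q => C q.2 * D q.1)
      = (∫ z in (0 : ℝ)..P.h, A z * C z) * ∫ x in (0 : ℝ)..P.L, B x * D x := by
  rw [inner_toL2 (by fun_prop) (by fun_prop), integral_cell (by fun_prop)]
  have e : ∀ x z, A z * B x * (C z * D x) = (B x * D x) * (A z * C z) := fun x z => by ring
  simp only [e, intervalIntegral.integral_const_mul, intervalIntegral.integral_mul_const]
  ring

variable (P)

/-- The functions `sin (β z) τ(x)`. -/
def sB (j : ℕ × ℤ) (q : ℝ × ℝ) : ℝ := P.sn j.1 q.2 * P.τ j.2 q.1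

/-- The functions `cos (β z) τ(x)`. -/
def cB (j : ℕ × ℤ) (q : ℝ × ℝ) : ℝ := P.cs j.1 q.2 * P.τ j.2 q.1

/-- The zonal velocity of the basis fields. -/
def uB : Option (ℕ × ℤ) → ℝ × ℝ → ℝ
  | none => fun _ => 1 / √(P.L * P.h)
  | some j => fun q => P.wz j.1 / P.ev j.1 j.2 * P.cB j q

/-- The vertical velocity of the basis fields. -/
def wB : Option (ℕ × ℤ) → ℝ × ℝ → ℝ
  | none => fun _ => 0
  | some j => fun q => -(P.wx j.2 / P.ev j.1 j.2) * P.sB (j.1, -j.2) q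

/-- `∂x` of the zonal velocity of the basis fields. -/
def uxB : Option (ℕ × ℤ) → ℝ × ℝ → ℝ
  | none => fun _ => 0
  | some j => fun q => (P.wz j.1 * P.wx j.2 / P.ev j.1 j.2) * P.cB (j.1, -j.2) q

/-- `∂z` of the zonal velocity of the basis fields. -/
def uzB : Option (ℕ × ℤ) → ℝ × ℝ → ℝ
  | none => fun _ => 0
  | some j => fun q => -(P.wz j.1 ^ 2 / P.ev j.1 j.2) * P.sB j q

/-- `∂x` of the vertical velocity of the basis fields. -/
def wxB : Option (ℕ × ℤ) → ℝ × ℝ → ℝ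
  | none => fun _ => 0
  | some j => fun q => (P.wx j.2 ^ 2 / P.ev j.1 j.2) * P.sB j q

@[fun_prop]
theorem continuous_sB (j : ℕ × ℤ) : Continuous (P.sB j) := by unfold sB; fun_prop

@[fun_prop]
theorem continuous_cB (j : ℕ × ℤ) : Continuous (P.cB j) := by unfold cB; fun_prop

@[fun_prop]
theorem continuous_uB (j : Option (ℕ × ℤ)) : Continuous (P.uB j) := by
  cases j <;> unfold uB <;> fun_prop

@[fun_prop]
theorem continuous_wB (j : Option (ℕ × ℤ)) : Continuous (P.wB j) := by
  cases j <;> unfold wB <;> fun_prop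

@[fun_prop]
theorem continuous_uxB (j : Option (ℕ × ℤ)) : Continuous (P.uxB j) := by
  cases j <;> unfold uxB <;> fun_prop

@[fun_prop]
theorem continuous_uzB (j : Option (ℕ × ℤ)) : Continuous (P.uzB j) := by
  cases j <;> unfold uzB <;> fun_prop

@[fun_prop]
theorem continuous_wxB (j : Option (ℕ × ℤ)) : Continuous (P.wxB j) := by
  cases j <;> unfold wxB <;> fun_prop

/-- These functions are the vorticities of the basis fields, whose stream functions are `sB`/`ev`.
Orthonormality of the vorticities is what makes the bulk dissipation the identity in the
coefficients. -/
theorem orthonormal_sB : Orthonormal ℝ fun j => P.toL2 (P.sB j) := by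
  classical
  rw [orthonormal_iff_ite]
  rintro ⟨n, k⟩ ⟨m, l⟩
  have := inner_toL2_prod (P := P) (P.continuous_sn n) (P.continuous_τ k) (P.continuous_sn m)
    (P.continuous_τ l)
  rw [integral_sn_mul_sn, integral_τ_mul_τ] at this
  refine Eq.trans this ?_
  by_cases h1 : n = m <;> by_cases h2 : k = l <;> simp [h1, h2]

theorem orthonormal_cB : Orthonormal ℝ fun j => P.toL2 (P.cB j) := by
  classical
  rw [orthonormal_iff_ite]
  rintro ⟨n, k⟩ ⟨m, l⟩
  have := inner_toL2_prod (P := P) (P.continuous_cs n) (P.continuous_τ k) (P.continuous_cs m)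
    (P.continuous_τ l)
  rw [integral_cs_mul_cs, integral_τ_mul_τ] at this
  refine Eq.trans this ?_
  by_cases h1 : n = m <;> by_cases h2 : k = l <;> simp [h1, h2]

theorem inner_const_cB (j : ℕ × ℤ) : inner ℝ (P.toL2 (P.uB none)) (P.toL2 (P.cB j)) = 0 := by
  have := inner_toL2_prod (P := P) (A := fun _ => 1 / √(P.L * P.h)) (B := fun _ => 1)
    continuous_const continuous_const (P.continuous_cs j.1) (P.continuous_τ j.2)
  rw [intervalIntegral.integral_const_mul, integral_cs] at this
  simp only [mul_one, mul_zero, zero_mul] at this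
  exact this

theorem norm_uB_none : ‖P.toL2 (P.uB none)‖ = 1 := by
  have hL := P.L_pos
  have hh := P.h_pos
  have := inner_toL2_prod (P := P) (A := fun _ => 1 / √(P.L * P.h)) (B := fun _ => 1)
    (C := fun _ => 1 / √(P.L * P.h)) (D := fun _ => 1)
    continuous_const continuous_const continuous_const continuous_const
  have e : (1 / √(P.L * P.h)) * (1 / √(P.L * P.h)) = 1 / (P.L * P.h) := by
    rw [div_mul_div_comm, Real.mul_self_sqrt (by positivity), one_mul]
  simp only [e, mul_one, intervalIntegral.integral_const, smul_eq_mul, sub_zero] at this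
  have h2 : ‖P.toL2 (P.uB none)‖ ^ 2 = 1 := by
    rw [← real_inner_self_eq_norm_sq]
    refine Eq.trans this ?_
    field_simp
  have := norm_nonneg (P.toL2 (P.uB none))
  nlinarith

/-- The inequality of arithmetic and geometric means bounds a sum of squares below by a product, so
double series over (n,k) can be compared with products of single ones. -/
theorem exists_ev_ge : ∃ c : ℝ, 0 < c ∧ ∀ n k, c * ((n + 1) * P.wt k) ≤ P.ev n k := by
  have hh := P.h_pos
  have hpi := Real.pi_pos
  set b := Real.pi / P.h with hb
  have hb0 : 0 < b := by positivity
  refine ⟨min (b ^ 2 / 2) (b / 2), by positivity, fun n k => ?_⟩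
  have h1 : P.wz n = b * (n + 1) := rfl
  have h2 : 0 ≤ |P.wx k| := abs_nonneg _
  have hn : (1 : ℝ) ≤ n + 1 := by simp
  have m1 := min_le_left (b ^ 2 / 2) (b / 2)
  have m2 := min_le_right (b ^ 2 / 2) (b / 2)
  rw [ev, ← sq_abs (P.wx k), h1, wt]
  calc _ = min (b ^ 2 / 2) (b / 2) * (n + 1) + min (b ^ 2 / 2) (b / 2) * ((n + 1) * |P.wx k|) := by
        ring
    _ ≤ b ^ 2 / 2 * (n + 1) + b / 2 * ((n + 1) * |P.wx k|) := by gcongr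
    _ ≤ _ := by
      have h3 : (n + 1 : ℝ) ≤ (n + 1) ^ 2 := by nlinarith
      have h4 : b ^ 2 / 2 * (n + 1) ≤ b ^ 2 / 2 * (n + 1) ^ 2 := by gcongr
      nlinarith [sq_nonneg (b * (n + 1) - |P.wx k|)]

theorem summable_wt_rpow {s : ℝ} (hs : 1 < s) : Summable fun k => P.wt k ^ (-s) := by
  have ha := P.wx_one_pos
  have h1 := (Real.summable_abs_int_rpow hs).mul_left (P.wx 1 ^ (-s))
  have h2 : Summable fun k : ℤ => if k = 0 then (1 : ℝ) else 0 :=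
    summable_of_hasFiniteSupport ((finite_singleton (0 : ℤ)).subset fun k hk => by
      by_contra h; simp_all)
  refine Summable.of_nonneg_of_le (fun k => Real.rpow_nonneg (P.wt_pos k).le _) (fun k => ?_)
    (h1.add h2)
  by_cases hk : k = 0
  · subst hk
    have : P.wt 0 = 1 := by simp [wt, wx_zero]
    rw [this, Real.one_rpow]
    have : 0 ≤ P.wx 1 ^ (-s) * |((0 : ℤ) : ℝ)| ^ (-s) := by positivity
    simp only [if_true]; linarith
  · have hk' : (0 : ℝ) < |(k : ℝ)| := by
      have : (k : ℝ) ≠ 0 := by exact_mod_cast hk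
      positivity
    have e : P.wx 1 * |(k : ℝ)| ≤ P.wt k := by
      rw [← abs_of_pos ha, ← abs_mul]
      simp [wx, wt]
    simp only [hk, if_false, add_zero]
    rw [← Real.mul_rpow ha.le hk'.le]
    exact Real.rpow_le_rpow_of_nonpos (by positivity) e (by linarith)

theorem summable_inv_nat_sq : Summable fun n : ℕ => ((n : ℝ) + 1)⁻¹ ^ 2 := by
  have := (summable_nat_add_iff 1).2 (Real.summable_nat_pow_inv (p := 2).2 one_lt_two)
  simpa [inv_pow] using this

/-- `∑ wt^r / ev²` is finite for `r < 1`. -/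
theorem summable_wt_div_ev_sq {r : ℝ} (hr : r < 1) :
    Summable fun j : ℕ × ℤ => P.wt j.2 ^ r / P.ev j.1 j.2 ^ 2 := by
  obtain ⟨c, hc, h⟩ := P.exists_ev_ge
  have h1 := (summable_inv_nat_sq.mul_of_nonneg (P.summable_wt_rpow (s := 2 - r) (by linarith))
    (fun n => by positivity) (fun k => Real.rpow_nonneg (P.wt_pos k).le _)).mul_left (1 / c ^ 2)
  refine Summable.of_nonneg_of_le (fun j => ?_) (fun j => ?_) h1
  · have := Real.rpow_nonneg (P.wt_pos j.2).le r
    positivity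
  · obtain ⟨n, k⟩ := j
    have hw := P.wt_pos k
    have e := h n k
    have : P.wt k ^ (-(2 - r)) = P.wt k ^ r / P.wt k ^ 2 := by
      rw [neg_sub, Real.rpow_sub hw]; norm_num
    simp only [this]
    calc P.wt k ^ r / P.ev n k ^ 2 ≤ P.wt k ^ r / (c * ((n + 1) * P.wt k)) ^ 2 := by gcongr
      _ = _ := by field_simp

theorem tendsto_inv_ev : Tendsto (fun j : ℕ × ℤ => 1 / P.ev j.1 j.2) cofinite (𝓝 0) := by
  have := (P.summable_wt_div_ev_sq (r := 0) one_pos).tendsto_cofinite_zero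
  have := (Real.continuous_sqrt.tendsto 0).comp this
  rw [Real.sqrt_zero] at this
  refine this.congr fun j => ?_
  have := P.ev_pos j.1 j.2
  simp [Real.sqrt_sq this.le]

/-- The multipliers from vorticity to velocity are of size ev^{-1/2} and tend to zero, which makes
the velocity a compact function of the vorticity coefficients. -/
theorem abs_wz_div_ev_le (n : ℕ) (k : ℤ) : |P.wz n / P.ev n k| ≤ √(1 / P.ev n k) := by
  have := P.ev_pos n k
  refine Real.le_sqrt_of_sq_le ?_
  rw [sq_abs, div_pow, div_le_div_iff₀ (by positivity) this]
  unfold ev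
  nlinarith [sq_nonneg (P.wz n), sq_nonneg (P.wx k)]

theorem abs_wx_div_ev_le (n : ℕ) (k : ℤ) : |-(P.wx k / P.ev n k)| ≤ √(1 / P.ev n k) := by
  have := P.ev_pos n k
  refine Real.le_sqrt_of_sq_le ?_
  rw [sq_abs, neg_sq, div_pow, div_le_div_iff₀ (by positivity) this]
  unfold ev
  nlinarith [sq_nonneg (P.wz n), sq_nonneg (P.wx k)]

section OptionFamilies

variable {E : Type*} [NormedAddCommGroup E] [InnerProductSpace ℝ E] {ι : Type*}

/-- The index `none` carries the uniform flow; the other members are multiples of an orthonormal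
family reindexed by σ, in practice the identity or k ↦ -k. -/
theorem pairwise_orthogonal_option {e : ι → E} (he : Orthonormal ℝ e) {y : E}
    (hy : ∀ i, inner ℝ y (e i) = 0) {σ : ι → ι} (hσ : Function.Injective σ) (a : ι → ℝ)
    {f : Option ι → E} (h0 : f none = y) (h1 : ∀ i, f (some i) = a i • e (σ i)) :
    Pairwise fun i j => inner ℝ (f i) (f j) = 0 := by
  intro i j hij
  cases i with
  | none => cases j with
    | none => exact absurd rfl hij
    | some j => rw [h0, h1, real_inner_smul_right, hy, mul_zero]
  | some i => cases j with
    | none => rw [h0, h1, real_inner_smul_left, real_inner_comm, hy, mul_zero]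
    | some j =>
      rw [h1, h1, real_inner_smul_left, real_inner_smul_right,
        he.2 (fun h => hij (congrArg some (hσ h))), mul_zero, mul_zero]

theorem norm_option_le {e : ι → E} (he : Orthonormal ℝ e) {y : E} {σ : ι → ι} {a : ι → ℝ}
    {f : Option ι → E} (h0 : f none = y) (h1 : ∀ i, f (some i) = a i • e (σ i)) {C : ℝ}
    (hy : ‖y‖ ≤ C) (ha : ∀ i, |a i| ≤ C) (j : Option ι) : ‖f j‖ ≤ C := by
  cases j with
  | none => rwa [h0]
  | some i => rw [h1, norm_smul, he.1, mul_one]; exact ha i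

theorem tendsto_norm_option {e : ι → E} (he : Orthonormal ℝ e) {σ : ι → ι} {a b : ι → ℝ}
    {f : Option ι → E} (h1 : ∀ i, f (some i) = a i • e (σ i))
    (hab : ∀ i, |a i| ≤ b i) (hb : Tendsto b cofinite (𝓝 0)) :
    Tendsto (fun j => ‖f j‖) cofinite (𝓝 0) := by
  have h2 : Tendsto (fun i => ‖f (some i)‖) cofinite (𝓝 0) := by
    refine squeeze_zero (fun _ => norm_nonneg _) (fun i => ?_) hb
    rw [h1, norm_smul, he.1, mul_one]
    exact hab i
  rw [Metric.tendsto_nhds] at h2 ⊢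
  intro ε hε
  have := h2 ε hε
  rw [eventually_cofinite] at this ⊢
  refine ((this.image some).union (finite_singleton none)).subset fun j hj => ?_
  cases j with
  | none => right; rfl
  | some i => left; exact ⟨i, hj, rfl⟩

end OptionFamilies

end

end Params

end RotatingBoussinesq

/-! ### Synthesis of velocities from vorticity coefficients, and curls of transformed velocities. -/

namespace RotatingBoussinesq

open Filter Topology MeasureTheory

theorem synthesis_single {ι E : Type*} [DecidableEq ι] [NormedAddCommGroup E] [NormedSpace ℝ E]
    {f : ι → E}
    {J : lp (fun _ : ι => ℝ) 2 →L[ℝ] E} (hJ : ∀ c, HasSum (fun i => c i • f i) (J c)) (i : ι) :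
    J (lp.single 2 i 1) = f i := by
  refine (hJ _).unique ?_
  have : (fun j => (lp.single 2 i (1 : ℝ) : lp (fun _ : ι => ℝ) 2) j • f j)
      = fun j => if j = i then f i else 0 := by
    ext j
    rw [lp.single_apply]
    by_cases h : j = i
    · subst h; simp
    · simp [h]
  rw [this]
  exact hasSum_ite_eq i (f i)

theorem eq_of_single {ι : Type*} [DecidableEq ι] {φ ψ : lp (fun _ : ι => ℝ) 2 →L[ℝ] ℝ}
    (h : ∀ i, φ (lp.single 2 i 1) = ψ (lp.single 2 i 1)) (c : lp (fun _ : ι => ℝ) 2) :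
    φ c = ψ c := by
  have hs := lp.hasSum_single (p := 2) (by norm_num) c
  have h1 := hs.mapL φ
  have h2 := hs.mapL ψ
  refine h1.unique ?_
  convert h2 using 2 with i
  have : lp.single 2 i (c i) = c i • (lp.single 2 i 1 : lp (fun _ : ι => ℝ) 2) := by
    rw [← lp.single_smul]; simp
  rw [this, map_smul, map_smul, h]

namespace Params

noncomputable section

variable {P : Params}

section Parts

variable {f f' φ φ' : ℝ × ℝ → ℝ}

theorem integral_cell_dx_mul (hf : ContinuousOn f P.closedStrip)
    (hf' : ContinuousOn f' P.closedStrip) (hφ : ContinuousOn φ P.closedStrip)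
    (hφ' : ContinuousOn φ' P.closedStrip)
    (df : ∀ q ∈ P.closedStrip, HasDerivAt (fun x => f (x, q.2)) (f' q) q.1)
    (dφ : ∀ q ∈ P.closedStrip, HasDerivAt (fun x => φ (x, q.2)) (φ' q) q.1)
    (pf : P.PeriodicX f) (pφ : P.PeriodicX φ) :
    ∫ q in P.cell, f' q * φ q = -∫ q in P.cell, f q * φ' q := by
  have c1 : ContinuousOn (fun q => f' q * φ q) P.closedStrip := hf'.mul hφ
  have c2 : ContinuousOn (fun q => f q * φ' q) P.closedStrip := hf.mul hφ'
  have hi : ∀ {g : ℝ × ℝ → ℝ}, ContinuousOn g P.closedStrip → IntegrableOn g P.cell := fun hg =>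
    (hg.mono P.cell_subset).integrableOn_compact P.isCompact_cell
  have c3 : ContinuousOn (fun q => f' q * φ q + f q * φ' q) P.closedStrip := c1.add c2
  rw [eq_neg_iff_add_eq_zero, ← integral_add (hi c1) (hi c2)]
  rw [integral_cell_swap (f := fun q => f' q * φ q + f q * φ' q) c3]
  have : ∀ z ∈ uIcc 0 P.h, ∫ x in (0 : ℝ)..P.L, (f' (x, z) * φ (x, z) + f (x, z) * φ' (x, z)) = 0 := by
    intro z hz
    rw [uIcc_of_le P.h_pos.le] at hz
    refine integral_deriv_periodic (f := fun x => f (x, z) * φ (x, z))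
      (fun x => (df (x, z) ⟨mem_univ _, hz⟩).mul (dφ (x, z) ⟨mem_univ _, hz⟩)) ?_ ?_
    · exact c3.comp_continuous (f := fun x => (x, z)) (by fun_prop) fun x => ⟨mem_univ _, hz⟩
    · simp only [pf.apply_L hz, pφ.apply_L hz]
  rw [intervalIntegral.integral_congr this]
  simp

theorem integral_cell_dz_mul (hf : ContinuousOn f P.closedStrip)
    (hf' : ContinuousOn f' P.closedStrip) (hφ : ContinuousOn φ P.closedStrip)
    (hφ' : ContinuousOn φ' P.closedStrip)
    (df : ∀ q ∈ P.closedStrip, HasDerivWithinAt (fun z => f (q.1, z)) (f' q) (Icc 0 P.h) q.2)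
    (dφ : ∀ q ∈ P.closedStrip, HasDerivWithinAt (fun z => φ (q.1, z)) (φ' q) (Icc 0 P.h) q.2)
    (h0 : ∀ x, φ (x, 0) = 0) (hh : ∀ x, φ (x, P.h) = 0) :
    ∫ q in P.cell, f' q * φ q = -∫ q in P.cell, f q * φ' q := by
  have c1 : ContinuousOn (fun q => f' q * φ q) P.closedStrip := hf'.mul hφ
  have c2 : ContinuousOn (fun q => f q * φ' q) P.closedStrip := hf.mul hφ'
  have hi : ∀ {g : ℝ × ℝ → ℝ}, ContinuousOn g P.closedStrip → IntegrableOn g P.cell := fun hg =>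
    (hg.mono P.cell_subset).integrableOn_compact P.isCompact_cell
  have c3 : ContinuousOn (fun q => f' q * φ q + f q * φ' q) P.closedStrip := c1.add c2
  rw [eq_neg_iff_add_eq_zero, ← integral_add (hi c1) (hi c2)]
  rw [integral_cell (f := fun q => f' q * φ q + f q * φ' q) c3]
  have : ∀ x ∈ uIcc 0 P.L, ∫ z in (0 : ℝ)..P.h, (f' (x, z) * φ (x, z) + f (x, z) * φ' (x, z)) = 0 := by
    intro x _
    have hc : ∀ {g : ℝ × ℝ → ℝ}, ContinuousOn g P.closedStrip →
        ContinuousOn (fun z => g (x, z)) (Icc 0 P.h) := fun hg =>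
      hg.comp (by fun_prop) fun z hz => ⟨mem_univ _, hz⟩
    rw [intervalIntegral.integral_eq_sub_of_hasDerivAt_of_le P.h_pos.le
      (f := fun z => f (x, z) * φ (x, z)) ((hc hf).mul (hc hφ)) (fun z hz => ?_)
      ((hc c3).intervalIntegrable_of_Icc P.h_pos.le), h0, hh]
    · simp
    · have hz' := Ioo_subset_Icc_self hz
      exact ((df (x, z) ⟨mem_univ _, hz'⟩).hasDerivAt (Icc_mem_nhds hz.1 hz.2)).mul
        ((dφ (x, z) ⟨mem_univ _, hz'⟩).hasDerivAt (Icc_mem_nhds hz.1 hz.2))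
  rw [intervalIntegral.integral_congr this]
  simp

end Parts

theorem hasDerivAt_sB_fst (j : ℕ × ℤ) (q : ℝ × ℝ) :
    HasDerivAt (fun x => P.sB j (x, q.2)) (P.wx j.2 * P.sB (j.1, -j.2) q) q.1 :=
  ((P.hasDerivAt_τ j.2 q.1).const_mul (P.sn j.1 q.2)).congr_deriv (by simp only [sB]; ring)

theorem hasDerivAt_sB_snd (j : ℕ × ℤ) (q : ℝ × ℝ) :
    HasDerivAt (fun z => P.sB j (q.1, z)) (P.wz j.1 * P.cB j q) q.2 :=
  ((P.hasDerivAt_sn j.1 q.2).mul_const (P.τ j.2 q.1)).congr_deriv (by simp only [cB]; ring)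

theorem hasDerivAt_cB_fst (j : ℕ × ℤ) (q : ℝ × ℝ) :
    HasDerivAt (fun x => P.cB j (x, q.2)) (P.wx j.2 * P.cB (j.1, -j.2) q) q.1 :=
  ((P.hasDerivAt_τ j.2 q.1).const_mul (P.cs j.1 q.2)).congr_deriv (by simp only [cB]; ring)

theorem hasDerivAt_cB_snd (j : ℕ × ℤ) (q : ℝ × ℝ) :
    HasDerivAt (fun z => P.cB j (q.1, z)) (-(P.wz j.1 * P.sB j q)) q.2 :=
  ((P.hasDerivAt_cs j.1 q.2).mul_const (P.τ j.2 q.1)).congr_deriv (by simp only [sB]; ring)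

theorem hasDerivAt_uB_fst (j : Option (ℕ × ℤ)) (q : ℝ × ℝ) :
    HasDerivAt (fun x => P.uB j (x, q.2)) (P.uxB j q) q.1 := by
  cases j with
  | none => exact hasDerivAt_const _ _
  | some j => exact ((hasDerivAt_cB_fst j q).const_mul _).congr_deriv (by simp only [uxB]; ring)

theorem hasDerivAt_uB_snd (j : Option (ℕ × ℤ)) (q : ℝ × ℝ) :
    HasDerivAt (fun z => P.uB j (q.1, z)) (P.uzB j q) q.2 := by
  cases j with
  | none => exact hasDerivAt_const _ _
  | some j => exact ((hasDerivAt_cB_snd j q).const_mul _).congr_deriv (by simp only [uzB]; ring)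

theorem hasDerivAt_wB_fst (j : Option (ℕ × ℤ)) (q : ℝ × ℝ) :
    HasDerivAt (fun x => P.wB j (x, q.2)) (P.wxB j q) q.1 := by
  cases j with
  | none => exact hasDerivAt_const _ _
  | some j =>
    refine ((hasDerivAt_sB_fst (j.1, -j.2) q).const_mul _).congr_deriv ?_
    simp only [wxB, wx_neg, neg_neg]; ring

theorem hasDerivAt_wB_snd (j : Option (ℕ × ℤ)) (q : ℝ × ℝ) :
    HasDerivAt (fun z => P.wB j (q.1, z)) (-P.uxB j q) q.2 := by
  cases j with
  | none => exact (hasDerivAt_const _ _).congr_deriv (by simp [uxB])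
  | some j =>
    exact ((hasDerivAt_sB_snd (j.1, -j.2) q).const_mul _).congr_deriv (by simp only [uxB]; ring)

theorem periodicX_sB (j : ℕ × ℤ) : P.PeriodicX (P.sB j) := fun x z _ => by
  simp only [sB]; rw [P.τ_periodic]

theorem periodicX_cB (j : ℕ × ℤ) : P.PeriodicX (P.cB j) := fun x z _ => by
  simp only [cB]; rw [P.τ_periodic]

theorem periodicX_uB (j : Option (ℕ × ℤ)) : P.PeriodicX (P.uB j) := fun x z hz => by
  cases j with
  | none => rfl
  | some j => simp only [uB]; rw [periodicX_cB j x z hz]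

theorem periodicX_wB (j : Option (ℕ × ℤ)) : P.PeriodicX (P.wB j) := fun x z hz => by
  cases j with
  | none => rfl
  | some j => simp only [wB]; rw [periodicX_sB _ x z hz]

/-- Testing a vector field with a basis field is testing its curl with the stream function. -/
theorem integral_curl {F₁ F₂ F₁z F₂x : ℝ × ℝ → ℝ} (h₁ : ContinuousOn F₁ P.closedStrip)
    (h₂ : ContinuousOn F₂ P.closedStrip) (h₁z : ContinuousOn F₁z P.closedStrip)
    (h₂x : ContinuousOn F₂x P.closedStrip)
    (d₁ : ∀ q ∈ P.closedStrip, HasDerivWithinAt (fun z => F₁ (q.1, z)) (F₁z q) (Icc 0 P.h) q.2)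
    (d₂ : ∀ q ∈ P.closedStrip, HasDerivAt (fun x => F₂ (x, q.2)) (F₂x q) q.1)
    (p₂ : P.PeriodicX F₂) (j : ℕ × ℤ) :
    (∫ q in P.cell, F₁ q * P.uB (some j) q) + ∫ q in P.cell, F₂ q * P.wB (some j) q
      = 1 / P.ev j.1 j.2 * ∫ q in P.cell, (F₂x q - F₁z q) * P.sB j q := by
  have e1 := integral_cell_dz_mul (φ := P.sB j) (φ' := fun q => P.wz j.1 * P.cB j q) h₁ h₁z
    (by fun_prop) (by fun_prop) d₁
    (fun q _ => (hasDerivAt_sB_snd j q).hasDerivWithinAt) (fun x => by simp [sB, sn_zero])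
    (fun x => by simp [sB, sn_h])
  have e2 := integral_cell_dx_mul (φ := P.sB j) (φ' := fun q => P.wx j.2 * P.sB (j.1, -j.2) q) h₂ h₂x
    (by fun_prop) (by fun_prop) d₂ (fun q _ => hasDerivAt_sB_fst j q) p₂ (periodicX_sB j)
  have hi : ∀ {g : ℝ × ℝ → ℝ}, ContinuousOn g P.closedStrip → IntegrableOn g P.cell := fun hg =>
    (hg.mono P.cell_subset).integrableOn_compact P.isCompact_cell
  have i1 : ∫ q in P.cell, F₁ q * P.uB (some j) q
      = 1 / P.ev j.1 j.2 * ∫ q in P.cell, F₁ q * (P.wz j.1 * P.cB j q) := by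
    rw [← integral_const_mul]; congr 1; ext q; simp only [uB]; ring
  have i2 : ∫ q in P.cell, F₂ q * P.wB (some j) q
      = -(1 / P.ev j.1 j.2 * ∫ q in P.cell, F₂ q * (P.wx j.2 * P.sB (j.1, -j.2) q)) := by
    rw [← integral_const_mul, ← integral_neg]; congr 1; ext q; simp only [wB]; ring
  have i3 : ∫ q in P.cell, (F₂x q - F₁z q) * P.sB j q
      = (∫ q in P.cell, F₂x q * P.sB j q) - ∫ q in P.cell, F₁z q * P.sB j q := by
    simp only [sub_mul]
    exact integral_sub (hi (by fun_prop)) (hi (by fun_prop))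
  rw [i1, i2, i3, e1, e2]
  ring

/-- The space of coefficients. -/
abbrev Coeff := lp (fun _ : Option (ℕ × ℤ) => ℝ) 2

theorem toL2_mul_continuous {f : ℝ × ℝ → ℝ} (hf : Continuous f) (a : ℝ) :
    P.toL2 (fun q => a * f q) = a • P.toL2 f := toL2_const_mul hf.continuousOn a

theorem neg_snd_injective : Function.Injective fun j : ℕ × ℤ => (j.1, -j.2) := by
  rintro ⟨n, k⟩ ⟨m, l⟩ h
  simpa using h

variable (P)

theorem one_div_ev_le : ∃ C : ℝ, 0 < C ∧ ∀ n k, 1 / P.ev n k ≤ C := by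
  obtain ⟨c, hc, h⟩ := P.exists_ev_ge
  refine ⟨1 / c, by positivity, fun n k => ?_⟩
  refine one_div_le_one_div_of_le hc (le_trans ?_ (h n k))
  have h1 : (1 : ℝ) ≤ (n + 1) * P.wt k :=
    one_le_mul_of_one_le_of_one_le (by simp) (P.one_le_wt k)
  nlinarith

theorem tendsto_sqrt_inv_ev :
    Tendsto (fun j : ℕ × ℤ => √(1 / P.ev j.1 j.2)) cofinite (𝓝 0) := by
  have := (Real.continuous_sqrt.tendsto 0).comp P.tendsto_inv_ev
  rwa [Real.sqrt_zero] at this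

theorem pairwise_uB : Pairwise fun i j => inner ℝ (P.toL2 (P.uB i)) (P.toL2 (P.uB j)) = 0 :=
  pairwise_orthogonal_option P.orthonormal_cB P.inner_const_cB Function.injective_id
    (fun j : ℕ × ℤ => P.wz j.1 / P.ev j.1 j.2) rfl fun j =>
      toL2_mul_continuous (P.continuous_cB j) _

theorem exists_synthesis_u : ∃ J : Coeff →L[ℝ] Lp ℝ 2 P.cellMeasure,
    (∀ c, HasSum (fun i => c i • P.toL2 (P.uB i)) (J c)) ∧ IsCompactOperator J := by
  obtain ⟨C, hC, hev⟩ := P.one_div_ev_le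
  have h1 : ∀ j : ℕ × ℤ, P.toL2 (P.uB (some j)) = (P.wz j.1 / P.ev j.1 j.2) • P.toL2 (P.cB j) :=
    fun j => toL2_mul_continuous (P.continuous_cB j) _
  obtain ⟨J, hJ, -⟩ := exists_synthesis P.pairwise_uB (C := 1 + √C) (by positivity)
    (norm_option_le P.orthonormal_cB (σ := id) rfl h1
      (by rw [P.norm_uB_none]; linarith [Real.sqrt_nonneg C]) fun j => by
        have := (P.abs_wz_div_ev_le j.1 j.2).trans (Real.sqrt_le_sqrt (hev j.1 j.2))
        linarith)
  exact ⟨J, hJ, isCompactOperator_of_synthesis P.pairwise_uB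
    (tendsto_norm_option P.orthonormal_cB (σ := id) h1 (fun j => P.abs_wz_div_ev_le j.1 j.2)
      P.tendsto_sqrt_inv_ev) J hJ⟩

theorem exists_synthesis_w : ∃ J : Coeff →L[ℝ] Lp ℝ 2 P.cellMeasure,
    (∀ c, HasSum (fun i => c i • P.toL2 (P.wB i)) (J c)) ∧ IsCompactOperator J := by
  obtain ⟨C, hC, hev⟩ := P.one_div_ev_le
  have h1 : ∀ j : ℕ × ℤ, P.toL2 (P.wB (some j))
      = (-(P.wx j.2 / P.ev j.1 j.2)) • P.toL2 (P.sB (j.1, -j.2)) :=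
    fun j => toL2_mul_continuous (P.continuous_sB _) _
  have ho : Pairwise fun i j => inner ℝ (P.toL2 (P.wB i)) (P.toL2 (P.wB j)) = 0 :=
    pairwise_orthogonal_option P.orthonormal_sB (fun _ => inner_zero_left _) neg_snd_injective
      _ toL2_zero h1
  obtain ⟨J, hJ, -⟩ := exists_synthesis ho (C := √C) (by positivity)
    (norm_option_le P.orthonormal_sB toL2_zero h1 (by simp) fun j =>
        (P.abs_wx_div_ev_le j.1 j.2).trans (Real.sqrt_le_sqrt (hev j.1 j.2)))
  exact ⟨J, hJ, isCompactOperator_of_synthesis ho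
    (tendsto_norm_option P.orthonormal_sB h1 (fun j => P.abs_wx_div_ev_le j.1 j.2)
      P.tendsto_sqrt_inv_ev) J hJ⟩

theorem exists_synthesis_ux : ∃ J : Coeff →L[ℝ] Lp ℝ 2 P.cellMeasure,
    ∀ c, HasSum (fun i => c i • P.toL2 (P.uxB i)) (J c) := by
  have h1 : ∀ j : ℕ × ℤ, P.toL2 (P.uxB (some j))
      = (P.wz j.1 * P.wx j.2 / P.ev j.1 j.2) • P.toL2 (P.cB (j.1, -j.2)) :=
    fun j => toL2_mul_continuous (P.continuous_cB _) _
  have ho : Pairwise fun i j => inner ℝ (P.toL2 (P.uxB i)) (P.toL2 (P.uxB j)) = 0 :=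
    pairwise_orthogonal_option P.orthonormal_cB (fun _ => inner_zero_left _) neg_snd_injective
      _ toL2_zero h1
  obtain ⟨J, hJ, -⟩ := exists_synthesis ho (C := 1) (by positivity)
    (norm_option_le P.orthonormal_cB toL2_zero h1 (by simp) fun j => by
      have := P.ev_pos j.1 j.2
      rw [abs_div, abs_of_pos this, div_le_one this, ev, abs_le]
      constructor <;> nlinarith [sq_nonneg (P.wz j.1 - P.wx j.2), sq_nonneg (P.wz j.1 + P.wx j.2)])
  exact ⟨J, hJ⟩

theorem exists_synthesis_uz : ∃ J : Coeff →L[ℝ] Lp ℝ 2 P.cellMeasure,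
    ∀ c, HasSum (fun i => c i • P.toL2 (P.uzB i)) (J c) := by
  have h1 : ∀ j : ℕ × ℤ, P.toL2 (P.uzB (some j))
      = (-(P.wz j.1 ^ 2 / P.ev j.1 j.2)) • P.toL2 (P.sB j) :=
    fun j => toL2_mul_continuous (P.continuous_sB _) _
  have ho : Pairwise fun i j => inner ℝ (P.toL2 (P.uzB i)) (P.toL2 (P.uzB j)) = 0 :=
    pairwise_orthogonal_option P.orthonormal_sB (fun _ => inner_zero_left _) Function.injective_id
      _ toL2_zero h1
  obtain ⟨J, hJ, -⟩ := exists_synthesis ho (C := 1) (by positivity)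
    (norm_option_le P.orthonormal_sB (σ := id) toL2_zero h1 (by simp) fun j => by
      have := P.ev_pos j.1 j.2
      rw [abs_neg, abs_of_nonneg (by positivity), div_le_one this, ev]
      nlinarith)
  exact ⟨J, hJ⟩

theorem exists_synthesis_wx : ∃ J : Coeff →L[ℝ] Lp ℝ 2 P.cellMeasure,
    ∀ c, HasSum (fun i => c i • P.toL2 (P.wxB i)) (J c) := by
  have h1 : ∀ j : ℕ × ℤ, P.toL2 (P.wxB (some j))
      = (P.wx j.2 ^ 2 / P.ev j.1 j.2) • P.toL2 (P.sB j) :=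
    fun j => toL2_mul_continuous (P.continuous_sB _) _
  have ho : Pairwise fun i j => inner ℝ (P.toL2 (P.wxB i)) (P.toL2 (P.wxB j)) = 0 :=
    pairwise_orthogonal_option P.orthonormal_sB (fun _ => inner_zero_left _) Function.injective_id
      _ toL2_zero h1
  obtain ⟨J, hJ, -⟩ := exists_synthesis ho (C := 1) (by positivity)
    (norm_option_le P.orthonormal_sB (σ := id) toL2_zero h1 (by simp) fun j => by
      have := P.ev_pos j.1 j.2
      rw [abs_of_nonneg (by positivity), div_le_one this, ev]
      nlinarith [sq_nonneg (P.wz j.1)])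
  exact ⟨J, hJ⟩

variable {P}

/-- The curl of a matrix times the velocity is square integrable. -/
theorem exists_curl_operator {m₁₁ m₁₂ m₂₂ : ℝ × ℝ → ℝ} (h₁₁ : ContDiffOn ℝ 1 m₁₁ P.closedStrip)
    (h₁₂ : ContDiffOn ℝ 1 m₁₂ P.closedStrip) (h₂₂ : ContDiffOn ℝ 1 m₂₂ P.closedStrip)
    (p₁₂ : P.PeriodicX m₁₂) (p₂₂ : P.PeriodicX m₂₂)
    {A₁₁ A₁₂ A₂₂ : Lp ℝ 2 P.cellMeasure →L[ℝ] Lp ℝ 2 P.cellMeasure}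
    (hA₁₁ : ∀ f, ContinuousOn f P.closedStrip → A₁₁ (P.toL2 f) = P.toL2 fun q => m₁₁ q * f q)
    (hA₁₂ : ∀ f, ContinuousOn f P.closedStrip → A₁₂ (P.toL2 f) = P.toL2 fun q => m₁₂ q * f q)
    (hA₂₂ : ∀ f, ContinuousOn f P.closedStrip → A₂₂ (P.toL2 f) = P.toL2 fun q => m₂₂ q * f q)
    {J₁ J₂ : Coeff →L[ℝ] Lp ℝ 2 P.cellMeasure}
    (hJ₁ : ∀ c, HasSum (fun i => c i • P.toL2 (P.uB i)) (J₁ c))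
    (hJ₂ : ∀ c, HasSum (fun i => c i • P.toL2 (P.wB i)) (J₂ c)) :
    ∃ 𝒢 : Coeff →L[ℝ] Lp ℝ 2 P.cellMeasure, ∀ c (j : ℕ × ℤ),
      inner ℝ (A₁₁ (J₁ c) + A₁₂ (J₂ c)) (P.toL2 (P.uB (some j)))
        + inner ℝ (A₁₂ (J₁ c) + A₂₂ (J₂ c)) (P.toL2 (P.wB (some j)))
        = 1 / P.ev j.1 j.2 * inner ℝ (𝒢 c) (P.toL2 (P.sB j)) := by
  classical
  obtain ⟨Jux, hJux⟩ := P.exists_synthesis_ux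
  obtain ⟨Juz, hJuz⟩ := P.exists_synthesis_uz
  obtain ⟨Jwx, hJwx⟩ := P.exists_synthesis_wx
  have c₁₁ := h₁₁.continuousOn
  have c₁₂ := h₁₂.continuousOn
  have c₂₂ := h₂₂.continuousOn
  have c₁₁z := continuousOn_dz h₁₁
  have c₁₂z := continuousOn_dz h₁₂
  have c₁₂x := continuousOn_dx h₁₂
  have c₂₂x := continuousOn_dx h₂₂
  obtain ⟨M₁, hM₁, -⟩ := exists_mulL2 (P := P) (m := fun q => P.dx m₁₂ q - P.dz m₁₁ q) (by fun_prop)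
  obtain ⟨M₂, hM₂, -⟩ := exists_mulL2 (P := P) (m := fun q => P.dx m₂₂ q - P.dz m₁₂ q) (by fun_prop)
  let 𝒢 : Coeff →L[ℝ] Lp ℝ 2 P.cellMeasure :=
    -- This is the product rule for the curl of m·(u,w). The factor 2 arises because w_z = -u_x, so
    -- m₁₂ meets u_x twice.
    M₁ ∘L J₁ + M₂ ∘L J₂ + (2 : ℝ) • (A₁₂ ∘L Jux) + A₂₂ ∘L Jwx - A₁₁ ∘L Juz
  refine ⟨𝒢, fun c j => ?_⟩
  let φ : Coeff →L[ℝ] ℝ :=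
    (innerSL ℝ (P.toL2 (P.uB (some j)))) ∘L (A₁₁ ∘L J₁ + A₁₂ ∘L J₂)
      + (innerSL ℝ (P.toL2 (P.wB (some j)))) ∘L (A₁₂ ∘L J₁ + A₂₂ ∘L J₂)
  let ψ : Coeff →L[ℝ] ℝ := (1 / P.ev j.1 j.2) • (innerSL ℝ (P.toL2 (P.sB j))) ∘L 𝒢
  -- Both sides are continuous linear in c, so it is enough to compare them on single basis fields,
  -- which are smooth enough for integration by parts.
  have key : φ c = ψ c := by
    refine eq_of_single (fun i => ?_) c
    simp only [φ, ψ, 𝒢, add_apply, smul_apply, sub_apply, ContinuousLinearMap.comp_apply,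
      innerSL_apply_apply, synthesis_single hJ₁, synthesis_single hJ₂, synthesis_single hJux,
      synthesis_single hJuz, synthesis_single hJwx]
    have d1 := P.continuous_uB i
    have d2 := P.continuous_wB i
    have d3 := P.continuous_uxB i
    have d4 := P.continuous_uzB i
    have d5 := P.continuous_wxB i
    rw [hA₁₁ _ (by fun_prop), hA₁₁ _ (by fun_prop), hA₁₂ _ (by fun_prop), hA₁₂ _ (by fun_prop),
      hA₁₂ _ (by fun_prop), hA₂₂ _ (by fun_prop), hA₂₂ _ (by fun_prop), hM₁ _ (by fun_prop),
      hM₂ _ (by fun_prop), ← toL2_add (by fun_prop) (by fun_prop),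
      ← toL2_add (by fun_prop) (by fun_prop), ← toL2_const_mul (by fun_prop),
      ← toL2_add (by fun_prop) (by fun_prop), ← toL2_add (by fun_prop) (by fun_prop),
      ← toL2_add (by fun_prop) (by fun_prop), sub_eq_add_neg, ← neg_one_smul ℝ,
      ← toL2_const_mul (by fun_prop), ← toL2_add (by fun_prop) (by fun_prop),
      real_inner_comm, inner_toL2 (by fun_prop) (by fun_prop), real_inner_comm,
      inner_toL2 (by fun_prop) (by fun_prop), real_inner_comm,
      inner_toL2 (by fun_prop) (by fun_prop)]
    have key := integral_curl (P := P)
      (F₁ := fun q => m₁₁ q * P.uB i q + m₁₂ q * P.wB i q)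
      (F₂ := fun q => m₁₂ q * P.uB i q + m₂₂ q * P.wB i q)
      (F₁z := fun q => P.dz m₁₁ q * P.uB i q + m₁₁ q * P.uzB i q
        + (P.dz m₁₂ q * P.wB i q + m₁₂ q * -P.uxB i q))
      (F₂x := fun q => P.dx m₁₂ q * P.uB i q + m₁₂ q * P.uxB i q
        + (P.dx m₂₂ q * P.wB i q + m₂₂ q * P.wxB i q))
      (by fun_prop) (by fun_prop) (by fun_prop) (by fun_prop)
      (fun q hq => ((hasDerivWithinAt_dz h₁₁ hq).mul (hasDerivAt_uB_snd i q).hasDerivWithinAt).add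
        ((hasDerivWithinAt_dz h₁₂ hq).mul (hasDerivAt_wB_snd i q).hasDerivWithinAt))
      (fun q hq => ((hasDerivAt_dx h₁₂ hq).mul (hasDerivAt_uB_fst i q)).add
        ((hasDerivAt_dx h₂₂ hq).mul (hasDerivAt_wB_fst i q)))
      (fun x z hz => by
        simp only [p₁₂ x z hz, p₂₂ x z hz, periodicX_uB i x z hz, periodicX_wB i x z hz]) j
    refine key.trans ?_
    rw [smul_eq_mul]
    congr 2
    ext q
    ring
  simpa only [φ, ψ, add_apply, smul_apply, ContinuousLinearMap.comp_apply, innerSL_apply_apply,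
    smul_eq_mul, real_inner_comm] using key

end

end Params

end RotatingBoussinesq

/-! ### Trace functionals on z = 0 and the weak eigenvalue problem. -/

namespace RotatingBoussinesq

open Filter Topology MeasureTheory

namespace Params

noncomputable section

variable (P : Params)

/-- The coefficients of the trace functionals. -/
def traceCoeff (k : ℤ) : Option (ℕ × ℤ) → ℝ
  | none => if k = 0 then 1 / √P.h else 0
  | some j => if j.2 = k then √(2 / P.h) * (P.wz j.1 / P.ev j.1 j.2) else 0

/-- A trace functional sees only one zonal wave number and possibly the uniform flow; this reduces
its sum to the vertical index. -/
theorem hasSum_option_fiber {f : Option (ℕ × ℤ) → ℝ} {k : ℤ} {s : ℝ}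
    (h0 : ∀ j : ℕ × ℤ, j.2 ≠ k → f (some j) = 0) :
    HasSum f s ↔ HasSum (fun n : ℕ => f (some (n, k))) (s - f none) := by
  have h1 : HasSum (Function.update f none 0) (s - f none) ↔ HasSum f s := by
    constructor
    · intro h
      have := h.update none (f none)
      simpa using this
    · intro h
      have := h.update none 0
      rwa [zero_sub, neg_add_eq_sub] at this
  rw [← h1]
  have hinj : Function.Injective fun n : ℕ => (some (n, k) : Option (ℕ × ℤ)) := by
    intro n m h; simpa using h
  rw [← hinj.hasSum_iff]
  · rfl
  · intro j hj
    cases j with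
    | none => simp
    | some j =>
      have : j.2 ≠ k := by
        rintro rfl
        exact hj ⟨j.1, rfl⟩
      simp [h0 j this]

theorem exists_sum_wz_div_ev_sq : ∃ C : ℝ, 0 < C ∧ ∀ k : ℤ,
    Summable (fun n : ℕ => (P.wz n / P.ev n k) ^ 2) ∧ ∑' n : ℕ, (P.wz n / P.ev n k) ^ 2 ≤ C := by
  have hh := P.h_pos
  have hpi := Real.pi_pos
  have hs : Summable fun n : ℕ => (P.h / Real.pi) ^ 2 * ((n : ℝ) + 1)⁻¹ ^ 2 :=
    summable_inv_nat_sq.mul_left _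
  have hle : ∀ k n, (P.wz n / P.ev n k) ^ 2 ≤ (P.h / Real.pi) ^ 2 * ((n : ℝ) + 1)⁻¹ ^ 2 := by
    intro k n
    have hw := P.wz_pos n
    have : P.wz n / P.ev n k ≤ 1 / P.wz n := by
      rw [div_le_div_iff₀ (P.ev_pos n k) hw, ev]
      nlinarith [sq_nonneg (P.wx k)]
    calc _ ≤ (1 / P.wz n) ^ 2 := by
          have := P.ev_pos n k
          gcongr
      _ = _ := by unfold wz; field_simp
  refine ⟨∑' n : ℕ, (P.h / Real.pi) ^ 2 * ((n : ℝ) + 1)⁻¹ ^ 2, ?_, fun k => ?_⟩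
  · exact hs.tsum_pos (fun n => by positivity) 0 (by positivity)
  · have h1 := Summable.of_nonneg_of_le (fun n => sq_nonneg _) (hle k) hs
    exact ⟨h1, h1.tsum_le_tsum (hle k) hs⟩

/-- ρ k represents the k-th Fourier coefficient of u on z = 0. Distinct k involve disjoint sets of
indices, so the ρ k are orthogonal, and they are uniformly bounded because ∑ₙ(wz/ev)² is. Their
synthesis operator K is therefore bounded, and N = K K* is the friction form. -/
theorem exists_trace : ∃ (ρ : ℤ → Coeff) (N : Coeff →L[ℝ] Coeff),
    (∀ k j, ρ k j = P.traceCoeff k j) ∧ (∀ x y, inner ℝ (N x) y = inner ℝ x (N y)) ∧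
    (∀ x, 0 ≤ inner ℝ (N x) x) ∧ (∀ x, N x none = inner ℝ (ρ 0) x * (1 / √P.h)) ∧
    (∀ x n k, N x (some (n, k)) = inner ℝ (ρ k) x * (√(2 / P.h) * (P.wz n / P.ev n k))) := by
  classical
  obtain ⟨C, hC, hsum⟩ := P.exists_sum_wz_div_ev_sq
  have hsq : ∀ k, HasSum (fun j => P.traceCoeff k j ^ 2)
      ((√(2 / P.h)) ^ 2 * (∑' n : ℕ, (P.wz n / P.ev n k) ^ 2) + P.traceCoeff k none ^ 2) := by
    intro k
    rw [hasSum_option_fiber (k := k) (fun j hj => by simp [traceCoeff, hj]), add_sub_cancel_right]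
    have := (hsum k).1.hasSum.mul_left ((√(2 / P.h)) ^ 2)
    simpa [traceCoeff, mul_pow] using this
  have hmem : ∀ k, Memℓp (P.traceCoeff k) 2 := by
    intro k
    refine memℓp_gen ?_
    simpa using (hsq k).summable
  let ρ : ℤ → Coeff := fun k => ⟨P.traceCoeff k, hmem k⟩
  have hρ : ∀ k j, ρ k j = P.traceCoeff k j := fun k j => rfl
  have horth : Pairwise fun i j => inner ℝ (ρ i) (ρ j) = 0 := by
    intro i j hij
    rw [lp.inner_eq_tsum]
    have : ∀ l, inner ℝ (ρ i l) (ρ j l) = 0 := by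
      intro l
      simp only [hρ, RCLike.inner_apply, conj_trivial]
      cases l with
      | none =>
        simp only [traceCoeff]
        by_cases h : i = 0
        · simp [h, show j ≠ 0 from fun h' => hij (h.trans h'.symm)]
        · simp [h]
      | some l =>
        simp only [traceCoeff]
        by_cases h : l.2 = i
        · simp [h, hij]
        · simp [h]
    simp only [this, tsum_zero]
  set D := (√(2 / P.h)) ^ 2 * C + (1 / √P.h) ^ 2 with hD
  have hbound : ∀ k, ‖ρ k‖ ≤ √D := by
    intro k
    refine Real.le_sqrt_of_sq_le ?_
    rw [lp_two_norm_sq]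
    simp only [hρ]
    rw [(hsq k).tsum_eq, hD]
    have : P.traceCoeff k none ^ 2 ≤ (1 / √P.h) ^ 2 := by
      simp only [traceCoeff]
      split_ifs
      · rfl
      · rw [zero_pow two_ne_zero]; positivity
    have := (hsum k).2
    gcongr
  obtain ⟨K, hK, -⟩ := exists_synthesis horth (Real.sqrt_nonneg D) hbound
  have hadj : ∀ x k, (K.adjoint x) k = inner ℝ (ρ k) x := by
    intro x k
    have h1 : inner ℝ (lp.single 2 k (1 : ℝ) : lp (fun _ : ℤ => ℝ) 2) (K.adjoint x)
        = inner ℝ (ρ k) x := by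
      rw [ContinuousLinearMap.adjoint_inner_right, synthesis_single hK]
    rw [lp.inner_single_left] at h1
    simpa using h1
  have hN : ∀ x j, (K (K.adjoint x)) j = ∑' k, inner ℝ (ρ k) x * P.traceCoeff k j := by
    intro x j
    have h1 := (hK (K.adjoint x)).mapL (innerSL ℝ (lp.single 2 j (1 : ℝ) : Coeff))
    rw [innerSL_apply_apply, lp.inner_single_left] at h1
    have h2 := h1.tsum_eq
    simp only [innerSL_apply_apply, lp.inner_single_left, RCLike.inner_apply, conj_trivial,
      mul_one, lp.coeFn_smul, Pi.smul_apply, smul_eq_mul, hadj, hρ] at h2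
    exact h2.symm
  refine ⟨ρ, K ∘L K.adjoint, hρ, fun x y => ?_, fun x => ?_, fun x => ?_, fun x n k => ?_⟩
  · simp only [ContinuousLinearMap.comp_apply]
    rw [← ContinuousLinearMap.adjoint_inner_right, ContinuousLinearMap.adjoint_inner_left]
  · simp only [ContinuousLinearMap.comp_apply]
    rw [← ContinuousLinearMap.adjoint_inner_right]
    exact real_inner_self_nonneg
  · rw [ContinuousLinearMap.comp_apply, hN, tsum_eq_single 0 (fun k hk => by simp [traceCoeff, hk])]
    simp [traceCoeff]
  · rw [ContinuousLinearMap.comp_apply, hN,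
      tsum_eq_single k (fun l hl => by simp [traceCoeff, hl.symm])]
    simp [traceCoeff]

variable {P}

set_option maxHeartbeats 1600000 in
/-- The variational form of the eigenvalue problem has a solution with a positive eigenvalue. -/
theorem exists_weak_mode {b₁₁ b₁₂ b₂₂ : ℝ × ℝ → ℝ} (h₁₁ : ContDiffOn ℝ 1 b₁₁ P.closedStrip)
    (h₁₂ : ContDiffOn ℝ 1 b₁₂ P.closedStrip) (h₂₂ : ContDiffOn ℝ 1 b₂₂ P.closedStrip)
    (p₁₂ : P.PeriodicX b₁₂) (p₂₂ : P.PeriodicX b₂₂) {s : Finset (Option (ℕ × ℤ))}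
    {a : Option (ℕ × ℤ) → ℝ}
    (hpos : 0 < ∫ q in P.cell, (b₁₁ q * (∑ i ∈ s, a i * P.uB i q) ^ 2
      + 2 * b₁₂ q * ((∑ i ∈ s, a i * P.uB i q) * ∑ i ∈ s, a i * P.wB i q)
      + b₂₂ q * (∑ i ∈ s, a i * P.wB i q) ^ 2)) :
    ∃ lam : ℝ, 0 < lam ∧ ∃ (c : Option (ℕ × ℤ) → ℝ) (e : ℤ → ℝ) (G : ℕ × ℤ → ℝ) (H : ℝ),
      (∃ i, c i ≠ 0) ∧ Summable (fun i => c i ^ 2) ∧ Summable (fun j => G j ^ 2) ∧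
      (∀ k, HasSum (fun n => √(2 / P.h) * (P.wz n / P.ev n k) * c (some (n, k)))
        (e k - if k = 0 then c none / √P.h else 0)) ∧
      (∀ n k, P.ν * c (some (n, k)) + P.ν * P.α * e k * (√(2 / P.h) * (P.wz n / P.ev n k))
        = G (n, k) / P.ev n k) ∧
      P.ν * P.α * e 0 / √P.h = H ∧
      ∀ u w, ContinuousOn u P.closedStrip → ContinuousOn w P.closedStrip →
        (∃ B : Option (ℕ × ℤ) → ℝ, Summable B ∧ ∀ i, ∀ q ∈ P.cell, |c i * P.uB i q| ≤ B i) →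
        (∃ B : Option (ℕ × ℤ) → ℝ, Summable B ∧ ∀ i, ∀ q ∈ P.cell, |c i * P.wB i q| ≤ B i) →
        (∀ q ∈ P.cell, HasSum (fun i => c i * P.uB i q) (u q)) →
        (∀ q ∈ P.cell, HasSum (fun i => c i * P.wB i q) (w q)) →
        ∀ j, (∫ q in P.cell, ((b₁₁ q * u q + b₁₂ q * w q) / lam - lam * u q) * P.uB j q)
          + (∫ q in P.cell, ((b₁₂ q * u q + b₂₂ q * w q) / lam - lam * w q) * P.wB j q)
          = j.elim H fun j => G j / P.ev j.1 j.2 := by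
  classical
  obtain ⟨J₁, hJ₁, cJ₁⟩ := P.exists_synthesis_u
  obtain ⟨J₂, hJ₂, cJ₂⟩ := P.exists_synthesis_w
  have c₁₁ := h₁₁.continuousOn
  have c₁₂ := h₁₂.continuousOn
  have c₂₂ := h₂₂.continuousOn
  obtain ⟨A₁₁, hA₁₁, sA₁₁⟩ := exists_mulL2 c₁₁
  obtain ⟨A₁₂, hA₁₂, sA₁₂⟩ := exists_mulL2 c₁₂
  obtain ⟨A₂₂, hA₂₂, sA₂₂⟩ := exists_mulL2 c₂₂
  obtain ⟨𝒢, h𝒢⟩ := exists_curl_operator h₁₁ h₁₂ h₂₂ p₁₂ p₂₂ hA₁₁ hA₁₂ hA₂₂ hJ₁ hJ₂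
  -- The identity matrix accounts for the term -λu in the forcing; the matrix b accounts for the
  -- other part.
  obtain ⟨𝒢', h𝒢'⟩ := exists_curl_operator (P := P) (m₁₁ := fun _ => 1) (m₁₂ := fun _ => 0)
    (m₂₂ := fun _ => 1) contDiffOn_const contDiffOn_const contDiffOn_const
    (fun _ _ _ => rfl) (fun _ _ _ => rfl) (A₁₁ := ContinuousLinearMap.id ℝ _) (A₁₂ := 0)
    (A₂₂ := ContinuousLinearMap.id ℝ _) (fun f _ => by simp) (fun f _ => by simp [toL2_zero])
    (fun f _ => by simp) hJ₁ hJ₂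
  simp only [ContinuousLinearMap.id_apply, zero_apply, add_zero, zero_add] at h𝒢'
  obtain ⟨ρ, N, hρ, sN, pN, hN0, hN⟩ := P.exists_trace
  obtain ⟨S, hS, cS⟩ : ∃ S : Coeff →L[ℝ] Coeff, (∀ x y, inner ℝ (S x) y
      = inner ℝ (J₁ x) (J₁ y) + inner ℝ (J₂ x) (J₂ y)) ∧ IsCompactOperator S := by
    refine ⟨J₁.adjoint ∘L J₁ + J₂.adjoint ∘L J₂, fun x y => ?_,
      (cJ₁.clm_comp J₁.adjoint).add (cJ₂.clm_comp J₂.adjoint)⟩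
    simp only [add_apply, ContinuousLinearMap.comp_apply, inner_add_left,
      ContinuousLinearMap.adjoint_inner_left]
  obtain ⟨T, hT, cT⟩ : ∃ T : Coeff →L[ℝ] Coeff, (∀ x y, inner ℝ (T x) y
      = inner ℝ (A₁₁ (J₁ x) + A₁₂ (J₂ x)) (J₁ y) + inner ℝ (A₁₂ (J₁ x) + A₂₂ (J₂ x)) (J₂ y)) ∧
      IsCompactOperator T := by
    refine ⟨J₁.adjoint ∘L (A₁₁ ∘L J₁ + A₁₂ ∘L J₂) + J₂.adjoint ∘L (A₁₂ ∘L J₁ + A₂₂ ∘L J₂),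
      fun x y => ?_, (((cJ₁.clm_comp A₁₁).add (cJ₂.clm_comp A₁₂)).clm_comp J₁.adjoint).add
      (((cJ₁.clm_comp A₁₂).add (cJ₂.clm_comp A₂₂)).clm_comp J₂.adjoint)⟩
    simp only [add_apply, ContinuousLinearMap.comp_apply, inner_add_left,
      ContinuousLinearMap.adjoint_inner_left]
  let e₀ : Coeff := lp.single 2 none 1
  let Pr : Coeff →L[ℝ] Coeff := (innerSL ℝ e₀).smulRight e₀
  have hPr : ∀ x, Pr x = x none • e₀ := by
    intro x
    simp only [Pr, e₀, ContinuousLinearMap.smulRight_apply, innerSL_apply_apply,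
      lp.inner_single_left, RCLike.inner_apply, conj_trivial, mul_one]
  have he₀ : ∀ x : Coeff, inner ℝ e₀ x = x none := by
    intro x; simp [e₀, lp.inner_single_left]
  have he₀' : ∀ x : Coeff, inner ℝ x e₀ = x none := by
    intro x; rw [real_inner_comm, he₀]
  have hPri : ∀ x y, inner ℝ (Pr x) y = x none * y none := by
    intro x y; rw [hPr, real_inner_smul_left, he₀]
  have hJe : J₁ e₀ = P.toL2 (P.uB none) := synthesis_single hJ₁ none
  -- The uniform flow is a unit vector orthogonal to the other zonal velocities, so its coefficient
  -- is an inner product with the velocity.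
  have hJx : ∀ x, inner ℝ (J₁ x) (P.toL2 (P.uB none)) = x none := by
    intro x
    have h1 := (hJ₁ x).mapL (innerSL ℝ (P.toL2 (P.uB none)))
    have h2 : HasSum (fun i => (innerSL ℝ (P.toL2 (P.uB none))) (x i • P.toL2 (P.uB i)))
        (x none) := by
      have : (fun i => (innerSL ℝ (P.toL2 (P.uB none))) (x i • P.toL2 (P.uB i)))
          = fun i => if i = none then x none else 0 := by
        ext i
        rw [innerSL_apply_apply, real_inner_smul_right]
        by_cases hi : i = none
        · subst hi
          simp [P.norm_uB_none]
        · rw [P.pairwise_uB (Ne.symm hi), if_neg hi, mul_zero]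
      rw [this]
      exact hasSum_ite_eq none _
    rw [real_inner_comm]
    exact h1.unique h2
  let x₀ : Coeff := ∑ i ∈ s, a i • lp.single 2 i 1
  have hx₁ : J₁ x₀ = P.toL2 fun q => ∑ i ∈ s, a i * P.uB i q := by
    rw [toL2_sum s fun i => (P.continuous_uB i).continuousOn]
    simp only [x₀, map_sum, map_smul, synthesis_single hJ₁]
  have hx₂ : J₂ x₀ = P.toL2 fun q => ∑ i ∈ s, a i * P.wB i q := by
    rw [toL2_sum s fun i => (P.continuous_wB i).continuousOn]
    simp only [x₀, map_sum, map_smul, synthesis_single hJ₂]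
  have hx₀ : 0 < inner ℝ (T x₀) x₀ := by
    have d1 : Continuous fun q => ∑ i ∈ s, a i * P.uB i q := by fun_prop
    have d2 : Continuous fun q => ∑ i ∈ s, a i * P.wB i q := by fun_prop
    have hi : ∀ {g : ℝ × ℝ → ℝ}, ContinuousOn g P.closedStrip → IntegrableOn g P.cell := fun hg =>
      (hg.mono P.cell_subset).integrableOn_compact P.isCompact_cell
    rw [hT, hx₁, hx₂, hA₁₁ _ (by fun_prop), hA₁₂ _ (by fun_prop), hA₁₂ _ (by fun_prop),
      hA₂₂ _ (by fun_prop), ← toL2_add (by fun_prop) (by fun_prop),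
      ← toL2_add (by fun_prop) (by fun_prop), inner_toL2 (by fun_prop) (by fun_prop),
      inner_toL2 (by fun_prop) (by fun_prop), ← integral_add (hi (by fun_prop)) (hi (by fun_prop))]
    refine hpos.trans_eq ?_
    congr 1
    ext q
    ring
  have cPr : IsCompactOperator Pr := by
    have : IsCompactOperator (ContinuousLinearMap.toSpanSingleton ℝ e₀) :=
      isCompactOperator_of_locallyCompactSpace_rng _
    exact this.comp_clm (innerSL ℝ e₀)
  have sS : ∀ x y, inner ℝ (S x) y = inner ℝ x (S y) := by
    intro x y
    rw [hS, real_inner_comm (S y) x, hS, real_inner_comm (J₁ y) (J₁ x),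
      real_inner_comm (J₂ y) (J₂ x)]
  have sT : ∀ x y, inner ℝ (T x) y = inner ℝ x (T y) := by
    intro x y
    rw [real_inner_comm (T y) x, hT, hT]
    simp only [inner_add_left, sA₁₁, sA₁₂, sA₂₂]
    rw [real_inner_comm (A₁₁ (J₁ y)), real_inner_comm (A₁₂ (J₁ y)), real_inner_comm (A₁₂ (J₂ y)),
      real_inner_comm (A₂₂ (J₂ y)), sA₁₁, sA₁₂, sA₁₂, sA₂₂]
    ring
  obtain ⟨lam, hlam, x, hx, heq⟩ := exists_pencil_kernel S T Pr (P.α • N) sS sT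
    (fun x y => by rw [hPri, real_inner_comm (Pr y) x, hPri, mul_comm])
    (fun x y => by
      simp only [smul_apply, real_inner_smul_left, real_inner_smul_right, sN])
    cS cT
    cPr (fun x => by
      rw [smul_apply, real_inner_smul_left]
      exact mul_nonneg P.α_pos.le (pN x))
    (fun x => by rw [hPri]; exact mul_self_nonneg _)
    -- The uniform flow escapes the bulk dissipation but has kinetic energy: by Cauchy–Schwarz its
    -- squared coefficient is at most ‖u‖².
    (fun x => by
      rw [hPri, hS, real_inner_self_eq_norm_sq, real_inner_self_eq_norm_sq]
      have h1 := abs_real_inner_le_norm (J₁ x) (P.toL2 (P.uB none))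
      rw [hJx, P.norm_uB_none, mul_one] at h1
      have h2 := sq_le_sq' (by linarith [abs_nonneg (x none), norm_nonneg (J₁ x)]) h1
      rw [sq_abs] at h2
      nlinarith [sq_nonneg ‖J₂ x‖])
    (fun x => by
      rw [hPri]
      have := lp_two_sum_sq_le x {none}
      simpa [pow_two] using this)
    P.ν_pos x₀ hx₀
  let F₁ := (1 / lam) • (A₁₁ (J₁ x) + A₁₂ (J₂ x)) - lam • J₁ x
  let F₂ := (1 / lam) • (A₁₂ (J₁ x) + A₂₂ (J₂ x)) - lam • J₂ x
  -- The kernel equation of the pencil, paired with a basis vector and divided by λ: the forcing F =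
  -- (b/λ - λ)u balances viscosity and friction.
  have hweak : ∀ j, inner ℝ F₁ (P.toL2 (P.uB j)) + inner ℝ F₂ (P.toL2 (P.wB j))
      = P.ν * (x j - (Pr x) j + P.α * (N x) j) := by
    intro j
    have h1 : inner ℝ ((lam ^ 2) • S x + (lam * P.ν) • (x - Pr x + (P.α • N) x) - T x)
        (lp.single 2 j (1 : ℝ) : Coeff) = 0 := by rw [heq, inner_zero_left]
    have hs : ∀ y : Coeff, inner ℝ y (lp.single 2 j (1 : ℝ) : Coeff) = y j := by
      intro y; simp [lp.inner_single_right]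
    rw [inner_sub_left, inner_add_left, real_inner_smul_left, real_inner_smul_left, hS, hT,
      synthesis_single hJ₁, synthesis_single hJ₂, hs] at h1
    simp only [F₁, F₂, inner_sub_left, real_inner_smul_left]
    simp only [lp.coeFn_add, lp.coeFn_sub, Pi.add_apply, Pi.sub_apply, smul_apply, lp.coeFn_smul,
      Pi.smul_apply, smul_eq_mul] at h1
    field_simp
    linarith
  let G : ℕ × ℤ → ℝ := fun j =>
    inner ℝ (P.toL2 (P.sB j)) ((1 / lam) • 𝒢 x - lam • 𝒢' x)
  have hG : ∀ j : ℕ × ℤ, inner ℝ F₁ (P.toL2 (P.uB (some j)))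
      + inner ℝ F₂ (P.toL2 (P.wB (some j))) = G j / P.ev j.1 j.2 := by
    intro j
    have h1 := h𝒢 x j
    have h2 := h𝒢' x j
    simp only [F₁, F₂, G, inner_sub_left, inner_sub_right, real_inner_smul_left,
      real_inner_smul_right]
    rw [real_inner_comm (𝒢 x), real_inner_comm (𝒢' x)]
    linear_combination (1 / lam) * h1 - lam * h2
  refine ⟨lam, hlam, x, fun k => inner ℝ (ρ k) x, G, P.ν * P.α * inner ℝ (ρ 0) x / √P.h, ?_,
    lp_two_summable_sq x, ?_, fun k => ?_, fun n k => ?_, rfl, ?_⟩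
  · by_contra! h
    exact hx (lp.ext (funext h))
  -- Bessel's inequality: G consists of the coefficients of the L² curl of the forcing.
  · have := P.orthonormal_sB.inner_products_summable ((1 / lam) • 𝒢 x - lam • 𝒢' x)
    simpa [G] using this
  · have h1 := lp.hasSum_inner (𝕜 := ℝ) (ρ k) x
    rw [hasSum_option_fiber (k := k) (fun j hj => by simp [hρ, traceCoeff, hj])] at h1
    simp only [hρ, traceCoeff, RCLike.inner_apply, conj_trivial, if_true] at h1
    convert h1 using 1
    · ext n; ring
    · split_ifs <;> simp [div_eq_mul_inv]
  · have h1 := (hweak (some (n, k))).symm.trans (hG (n, k))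
    have h2 : (Pr x) (some (n, k)) = 0 := by
      rw [hPr]; simp [e₀, lp.single_apply]
    rw [h2, hN] at h1
    rw [← h1]; ring
  -- At this stage the velocity is known only as an L² class. The integral form of the equation is
  -- therefore stated for any continuous fields to which the expansion converges uniformly, and is
  -- used once such fields have been constructed.
  · rintro u w cu cw ⟨B, hB, hBu⟩ ⟨B', hB', hBw⟩ su sw j
    have hu : J₁ x = P.toL2 u := (hJ₁ x).unique
      (hasSum_toL2 (fun i => (P.continuous_uB i).continuousOn) cu hB hBu su)
    have hw : J₂ x = P.toL2 w := (hJ₂ x).unique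
      (hasSum_toL2 (fun i => (P.continuous_wB i).continuousOn) cw hB' hBw sw)
    have e1 : F₁ = P.toL2 fun q => (1 / lam) * (b₁₁ q * u q + b₁₂ q * w q) + (-lam) * u q := by
      simp only [F₁, hu, hw]
      rw [hA₁₁ _ cu, hA₁₂ _ cw, ← toL2_add (by fun_prop) (by fun_prop),
        ← toL2_const_mul (by fun_prop), sub_eq_add_neg, ← neg_smul, ← toL2_const_mul cu,
        ← toL2_add (by fun_prop) (by fun_prop)]
    have e2 : F₂ = P.toL2 fun q => (1 / lam) * (b₁₂ q * u q + b₂₂ q * w q) + (-lam) * w q := by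
      simp only [F₂, hu, hw]
      rw [hA₁₂ _ cu, hA₂₂ _ cw, ← toL2_add (by fun_prop) (by fun_prop),
        ← toL2_const_mul (by fun_prop), sub_eq_add_neg, ← neg_smul, ← toL2_const_mul cw,
        ← toL2_add (by fun_prop) (by fun_prop)]
    have key : (∫ q in P.cell, ((b₁₁ q * u q + b₁₂ q * w q) / lam - lam * u q) * P.uB j q)
          + (∫ q in P.cell, ((b₁₂ q * u q + b₂₂ q * w q) / lam - lam * w q) * P.wB j q)
        = inner ℝ F₁ (P.toL2 (P.uB j)) + inner ℝ F₂ (P.toL2 (P.wB j)) := by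
      rw [e1, e2, inner_toL2 (by fun_prop) (by fun_prop), inner_toL2 (by fun_prop) (by fun_prop)]
      congr 2 <;>
      · ext q; ring
    rw [key]
    cases j with
    | none =>
      rw [hweak, hN0, hPr]
      simp [e₀]
      ring
    | some j => exact hG j

end

end Params

end RotatingBoussinesq

/-! ### Fourier series in x: termwise calculus and Hölder continuity. -/

namespace RotatingBoussinesq

open Filter Topology MeasureTheory

/-- Termwise differentiation of a series on a convex set. -/
theorem hasDerivWithinAt_tsum {ι : Type*} {f f' : ι → ℝ → ℝ} {B : ι → ℝ} {I : Set ℝ}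
    (hI : Convex ℝ I) (hB : Summable B)
    (hd : ∀ i, ∀ z ∈ I, HasDerivWithinAt (f i) (f' i z) I z)
    (hf' : ∀ i, ∀ z ∈ I, |f' i z| ≤ B i) (hs : ∀ z ∈ I, Summable fun i => f i z) {z : ℝ}
    (hz : z ∈ I) : HasDerivWithinAt (fun z => ∑' i, f i z) (∑' i, f' i z) I z := by
  rw [hasDerivWithinAt_iff_tendsto_slope]
  have h1 : Tendsto (fun y => ∑' i, slope (f i) z y) (𝓝[I \ {z}] z) (𝓝 (∑' i, f' i z)) := by
    refine tendsto_tsum_of_dominated_convergence hB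
      (fun i => hasDerivWithinAt_iff_tendsto_slope.1 (hd i z hz)) ?_
    filter_upwards [self_mem_nhdsWithin] with y hy i
    have hne : 0 < |y - z| := abs_pos.2 (sub_ne_zero.2 hy.2)
    have := hI.norm_image_sub_le_of_norm_hasDerivWithin_le (hd i) (hf' i) hz hy.1
    rw [slope_def_field, norm_div, Real.norm_eq_abs, Real.norm_eq_abs, div_le_iff₀ hne]
    exact this
  refine h1.congr' ?_
  filter_upwards [self_mem_nhdsWithin] with y hy
  rw [slope_def_field, ← (hs y hy.1).tsum_sub (hs z hz), ← tsum_div_const]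
  simp only [slope_def_field]

/-- Termwise integration of a uniformly convergent series against a continuous function. -/
theorem hasSum_intervalIntegral_mul {ι : Type*} [Countable ι] {a b : ℝ} (hab : a ≤ b)
    {f : ι → ℝ → ℝ} {g : ℝ → ℝ} {B : ι → ℝ} (hB : Summable B)
    (hf : ∀ i, ContinuousOn (f i) (Icc a b)) (hfB : ∀ i, ∀ z ∈ Icc a b, |f i z| ≤ B i)
    (hg : ContinuousOn g (Icc a b)) :
    HasSum (fun i => ∫ z in a..b, f i z * g z) (∫ z in a..b, (∑' i, f i z) * g z) := by
  obtain ⟨C, hC⟩ := isCompact_Icc.exists_bound_of_continuousOn hg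
  have hsub : uIoc a b ⊆ Icc a b := by
    rw [uIoc_of_le hab]; exact Ioc_subset_Icc_self
  refine intervalIntegral.hasSum_integral_of_dominated_convergence (fun i _ => B i * C)
    (fun i => ?_) (fun i => ?_) ?_ ?_ ?_
  · exact (((hf i).mul hg).mono hsub).aestronglyMeasurable measurableSet_uIoc
  · refine .of_forall fun z hz => ?_
    rw [norm_mul]
    exact mul_le_mul (hfB i z (hsub hz)) (hC z (hsub hz)) (norm_nonneg _)
      ((abs_nonneg _).trans (hfB i z (hsub hz)))
  · exact Filter.Eventually.of_forall fun z _ => hB.mul_right C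
  · exact intervalIntegrable_const
  · refine .of_forall fun z hz => ?_
    exact (Summable.of_norm_bounded (f := fun i => f i z) hB fun i =>
      hfB i z (hsub hz)).hasSum.mul_right (g z)

namespace Params

noncomputable section

variable (P : Params)

/-- The function with Fourier coefficients `a k` in `x`. -/
def fs (a : ℤ → ℝ → ℝ) (q : ℝ × ℝ) : ℝ := ∑' k, a k q.2 * P.τ k q.1

/-- The Fourier coefficients of the `x`-derivative. -/
def fdx (a : ℤ → ℝ → ℝ) (k : ℤ) (z : ℝ) : ℝ := -(P.wx k * a (-k) z)

/-- The Fourier coefficients in `x`. -/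
def fc (f : ℝ × ℝ → ℝ) (k : ℤ) (z : ℝ) : ℝ := ∫ x in (0 : ℝ)..P.L, f (x, z) * P.τ k x

theorem summable_neg_iff {B : ℤ → ℝ} : Summable (fun k => B (-k)) ↔ Summable B :=
  (Equiv.neg ℤ).summable_iff

variable {P} {a b a' : ℤ → ℝ → ℝ} {B : ℤ → ℝ} {I : Set ℝ}

theorem abs_mul_τ_le (a : ℝ) (k : ℤ) (x : ℝ) : |a * P.τ k x| ≤ |a| * (2 / √P.L) := by
  rw [abs_mul]
  exact mul_le_mul_of_nonneg_left (P.abs_τ_le k x) (abs_nonneg _)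

theorem summable_fs {z : ℝ} (hB : Summable B) (ha : ∀ k, |a k z| ≤ B k) (x : ℝ) :
    Summable fun k => a k z * P.τ k x := by
  refine Summable.of_norm_bounded (hB.mul_right (2 / √P.L)) fun k => ?_
  exact (abs_mul_τ_le _ k x).trans (mul_le_mul_of_nonneg_right (ha k) (by positivity))

theorem fs_add {q : ℝ × ℝ} {B' : ℤ → ℝ} (hB : Summable B) (ha : ∀ k, |a k q.2| ≤ B k)
    (hB' : Summable B') (hb : ∀ k, |b k q.2| ≤ B' k) :
    P.fs (fun k z => a k z + b k z) q = P.fs a q + P.fs b q := by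
  simp only [fs, add_mul]
  exact (summable_fs hB ha q.1).tsum_add (summable_fs hB' hb q.1)

theorem fs_const_mul (c : ℝ) (q : ℝ × ℝ) : P.fs (fun k z => c * a k z) q = c * P.fs a q := by
  simp only [fs, mul_assoc, tsum_mul_left]

theorem fs_congr {q : ℝ × ℝ} (h : ∀ k, a k q.2 = b k q.2) : P.fs a q = P.fs b q := by
  simp only [fs, h]

theorem periodicX_fs (a : ℤ → ℝ → ℝ) : P.PeriodicX (P.fs a) := fun x z _ => by
  simp only [fs]
  congr 1
  ext k
  rw [P.τ_periodic]

theorem continuousOn_fs (hB : Summable B) (hc : ∀ k, ContinuousOn (a k) I)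
    (ha : ∀ k, ∀ z ∈ I, |a k z| ≤ B k) : ContinuousOn (P.fs a) (univ ×ˢ I) := by
  refine continuousOn_tsum (fun k => ?_) (hB.mul_right (2 / √P.L)) fun k q hq => ?_
  · refine ContinuousOn.mul ?_ (by fun_prop)
    exact (hc k).comp continuousOn_snd fun q hq => hq.2
  · exact (abs_mul_τ_le _ k q.1).trans (mul_le_mul_of_nonneg_right (ha k _ hq.2) (by positivity))

theorem abs_fdx_le {z : ℝ} (ha : ∀ k, P.wt k * |a k z| ≤ B k) (k : ℤ) : |P.fdx a k z| ≤ B (-k) := by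
  rw [fdx, abs_neg, abs_mul]
  calc _ ≤ P.wt (-k) * |a (-k) z| := by
        gcongr
        rw [wt_neg]; exact P.abs_wx_le_wt k
    _ ≤ _ := ha _

theorem wt_mul_abs_fdx_le {z : ℝ} (ha : ∀ k, P.wt k ^ 2 * |a k z| ≤ B k) (k : ℤ) :
    P.wt k * |P.fdx a k z| ≤ B (-k) := by
  have := abs_fdx_le (B := fun k => B k / P.wt k) (a := a) (z := z) (fun k => by
    rw [le_div_iff₀ (P.wt_pos k)]
    exact le_of_eq_of_le (by ring) (ha k)) k
  simp only [wt_neg] at this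
  rwa [le_div_iff₀ (P.wt_pos k), mul_comm] at this

theorem abs_le_of_wt_mul {z : ℝ} (ha : ∀ k, P.wt k * |a k z| ≤ B k) (k : ℤ) : |a k z| ≤ B k :=
  (le_mul_of_one_le_left (abs_nonneg _) (P.one_le_wt k)).trans (ha k)

theorem hasDerivAt_fs_fst {z : ℝ} (hB : Summable B) (ha : ∀ k, P.wt k * |a k z| ≤ B k) (x : ℝ) :
    HasDerivAt (fun x => P.fs a (x, z)) (P.fs (P.fdx a) (x, z)) x := by
  have h1 : HasDerivAt (fun x => P.fs a (x, z))
      (∑' k, a k z * (P.wx k * P.τ (-k) x)) x := by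
    refine hasDerivAt_tsum (hB.mul_right (2 / √P.L)) (fun k y => (P.hasDerivAt_τ k y).const_mul _)
      (fun k y => ?_) (y₀ := 0) (summable_fs hB (abs_le_of_wt_mul ha) 0) x
    rw [← mul_assoc]
    refine (abs_mul_τ_le _ (-k) y).trans (mul_le_mul_of_nonneg_right ?_ (by positivity))
    rw [abs_mul, mul_comm]
    exact (mul_le_mul_of_nonneg_right (P.abs_wx_le_wt k) (abs_nonneg _)).trans (ha k)
  refine h1.congr_deriv ?_
  -- The derivative of the k-th term is a multiple of the (-k)-th basis function, so the series is
  -- reindexed by reflection.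
  rw [fs, ← (Equiv.neg ℤ).tsum_eq]
  congr 1
  ext k
  simp only [Equiv.neg_apply, neg_neg, fdx, wx_neg]
  ring

theorem hasDerivWithinAt_fs_snd (hI : Convex ℝ I) (hB : Summable B)
    (hd : ∀ k, ∀ z ∈ I, HasDerivWithinAt (a k) (a' k z) I z)
    (ha : ∀ k, ∀ z ∈ I, |a k z| ≤ B k) (ha' : ∀ k, ∀ z ∈ I, |a' k z| ≤ B k) {q : ℝ × ℝ}
    (hq : q.2 ∈ I) : HasDerivWithinAt (fun z => P.fs a (q.1, z)) (P.fs a' q) I q.2 :=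
  hasDerivWithinAt_tsum hI (hB.mul_right (2 / √P.L))
    (fun k z hz => (hd k z hz).mul_const (P.τ k q.1))
    (fun k z hz => (abs_mul_τ_le _ k q.1).trans
      (mul_le_mul_of_nonneg_right (ha' k z hz) (by positivity)))
    (fun z hz => summable_fs hB (fun k => ha k z hz) q.1) hq

theorem contDiffOn_one_fs (hI : Convex ℝ I) (hIu : UniqueDiffOn ℝ I) (hB : Summable B)
    (hd : ∀ k, ∀ z ∈ I, HasDerivWithinAt (a k) (a' k z) I z)
    (hc : ∀ k, ContinuousOn (a' k) I)
    (ha : ∀ k, ∀ z ∈ I, P.wt k * |a k z| ≤ B k) (ha' : ∀ k, ∀ z ∈ I, |a' k z| ≤ B k) :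
    ContDiffOn ℝ 1 (P.fs a) (univ ×ˢ I) := by
  have h1 := contDiffOn_succ_of_partial (n := 0) hI hIu
    (f := P.fs a) (fx := P.fs (P.fdx a)) (fz := P.fs a')
    (fun q hq => hasDerivAt_fs_fst hB (fun k => ha k q.2 hq.2) q.1)
    (fun q hq => hasDerivWithinAt_fs_snd hI hB hd
      (fun k z hz => abs_le_of_wt_mul (fun k => ha k z hz) k) ha' hq.2)
    (by
      rw [Nat.cast_zero, contDiffOn_zero]
      refine continuousOn_fs (B := fun k => B (-k)) (summable_neg_iff.2 hB) (fun k => ?_)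
        fun k z hz => abs_fdx_le (fun k => ha k z hz) k
      have : ContinuousOn (a (-k)) I := fun z hz => (hd (-k) z hz).continuousWithinAt
      unfold fdx
      fun_prop)
    (by
      rw [Nat.cast_zero, contDiffOn_zero]
      exact continuousOn_fs hB hc ha')
  simpa using h1

theorem fc_fs {z : ℝ} (hB : Summable B) (ha : ∀ k, |a k z| ≤ B k) (k : ℤ) :
    P.fc (P.fs a) k z = a k z := by
  have h1 := hasSum_intervalIntegral_mul P.L_pos.le (f := fun l x => a l z * P.τ l x)
    (g := P.τ k) (hB.mul_right (2 / √P.L)) (fun l => by fun_prop)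
    (fun l x _ => (abs_mul_τ_le _ l x).trans (mul_le_mul_of_nonneg_right (ha l) (by positivity)))
    (by fun_prop)
  have h2 : (fun l => ∫ x in (0 : ℝ)..P.L, a l z * P.τ l x * P.τ k x)
      = fun l => if l = k then a k z else 0 := by
    ext l
    simp only [mul_assoc]
    rw [intervalIntegral.integral_const_mul, integral_τ_mul_τ]
    split_ifs with h
    · rw [h, mul_one]
    · rw [mul_zero]
  rw [h2] at h1
  exact h1.unique (hasSum_ite_eq k _)

/-- The difference of the two sides is continuous, periodic and has vanishing coefficients, so
completeness applies. -/
theorem fs_fc {f : ℝ × ℝ → ℝ} {z : ℝ} (hf : Continuous fun x => f (x, z))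
    (hp : Function.Periodic (fun x => f (x, z)) P.L) (hB : Summable B)
    (ha : ∀ k, |P.fc f k z| ≤ B k) (x : ℝ) : P.fs (P.fc f) (x, z) = f (x, z) := by
  have c1 : Continuous fun x => P.fs (P.fc f) (x, z) := by
    show Continuous fun x => ∑' k, P.fc f k z * P.τ k x
    refine continuous_tsum (fun k => by fun_prop) (hB.mul_right (2 / √P.L)) fun k y => ?_
    exact (abs_mul_τ_le _ k y).trans (mul_le_mul_of_nonneg_right (ha k) (by positivity))
  have hper : Function.Periodic (fun x => P.fs (P.fc f) (x, z) - f (x, z)) P.L := by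
    intro y
    have e1 : P.fs (P.fc f) (y + P.L, z) = P.fs (P.fc f) (y, z) := by
      simp only [fs]; congr 1; ext k; rw [P.τ_periodic]
    have e2 : f (y + P.L, z) = f (y, z) := hp y
    simp only [e1, e2]
  have key := P.eq_zero_of_τ_coeff (c1.sub hf) hper (by
    intro k
    have h1 := fc_fs (P := P) (a := P.fc f) hB ha k
    simp only [Pi.sub_apply, sub_mul]
    have i1 : Continuous fun x => P.fs (P.fc f) (x, z) * P.τ k x := c1.mul (P.continuous_τ k)
    have i2 : Continuous fun x => f (x, z) * P.τ k x := hf.mul (P.continuous_τ k)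
    rw [intervalIntegral.integral_sub (i1.intervalIntegrable _ _) (i2.intervalIntegrable _ _)]
    exact sub_eq_zero.2 h1) x
  exact sub_eq_zero.1 key

/-- Integration by parts for Fourier coefficients. -/
theorem fc_dx {f f' : ℝ × ℝ → ℝ} {z : ℝ} (hd : ∀ x, HasDerivAt (fun x => f (x, z)) (f' (x, z)) x)
    (hc : Continuous fun x => f' (x, z)) (hp : f (P.L, z) = f (0, z)) (k : ℤ) :
    P.fc f' k z = P.fdx (P.fc f) k z := by
  have cf : Continuous fun x => f (x, z) := continuous_iff_continuousAt.2 fun x => (hd x).continuousAt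
  have c1 : Continuous fun x => f' (x, z) * P.τ k x := hc.mul (P.continuous_τ k)
  have c2 : Continuous fun x => f (x, z) * (P.wx k * P.τ (-k) x) :=
    cf.mul (continuous_const.mul (P.continuous_τ _))
  have h1 := integral_deriv_periodic (l := P.L) (f := fun x => f (x, z) * P.τ k x)
    (f' := fun x => f' (x, z) * P.τ k x + f (x, z) * (P.wx k * P.τ (-k) x))
    (fun x => (hd x).mul (P.hasDerivAt_τ k x)) (c1.add c2) (by
      have := P.τ_periodic k 0
      rw [zero_add] at this
      rw [hp, this])
  rw [intervalIntegral.integral_add (c1.intervalIntegrable _ _) (c2.intervalIntegrable _ _)] at h1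
  have h2 : ∫ x in (0 : ℝ)..P.L, f (x, z) * (P.wx k * P.τ (-k) x) = P.wx k * P.fc f (-k) z := by
    rw [fc, ← intervalIntegral.integral_const_mul]
    congr 1; ext x; ring
  rw [h2] at h1
  rw [fdx]
  unfold fc at *
  linarith

theorem abs_fc_le {f : ℝ × ℝ → ℝ} {z C : ℝ} (hC : ∀ x, |f (x, z)| ≤ C) (k : ℤ) :
    |P.fc f k z| ≤ 2 * √P.L * C := by
  have hL := P.L_pos
  have h1 := intervalIntegral.norm_integral_le_of_norm_le_const (a := 0) (b := P.L)
    (f := fun x => f (x, z) * P.τ k x) (C := C * (2 / √P.L)) fun x _ => by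
      rw [norm_mul]
      exact mul_le_mul (hC x) (P.abs_τ_le k x) (abs_nonneg _) ((abs_nonneg _).trans (hC x))
  rw [fc]
  refine h1.trans_eq ?_
  have : √P.L * √P.L = P.L := Real.mul_self_sqrt hL.le
  have hs : √P.L ≠ 0 := (Real.sqrt_pos.2 hL).ne'
  rw [sub_zero, abs_of_pos hL]
  nth_rewrite 2 [← this]
  field_simp

/-- Bounded functions that are Hölder continuous in `x` with exponent `1/4`, for `z ∈ I`. -/
def HolderX (f : ℝ × ℝ → ℝ) (I : Set ℝ) : Prop :=
  ∃ C : ℝ, 0 ≤ C ∧ ∀ z ∈ I, (∀ x, |f (x, z)| ≤ C) ∧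
    ∀ x y, |f (x, z) - f (y, z)| ≤ C * |x - y| ^ (1 / 4 : ℝ)

theorem HolderX.add {f g : ℝ × ℝ → ℝ} (hf : HolderX f I) (hg : HolderX g I) :
    HolderX (fun q => f q + g q) I := by
  obtain ⟨C, hC, h⟩ := hf
  obtain ⟨D, hD, h'⟩ := hg
  refine ⟨C + D, add_nonneg hC hD, fun z hz => ⟨fun x => ?_, fun x y => ?_⟩⟩
  · exact (abs_add_le _ _).trans (add_le_add ((h z hz).1 x) ((h' z hz).1 x))
  · rw [add_sub_add_comm, add_mul]
    exact (abs_add_le _ _).trans (add_le_add ((h z hz).2 x y) ((h' z hz).2 x y))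

theorem HolderX.mul {f g : ℝ × ℝ → ℝ} (hf : HolderX f I) (hg : HolderX g I) :
    HolderX (fun q => f q * g q) I := by
  obtain ⟨C, hC, h⟩ := hf
  obtain ⟨D, hD, h'⟩ := hg
  refine ⟨C * D + C * D, by positivity, fun z hz => ⟨fun x => ?_, fun x y => ?_⟩⟩
  · rw [abs_mul]
    have := mul_le_mul ((h z hz).1 x) ((h' z hz).1 x) (abs_nonneg _) hC
    have : 0 ≤ C * D := by positivity
    linarith
  · have e : f (x, z) * g (x, z) - f (y, z) * g (y, z)
        = f (x, z) * (g (x, z) - g (y, z)) + (f (x, z) - f (y, z)) * g (y, z) := by ring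
    rw [e]
    have hr : 0 ≤ |x - y| ^ (1 / 4 : ℝ) := by positivity
    refine (abs_add_le _ _).trans ?_
    rw [abs_mul, abs_mul, add_mul]
    refine add_le_add ?_ ?_
    · rw [mul_assoc]
      exact mul_le_mul ((h z hz).1 x) ((h' z hz).2 x y) (abs_nonneg _) hC
    · rw [mul_right_comm]
      exact mul_le_mul ((h z hz).2 x y) ((h' z hz).1 y) (abs_nonneg _) (by positivity)

theorem holderX_const (c : ℝ) : HolderX (fun _ => c) I :=
  ⟨|c|, abs_nonneg c, fun z _ => ⟨fun _ => le_rfl, fun x y => by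
    rw [sub_self, abs_zero]; positivity⟩⟩

theorem HolderX.const_mul {f : ℝ × ℝ → ℝ} (hf : HolderX f I) (c : ℝ) :
    HolderX (fun q => c * f q) I := (holderX_const c).mul hf

theorem HolderX.sub {f g : ℝ × ℝ → ℝ} (hf : HolderX f I) (hg : HolderX g I) :
    HolderX (fun q => f q - g q) I := by
  have := hf.add (hg.const_mul (-1))
  simpa [sub_eq_add_neg] using this

/-- This interpolates between boundedness and a Lipschitz bound; with it the Hölder estimates hold
for all pairs of points, not only nearby ones. -/
theorem min_one_le_rpow {t : ℝ} (ht : 0 ≤ t) : min 1 t ≤ t ^ (1 / 4 : ℝ) := by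
  rcases le_total t 1 with h | h
  · rw [min_eq_right h]
    rcases ht.eq_or_lt with rfl | h0
    · positivity
    · exact Real.self_le_rpow_of_le_one ht h (by norm_num)
  · rw [min_eq_left h]
    exact Real.one_le_rpow h (by norm_num)

theorem holderX_of_lipschitz {f f' : ℝ × ℝ → ℝ} {C D : ℝ} (hC : 0 ≤ C) (hD : 0 ≤ D)
    (hf : ∀ z ∈ I, ∀ x, |f (x, z)| ≤ C)
    (hd : ∀ z ∈ I, ∀ x, HasDerivAt (fun x => f (x, z)) (f' (x, z)) x)
    (hf' : ∀ z ∈ I, ∀ x, |f' (x, z)| ≤ D) : HolderX f I := by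
  refine ⟨2 * C + D, by positivity, fun z hz => ⟨fun x => ?_, fun x y => ?_⟩⟩
  · linarith [hf z hz x]
  · have h1 : |f (x, z) - f (y, z)| ≤ D * |x - y| :=
      convex_univ.norm_image_sub_le_of_norm_hasDerivWithin_le
        (fun x _ => (hd z hz x).hasDerivWithinAt) (fun x _ => hf' z hz x) (mem_univ y) (mem_univ x)
    have h2 : |f (x, z) - f (y, z)| ≤ 2 * C := by
      refine (abs_sub _ _).trans ?_
      linarith [hf z hz x, hf z hz y]
    have h3 := min_one_le_rpow (abs_nonneg (x - y))
    refine le_trans ?_ (mul_le_mul_of_nonneg_left h3 (by positivity))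
    rcases le_total 1 |x - y| with h | h
    · rw [min_eq_left h]; linarith
    · rw [min_eq_right h]; nlinarith [abs_nonneg (x - y)]

theorem abs_τ_sub_le (k : ℤ) (x y : ℝ) :
    |P.τ k x - P.τ k y| ≤ 6 / √P.L * (P.wt k ^ (1 / 4 : ℝ) * |x - y| ^ (1 / 4 : ℝ)) := by
  have hs : 0 < √P.L := Real.sqrt_pos.2 P.L_pos
  have h1 : |P.τ k x - P.τ k y| ≤ (P.wt k * (2 / √P.L)) * |x - y| := by
    refine convex_univ.norm_image_sub_le_of_norm_hasDerivWithin_le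
        (fun x _ => (P.hasDerivAt_τ k x).hasDerivWithinAt) (fun x _ => ?_) (mem_univ y) (mem_univ x)
    rw [norm_mul]
    exact mul_le_mul (P.abs_wx_le_wt k) (P.abs_τ_le _ _) (abs_nonneg _) (P.wt_pos k).le
  have h2 : |P.τ k x - P.τ k y| ≤ 4 / √P.L := by
    refine (abs_sub _ _).trans ?_
    have := P.abs_τ_le k x
    have := P.abs_τ_le k y
    have e : 4 / √P.L = 2 / √P.L + 2 / √P.L := by ring
    linarith
  have hw := P.wt_pos k
  rw [← Real.mul_rpow hw.le (abs_nonneg _)]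
  have h3 := min_one_le_rpow (mul_nonneg hw.le (abs_nonneg (x - y)))
  refine le_trans ?_ (mul_le_mul_of_nonneg_left h3 (by positivity))
  rcases le_total 1 (P.wt k * |x - y|) with h | h
  · rw [min_eq_left h, mul_one]
    exact h2.trans (by gcongr; norm_num)
  · rw [min_eq_right h]
    refine h1.trans ?_
    have : P.wt k * (2 / √P.L) * |x - y| = 2 / √P.L * (P.wt k * |x - y|) := by ring
    rw [this]
    gcongr
    norm_num

/-- The Hölder seminorm of the k-th basis function is of order wt^{1/4}, so this weighted
summability is exactly what termwise estimation needs. -/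
theorem holderX_fs (hB : Summable fun k => P.wt k ^ (1 / 4 : ℝ) * B k)
    (ha : ∀ k, ∀ z ∈ I, |a k z| ≤ B k) : HolderX (P.fs a) I := by
  by_cases hI : ∃ z, z ∈ I
  swap
  · exact ⟨0, le_rfl, fun z hz => absurd ⟨z, hz⟩ hI⟩
  obtain ⟨z₀, hz₀⟩ := hI
  have hB0 : ∀ k, 0 ≤ B k := fun k => (abs_nonneg _).trans (ha k z₀ hz₀)
  have hw1 : ∀ k, 1 ≤ P.wt k ^ (1 / 4 : ℝ) := fun k => Real.one_le_rpow (P.one_le_wt k) (by norm_num)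
  have hle : ∀ k, B k ≤ P.wt k ^ (1 / 4 : ℝ) * B k := fun k => le_mul_of_one_le_left (hB0 k) (hw1 k)
  have hsB : Summable B := Summable.of_nonneg_of_le hB0 hle hB
  set S := ∑' k, P.wt k ^ (1 / 4 : ℝ) * B k with hS
  have hS0 : 0 ≤ S := tsum_nonneg fun k => (hB0 k).trans (hle k)
  refine ⟨6 / √P.L * S, by positivity, fun z hz => ⟨fun x => ?_, fun x y => ?_⟩⟩
  · rw [fs, ← Real.norm_eq_abs]
    refine (tsum_of_norm_bounded (hB.hasSum.mul_left (6 / √P.L)) fun k => ?_)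
    refine (abs_mul_τ_le _ k x).trans ?_
    rw [mul_comm]
    gcongr
    · norm_num
    · exact (ha k z hz).trans (hle k)
  · have hs1 := summable_fs (P := P) hsB (fun k => ha k z hz) x
    have hs2 := summable_fs (P := P) hsB (fun k => ha k z hz) y
    simp only [fs]
    rw [← hs1.tsum_sub hs2, ← Real.norm_eq_abs]
    have := (hB.hasSum.mul_left (6 / √P.L)).mul_right (|x - y| ^ (1 / 4 : ℝ))
    refine tsum_of_norm_bounded this fun k => ?_
    rw [← mul_sub, norm_mul]
    calc _ ≤ B k * (6 / √P.L * (P.wt k ^ (1 / 4 : ℝ) * |x - y| ^ (1 / 4 : ℝ))) :=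
          mul_le_mul (ha k z hz) (abs_τ_sub_le k x y) (abs_nonneg _) (hB0 k)
      _ = _ := by ring

/-- The Fourier coefficients of a Hölder continuous function decay. -/
theorem HolderX.exists_fc_le {f : ℝ × ℝ → ℝ} (hf : HolderX f I)
    (hc : ∀ z ∈ I, Continuous fun x => f (x, z))
    (hp : ∀ z ∈ I, Function.Periodic (fun x => f (x, z)) P.L) :
    ∃ C : ℝ, 0 ≤ C ∧ ∀ k, ∀ z ∈ I, |P.fc f k z| ≤ C * P.wt k ^ (-(1 / 4) : ℝ) := by
  obtain ⟨C, hC, h⟩ := hf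
  have hL := P.L_pos
  have ha := P.wx_one_pos
  set D := (1 + 1 / P.wx 1) * Real.pi with hD
  have hD0 : 0 < D := by have := Real.pi_pos; positivity
  refine ⟨2 * √P.L * (C + C * D ^ (1 / 4 : ℝ)), by positivity, fun k z hz => ?_⟩
  by_cases hk : k = 0
  · subst hk
    have hw : P.wt 0 = 1 := by simp [wt, wx_zero]
    rw [hw, Real.one_rpow, mul_one]
    refine (abs_fc_le (h z hz).1 0).trans ?_
    gcongr
    have : 0 ≤ C * D ^ (1 / 4 : ℝ) := by positivity
    linarith
  -- A shift by s reverses the sign of the basis function, so twice the coefficient of f is the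
  -- coefficient of f(x) - f(x+s), which is of order |s|^{1/4}.
  · set s := Real.pi / P.wx k with hs
    have hcz := hc z hz
    have hpk : Function.Periodic (fun x => f (x, z) * P.τ k x) P.L := fun x => by
      have e1 : f (x + P.L, z) = f (x, z) := hp z hz x
      simp only [e1, P.τ_periodic k x]
    have e1 : P.fc f k z = - P.fc (fun q => f (q.1 + s, q.2)) k z := by
      have h1 := hpk.intervalIntegral_add_eq s 0
      have h2 := intervalIntegral.integral_comp_add_right (a := 0) (b := P.L)
        (fun x => f (x, z) * P.τ k x) s
      rw [zero_add, add_comm P.L s, h1] at h2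
      simp only [hs, P.τ_half_period hk, mul_neg, intervalIntegral.integral_neg, zero_add] at h2
      simp only [fc, hs]
      linarith
    have e2 : P.fc (fun q => f q - f (q.1 + s, q.2)) k z = 2 * P.fc f k z := by
      have : P.fc (fun q => f q - f (q.1 + s, q.2)) k z
          = P.fc f k z - P.fc (fun q => f (q.1 + s, q.2)) k z := by
        simp only [fc, sub_mul]
        refine intervalIntegral.integral_sub
          ((hcz.mul (P.continuous_τ k)).intervalIntegrable _ _) ?_
        exact ((hcz.comp (by fun_prop : Continuous fun x => x + s)).mul
          (P.continuous_τ k)).intervalIntegrable _ _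
      rw [this]; linarith
    have hwx := P.abs_wx_ge hk
    have hwk := P.wt_pos k
    have hsD : |s| ≤ D * P.wt k ^ (-1 : ℝ) := by
      rw [hs, abs_div, abs_of_pos Real.pi_pos, Real.rpow_neg_one, ← div_eq_mul_inv,
        div_le_div_iff₀ (ha.trans_le hwx) hwk, hD]
      have h3 : P.wt k ≤ (1 + 1 / P.wx 1) * |P.wx k| := by
        rw [wt, add_mul, one_mul, add_comm]
        gcongr
        rw [one_div_mul_eq_div, one_le_div ha]; exact hwx
      nlinarith [Real.pi_pos]
    have h4 : ∀ x, |f (x, z) - f (x + s, z)| ≤ C * (D ^ (1 / 4 : ℝ) * P.wt k ^ (-(1 / 4) : ℝ)) := by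
      intro x
      refine ((h z hz).2 x (x + s)).trans ?_
      gcongr
      calc |x - (x + s)| ^ (1 / 4 : ℝ) = |s| ^ (1 / 4 : ℝ) := by
            rw [sub_add_cancel_left, abs_neg]
        _ ≤ (D * P.wt k ^ (-1 : ℝ)) ^ (1 / 4 : ℝ) := by gcongr
        _ = _ := by
          rw [Real.mul_rpow hD0.le (by positivity), ← Real.rpow_mul hwk.le]
          norm_num
    have h5 := abs_fc_le (P := P) (f := fun q => f q - f (q.1 + s, q.2)) h4 k
    rw [e2, abs_mul, abs_two] at h5
    have h6 : 0 ≤ 2 * √P.L * C * P.wt k ^ (-(1 / 4) : ℝ) := by positivity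
    nlinarith [abs_nonneg (P.fc f k z)]

end

end Params

end RotatingBoussinesq

/-! ### Summability of a weak mode and its expansion in vorticity and stream function. -/

namespace RotatingBoussinesq

open Filter Topology MeasureTheory

namespace Params

noncomputable section

variable (P : Params)

theorem wz_zero_le (n : ℕ) : P.wz 0 ≤ P.wz n := by
  have := P.h_pos
  have := Real.pi_pos
  unfold wz
  gcongr
  exact_mod_cast Nat.zero_le n

theorem wt_mul_wz_div_ev_le (n : ℕ) (k : ℤ) :
    P.wt k * (P.wz n / P.ev n k) ≤ 1 / P.wz 0 + 1 := by
  have h0 := P.wz_pos 0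
  have hn := P.wz_pos n
  have he := P.ev_pos n k
  have h1 : P.wz n / P.ev n k ≤ 1 / P.wz 0 := by
    rw [div_le_div_iff₀ he h0, ev]
    nlinarith [P.wz_zero_le n, sq_nonneg (P.wx k)]
  have h2 : |P.wx k| * (P.wz n / P.ev n k) ≤ 1 := by
    rw [mul_div_assoc', div_le_one he, ev, ← sq_abs (P.wx k)]
    nlinarith [sq_nonneg (P.wz n - |P.wx k|), abs_nonneg (P.wx k)]
  rw [wt, add_mul, one_mul]
  exact add_le_add h1 h2

theorem wz_div_ev_le (n : ℕ) (k : ℤ) : P.wz n / P.ev n k ≤ 1 / P.wz 0 + 1 := by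
  have hn := P.wz_pos n
  have he := P.ev_pos n k
  exact (le_mul_of_one_le_left (by positivity) (P.one_le_wt k)).trans (P.wt_mul_wz_div_ev_le n k)

theorem abs_wx_div_ev_le_const (n : ℕ) (k : ℤ) : |P.wx k| / P.ev n k ≤ 1 / P.wz 0 := by
  have h0 := P.wz_pos 0
  have hn := P.wz_pos n
  have he := P.ev_pos n k
  rw [div_le_div_iff₀ he h0, ev, ← sq_abs (P.wx k)]
  nlinarith [P.wz_zero_le n, sq_nonneg (P.wz n - |P.wx k|), abs_nonneg (P.wx k)]

/-- The numerator is at most ev, and ev ≥ wz²; the bound does not depend on k, so the sum over k is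
left to the traces. -/
theorem wz_mul_div_ev_sq_le (n : ℕ) (k : ℤ) :
    P.wz n * max (P.wz n) |P.wx k| / P.ev n k ^ 2 ≤ (P.h / Real.pi) ^ 2 * ((n : ℝ) + 1)⁻¹ ^ 2 := by
  have hh := P.h_pos
  have hpi := Real.pi_pos
  have hn := P.wz_pos n
  have he := P.ev_pos n k
  have h1 : P.wz n * max (P.wz n) |P.wx k| ≤ P.ev n k := by
    rw [ev, ← sq_abs (P.wx k)]
    rcases max_cases (P.wz n) |P.wx k| with h | h <;> rw [h.1] <;>
      nlinarith [sq_nonneg (P.wz n - |P.wx k|), sq_nonneg (P.wx k), abs_nonneg (P.wx k)]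
  have h2 : P.wz n ^ 2 ≤ P.ev n k := by
    rw [ev]; nlinarith [sq_nonneg (P.wx k)]
  calc _ ≤ P.ev n k / P.ev n k ^ 2 := by gcongr
    _ = 1 / P.ev n k := by field_simp
    _ ≤ 1 / P.wz n ^ 2 := by gcongr
    _ = _ := by unfold wz; field_simp

/-- The coefficient form of the variational problem. -/
structure IsWeakMode (c : Option (ℕ × ℤ) → ℝ) (e : ℤ → ℝ) (G : ℕ × ℤ → ℝ) : Prop where
  summable_sq : Summable fun j => G j ^ 2
  trace : ∀ k, HasSum (fun n => √(2 / P.h) * (P.wz n / P.ev n k) * c (some (n, k)))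
    (e k - if k = 0 then c none / √P.h else 0)
  eqn : ∀ n k, P.ν * c (some (n, k)) + P.ν * P.α * e k * (√(2 / P.h) * (P.wz n / P.ev n k))
    = G (n, k) / P.ev n k

namespace IsWeakMode

variable {P} {c : Option (ℕ × ℤ) → ℝ} {e : ℤ → ℝ} {G : ℕ × ℤ → ℝ}

theorem coeff_eq (hw : P.IsWeakMode c e G) (n : ℕ) (k : ℤ) : c (some (n, k)) = G (n, k) / (P.ν * P.ev n k)
    - P.α * √(2 / P.h) * e k * (P.wz n / P.ev n k) := by
  have hν := P.ν_pos
  have he := P.ev_pos n k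
  have := hw.eqn n k
  field_simp
  field_simp at this
  linarith

/-- Each term is a product of |G|, square summable, with a multiple of wt^{1/4}/ev. The square of
the latter is wt^{1/2}/ev², and ∑ wt^r/ev² converges for r < 1; this leaves room for the Hölder
exponent 1/4. -/
theorem summable_weighted (hw : P.IsWeakMode c e G) :
    Summable fun j : ℕ × ℤ => P.wt j.2 ^ (1 / 4 : ℝ) * |G j / (P.ν * P.ev j.1 j.2)| := by
  have hν := P.ν_pos
  have h1 := (P.summable_wt_div_ev_sq (r := 1 / 2) (by norm_num)).mul_left (1 / P.ν ^ 2)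
  refine Summable.of_nonneg_of_le (fun j => ?_) (fun j => ?_) (hw.summable_sq.add h1)
  · have := P.wt_pos j.2
    positivity
  · have hwt := P.wt_pos j.2
    have he := P.ev_pos j.1 j.2
    have e1 : P.wt j.2 ^ (1 / 2 : ℝ) = (P.wt j.2 ^ (1 / 4 : ℝ)) ^ 2 := by
      rw [← Real.rpow_natCast, ← Real.rpow_mul hwt.le]; norm_num
    have hp : 0 < P.wt j.2 ^ (1 / 4 : ℝ) := by positivity
    rw [e1, abs_div, abs_of_pos (by positivity : 0 < P.ν * P.ev j.1 j.2)]
    set t := P.wt j.2 ^ (1 / 4 : ℝ) / (P.ν * P.ev j.1 j.2) with ht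
    have e2 : P.wt j.2 ^ (1 / 4 : ℝ) * (|G j| / (P.ν * P.ev j.1 j.2)) = |G j| * t := by
      rw [ht]; field_simp
    have e3 : 1 / P.ν ^ 2 * ((P.wt j.2 ^ (1 / 4 : ℝ)) ^ 2 / P.ev j.1 j.2 ^ 2) = t ^ 2 := by
      rw [ht]; field_simp
    rw [e2, e3, ← sq_abs (G j)]
    nlinarith [sq_nonneg (|G j| - t), sq_nonneg |G j|, sq_nonneg t]

theorem summable_abs (hw : P.IsWeakMode c e G) : Summable fun j : ℕ × ℤ => |G j / (P.ν * P.ev j.1 j.2)| :=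
  Summable.of_nonneg_of_le (fun _ => abs_nonneg _) (fun j => le_mul_of_one_le_left (abs_nonneg _)
    (Real.one_le_rpow (P.one_le_wt j.2) (by norm_num))) hw.summable_weighted

theorem summable_fiber (hw : P.IsWeakMode c e G) (k : ℤ) : Summable fun n : ℕ => |G (n, k) / (P.ν * P.ev n k)| :=
  hw.summable_abs.comp_injective (i := fun n : ℕ => (n, k)) fun n m h => by simpa using h

theorem summable_tsum (hw : P.IsWeakMode c e G) : Summable fun k : ℤ =>
    P.wt k ^ (1 / 4 : ℝ) * ∑' n : ℕ, |G (n, k) / (P.ν * P.ev n k)| := by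
  have h1 := hw.summable_weighted.prod_symm.prod
  simpa only [Prod.fst_swap, Prod.snd_swap, Prod.swap_prod_mk, tsum_mul_left] using h1

/-- Inserting the formula for the coefficients into the trace gives an equation for e k alone.
Friction has the good sign, so it only enlarges the factor of e k, and the source gains one power of
wt from the multiplier wz/ev. -/
theorem summable_wt_mul_trace (hw : P.IsWeakMode c e G) : Summable fun k => P.wt k * |e k| := by
  obtain ⟨D, hD, hsum⟩ := P.exists_sum_wz_div_ev_sq
  have hα := P.α_pos
  have hh := P.h_pos
  have h00 := P.wz_pos 0
  set s₀ := √(2 / P.h) with hs₀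
  have hs0 : 0 < s₀ := by positivity
  set C := s₀ * (1 / P.wz 0 + 1) with hC
  have hC0 : 0 ≤ C := by positivity
  have h1 : Summable fun k : ℤ => C * ∑' n : ℕ, |G (n, k) / (P.ν * P.ev n k)| := by
    refine Summable.mul_left _ (Summable.of_nonneg_of_le (fun k => tsum_nonneg fun n => abs_nonneg _)
      (fun k => le_mul_of_one_le_left (tsum_nonneg fun n => abs_nonneg _)
        (Real.one_le_rpow (P.one_le_wt k) (by norm_num))) hw.summable_tsum)
  have h2 : Summable fun k : ℤ => if k = 0 then |c none / √P.h| else 0 :=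
    summable_of_hasFiniteSupport ((finite_singleton (0 : ℤ)).subset fun k hk => by
      by_contra h; simp_all)
  refine Summable.of_nonneg_of_le (fun k => mul_nonneg (P.wt_pos k).le (abs_nonneg _)) (fun k => ?_)
    (h1.add h2)
  have hwt := P.wt_pos k
  have hr := hw.summable_fiber k
  set R := ∑' n : ℕ, |G (n, k) / (P.ν * P.ev n k)| with hR
  have hR0 : 0 ≤ R := tsum_nonneg fun n => abs_nonneg _
  have hle : ∀ n : ℕ, |s₀ * (P.wz n / P.ev n k) * (G (n, k) / (P.ν * P.ev n k))|
      ≤ C / P.wt k * |G (n, k) / (P.ν * P.ev n k)| := by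
    intro n
    have hn := P.wz_pos n
    have he := P.ev_pos n k
    rw [abs_mul, abs_of_pos (by positivity : 0 < s₀ * (P.wz n / P.ev n k))]
    gcongr
    rw [le_div_iff₀ hwt, hC, mul_assoc, mul_comm _ (P.wt k)]
    gcongr
    exact P.wt_mul_wz_div_ev_le n k
  have hX := Summable.of_norm_bounded
    (f := fun n : ℕ => s₀ * (P.wz n / P.ev n k) * (G (n, k) / (P.ν * P.ev n k)))
    (hr.mul_left (C / P.wt k)) hle
  have hXle : |∑' n : ℕ, s₀ * (P.wz n / P.ev n k) * (G (n, k) / (P.ν * P.ev n k))|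
      ≤ C / P.wt k * R := by
    rw [← Real.norm_eq_abs]
    exact tsum_of_norm_bounded (hr.hasSum.mul_left (C / P.wt k)) hle
  set X := ∑' n : ℕ, s₀ * (P.wz n / P.ev n k) * (G (n, k) / (P.ν * P.ev n k)) with hXdef
  set S := ∑' n : ℕ, (P.wz n / P.ev n k) ^ 2 with hS
  have hS0 : 0 ≤ S := tsum_nonneg fun n => sq_nonneg _
  set d := (if k = 0 then c none / √P.h else 0) with hd
  -- Hence e k (1 + α s₀² S) = X + d with a factor at least 1.
  have key : e k - d = X - P.α * s₀ ^ 2 * e k * S := by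
    refine (hw.trace k).unique ?_
    have := hX.hasSum.sub ((hsum k).1.hasSum.mul_left (P.α * s₀ ^ 2 * e k))
    refine this.congr_fun fun n : ℕ => ?_
    rw [hw.coeff_eq n k]
    ring
  have hek : |e k| ≤ |X| + |d| := by
    have h3 : e k * (1 + P.α * s₀ ^ 2 * S) = X + d := by linarith
    have h4 : |e k| * (1 + P.α * s₀ ^ 2 * S) ≤ |X| + |d| := by
      have h5 : 0 ≤ P.α * s₀ ^ 2 * S := by positivity
      rw [← abs_of_nonneg (by linarith : 0 ≤ 1 + P.α * s₀ ^ 2 * S), ← abs_mul, h3]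
      exact abs_add_le _ _
    refine le_trans (le_mul_of_one_le_right (abs_nonneg _) ?_) h4
    have : 0 ≤ P.α * s₀ ^ 2 * S := by positivity
    linarith
  have hd' : P.wt k * |d| = if k = 0 then |c none / √P.h| else 0 := by
    rw [hd]
    split_ifs with h0
    · subst h0
      simp [wt, wx_zero]
    · simp
  calc P.wt k * |e k| ≤ P.wt k * (C / P.wt k * R + |d|) := by
        gcongr
        linarith
    _ = C * R + P.wt k * |d| := by field_simp
    _ = _ := by rw [hd']

/-- The maximum dominates the multipliers of both velocity components, so the expansions of u and w
in the basis fields converge absolutely and uniformly. -/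
theorem summable_coeff_mul (hw : P.IsWeakMode c e G) : Summable fun j : ℕ × ℤ =>
    |c (some j)| * (max (P.wz j.1) |P.wx j.2| / P.ev j.1 j.2) := by
  have hα := P.α_pos
  have hh := P.h_pos
  have h00 := P.wz_pos 0
  have h1 := hw.summable_abs.mul_left (1 / P.wz 0 + 1)
  have he : Summable fun k => |e k| := Summable.of_nonneg_of_le (fun _ => abs_nonneg _)
    (fun k => le_mul_of_one_le_left (abs_nonneg _) (P.one_le_wt k)) hw.summable_wt_mul_trace
  have h2 := (((summable_inv_nat_sq.mul_left ((P.h / Real.pi) ^ 2)).mul_of_nonneg he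
    (fun n => by positivity) (fun k => abs_nonneg _))).mul_left (P.α * √(2 / P.h))
  refine Summable.of_nonneg_of_le (fun j => ?_) (fun j => ?_) (h1.add h2)
  · have := P.ev_pos j.1 j.2
    have := P.wz_pos j.1
    positivity
  · obtain ⟨n, k⟩ := j
    have hev := P.ev_pos n k
    have hn := P.wz_pos n
    simp only
    have hm : max (P.wz n) |P.wx k| / P.ev n k ≤ 1 / P.wz 0 + 1 := by
      rcases max_cases (P.wz n) |P.wx k| with h | h <;> rw [h.1]
      · exact P.wz_div_ev_le n k
      · exact (P.abs_wx_div_ev_le_const n k).trans (by linarith)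
    have hm0 : 0 ≤ max (P.wz n) |P.wx k| / P.ev n k := by positivity
    rw [hw.coeff_eq n k]
    calc _ ≤ (|G (n, k) / (P.ν * P.ev n k)| + |P.α * √(2 / P.h) * e k * (P.wz n / P.ev n k)|)
          * (max (P.wz n) |P.wx k| / P.ev n k) := by
          gcongr; exact abs_sub _ _
      _ = |G (n, k) / (P.ν * P.ev n k)| * (max (P.wz n) |P.wx k| / P.ev n k)
          + P.α * √(2 / P.h) * (P.wz n * max (P.wz n) |P.wx k| / P.ev n k ^ 2 * |e k|) := by
          rw [abs_mul, abs_mul, abs_of_pos (by positivity : 0 < P.α * √(2 / P.h)),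
            abs_of_pos (by positivity : 0 < P.wz n / P.ev n k)]
          field_simp
      _ ≤ |G (n, k) / (P.ν * P.ev n k)| * (1 / P.wz 0 + 1)
          + P.α * √(2 / P.h) * ((P.h / Real.pi) ^ 2 * ((n : ℝ) + 1)⁻¹ ^ 2 * |e k|) := by
          gcongr
          exact P.wz_mul_div_ev_sq_le n k
      _ = _ := by ring

end IsWeakMode

/-- Sine series are determined by, and determine, their coefficients. -/
theorem integral_tsum_mul_sn {r : ℕ → ℝ} (hr : Summable fun n => |r n|) (m : ℕ) :
    ∫ z in (0 : ℝ)..P.h, (∑' n, r n * P.sn n z) * P.sn m z = r m := by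
  have h1 := hasSum_intervalIntegral_mul P.h_pos.le (f := fun n z => r n * P.sn n z)
    (g := P.sn m) (hr.mul_right √(2 / P.h)) (fun n => by fun_prop)
    (fun n z _ => by
      rw [abs_mul]
      exact mul_le_mul_of_nonneg_left (P.abs_sn_le n z) (abs_nonneg _))
    (by fun_prop)
  have h2 : (fun n => ∫ z in (0 : ℝ)..P.h, r n * P.sn n z * P.sn m z)
      = fun n => if n = m then r m else 0 := by
    ext n
    simp only [mul_assoc]
    rw [intervalIntegral.integral_const_mul, integral_sn_mul_sn]
    split_ifs with h
    · rw [h, mul_one]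
    · rw [mul_zero]
  rw [h2] at h1
  exact h1.unique (hasSum_ite_eq m _)

theorem summable_mul_sn {r : ℕ → ℝ} (hr : Summable fun n => |r n|) (z : ℝ) :
    Summable fun n => r n * P.sn n z := by
  refine Summable.of_norm_bounded (hr.mul_right √(2 / P.h)) fun n => ?_
  rw [norm_mul]
  exact mul_le_mul_of_nonneg_left (P.abs_sn_le n z) (abs_nonneg _)

theorem continuous_tsum_sn {r : ℕ → ℝ} (hr : Summable fun n => |r n|) :
    Continuous fun z => ∑' n, r n * P.sn n z := by
  refine continuous_tsum (fun n => by fun_prop) (hr.mul_right √(2 / P.h)) fun n z => ?_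
  rw [norm_mul]
  exact mul_le_mul_of_nonneg_left (P.abs_sn_le n z) (abs_nonneg _)

theorem eq_tsum_sn {Y : ℝ → ℝ} (hY : ContinuousOn Y (Icc 0 P.h)) {r : ℕ → ℝ}
    (hr : Summable fun n => |r n|) (h : ∀ n, ∫ z in (0 : ℝ)..P.h, Y z * P.sn n z = r n) :
    ∀ z ∈ Icc 0 P.h, Y z = ∑' n, r n * P.sn n z := by
  have hc := P.continuous_tsum_sn hr
  have c2 : ContinuousOn (fun z => Y z - ∑' n, r n * P.sn n z) (Icc 0 P.h) := hY.sub hc.continuousOn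
  have key := P.eq_zero_of_sn_coeff c2 (fun n => by
    simp only [sub_mul]
    have i1 : ContinuousOn (fun z => Y z * P.sn n z) (Icc 0 P.h) := by fun_prop
    have i2 : Continuous fun z => (∑' n, r n * P.sn n z) * P.sn n z := by fun_prop
    rw [intervalIntegral.integral_sub (i1.intervalIntegrable_of_Icc P.h_pos.le)
      (i2.intervalIntegrable _ _), h, P.integral_tsum_mul_sn hr, sub_self])
  exact fun z hz => sub_eq_zero.1 (key z hz)

/-- The stream function and the vorticity of a weak mode, as Fourier series in `x`. -/
structure IsModeExpansion (c : Option (ℕ × ℤ) → ℝ) (e : ℤ → ℝ) (ω ψ U : ℤ → ℝ → ℝ)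
    (Ω : ℤ → ℝ) : Prop where
  summable : Summable fun k => P.wt k ^ (1 / 4 : ℝ) * Ω k
  summable_trace : Summable fun k => P.wt k * |e k|
  continuousOn : ∀ k, ContinuousOn (ω k) (Icc 0 P.h)
  abs_ω_le : ∀ k, ∀ z ∈ Icc 0 P.h, |ω k z| ≤ Ω k
  abs_U_le : ∀ k, ∀ z ∈ Icc 0 P.h, P.wt k * |U k z| ≤ Ω k
  abs_ψ_le : ∀ k, ∀ z ∈ Icc 0 P.h, P.wt k ^ 2 * |ψ k z| ≤ Ω k
  ode : ∀ k, IsODESolution (P.wx k) 0 P.h (ψ k) (U k) fun z => -ω k z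
  ψ_zero : ∀ k, ψ k 0 = 0
  ψ_h : ∀ k, ψ k P.h = 0
  ω_zero : ∀ k, ω k 0 = -(P.α * e k)
  ω_h : ∀ k, ω k P.h = 0
  U_zero : ∀ k, U k 0 = e k - if k = 0 then c none / √P.h else 0
  hasSum_U : ∀ k, ∀ z ∈ Icc 0 P.h,
    HasSum (fun n => c (some (n, k)) * (P.wz n / P.ev n k) * P.cs n z) (U k z)
  hasSum_ψ : ∀ k, ∀ z ∈ Icc 0 P.h,
    HasSum (fun n => c (some (n, k)) * (1 / P.ev n k) * P.sn n z) (ψ k z)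
  summable_coeff : Summable fun j : ℕ × ℤ =>
    |c (some j)| * (max (P.wz j.1) |P.wx j.2| / P.ev j.1 j.2)

variable {P}

/-- The vorticity does not vanish at z = 0, so its bare sine series is unsuitable up to the
boundary. Separating off -α e k times the lift leaves coefficients G/(ν ev), which are absolutely
summable. The last clause waits for the moment when G is recognized as the sine coefficients of
continuous functions; only then does ω solve its own equation. -/
theorem IsWeakMode.exists_expansion {c : Option (ℕ × ℤ) → ℝ} {e : ℤ → ℝ} {G : ℕ × ℤ → ℝ}
    (hw : P.IsWeakMode c e G) : ∃ (ω ψ U : ℤ → ℝ → ℝ) (Ω : ℤ → ℝ),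
      P.IsModeExpansion c e ω ψ U Ω ∧
      ∃ C : ℝ, 0 < C ∧ ∀ (k : ℤ) (γ : ℝ → ℝ) (Γ : ℝ), ContinuousOn γ (Icc 0 P.h) →
        (∀ z ∈ Icc 0 P.h, |γ z| ≤ Γ) →
        (∀ n, ∫ z in (0 : ℝ)..P.h, γ z * P.sn n z = G (n, k)) →
        ∃ ω₁ : ℝ → ℝ, IsODESolution (P.wx k) 0 P.h (ω k) ω₁ (fun z => -(γ z / P.ν)) ∧
          ∀ z ∈ Icc 0 P.h, |ω₁ z| ≤ C * (Γ / P.wt k + P.wt k * |e k|) ∧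
            P.wt k * |ω k z| ≤ C * (Γ / P.wt k + P.wt k * |e k|) := by
  have hα := P.α_pos
  have hν := P.ν_pos
  have hh := P.h_pos
  obtain ⟨Cl, hCl, l, l₁, hl⟩ := P.exists_lift
  obtain ⟨Cd, hCd, hdir⟩ := P.exists_dirichlet_bound
  set s₀ := √(2 / P.h) with hs₀
  have hs0 : 0 < s₀ := by positivity
  let r : ℕ → ℤ → ℝ := fun n k => G (n, k) / (P.ν * P.ev n k)
  have hr : ∀ k, Summable fun n => |r n k| := hw.summable_fiber
  let W : ℤ → ℝ → ℝ := fun k z => ∑' n, r n k * P.sn n z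
  have cW : ∀ k, Continuous (W k) := fun k => P.continuous_tsum_sn (hr k)
  -- Since the lift is 1 at the bottom and 0 at the top, ω has the boundary values -α e k and 0
  -- demanded by the two slip conditions.
  let ω : ℤ → ℝ → ℝ := fun k z => W k z - P.α * e k * l k z
  have cl : ∀ k, ContinuousOn (l k) (Icc 0 P.h) := fun k => (hl k).1.continuousOn
  have cω : ∀ k, ContinuousOn (ω k) (Icc 0 P.h) := fun k =>
    (cW k).continuousOn.sub (continuousOn_const.mul (cl k))
  let R : ℤ → ℝ := fun k => ∑' n, |r n k|
  have hR0 : ∀ k, 0 ≤ R k := fun k => tsum_nonneg fun n => abs_nonneg _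
  have hω : ∀ k, ∀ z ∈ Icc 0 P.h, |ω k z| ≤ s₀ * R k + P.α * Cl * |e k| := by
    intro k z hz
    refine (abs_sub _ _).trans (add_le_add ?_ ?_)
    · rw [← Real.norm_eq_abs]
      refine tsum_of_norm_bounded ((hr k).hasSum.mul_left s₀) fun n => ?_
      rw [norm_mul, mul_comm]
      exact mul_le_mul_of_nonneg_right (P.abs_sn_le n z) (abs_nonneg _)
    · rw [abs_mul, abs_mul, abs_of_pos hα, mul_right_comm]
      exact mul_le_mul_of_nonneg_right
        (mul_le_mul_of_nonneg_left ((hl k).2.2.2 z hz).1 hα.le) (abs_nonneg _)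
  choose ψ U hψ hψ0 hψh using fun k => exists_dirichlet_solution (P.wx k) hh (g := fun z => -ω k z)
    (cω k).neg
  let Ω : ℤ → ℝ := fun k => (1 + Cd) * (s₀ * R k + P.α * Cl * |e k|)
  have hΩ0 : ∀ k, 0 ≤ s₀ * R k + P.α * Cl * |e k| := fun k => by
    have := hR0 k
    positivity
  have hb : ∀ k, ∀ z ∈ Icc 0 P.h, P.wt k * |U k z| ≤ Ω k ∧ P.wt k ^ 2 * |ψ k z| ≤ Ω k := by
    intro k z hz
    have := hdir k (ψ k) (U k) _ (s₀ * R k + P.α * Cl * |e k|) (hψ k) (hψ0 k) (hψh k)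
      (fun y hy => by rw [abs_neg]; exact hω k y hy) z hz
    have h0 := hΩ0 k
    constructor
    · refine this.1.trans ?_
      simp only [Ω]; nlinarith
    · refine this.2.trans ?_
      simp only [Ω]; nlinarith
  -- These are the multipliers of the trace functional; therefore subtracting the lift reproduces
  -- the friction term of the weak equation.
  have hl_coeff : ∀ n k, ∫ z in (0 : ℝ)..P.h, l k z * P.sn n z = P.wz n / P.ev n k * s₀ := by
    intro n k
    have := P.integral_mul_sn (hl k).1 continuousOn_const (hl k).2.2.1 n
    rw [(hl k).2.1] at this
    have he := P.ev_pos n k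
    rw [ev] at he ⊢
    simp only [zero_mul, intervalIntegral.integral_zero, mul_one, sub_zero] at this
    rw [div_mul_eq_mul_div, eq_div_iff he.ne', mul_comm]
    exact this
  have hω_coeff : ∀ n k, ∫ z in (0 : ℝ)..P.h, ω k z * P.sn n z = c (some (n, k)) := by
    intro n k
    have i1 : Continuous fun z => W k z * P.sn n z := (cW k).mul (P.continuous_sn n)
    have i2 : ContinuousOn (fun z => P.α * e k * (l k z * P.sn n z)) (Icc 0 P.h) :=
      continuousOn_const.mul ((cl k).mul (P.continuous_sn n).continuousOn)
    have e1 : ∀ z, ω k z * P.sn n z = W k z * P.sn n z - P.α * e k * (l k z * P.sn n z) := by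
      intro z; simp only [ω]; ring
    simp only [e1]
    rw [intervalIntegral.integral_sub (i1.intervalIntegrable _ _)
      (i2.intervalIntegrable_of_Icc hh.le), intervalIntegral.integral_const_mul, hl_coeff,
      P.integral_tsum_mul_sn (hr k), hw.coeff_eq n k]
    ring
  have hψ_coeff : ∀ n k, ∫ z in (0 : ℝ)..P.h, ψ k z * P.sn n z
      = c (some (n, k)) * (1 / P.ev n k) := by
    intro n k
    have := P.integral_mul_sn (hψ k) (cω k).neg (hψh k) n
    have he := P.ev_pos n k
    rw [ev] at he ⊢
    rw [hψ0, mul_zero, zero_sub] at this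
    simp only [neg_mul, intervalIntegral.integral_neg, neg_neg] at this
    rw [hω_coeff] at this
    rw [mul_one_div, eq_div_iff he.ne', mul_comm]
    exact this
  have hsc := hw.summable_coeff_mul
  have hsc1 : ∀ k, Summable fun n : ℕ => |c (some (n, k))| * (P.wz n / P.ev n k) := fun k => by
    refine Summable.of_nonneg_of_le (fun n => ?_) (fun n => ?_)
      (hsc.comp_injective (i := fun n : ℕ => (n, k)) fun n m h => by simpa using h)
    · have := P.wz_pos n
      have := P.ev_pos n k
      positivity
    · have := P.ev_pos n k
      simp only [Function.comp]
      gcongr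
      exact le_max_left _ _
  have hsc2 : ∀ k, Summable fun n : ℕ => |c (some (n, k)) * (1 / P.ev n k)| := fun k => by
    have h0 := P.wz_pos 0
    refine Summable.of_nonneg_of_le (fun n => abs_nonneg _) (fun n => ?_)
      ((hsc1 k).mul_left (1 / P.wz 0))
    have he := P.ev_pos n k
    rw [abs_mul, abs_of_pos (by positivity : 0 < 1 / P.ev n k)]
    have : 1 ≤ 1 / P.wz 0 * P.wz n := by
      rw [one_div_mul_eq_div, one_le_div h0]; exact P.wz_zero_le n
    calc _ ≤ |c (some (n, k))| * (1 / P.ev n k) * (1 / P.wz 0 * P.wz n) :=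
          le_mul_of_one_le_right (by positivity) this
      _ = _ := by ring
  have hψ_sum : ∀ k, ∀ z ∈ Icc 0 P.h,
      ψ k z = ∑' n, c (some (n, k)) * (1 / P.ev n k) * P.sn n z := fun k =>
    P.eq_tsum_sn (hψ k).continuousOn (hsc2 k) fun n => hψ_coeff n k
  have hcs : ∀ k z, Summable fun n => c (some (n, k)) * (P.wz n / P.ev n k) * P.cs n z := by
    intro k z
    refine Summable.of_norm_bounded ((hsc1 k).mul_right s₀) fun n => ?_
    have := P.wz_pos n
    have := P.ev_pos n k
    rw [norm_mul, norm_mul, Real.norm_of_nonneg (by positivity : 0 ≤ P.wz n / P.ev n k)]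
    exact mul_le_mul_of_nonneg_left (P.abs_cs_le n z) (by positivity)
  have hU_sum : ∀ k, ∀ z ∈ Icc 0 P.h,
      U k z = ∑' n, c (some (n, k)) * (P.wz n / P.ev n k) * P.cs n z := by
    intro k z hz
    -- The cosine series of U is obtained by differentiating the sine series of ψ termwise; it thus
    -- holds at the endpoints too, which gives the trace of U.
    have hd : HasDerivAt (fun z => ∑' n, c (some (n, k)) * (1 / P.ev n k) * P.sn n z)
        (∑' n, c (some (n, k)) * (1 / P.ev n k) * (P.wz n * P.cs n z)) z := by
      refine hasDerivAt_tsum ((hsc1 k).mul_right s₀)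
        (fun n y => (P.hasDerivAt_sn n y).const_mul _) (fun n y => ?_) (y₀ := 0)
        (P.summable_mul_sn (hsc2 k) 0) z
      have := P.wz_pos n
      have := P.ev_pos n k
      have e1 : c (some (n, k)) * (1 / P.ev n k) * (P.wz n * P.cs n y)
          = c (some (n, k)) * (P.wz n / P.ev n k) * P.cs n y := by ring
      rw [e1, norm_mul, norm_mul, Real.norm_of_nonneg (by positivity : 0 ≤ P.wz n / P.ev n k)]
      exact mul_le_mul_of_nonneg_left (P.abs_cs_le n y) (by positivity)
    have h2 := (uniqueDiffOn_Icc hh z hz).eq_deriv _ ((hψ k).deriv_zero z hz)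
      (hd.hasDerivWithinAt.congr (hψ_sum k) (hψ_sum k z hz))
    rw [h2]
    congr 1
    ext n
    ring
  have hU0 : ∀ k, ∀ z ∈ Icc 0 P.h,
      HasSum (fun n => c (some (n, k)) * (P.wz n / P.ev n k) * P.cs n z) (U k z) := fun k z hz => by
    rw [hU_sum k z hz]; exact (hcs k z).hasSum
  have h0m : (0 : ℝ) ∈ Icc 0 P.h := left_mem_Icc.2 hh.le
  refine ⟨ω, ψ, U, Ω, ⟨?_, hw.summable_wt_mul_trace, cω, fun k z hz => (hω k z hz).trans ?_,
    fun k z hz => (hb k z hz).1, fun k z hz => (hb k z hz).2, hψ, hψ0, hψh, fun k => ?_,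
    fun k => ?_, fun k => ?_, hU0, fun k z hz => ?_, hsc⟩,
    Cd / P.ν + P.α * Cl, by positivity, ?_⟩
  · have h1 := hw.summable_tsum.mul_left ((1 + Cd) * s₀)
    have h2 : Summable fun k => P.wt k ^ (1 / 4 : ℝ) * |e k| := by
      refine Summable.of_nonneg_of_le (fun k => ?_) (fun k => ?_) hw.summable_wt_mul_trace
      · have := P.wt_pos k
        positivity
      · gcongr
        exact Real.rpow_le_self_of_one_le (P.one_le_wt k) (by norm_num)
    refine (h1.add (h2.mul_left ((1 + Cd) * (P.α * Cl)))).congr fun k => ?_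
    simp only [Ω, R, r]
    ring
  · have := hΩ0 k
    simp only [Ω]; nlinarith
  · simp only [ω, W, sn_zero, mul_zero, tsum_zero, (hl k).2.1]; ring
  · simp only [ω, W, sn_h, mul_zero, tsum_zero, (hl k).2.2.1]; ring
  · refine (hU0 k 0 h0m).unique ?_
    have := hw.trace k
    simp only [cs_zero]
    convert this using 1
    ext n; ring
  · rw [hψ_sum k z hz]; exact (P.summable_mul_sn (hsc2 k) z).hasSum
  · intro k γ Γ hγ hγΓ hγc
    -- The Dirichlet solution with forcing -γ/ν has the sine coefficients of W, hence equals W;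
    -- adding the lift gives the equation for ω.
    obtain ⟨Y, Y₁, hY, hY0, hYh⟩ := exists_dirichlet_solution (P.wx k) hh
      (g := fun z => -(γ z / P.ν)) (hγ.div_const _).neg
    have hYc : ∀ n, ∫ z in (0 : ℝ)..P.h, Y z * P.sn n z = r n k := by
      intro n
      have := P.integral_mul_sn hY (hγ.div_const _).neg hYh n
      have he := P.ev_pos n k
      simp only [r]
      rw [ev] at he ⊢
      rw [hY0, mul_zero, zero_sub] at this
      simp only [neg_mul, intervalIntegral.integral_neg, neg_neg, div_mul_eq_mul_div,
        intervalIntegral.integral_div] at this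
      rw [hγc] at this
      rw [eq_div_iff (by positivity)]
      field_simp at this
      linarith
    have hYW := P.eq_tsum_sn hY.continuousOn (hr k) hYc
    have hΓ0 : 0 ≤ Γ := (abs_nonneg _).trans (hγΓ 0 h0m)
    have hYb := hdir k Y Y₁ _ (Γ / P.ν) hY hY0 hYh fun z hz => by
      rw [abs_neg, abs_div, abs_of_pos hν]
      gcongr
      exact hγΓ z hz
    have hwt := P.wt_pos k
    have hode := (hY.add ((hl k).1.const_mul (-(P.α * e k)))).congr_left (Z := ω k) fun z hz => by
      simp only [ω, W, hYW z hz]; ring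
    refine ⟨_, hode.congr_right fun z hz => by ring, fun z hz => ?_⟩
    have hb1 := (hYb z hz).1
    have hb2 := (hYb z hz).2
    have hl1 := ((hl k).2.2.2 z hz).1
    have hl2 := ((hl k).2.2.2 z hz).2
    have he0 : 0 ≤ P.wt k * |e k| := by positivity
    have q1 : 0 ≤ Cd / P.ν * (P.wt k * |e k|) := by positivity
    have q2 : 0 ≤ P.α * Cl * (Γ / P.wt k) := by positivity
    have hb1' : |Y₁ z| ≤ Cd / P.ν * (Γ / P.wt k) := by
      have : Cd / P.ν * (Γ / P.wt k) = Cd * (Γ / P.ν) / P.wt k := by field_simp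
      rw [this, le_div_iff₀ hwt, mul_comm]
      exact hb1
    have hb2' : P.wt k * |Y z| ≤ Cd / P.ν * (Γ / P.wt k) := by
      have : Cd / P.ν * (Γ / P.wt k) = Cd * (Γ / P.ν) / P.wt k := by field_simp
      rw [this, le_div_iff₀ hwt]
      refine le_of_eq_of_le (by ring) hb2
    constructor
    · calc _ ≤ |Y₁ z| + |-(P.α * e k) * l₁ k z| := abs_add_le _ _
        _ = |Y₁ z| + P.α * |e k| * |l₁ k z| := by
          rw [abs_mul, abs_neg, abs_mul, abs_of_pos hα]
        _ ≤ Cd / P.ν * (Γ / P.wt k) + P.α * |e k| * (Cl * P.wt k) := by gcongr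
        _ ≤ _ := by nlinarith
    · have : ω k z = Y z + -(P.α * e k) * l k z := by
        simp only [ω, W, hYW z hz]; ring
      rw [this]
      calc _ ≤ P.wt k * (|Y z| + |-(P.α * e k) * l k z|) := by gcongr; exact abs_add_le _ _
        _ = P.wt k * |Y z| + P.α * (P.wt k * |e k|) * |l k z| := by
          rw [abs_mul, abs_neg, abs_mul, abs_of_pos hα]; ring
        _ ≤ Cd / P.ν * (Γ / P.wt k) + P.α * (P.wt k * |e k|) * Cl := by gcongr
        _ ≤ _ := by nlinarith

end

end Params

end RotatingBoussinesq

/-! ### Velocity fields of an expansion, their boundary conditions, and interior decay of modes. -/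

namespace RotatingBoussinesq

open Filter Topology MeasureTheory

namespace Params

noncomputable section

variable {P : Params}

section Tools

variable {a a' a'' : ℤ → ℝ → ℝ} {B : ℤ → ℝ} {I : Set ℝ}

theorem hasDerivWithinAt_fdx (hd : ∀ k, ∀ z ∈ I, HasDerivWithinAt (a k) (a' k z) I z) (k : ℤ)
    {z : ℝ} (hz : z ∈ I) : HasDerivWithinAt (P.fdx a k) (P.fdx a' k z) I z :=
  ((hd (-k) z hz).const_mul (P.wx k)).neg

theorem contDiffOn_two_fs (hI : Convex ℝ I) (hIu : UniqueDiffOn ℝ I) (hB : Summable B)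
    (hd : ∀ k, ∀ z ∈ I, HasDerivWithinAt (a k) (a' k z) I z)
    (hd' : ∀ k, ∀ z ∈ I, HasDerivWithinAt (a' k) (a'' k z) I z)
    (hc : ∀ k, ContinuousOn (a'' k) I)
    (ha : ∀ k, ∀ z ∈ I, P.wt k ^ 2 * |a k z| ≤ B k)
    (ha' : ∀ k, ∀ z ∈ I, P.wt k * |a' k z| ≤ B k) (ha'' : ∀ k, ∀ z ∈ I, |a'' k z| ≤ B k) :
    ContDiffOn ℝ 2 (P.fs a) (univ ×ˢ I) := by
  have ha1 : ∀ k, ∀ z ∈ I, P.wt k * |a k z| ≤ B k := fun k z hz => by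
    refine le_trans ?_ (ha k z hz)
    rw [pow_two, mul_assoc]
    exact le_mul_of_one_le_left (mul_nonneg (P.wt_pos k).le (abs_nonneg _)) (P.one_le_wt k)
  have h1 := contDiffOn_succ_of_partial (n := 1) hI hIu
    (f := P.fs a) (fx := P.fs (P.fdx a)) (fz := P.fs a')
    (fun q hq => hasDerivAt_fs_fst hB (fun k => ha1 k q.2 hq.2) q.1)
    (fun q hq => hasDerivWithinAt_fs_snd hI hB hd
      (fun k z hz => abs_le_of_wt_mul (fun k => ha1 k z hz) k)
      (fun k z hz => abs_le_of_wt_mul (fun k => ha' k z hz) k) hq.2)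
    (by
      rw [Nat.cast_one]
      refine contDiffOn_one_fs (a' := P.fdx a') hI hIu (summable_neg_iff.2 hB)
        (fun k z hz => hasDerivWithinAt_fdx hd k hz) (fun k => ?_)
        (fun k z hz => wt_mul_abs_fdx_le (fun k => ha k z hz) k)
        fun k z hz => abs_fdx_le (fun k => ha' k z hz) k
      have : ContinuousOn (a' (-k)) I := fun z hz => (hd' (-k) z hz).continuousWithinAt
      unfold fdx
      fun_prop)
    (by
      rw [Nat.cast_one]
      exact contDiffOn_one_fs hI hIu hB hd' hc ha' ha'')
  have h : ((1 : ℕ) : WithTop ℕ∞) + 1 = 2 := by norm_num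
  rwa [h] at h1

theorem contDiffOn_strip_of_Icc {f : ℝ × ℝ → ℝ} {n : WithTop ℕ∞}
    (h : ∀ a b, 0 < a → a < b → b < P.h → ContDiffOn ℝ n f (univ ×ˢ Icc a b)) :
    ContDiffOn ℝ n f P.strip := by
  rintro ⟨x, z⟩ ⟨-, hz⟩
  have hz1 : 0 < z := hz.1
  have hz2 : z < P.h := hz.2
  have := h (z / 2) ((z + P.h) / 2) (by linarith) (by linarith) (by linarith)
  refine ((this (x, z) ⟨mem_univ _, by simp only; constructor <;> linarith⟩).contDiffAt
    ?_).contDiffWithinAt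
  exact prod_mem_nhds univ_mem (Icc_mem_nhds (by linarith) (by linarith))

theorem hasSum_option {ι : Type*} {f : Option ι → ℝ} {s : ℝ} (h : HasSum (fun i => f (some i)) s) :
    HasSum f (s + f none) := by
  classical
  have h1 : HasSum (Function.update f none 0) s := by
    rw [← (Option.some_injective ι).hasSum_iff]
    · refine h.congr_fun fun i => ?_
      simp
    · intro j hj
      cases j with
      | none => simp
      | some j => exact absurd ⟨j, rfl⟩ hj
  have h2 := h1.update none (f none)
  simpa [add_comm] using h2

/-- Interior decay estimate for the modes. -/
theorem exists_interior_bound {a a' b' b : ℝ} (ha : a < a') (hb : b' < b) (N : ℕ) :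
    ∃ C : ℝ, 0 < C ∧ ∀ (k : ℤ) (Y Y₁ g : ℝ → ℝ) (Γ M : ℝ), 0 ≤ M →
      IsODESolution (P.wx k) a b Y Y₁ g → (∀ z ∈ Icc a b, |g z| ≤ Γ) →
      (∀ z ∈ Icc a b, |Y₁ z| ≤ M) → (∀ z ∈ Icc a b, P.wt k * |Y z| ≤ M) →
      ∀ z ∈ Icc a' b', |Y₁ z| ≤ C * (M / P.wt k ^ N + Γ / P.wt k) ∧
        P.wt k * |Y z| ≤ C * (M / P.wt k ^ N + Γ / P.wt k) := by
  have hc₀ := P.wx_one_pos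
  set c₀ := P.wx 1
  set r := 1 / c₀ + 1 with hr
  have hr1 : 1 ≤ r := by
    have : 0 < 1 / c₀ := by positivity
    linarith
  have hr0 : 0 < r := by linarith
  set d := min (a' - a) (b - b') with hd
  have hd0 : 0 < d := lt_min (by linarith) (by linarith)
  set E := (N.factorial : ℝ) * (r / d) ^ N with hE
  have hE0 : 0 < E := by positivity
  refine ⟨1 + r * r + 4 * E * r, by positivity, ?_⟩
  intro k Y Y₁ g Γ M hM0 hY hg hY₁ hY0 z hz
  have hz' : z ∈ Icc a b := ⟨by linarith [hz.1], by linarith [hz.2]⟩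
  have hΓ0 : 0 ≤ Γ := (abs_nonneg _).trans (hg z hz')
  have hwt := P.wt_pos k
  by_cases hk : k = 0
  · subst hk
    have hw : P.wt 0 = 1 := by simp [wt, wx_zero]
    have h1 := hY₁ z hz'
    have h2 := hY0 z hz'
    rw [hw] at h2 ⊢
    simp only [one_pow, div_one]
    have q1 : 0 ≤ (r * r + 4 * E * r) * M := by positivity
    have q2 : 0 ≤ (1 + r * r + 4 * E * r) * Γ := by positivity
    constructor <;> nlinarith
  · have hge := P.abs_wx_ge hk
    set κ := |P.wx k| with hκ
    have hκ0 : 0 < κ := hc₀.trans_le hge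
    have hw : P.wt k ≤ r * κ := by
      have : 1 ≤ 1 / c₀ * κ := by
        rw [one_div_mul_eq_div, one_le_div hc₀]; exact hge
      simp only [wt, ← hκ, hr]; linarith
    have hκw : κ ≤ P.wt k := P.abs_wx_le_wt k
    have ha0 : a ∈ Icc a b := left_mem_Icc.2 (hz'.1.trans hz'.2)
    have hb0 : b ∈ Icc a b := right_mem_Icc.2 (hz'.1.trans hz'.2)
    have hκY : ∀ y ∈ Icc a b, κ * |Y y| ≤ M := fun y hy =>
      (mul_le_mul_of_nonneg_right hκw (abs_nonneg _)).trans (hY0 y hy)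
    -- The end values Y' ± κY are bounded by |Y'| + κ|Y| ≤ 2M.
    have key := hY.abs_const.bounds hκ0 hg (M := 2 * M)
      ((abs_sub _ _).trans (by
        rw [abs_mul, abs_abs]; linarith [hY₁ a ha0, hκY a ha0]))
      ((abs_add_le _ _).trans (by
        rw [abs_mul, abs_abs]; linarith [hY₁ b hb0, hκY b hb0])) hz'
    rw [← hκ] at key
    -- At distance d from the ends the exponential beats every power of the weight, by y^N/N! ≤ e^y.
    have hexp : ∀ t, d ≤ t → Real.exp (-(κ * t)) ≤ E / P.wt k ^ N := by
      intro t ht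
      have h1 : Real.exp (-(κ * t)) ≤ Real.exp (-(P.wt k * d / r)) := by
        rw [Real.exp_le_exp, neg_le_neg_iff, div_le_iff₀ hr0]
        calc P.wt k * d ≤ (r * κ) * t := by gcongr
          _ = _ := by ring
      refine h1.trans ?_
      have h2 := Real.pow_div_factorial_le_exp (P.wt k * d / r) (by positivity) N
      rw [Real.exp_neg, hE]
      have h3 : (0 : ℝ) < (P.wt k * d / r) ^ N / N.factorial := by positivity
      calc _ ≤ ((P.wt k * d / r) ^ N / N.factorial)⁻¹ := by gcongr
        _ = _ := by
          have h4 : P.wt k ^ N = (P.wt k * d / r) ^ N * (r / d) ^ N := by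
            rw [← mul_pow]; congr 1; field_simp
          rw [h4]; field_simp
    have e1 := hexp (b - z) ((min_le_right _ _).trans (by linarith [hz.2]))
    have e2 := hexp (z - a) ((min_le_left _ _).trans (by linarith [hz.1]))
    have hΓκ : Γ / κ ≤ r * (Γ / P.wt k) := by
      rw [div_le_iff₀ hκ0]
      calc Γ = Γ / P.wt k * P.wt k := by field_simp
        _ ≤ Γ / P.wt k * (r * κ) := by gcongr
        _ = _ := by ring
    have hfin : (Real.exp (-(κ * (b - z))) + Real.exp (-(κ * (z - a)))) * (2 * M) + Γ / κ
        ≤ 4 * E * (M / P.wt k ^ N) + r * (Γ / P.wt k) := by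
      calc _ ≤ (E / P.wt k ^ N + E / P.wt k ^ N) * (2 * M) + r * (Γ / P.wt k) := by gcongr
        _ = _ := by ring
    have q1 : 0 ≤ M / P.wt k ^ N := by positivity
    have q2 : 0 ≤ Γ / P.wt k := by positivity
    have q3 : 0 ≤ E * (M / P.wt k ^ N) := by positivity
    have q4 : 0 ≤ E * r * (Γ / P.wt k) := by positivity
    have q5 : E * (M / P.wt k ^ N) ≤ E * r * (M / P.wt k ^ N) := by
      calc _ ≤ E * (M / P.wt k ^ N) * r := le_mul_of_one_le_right q3 hr1
        _ = _ := by ring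
    have q6 : r * (Γ / P.wt k) ≤ (1 + r * r) * (Γ / P.wt k) := by
      gcongr; nlinarith
    have q7 : 0 ≤ (1 + r * r) * (M / P.wt k ^ N) := by positivity
    constructor
    · refine (key.1.trans hfin).trans ?_
      linarith
    · calc P.wt k * |Y z| ≤ (r * κ) * |Y z| := by gcongr
        _ = r * (κ * |Y z|) := by ring
        _ ≤ r * (4 * E * (M / P.wt k ^ N) + r * (Γ / P.wt k)) := by
          gcongr; exact key.2.trans hfin
        _ ≤ _ := by linarith

theorem exists_bound_slab {f : ℝ × ℝ → ℝ} (hp : P.PeriodicX f) (hf : ContinuousOn f P.strip)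
    {a b : ℝ} (ha : 0 < a) (hb : b < P.h) :
    ∃ C, 0 ≤ C ∧ ∀ z ∈ Icc a b, ∀ x, |f (x, z)| ≤ C := by
  have hs : Icc 0 P.L ×ˢ Icc a b ⊆ P.strip := fun q hq =>
    ⟨mem_univ _, ha.trans_le hq.2.1, hq.2.2.trans_lt hb⟩
  obtain ⟨C, hC⟩ := (isCompact_Icc.prod isCompact_Icc).exists_bound_of_continuousOn (hf.mono hs)
  refine ⟨max C 0, le_max_right _ _, fun z hz x => ?_⟩
  have hp : Function.Periodic (fun x => f (x, z)) P.L := fun x =>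
    hp x z ⟨ha.le.trans hz.1, hz.2.trans hb.le⟩
  obtain ⟨y, hy, he⟩ := hp.exists_mem_Ico₀ P.L_pos x
  rw [show f (x, z) = f (y, z) from he]
  exact (hC (y, z) ⟨Ico_subset_Icc_self hy, hz⟩).trans (le_max_left _ _)

theorem holderX_of_contDiffOn {f : ℝ × ℝ → ℝ} (hp : P.PeriodicX f) (hf : ContDiffOn ℝ 1 f P.strip)
    {a b : ℝ} (ha : 0 < a) (hb : b < P.h) : HolderX f (Icc a b) := by
  obtain ⟨C, hC, h1⟩ := exists_bound_slab hp hf.continuousOn ha hb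
  obtain ⟨D, hD, h2⟩ := exists_bound_slab hp.dx (continuousOn_dx_strip hf) ha hb
  exact holderX_of_lipschitz hC hD h1 (fun z hz x => hasDerivAt_dx_strip (q := (x, z)) hf
    ⟨mem_univ _, ha.trans_le hz.1, hz.2.trans_lt hb⟩) h2

theorem HolderX.congr {f g : ℝ × ℝ → ℝ} (hf : HolderX f I) (h : ∀ z ∈ I, ∀ x, g (x, z) = f (x, z)) :
    HolderX g I := by
  obtain ⟨C, hC, h'⟩ := hf
  refine ⟨C, hC, fun z hz => ⟨fun x => ?_, fun x y => ?_⟩⟩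
  · rw [h z hz]; exact (h' z hz).1 x
  · rw [h z hz, h z hz]; exact (h' z hz).2 x y

end Tools

section Velocity

variable (P) (c : Option (ℕ × ℤ) → ℝ) (ω ψ U : ℤ → ℝ → ℝ)

/-- The Fourier coefficients of the vertical velocity. -/
def wcoeff (k : ℤ) (z : ℝ) : ℝ := P.wx k * ψ (-k) z

/-- The zonal velocity. -/
def uField (q : ℝ × ℝ) : ℝ := P.fs U q + c none / √(P.L * P.h)

/-- The vertical velocity. -/
def wField : ℝ × ℝ → ℝ := P.fs (P.wcoeff ψ)

/-- The `z`-derivative of the coefficients of the zonal velocity. -/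
def uzcoeff (k : ℤ) (z : ℝ) : ℝ := P.wx k ^ 2 * ψ k z + -ω k z

end Velocity

namespace IsModeExpansion

variable {c : Option (ℕ × ℤ) → ℝ} {e : ℤ → ℝ} {ω ψ U : ℤ → ℝ → ℝ} {Ω : ℤ → ℝ}

theorem nonneg (h : P.IsModeExpansion c e ω ψ U Ω) (k : ℤ) : 0 ≤ Ω k :=
  (abs_nonneg _).trans (h.abs_ω_le k 0 (left_mem_Icc.2 P.h_pos.le))

theorem summable_bound (h : P.IsModeExpansion c e ω ψ U Ω) : Summable Ω :=
  Summable.of_nonneg_of_le h.nonneg (fun k => le_mul_of_one_le_left (h.nonneg k)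
    (Real.one_le_rpow (P.one_le_wt k) (by norm_num))) h.summable

theorem wx_sq_le (k : ℤ) : P.wx k ^ 2 ≤ P.wt k ^ 2 := by
  rw [← sq_abs (P.wx k)]
  have := P.abs_wx_le_wt k
  gcongr

theorem abs_uzcoeff_le (h : P.IsModeExpansion c e ω ψ U Ω) (k : ℤ) {z : ℝ} (hz : z ∈ Icc 0 P.h) :
    |P.uzcoeff ω ψ k z| ≤ 2 * Ω k := by
  refine (abs_add_le _ _).trans ?_
  rw [abs_mul, abs_neg, abs_of_nonneg (sq_nonneg (P.wx k))]
  have h1 := h.abs_ω_le k z hz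
  have h2 := (mul_le_mul_of_nonneg_right (wx_sq_le (P := P) k) (abs_nonneg (ψ k z))).trans
    (h.abs_ψ_le k z hz)
  linarith

theorem abs_wcoeff_le (h : P.IsModeExpansion c e ω ψ U Ω) (k : ℤ) {z : ℝ} (hz : z ∈ Icc 0 P.h) :
    P.wt k * |P.wcoeff ψ k z| ≤ Ω (-k) := by
  rw [wcoeff, abs_mul]
  refine le_trans ?_ (h.abs_ψ_le (-k) z hz)
  rw [wt_neg, pow_two, ← mul_assoc]
  have := P.abs_wx_le_wt k
  have := P.wt_pos k
  gcongr

theorem abs_wx_mul_U_le (h : P.IsModeExpansion c e ω ψ U Ω) (k : ℤ) {z : ℝ} (hz : z ∈ Icc 0 P.h) :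
    |P.wx k * U (-k) z| ≤ Ω (-k) := by
  rw [abs_mul]
  refine le_trans ?_ (h.abs_U_le (-k) z hz)
  rw [wt_neg]
  have := P.abs_wx_le_wt k
  gcongr

theorem hasDerivWithinAt_wcoeff (h : P.IsModeExpansion c e ω ψ U Ω) (k : ℤ) {z : ℝ}
    (hz : z ∈ Icc 0 P.h) :
    HasDerivWithinAt (P.wcoeff ψ k) (P.wx k * U (-k) z) (Icc 0 P.h) z :=
  ((h.ode (-k)).deriv_zero z hz).const_mul (P.wx k)

theorem contDiffOn_uField (h : P.IsModeExpansion c e ω ψ U Ω) :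
    ContDiffOn ℝ 1 (P.uField c U) P.closedStrip := by
  refine ContDiffOn.add (contDiffOn_one_fs (a' := P.uzcoeff ω ψ) (B := fun k => 2 * Ω k)
    (convex_Icc _ _) P.uniqueDiffOn_Icc_h (h.summable_bound.mul_left 2)
    (fun k z hz => (h.ode k).deriv_one z hz) (fun k => ?_) (fun k z hz => ?_)
    fun k z hz => h.abs_uzcoeff_le k hz) contDiffOn_const
  · exact (continuousOn_const.mul (h.ode k).continuousOn).add (h.continuousOn k).neg
  · have := h.abs_U_le k z hz
    linarith [h.nonneg k]

theorem contDiffOn_wField (h : P.IsModeExpansion c e ω ψ U Ω) :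
    ContDiffOn ℝ 1 (P.wField ψ) P.closedStrip :=
  contDiffOn_one_fs (a' := fun k z => P.wx k * U (-k) z) (B := fun k => Ω (-k))
    (convex_Icc _ _) P.uniqueDiffOn_Icc_h (summable_neg_iff.2 h.summable_bound)
    (fun k _ hz => h.hasDerivWithinAt_wcoeff k hz)
    (fun k => continuousOn_const.mul (h.ode (-k)).continuousOn_one)
    (fun k _ hz => h.abs_wcoeff_le k hz) fun k _ hz => h.abs_wx_mul_U_le k hz

theorem dx_uField (h : P.IsModeExpansion c e ω ψ U Ω) {q : ℝ × ℝ} (hq : q ∈ P.closedStrip) :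
    P.dx (P.uField c U) q = P.fs (P.fdx U) q :=
  ((hasDerivAt_fs_fst h.summable_bound (fun k => h.abs_U_le k q.2 hq.2) q.1).add_const _).deriv

theorem dz_uField (h : P.IsModeExpansion c e ω ψ U Ω) {q : ℝ × ℝ} (hq : q ∈ P.closedStrip) :
    P.dz (P.uField c U) q = P.fs (P.uzcoeff ω ψ) q := by
  have := (hasDerivWithinAt_fs_snd (P := P) (a' := P.uzcoeff ω ψ) (convex_Icc 0 P.h)
    (h.summable_bound.mul_left 2) (fun k z hz => (h.ode k).deriv_one z hz)
    (fun k z hz => by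
      have := abs_le_of_wt_mul (fun k => h.abs_U_le k z hz) k
      linarith [h.nonneg k])
    (fun k z hz => h.abs_uzcoeff_le k hz) hq.2).add_const (c none / √(P.L * P.h))
  exact this.derivWithin (P.uniqueDiffOn_Icc_h _ hq.2)

theorem dx_wField (h : P.IsModeExpansion c e ω ψ U Ω) {q : ℝ × ℝ} (hq : q ∈ P.closedStrip) :
    P.dx (P.wField ψ) q = P.fs (P.fdx (P.wcoeff ψ)) q :=
  (hasDerivAt_fs_fst (summable_neg_iff.2 h.summable_bound)
    (fun k => h.abs_wcoeff_le k hq.2) q.1).deriv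

theorem dz_wField (h : P.IsModeExpansion c e ω ψ U Ω) {q : ℝ × ℝ} (hq : q ∈ P.closedStrip) :
    P.dz (P.wField ψ) q = P.fs (fun k z => P.wx k * U (-k) z) q := by
  have := (hasDerivWithinAt_fs_snd (P := P) (a' := fun k z => P.wx k * U (-k) z)
    (convex_Icc 0 P.h) (summable_neg_iff.2 h.summable_bound)
    (fun k _ hz => h.hasDerivWithinAt_wcoeff k hz)
    (fun k z hz => abs_le_of_wt_mul (fun k => h.abs_wcoeff_le k hz) k)
    (fun k _ hz => h.abs_wx_mul_U_le k hz) hq.2)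
  exact this.derivWithin (P.uniqueDiffOn_Icc_h _ hq.2)

theorem periodicX_uField : P.PeriodicX (P.uField c U) := fun x z hz => by
  simp only [uField]; rw [periodicX_fs U x z hz]

theorem periodicX_wField : P.PeriodicX (P.wField ψ) := periodicX_fs _

theorem div_free (h : P.IsModeExpansion c e ω ψ U Ω) {q : ℝ × ℝ} (hq : q ∈ P.closedStrip) :
    P.dx (P.uField c U) q + P.dz (P.wField ψ) q = 0 := by
  rw [h.dx_uField hq, h.dz_wField hq, ← fs_add (summable_neg_iff.2 h.summable_bound)
    (fun k => abs_fdx_le (fun k => h.abs_U_le k q.2 hq.2) k) (summable_neg_iff.2 h.summable_bound)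
    (fun k => h.abs_wx_mul_U_le k hq.2)]
  simp [fs, fdx]

/-- On the boundary ψ vanishes, so w = 0 and ∂_z u = -ω there. The boundary values of ω then give no
stress at the top and the slip law at the bottom. -/
theorem boundaryConditions (h : P.IsModeExpansion c e ω ψ U Ω) :
    P.BoundaryConditions (P.uField c U) (P.wField ψ) := by
  have h0 : (0 : ℝ) ∈ Icc 0 P.h := left_mem_Icc.2 P.h_pos.le
  have hh : P.h ∈ Icc 0 P.h := right_mem_Icc.2 P.h_pos.le
  refine ⟨fun x => ?_, fun x => ?_, fun x => ?_, fun x => ?_⟩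
  · rw [h.dz_uField ⟨mem_univ _, hh⟩]
    simp [fs, uzcoeff, h.ψ_h, h.ω_h]
  · simp [wField, fs, wcoeff, h.ψ_h]
  · rw [h.dz_uField ⟨mem_univ _, h0⟩]
    have e1 : P.fs (P.uzcoeff ω ψ) (x, 0) = P.α * P.fs (fun k _ => e k) (x, 0) := by
      rw [← fs_const_mul]
      refine fs_congr fun k => ?_
      simp [uzcoeff, h.ψ_zero, h.ω_zero]
    have se : Summable fun k => |e k| := Summable.of_nonneg_of_le (fun _ => abs_nonneg _)
      (fun k => le_mul_of_one_le_left (abs_nonneg _) (P.one_le_wt k)) h.summable_trace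
    -- U lacks the uniform flow, which is c none/√h times the zeroth basis function; adding it
    -- restores the full trace e.
    have e2 : P.uField c U (x, 0) = P.fs (fun k _ => e k) (x, 0) := by
      have s1 := summable_fs (P := P) (a := fun k _ => e k) (z := 0) se (fun k => le_rfl) x
      have s2 : HasSum (fun k : ℤ => (if k = 0 then c none / √P.h else 0) * P.τ k x)
          (c none / √(P.L * P.h)) := by
        have : (fun k : ℤ => (if k = 0 then c none / √P.h else 0) * P.τ k x)
            = fun k => if k = 0 then c none / √(P.L * P.h) else 0 := by
          ext k
          split_ifs with hk
          · subst hk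
            have hL := P.L_pos
            simp only [τ, wx_zero, zero_mul, Real.cos_zero, Real.sin_zero, add_zero]
            rw [Real.sqrt_mul hL.le]
            field_simp
          · simp
        rw [this]
        exact hasSum_ite_eq 0 _
      have s3 := s1.hasSum.sub s2
      have : P.fs U (x, 0) = P.fs (fun k _ => e k) (x, 0) - c none / √(P.L * P.h) := by
        rw [fs, fs, ← s3.tsum_eq]
        congr 1; ext k
        rw [h.U_zero]; ring
      rw [uField, this]; ring
    rw [e1, e2, smul_eq_mul, sub_self]
  · simp [wField, fs, wcoeff, h.ψ_zero]

theorem abs_coeff_uB_le (c : Option (ℕ × ℤ) → ℝ) (j : ℕ × ℤ) (q : ℝ × ℝ) :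
    |c (some j) * P.uB (some j) q| ≤ |c (some j)| * (max (P.wz j.1) |P.wx j.2| / P.ev j.1 j.2)
      * (√(2 / P.h) * (2 / √P.L)) := by
  have hn := P.wz_pos j.1
  have he := P.ev_pos j.1 j.2
  simp only [uB, cB]
  rw [abs_mul, abs_mul, abs_mul, abs_of_pos (by positivity : 0 < P.wz j.1 / P.ev j.1 j.2), mul_assoc]
  gcongr
  · exact le_max_left _ _
  · exact P.abs_cs_le _ _
  · exact P.abs_τ_le _ _

theorem abs_coeff_wB_le (c : Option (ℕ × ℤ) → ℝ) (j : ℕ × ℤ) (q : ℝ × ℝ) :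
    |c (some j) * P.wB (some j) q| ≤ |c (some j)| * (max (P.wz j.1) |P.wx j.2| / P.ev j.1 j.2)
      * (√(2 / P.h) * (2 / √P.L)) := by
  have hn := P.wz_pos j.1
  have he := P.ev_pos j.1 j.2
  simp only [wB, sB]
  rw [abs_mul, abs_mul, abs_mul, abs_neg, abs_div, abs_of_pos he, mul_assoc]
  gcongr
  · exact le_max_right _ _
  · exact P.abs_sn_le _ _
  · exact P.abs_τ_le _ _

theorem summable_coeff_bound (h : P.IsModeExpansion c e ω ψ U Ω) (M : ℝ) :
    Summable fun i : Option (ℕ × ℤ) => i.elim M fun j =>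
      |c (some j)| * (max (P.wz j.1) |P.wx j.2| / P.ev j.1 j.2) * (√(2 / P.h) * (2 / √P.L)) :=
  (hasSum_option (f := fun i : Option (ℕ × ℤ) => i.elim M fun j =>
    |c (some j)| * (max (P.wz j.1) |P.wx j.2| / P.ev j.1 j.2) * (√(2 / P.h) * (2 / √P.L)))
    (h.summable_coeff.mul_right (√(2 / P.h) * (2 / √P.L))).hasSum).summable

theorem hasSum_swap_fiber {f : ℕ × ℤ → ℝ} {g : ℤ → ℝ} (hf : Summable f)
    (hg : ∀ k, HasSum (fun n => f (n, k)) (g k)) : HasSum f (∑' k, g k) := by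
  have h1 : HasSum (f ∘ Prod.swap) (∑' j, f j) :=
    (Equiv.prodComm ℤ ℕ).hasSum_iff.2 hf.hasSum
  have h2 := h1.prod_fiberwise hg
  rw [h2.tsum_eq]
  exact hf.hasSum

/-- Identifies the Fourier series in x with the expansion in basis fields, as required for using the
integral form of the weak equation. -/
theorem hasSum_uField (h : P.IsModeExpansion c e ω ψ U Ω) {q : ℝ × ℝ} (hq : q ∈ P.closedStrip) :
    HasSum (fun i => c i * P.uB i q) (P.uField c U q) := by
  have h1 : HasSum (fun j => c (some j) * P.uB (some j) q) (P.fs U q) := by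
    have hs : Summable fun j : ℕ × ℤ => c (some j) * P.uB (some j) q := Summable.of_norm_bounded
      (h.summable_coeff.mul_right (√(2 / P.h) * (2 / √P.L))) fun j => abs_coeff_uB_le c j q
    refine hasSum_swap_fiber hs fun k => ?_
    refine ((h.hasSum_U k q.2 hq.2).mul_right (P.τ k q.1)).congr_fun fun n => ?_
    simp only [uB, cB]; ring
  have h2 := hasSum_option (f := fun i => c i * P.uB i q) h1
  have h3 : P.uField c U q = P.fs U q + c none * P.uB none q := by
    rw [uField, uB]; ring
  rw [h3]
  exact h2

theorem hasSum_wField (h : P.IsModeExpansion c e ω ψ U Ω) {q : ℝ × ℝ} (hq : q ∈ P.closedStrip) :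
    HasSum (fun i => c i * P.wB i q) (P.wField ψ q) := by
  have h1 : HasSum (fun j => c (some j) * P.wB (some j) q)
      (∑' k, -(P.wx k) * ψ k q.2 * P.τ (-k) q.1) := by
    have hs : Summable fun j : ℕ × ℤ => c (some j) * P.wB (some j) q := Summable.of_norm_bounded
      (h.summable_coeff.mul_right (√(2 / P.h) * (2 / √P.L))) fun j => abs_coeff_wB_le c j q
    refine hasSum_swap_fiber hs fun k => ?_
    refine (((h.hasSum_ψ k q.2 hq.2).mul_left (-(P.wx k))).mul_right
      (P.τ (-k) q.1)).congr_fun fun n => ?_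
    simp only [wB, sB]; ring
  have e1 : ∑' k, -(P.wx k) * ψ k q.2 * P.τ (-k) q.1 = P.wField ψ q := by
    rw [wField, fs, ← (Equiv.neg ℤ).tsum_eq]
    congr 1; ext k
    simp [wcoeff, wx_neg]
  rw [e1] at h1
  have h2 := hasSum_option (f := fun i => c i * P.wB i q) h1
  have h3 : P.wField ψ q = P.wField ψ q + c none * P.wB none q := by
    rw [show P.wB none q = 0 from rfl, mul_zero, add_zero]
  rw [h3]
  exact h2

end IsModeExpansion

end

end Params

end RotatingBoussinesq

/-! ### Interior regularity of the forced vorticity. -/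

namespace RotatingBoussinesq

open Filter Topology MeasureTheory

namespace Params

noncomputable section

variable (P : Params)

/-- The decay rate of the Fourier coefficients of Hölder continuous functions. -/
def wq (k : ℤ) : ℝ := P.wt k ^ (-(1 / 4) : ℝ)

theorem wq_pos (k : ℤ) : 0 < P.wq k := Real.rpow_pos_of_pos (P.wt_pos k) _

theorem wq_neg (k : ℤ) : P.wq (-k) = P.wq k := by rw [wq, wq, wt_neg]

theorem one_div_wt_le_wq (k : ℤ) : 1 / P.wt k ≤ P.wq k := by
  rw [one_div, ← Real.rpow_neg_one]
  exact Real.rpow_le_rpow_of_exponent_le (P.one_le_wt k) (by norm_num)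

theorem wt_zero : P.wt 0 = 1 := by simp [wt, wx_zero]

theorem wq_zero : P.wq 0 = 1 := by simp [wq, wt_zero]

theorem summable_wq_div_wt : Summable fun k => P.wq k / P.wt k := by
  refine (P.summable_wt_rpow (s := 5 / 4) (by norm_num)).congr fun k => ?_
  rw [wq, ← Real.rpow_sub_one (P.wt_pos k).ne']
  norm_num

theorem exists_wt_le : ∃ r : ℝ, 1 ≤ r ∧ ∀ k ≠ 0, P.wt k ≤ r * |P.wx k| := by
  have hc := P.wx_one_pos
  have h0 : 0 < 1 / P.wx 1 := by positivity
  refine ⟨1 / P.wx 1 + 1, by linarith, fun k hk => ?_⟩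
  have : 1 ≤ 1 / P.wx 1 * |P.wx k| := by
    rw [one_div_mul_eq_div, one_le_div hc]; exact P.abs_wx_ge hk
  rw [wt]; linarith

variable {P}

/-- The curl of a planar vector field. -/
def curl (P : Params) (F₁ F₂ : ℝ × ℝ → ℝ) (q : ℝ × ℝ) : ℝ := P.dx F₂ q - P.dz F₁ q

theorem continuous_slice {f : ℝ × ℝ → ℝ} (hf : ContinuousOn f P.closedStrip) {z : ℝ}
    (hz : z ∈ Icc 0 P.h) : Continuous fun x => f (x, z) :=
  hf.comp_continuous (f := fun x : ℝ => (x, z)) (by fun_prop) fun _ => ⟨mem_univ _, hz⟩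

theorem continuousOn_fc {f : ℝ × ℝ → ℝ} (hf : ContinuousOn f P.closedStrip) (k : ℤ) :
    ContinuousOn (P.fc f k) (Icc 0 P.h) :=
  continuousOn_intervalIntegral_fst (f := fun q => f q * P.τ k q.1)
    (hf.mul (by fun_prop : Continuous fun q : ℝ × ℝ => P.τ k q.1).continuousOn)

theorem fc_sub {f g : ℝ × ℝ → ℝ} {z : ℝ} (hf : Continuous fun x => f (x, z))
    (hg : Continuous fun x => g (x, z)) (k : ℤ) :
    P.fc (fun q => f q - g q) k z = P.fc f k z - P.fc g k z := by
  have c1 : Continuous fun x => f (x, z) * P.τ k x := hf.mul (P.continuous_τ k)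
  have c2 : Continuous fun x => g (x, z) * P.τ k x := hg.mul (P.continuous_τ k)
  simp only [fc, sub_mul]
  exact intervalIntegral.integral_sub (c1.intervalIntegrable _ _) (c2.intervalIntegrable _ _)

theorem fc_dx_eq {f : ℝ × ℝ → ℝ} (hf : ContDiffOn ℝ 1 f P.closedStrip) (hp : P.PeriodicX f)
    (k : ℤ) {z : ℝ} (hz : z ∈ Icc 0 P.h) : P.fc (P.dx f) k z = P.fdx (P.fc f) k z :=
  fc_dx (fun x => hasDerivAt_dx (q := (x, z)) hf ⟨mem_univ _, hz⟩)
    (continuous_slice (continuousOn_dx hf) hz) (hp.apply_L hz) k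

theorem hasDerivAt_fc {f : ℝ × ℝ → ℝ} (hf : ContDiffOn ℝ 1 f P.closedStrip) (k : ℤ) {z : ℝ}
    (hz : z ∈ Ioo 0 P.h) : HasDerivAt (P.fc f k) (P.fc (P.dz f) k z) z := by
  have hf' := hf.mono P.strip_subset
  have hτ : Continuous fun q : ℝ × ℝ => P.τ k q.1 := by fun_prop
  exact hasDerivAt_intervalIntegral_of_continuousOn P.L_pos.le hz
    (f := fun q => f q * P.τ k q.1) (f' := fun q => P.dz f q * P.τ k q.1)
    (hf'.continuousOn.mul hτ.continuousOn) ((continuousOn_dz_strip hf').mul hτ.continuousOn)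
    fun q hq => (hasDerivAt_dz_strip hf' hq).mul_const (P.τ k q.1)

/-- A gain of one derivative in the decay of Fourier coefficients. -/
theorem exists_fc_le_div_wt {f : ℝ × ℝ → ℝ} (hf : ContDiffOn ℝ 1 f P.closedStrip)
    (hp : P.PeriodicX f) {I : Set ℝ} (hI : I ⊆ Icc 0 P.h) {B : ℤ → ℝ} {D : ℝ} (hD : 0 ≤ D)
    (hB0 : B 0 = 1) (hBneg : ∀ k, B (-k) = B k) (hB : ∀ k, 0 < B k)
    (h : ∀ k, ∀ z ∈ I, |P.fc (P.dx f) k z| ≤ D * B k) :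
    ∃ C, 0 ≤ C ∧ ∀ k, ∀ z ∈ I, |P.fc f k z| ≤ C * (B k / P.wt k) := by
  obtain ⟨M, hM, hfM⟩ := exists_bound_closedStrip hp hf.continuousOn
  obtain ⟨r, hr, hrk⟩ := P.exists_wt_le
  have hr0 : 0 < r := by linarith
  have hL : 0 ≤ 2 * √P.L * M := by positivity
  refine ⟨2 * √P.L * M + r * D, by positivity, fun k z hz => ?_⟩
  by_cases hk : k = 0
  · subst hk
    rw [hB0, wt_zero, div_one, mul_one]
    have := abs_fc_le (P := P) (fun x => hfM (x, z) ⟨mem_univ _, hI hz⟩) 0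
    have : 0 ≤ r * D := by positivity
    linarith
  · have h1 := h (-k) z hz
    rw [fc_dx_eq hf hp _ (hI hz), fdx, neg_neg, abs_neg, abs_mul, wx_neg, abs_neg, hBneg] at h1
    have hw := P.wt_pos k
    have h2 : P.wt k * |P.fc f k z| ≤ r * D * B k := by
      calc _ ≤ r * |P.wx k| * |P.fc f k z| := by gcongr; exact hrk k hk
        _ = r * (|P.wx k| * |P.fc f k z|) := by ring
        _ ≤ r * (D * B k) := by gcongr
        _ = _ := by ring
    have h3 : |P.fc f k z| ≤ r * D * B k / P.wt k := by
      rw [le_div_iff₀ hw, mul_comm]; exact h2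
    refine h3.trans ?_
    have := hB k
    rw [mul_div_assoc]
    gcongr
    linarith

theorem exists_fc_le_wq {f : ℝ × ℝ → ℝ} (hf : ContDiffOn ℝ 1 f P.closedStrip)
    (hp : P.PeriodicX f) {I : Set ℝ} (hI : I ⊆ Icc 0 P.h) (hH : HolderX (P.dx f) I) :
    ∃ C, 0 ≤ C ∧ ∀ k, ∀ z ∈ I, |P.fc f k z| ≤ C * (P.wq k / P.wt k) := by
  obtain ⟨D, hD, h⟩ := hH.exists_fc_le
    (fun z hz => continuous_slice (continuousOn_dx hf) (hI hz)) fun z hz x => hp.dx x z (hI hz)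
  exact exists_fc_le_div_wt hf hp hI hD P.wq_zero P.wq_neg P.wq_pos h

theorem exists_fc_le_one_div_wt {f : ℝ × ℝ → ℝ} (hf : ContDiffOn ℝ 1 f P.closedStrip)
    (hp : P.PeriodicX f) :
    ∃ C, 0 ≤ C ∧ ∀ k, ∀ z ∈ Icc 0 P.h, |P.fc f k z| ≤ C * (1 / P.wt k) := by
  obtain ⟨M, hM, hfM⟩ := exists_bound_closedStrip hp.dx (continuousOn_dx hf)
  exact exists_fc_le_div_wt (B := fun _ => 1) hf hp Subset.rfl (D := 2 * √P.L * M) (by positivity)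
    rfl (fun _ => rfl) (fun _ => one_pos) fun k z hz => by
      rw [mul_one]; exact abs_fc_le (fun x => hfM (x, z) ⟨mem_univ _, hz⟩) k

/-- The vorticity coefficients `ω` solve the vorticity equation with the forcing `(F₁, F₂)`. -/
structure IsForcedVorticity (P : Params) (e : ℤ → ℝ) (ω ω₁ : ℤ → ℝ → ℝ) (F₁ F₂ : ℝ × ℝ → ℝ) :
    Prop where
  contDiffOn_fst : ContDiffOn ℝ 1 F₁ P.closedStrip
  contDiffOn_snd : ContDiffOn ℝ 1 F₂ P.closedStrip
  periodic_fst : P.PeriodicX F₁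
  periodic_snd : P.PeriodicX F₂
  holder : ∀ a b, 0 < a → a < b → b < P.h → HolderX (P.dx F₁) (Icc a b) ∧
    HolderX (P.dx F₂) (Icc a b) ∧ HolderX (P.dz F₁) (Icc a b)
  ode : ∀ k, IsODESolution (P.wx k) 0 P.h (ω k) (ω₁ k) fun z => -(P.fc (P.curl F₁ F₂) k z / P.ν)
  bound : ∃ M, 0 ≤ M ∧ ∀ k, ∀ z ∈ Icc 0 P.h, |ω₁ k z| ≤ M * (1 / P.wt k + P.wt k * |e k|) ∧
    P.wt k * |ω k z| ≤ M * (1 / P.wt k + P.wt k * |e k|)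
  mean : ∀ z ∈ Icc 0 P.h, P.ν * ω₁ 0 z = P.fc F₁ 0 z

variable {c : Option (ℕ × ℤ) → ℝ} {e : ℤ → ℝ} {ω ω₁ ψ U : ℤ → ℝ → ℝ} {Ω : ℤ → ℝ}
  {F₁ F₂ : ℝ × ℝ → ℝ}

/-- A bootstrap on nested slabs. Hölder continuity makes the coefficients of curl F of order
wt^{-1/4}; the equation for ω gains one power of wt for ω' and wt·ω, and the equation for ψ then
carries the gain to the velocity. The resulting rate wt^{-5/4} is summable, which is what two
continuous derivatives of the velocity need. -/
theorem IsForcedVorticity.exists_interior (hF : P.IsForcedVorticity e ω ω₁ F₁ F₂)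
    (h : P.IsModeExpansion c e ω ψ U Ω) {a b : ℝ} (ha : 0 < a) (hab : a < b) (hb : b < P.h) :
    ∃ C, 0 ≤ C ∧ ∀ k, ∀ z ∈ Icc a b, |ω₁ k z| ≤ C * (P.wq k / P.wt k) ∧
      P.wt k * |ω k z| ≤ C * (P.wq k / P.wt k) ∧ P.wt k ^ 2 * |U k z| ≤ C * (P.wq k / P.wt k) ∧
      P.wt k ^ 3 * |ψ k z| ≤ C * (P.wq k / P.wt k) := by
  have hν := P.ν_pos
  have s1 : Icc (a / 2) ((b + P.h) / 2) ⊆ Icc (a / 4) ((b + 3 * P.h) / 4) :=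
    Icc_subset_Icc (by linarith) (by linarith)
  have s2 : Icc (a / 4) ((b + 3 * P.h) / 4) ⊆ Icc 0 P.h :=
    Icc_subset_Icc (by linarith) (by linarith)
  have s3 : Icc a b ⊆ Icc (a / 2) ((b + P.h) / 2) := Icc_subset_Icc (by linarith) (by linarith)
  obtain ⟨-, hH2, hH1⟩ := hF.holder (a / 4) ((b + 3 * P.h) / 4) (by linarith) (by linarith)
    (by linarith)
  have ccurl : ContinuousOn (P.curl F₁ F₂) P.closedStrip :=
    (continuousOn_dx hF.contDiffOn_snd).sub (continuousOn_dz hF.contDiffOn_fst)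
  obtain ⟨D, hD, hDg⟩ := (hH2.sub hH1).exists_fc_le (P := P)
    (fun z hz => continuous_slice (f := P.curl F₁ F₂) ccurl (s2 hz))
    fun z hz x => by
      simp only
      rw [hF.periodic_snd.dx x z (s2 hz), hF.periodic_fst.dz x z (s2 hz)]
  obtain ⟨M, hM, hMb⟩ := hF.bound
  obtain ⟨S, hS⟩ : ∃ S, ∀ k, P.wt k * |e k| ≤ S :=
    ⟨_, fun k => h.summable_trace.le_tsum k fun j _ => mul_nonneg (P.wt_pos j).le (abs_nonneg _)⟩
  have hS0 : 0 ≤ S := (mul_nonneg (P.wt_pos 0).le (abs_nonneg _)).trans (hS 0)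
  have hMb' : ∀ k, M * (1 / P.wt k + P.wt k * |e k|) ≤ M * (1 + S) := fun k => by
    have := hS k
    have : 1 / P.wt k ≤ 1 := (div_le_one (P.wt_pos k)).2 (P.one_le_wt k)
    gcongr
  -- The powers 2 here and 4 in the next application make the boundary contributions at least as
  -- small as the interior ones; the second has to absorb a factor wt².
  obtain ⟨C₁, hC₁, hb₁⟩ := exists_interior_bound (P := P) (a := a / 4) (a' := a / 2)
    (b' := (b + P.h) / 2) (b := (b + 3 * P.h) / 4) (by linarith) (by linarith) 2
  obtain ⟨C₂, hC₂, hb₂⟩ := exists_interior_bound (P := P) (a := a / 2) (a' := a)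
    (b' := b) (b := (b + P.h) / 2) (by linarith) (by linarith) 4
  set M₂ := ∑' k, Ω k
  have hM₂ : ∀ k, Ω k ≤ M₂ := fun k => h.summable_bound.le_tsum k fun j _ => h.nonneg j
  have hM₂0 : 0 ≤ M₂ := (h.nonneg 0).trans (hM₂ 0)
  set A := C₁ * (M * (1 + S) + D / P.ν) with hA
  have hA0 : 0 ≤ A := by positivity
  have hq : ∀ k (n : ℕ), 1 / P.wt k ^ (n + 2) ≤ P.wq k / P.wt k ^ (n + 1) := fun k n => by
    have hw := P.wt_pos k
    rw [div_le_div_iff₀ (by positivity) (by positivity), one_mul, pow_succ _ (n + 1)]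
    have := P.one_div_wt_le_wq k
    rw [div_le_iff₀ hw] at this
    calc _ = 1 * P.wt k ^ (n + 1) := (one_mul _).symm
      _ ≤ (P.wq k * P.wt k) * P.wt k ^ (n + 1) := by gcongr
      _ = _ := by ring
  have step1 : ∀ k, ∀ z ∈ Icc (a / 2) ((b + P.h) / 2), |ω₁ k z| ≤ A * (P.wq k / P.wt k) ∧
      P.wt k * |ω k z| ≤ A * (P.wq k / P.wt k) := by
    intro k z hz
    have hw := P.wt_pos k
    have hkey := hb₁ k (ω k) (ω₁ k) _ (D * P.wq k / P.ν) (M * (1 + S)) (by positivity)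
      ((hF.ode k).mono s2) (fun y hy => by
        rw [abs_neg, abs_div, abs_of_pos hν]
        gcongr
        exact hDg k y hy) (fun y hy => ((hMb k y (s2 hy)).1).trans (hMb' k))
      (fun y hy => ((hMb k y (s2 hy)).2).trans (hMb' k)) z hz
    have hle : C₁ * (M * (1 + S) / P.wt k ^ 2 + D * P.wq k / P.ν / P.wt k)
        ≤ A * (P.wq k / P.wt k) := by
      have e1 : M * (1 + S) / P.wt k ^ 2 ≤ M * (1 + S) * (P.wq k / P.wt k) := by
        have := hq k 0
        rw [zero_add, zero_add, pow_one] at this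
        rw [div_eq_mul_one_div]
        gcongr
      calc _ ≤ C₁ * (M * (1 + S) * (P.wq k / P.wt k) + D * P.wq k / P.ν / P.wt k) := by gcongr
        _ = _ := by rw [hA]; ring
    exact ⟨hkey.1.trans hle, hkey.2.trans hle⟩
  set A₂ := C₂ * (M₂ + A) with hA₂
  have hA₂0 : 0 ≤ A₂ := by positivity
  refine ⟨A + A₂, by positivity, fun k z hz => ?_⟩
  have hw := P.wt_pos k
  have hwq := P.wq_pos k
  have hR : 0 ≤ P.wq k / P.wt k := by positivity
  have s4 : Icc (a / 2) ((b + P.h) / 2) ⊆ Icc 0 P.h := s1.trans s2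
  have hkey := hb₂ k (ψ k) (U k) _ (A * (P.wq k / P.wt k ^ 2)) M₂ hM₂0 ((h.ode k).mono s4)
    (fun y hy => by
      rw [abs_neg]
      have := (step1 k y hy).2
      rw [mul_comm, ← le_div_iff₀ hw] at this
      refine this.trans_eq ?_
      field_simp)
    (fun y hy => (abs_le_of_wt_mul (fun k => h.abs_U_le k y (s4 hy)) k).trans (hM₂ k))
    (fun y hy => by
      have h1 := h.abs_ψ_le k y (s4 hy)
      have h2 : P.wt k * |ψ k y| ≤ P.wt k ^ 2 * |ψ k y| := by
        gcongr
        exact le_self_pow₀ (P.one_le_wt k) two_ne_zero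
      exact h2.trans (h1.trans (hM₂ k))) z hz
  have hle : P.wt k ^ 2 * (C₂ * (M₂ / P.wt k ^ 4 + A * (P.wq k / P.wt k ^ 2) / P.wt k))
      ≤ A₂ * (P.wq k / P.wt k) := by
    have e1 : M₂ / P.wt k ^ 4 ≤ M₂ * (P.wq k / P.wt k ^ 3) := by
      rw [div_eq_mul_one_div]
      exact mul_le_mul_of_nonneg_left (hq k 2) hM₂0
    calc _ ≤ P.wt k ^ 2 * (C₂ * (M₂ * (P.wq k / P.wt k ^ 3)
          + A * (P.wq k / P.wt k ^ 2) / P.wt k)) := by gcongr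
      _ = _ := by rw [hA₂]; field_simp
  have hs := step1 k z (s3 hz)
  have e1 : A * (P.wq k / P.wt k) ≤ (A + A₂) * (P.wq k / P.wt k) := by gcongr; linarith
  have e2 : A₂ * (P.wq k / P.wt k) ≤ (A + A₂) * (P.wq k / P.wt k) := by gcongr; linarith
  refine ⟨hs.1.trans e1, hs.2.trans e1, ?_, ?_⟩
  · refine le_trans ?_ (hle.trans e2)
    gcongr
    exact hkey.1
  · refine le_trans ?_ (hle.trans e2)
    calc _ = P.wt k ^ 2 * (P.wt k * |ψ k z|) := by ring
      _ ≤ _ := mul_le_mul_of_nonneg_left hkey.2 (by positivity)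

end

end Params

end RotatingBoussinesq

/-! ### Classical regularity of the velocity and construction of the pressure. -/

namespace RotatingBoussinesq

open Filter Topology MeasureTheory

namespace Params

noncomputable section

variable {P : Params}

theorem lap_fs {a a' a'' : ℤ → ℝ → ℝ} {B : ℤ → ℝ} {l r : ℝ} (hl : 0 < l)
    (hr : r < P.h) (hB : Summable B)
    (hd : ∀ k, ∀ z ∈ Icc l r, HasDerivWithinAt (a k) (a' k z) (Icc l r) z)
    (hd' : ∀ k, ∀ z ∈ Icc l r, HasDerivWithinAt (a' k) (a'' k z) (Icc l r) z)
    (ha : ∀ k, ∀ z ∈ Icc l r, P.wt k ^ 2 * |a k z| ≤ B k)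
    (ha' : ∀ k, ∀ z ∈ Icc l r, P.wt k * |a' k z| ≤ B k)
    (ha'' : ∀ k, ∀ z ∈ Icc l r, |a'' k z| ≤ B k) {q : ℝ × ℝ} (hq : q.2 ∈ Ioo l r) :
    P.lap (P.fs a) q = P.fs (fun k z => -(P.wx k ^ 2 * a k z) + a'' k z) q := by
  have hq' := Ioo_subset_Icc_self hq
  have ha1 : ∀ k, ∀ z ∈ Icc l r, P.wt k * |a k z| ≤ B k := fun k z hz => by
    refine le_trans ?_ (ha k z hz)
    rw [pow_two, mul_assoc]
    exact le_mul_of_one_le_left (mul_nonneg (P.wt_pos k).le (abs_nonneg _)) (P.one_le_wt k)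
  have ex : P.dx (P.dx (P.fs a)) q = P.fs (fun k z => -(P.wx k ^ 2 * a k z)) q := by
    have h1 : (fun x => P.dx (P.fs a) (x, q.2)) = fun x => P.fs (P.fdx a) (x, q.2) :=
      funext fun x => (hasDerivAt_fs_fst hB (fun k => ha1 k q.2 hq') x).deriv
    have h2 := (hasDerivAt_fs_fst (P := P) (a := P.fdx a) (summable_neg_iff.2 hB)
      (fun k => wt_mul_abs_fdx_le (fun k => ha k q.2 hq') k) q.1).deriv
    rw [dx, h1, h2]
    refine fs_congr fun k => ?_
    simp only [fdx, wx_neg, neg_neg]; ring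
  have ez : P.dz (P.dz (P.fs a)) q = P.fs a'' q := by
    have hs : ∀ z ∈ Ioo l r, (q.1, z) ∈ P.strip := fun z hz =>
      ⟨mem_univ _, hl.trans hz.1, hz.2.trans hr⟩
    have h1 : ∀ z ∈ Ioo l r, P.dz (P.fs a) (q.1, z) = P.fs a' (q.1, z) := fun z hz => by
      rw [dz_eq_deriv (hs z hz)]
      exact ((hasDerivWithinAt_fs_snd (q := (q.1, z)) (convex_Icc l r) hB hd
        (fun k z hz => abs_le_of_wt_mul (fun k => ha1 k z hz) k)
        (fun k z hz => abs_le_of_wt_mul (fun k => ha' k z hz) k)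
        (Ioo_subset_Icc_self hz)).hasDerivAt (Icc_mem_nhds hz.1 hz.2)).deriv
    rw [dz_eq_deriv (hs q.2 hq)]
    have h2 : (fun z => P.dz (P.fs a) (q.1, z)) =ᶠ[𝓝 q.2] fun z => P.fs a' (q.1, z) := by
      filter_upwards [Ioo_mem_nhds hq.1 hq.2] with z hz using h1 z hz
    rw [h2.deriv_eq]
    exact ((hasDerivWithinAt_fs_snd (q := q) (convex_Icc l r) hB hd'
        (fun k z hz => abs_le_of_wt_mul (fun k => ha' k z hz) k) ha'' hq').hasDerivAt
        (Icc_mem_nhds hq.1 hq.2)).deriv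
  rw [lap, ex, ez, ← fs_add hB (fun k => ?_) hB fun k => ha'' k q.2 hq']
  rw [abs_neg, abs_mul, abs_of_nonneg (sq_nonneg (P.wx k))]
  exact (mul_le_mul_of_nonneg_right (IsModeExpansion.wx_sq_le k) (abs_nonneg _)).trans (ha k q.2 hq')

theorem lap_add_const {f : ℝ × ℝ → ℝ} (r : ℝ) (q : ℝ × ℝ) : P.lap (fun q => f q + r) q = P.lap f q := by
  have h1 : P.dx (fun q => f q + r) = P.dx f := by
    ext q; exact deriv_add_const _
  have h2 : P.dz (fun q => f q + r) = P.dz f := by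
    ext q; exact derivWithin_add_const _
  rw [lap, lap, h1, h2]

namespace IsForcedVorticity

variable {c : Option (ℕ × ℤ) → ℝ} {e : ℤ → ℝ} {ω ω₁ ψ U : ℤ → ℝ → ℝ} {Ω : ℤ → ℝ}
  {F₁ F₂ : ℝ × ℝ → ℝ}

/-- For a solenoidal field Δu = -∂_z ω; on the modes this is U'' - κ²U = -ω'. -/
theorem regular_uField (hF : P.IsForcedVorticity e ω ω₁ F₁ F₂)
    (h : P.IsModeExpansion c e ω ψ U Ω) {a b : ℝ} (ha : 0 < a) (hab : a < b) (hb : b < P.h) :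
    ContDiffOn ℝ 2 (P.uField c U) (univ ×ˢ Icc a b) ∧
      ∀ q : ℝ × ℝ, q.2 ∈ Ioo a b → P.lap (P.uField c U) q = -P.fs ω₁ q := by
  have hs : Icc a b ⊆ Icc 0 P.h := Icc_subset_Icc ha.le hb.le
  obtain ⟨C, hC, hCb⟩ := hF.exists_interior h ha hab hb
  have hB : Summable fun k => 2 * C * (P.wq k / P.wt k) := P.summable_wq_div_wt.mul_left _
  have hR : ∀ k, 0 ≤ P.wq k / P.wt k := fun k => (div_pos (P.wq_pos k) (P.wt_pos k)).le
  have hCR : ∀ k, 0 ≤ C * (P.wq k / P.wt k) := fun k => mul_nonneg hC (hR k)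
  have hd : ∀ k, ∀ z ∈ Icc a b, HasDerivWithinAt (U k) (P.uzcoeff ω ψ k z) (Icc a b) z :=
    fun k z hz => ((h.ode k).mono hs).deriv_one z hz
  have hd' : ∀ k, ∀ z ∈ Icc a b, HasDerivWithinAt (P.uzcoeff ω ψ k)
      (P.wx k ^ 2 * U k z + -ω₁ k z) (Icc a b) z := fun k z hz =>
    ((((h.ode k).mono hs).deriv_zero z hz).const_mul _).add
      (((hF.ode k).mono hs).deriv_zero z hz).neg
  have b1 : ∀ k, ∀ z ∈ Icc a b, P.wt k ^ 2 * |U k z| ≤ 2 * C * (P.wq k / P.wt k) := fun k z hz => by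
    linarith [(hCb k z hz).2.2.1, hCR k]
  have b2 : ∀ k, ∀ z ∈ Icc a b, P.wt k * |P.uzcoeff ω ψ k z| ≤ 2 * C * (P.wq k / P.wt k) :=
    fun k z hz => by
      have hw := P.wt_pos k
      calc _ ≤ P.wt k * (P.wt k ^ 2 * |ψ k z| + |ω k z|) := by
            gcongr
            refine (abs_add_le _ _).trans ?_
            rw [abs_mul, abs_neg, abs_of_nonneg (sq_nonneg (P.wx k))]
            exact add_le_add (mul_le_mul_of_nonneg_right (IsModeExpansion.wx_sq_le k)
              (abs_nonneg _)) le_rfl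
        _ = P.wt k ^ 3 * |ψ k z| + P.wt k * |ω k z| := by ring
        _ ≤ _ := by linarith [(hCb k z hz).2.2.2, (hCb k z hz).2.1]
  have b3 : ∀ k, ∀ z ∈ Icc a b, |P.wx k ^ 2 * U k z + -ω₁ k z| ≤ 2 * C * (P.wq k / P.wt k) :=
    fun k z hz => by
      refine (abs_add_le _ _).trans ?_
      rw [abs_mul, abs_neg, abs_of_nonneg (sq_nonneg (P.wx k))]
      have := mul_le_mul_of_nonneg_right (IsModeExpansion.wx_sq_le (P := P) k) (abs_nonneg (U k z))
      linarith [(hCb k z hz).2.2.1, (hCb k z hz).1]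
  refine ⟨(contDiffOn_two_fs (convex_Icc a b) (uniqueDiffOn_Icc hab) hB hd hd' (fun k => ?_)
    b1 b2 b3).add contDiffOn_const, fun q hq => ?_⟩
  · exact (continuousOn_const.mul ((h.ode k).mono hs).continuousOn_one).add
      ((hF.ode k).mono hs).continuousOn_one.neg
  · have h1 := lap_add_const (P := P) (f := P.fs U) (c none / √(P.L * P.h)) q
    have h2 := lap_fs ha hb hB hd hd' b1 b2 b3 hq
    have h3 : P.lap (P.uField c U) q = _ := h1.trans h2
    rw [h3, neg_eq_neg_one_mul, ← fs_const_mul]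
    refine fs_congr fun k => ?_
    ring

/-- The companion relation Δw = ∂ₓω. -/
theorem regular_wField (hF : P.IsForcedVorticity e ω ω₁ F₁ F₂)
    (h : P.IsModeExpansion c e ω ψ U Ω) {a b : ℝ} (ha : 0 < a) (hab : a < b) (hb : b < P.h) :
    ContDiffOn ℝ 2 (P.wField ψ) (univ ×ˢ Icc a b) ∧
      ∀ q : ℝ × ℝ, q.2 ∈ Ioo a b → P.lap (P.wField ψ) q = P.fs (P.fdx ω) q := by
  have hs : Icc a b ⊆ Icc 0 P.h := Icc_subset_Icc ha.le hb.le
  obtain ⟨C, hC, hCb⟩ := hF.exists_interior h ha hab hb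
  have hB : Summable fun k => 2 * C * (P.wq k / P.wt k) := P.summable_wq_div_wt.mul_left _
  have hR : ∀ k, 0 ≤ P.wq k / P.wt k := fun k => (div_pos (P.wq_pos k) (P.wt_pos k)).le
  have hCR : ∀ k, 0 ≤ C * (P.wq k / P.wt k) := fun k => mul_nonneg hC (hR k)
  have hCb' : ∀ k, ∀ z ∈ Icc a b, P.wt k * |ω (-k) z| ≤ C * (P.wq k / P.wt k) ∧
      P.wt k ^ 2 * |U (-k) z| ≤ C * (P.wq k / P.wt k) ∧
      P.wt k ^ 3 * |ψ (-k) z| ≤ C * (P.wq k / P.wt k) := fun k z hz => by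
    have := (hCb (-k) z hz).2
    rwa [wt_neg, wq_neg] at this
  have hd : ∀ k, ∀ z ∈ Icc a b, HasDerivWithinAt (P.wcoeff ψ k) (P.wx k * U (-k) z) (Icc a b) z :=
    fun k z hz => (h.hasDerivWithinAt_wcoeff k (hs hz)).mono hs
  have hd' : ∀ k, ∀ z ∈ Icc a b, HasDerivWithinAt (fun z => P.wx k * U (-k) z)
      (P.wx k * P.uzcoeff ω ψ (-k) z) (Icc a b) z := fun k z hz =>
    (((h.ode (-k)).mono hs).deriv_one z hz).const_mul _
  have hwx : ∀ k (t : ℝ), |P.wx k * t| ≤ P.wt k * |t| := fun k t => by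
    rw [abs_mul]
    exact mul_le_mul_of_nonneg_right (P.abs_wx_le_wt k) (abs_nonneg _)
  have b1 : ∀ k, ∀ z ∈ Icc a b, P.wt k ^ 2 * |P.wcoeff ψ k z| ≤ 2 * C * (P.wq k / P.wt k) :=
    fun k z hz => by
      have hw := P.wt_pos k
      calc _ ≤ P.wt k ^ 2 * (P.wt k * |ψ (-k) z|) := by gcongr; exact hwx _ _
        _ = P.wt k ^ 3 * |ψ (-k) z| := by ring
        _ ≤ _ := by linarith [(hCb' k z hz).2.2, hCR k]
  have b2 : ∀ k, ∀ z ∈ Icc a b, P.wt k * |P.wx k * U (-k) z| ≤ 2 * C * (P.wq k / P.wt k) :=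
    fun k z hz => by
      have hw := P.wt_pos k
      calc _ ≤ P.wt k * (P.wt k * |U (-k) z|) := by gcongr; exact hwx _ _
        _ = P.wt k ^ 2 * |U (-k) z| := by ring
        _ ≤ _ := by linarith [(hCb' k z hz).2.1, hCR k]
  have b3 : ∀ k, ∀ z ∈ Icc a b, |P.wx k * P.uzcoeff ω ψ (-k) z| ≤ 2 * C * (P.wq k / P.wt k) :=
    fun k z hz => by
      have hw := P.wt_pos k
      calc _ ≤ P.wt k * |P.uzcoeff ω ψ (-k) z| := hwx _ _
        _ ≤ P.wt k * (P.wt k ^ 2 * |ψ (-k) z| + |ω (-k) z|) := by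
            gcongr
            refine (abs_add_le _ _).trans ?_
            rw [abs_mul, abs_neg, abs_of_nonneg (sq_nonneg (P.wx (-k)))]
            have := IsModeExpansion.wx_sq_le (P := P) (-k)
            rw [wt_neg] at this
            exact add_le_add (mul_le_mul_of_nonneg_right this (abs_nonneg _)) le_rfl
        _ = P.wt k ^ 3 * |ψ (-k) z| + P.wt k * |ω (-k) z| := by ring
        _ ≤ _ := by linarith [(hCb' k z hz).2.2, (hCb' k z hz).1]
  refine ⟨contDiffOn_two_fs (convex_Icc a b) (uniqueDiffOn_Icc hab) hB hd hd' (fun k => ?_)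
    b1 b2 b3, fun q hq => ?_⟩
  · exact continuousOn_const.mul ((continuousOn_const.mul ((h.ode (-k)).mono hs).continuousOn).add
      ((hF.ode (-k)).mono hs).continuousOn.neg)
  · rw [wField, lap_fs ha hb hB hd hd' b1 b2 b3 hq]
    refine fs_congr fun k => ?_
    simp only [wcoeff, uzcoeff, fdx, wx_neg]; ring

/-- The Fourier coefficients of the pressure. -/
def pcoeff (P : Params) (ω₁ : ℤ → ℝ → ℝ) (F₁ F₂ : ℝ × ℝ → ℝ) (k : ℤ) (z : ℝ) : ℝ :=
  if k = 0 then ∫ y in (0 : ℝ)..z, P.fc F₂ 0 y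
  else (P.fc F₁ (-k) z - P.ν * ω₁ (-k) z) / P.wx k

/-- The zonal momentum equation on the modes. For k ≠ 0 it defines the pressure; for k = 0 the
x-derivative of a periodic pressure has no mean, so the equation is a solvability condition,
supplied by the mean balance. -/
theorem fdx_pcoeff (hF : P.IsForcedVorticity e ω ω₁ F₁ F₂) (k : ℤ) {z : ℝ} (hz : z ∈ Icc 0 P.h) :
    P.fdx (pcoeff P ω₁ F₁ F₂) k z = P.fc F₁ k z - P.ν * ω₁ k z := by
  by_cases hk : k = 0
  · subst hk
    rw [hF.mean z hz]
    simp [fdx, wx_zero]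
  · have := P.wx_ne_zero hk
    rw [fdx, pcoeff, if_neg (by simpa using hk), neg_neg, wx_neg]
    field_simp

/-- The vertical momentum equation on the modes. For k = 0 it is the definition; for k ≠ 0 it is the
vorticity equation, that is, the compatibility of the two components of ∇p. -/
theorem hasDerivAt_pcoeff (hF : P.IsForcedVorticity e ω ω₁ F₁ F₂) (k : ℤ) {z : ℝ}
    (hz : z ∈ Ioo 0 P.h) :
    HasDerivAt (pcoeff P ω₁ F₁ F₂ k) (P.fc F₂ k z + P.ν * P.fdx ω k z) z := by
  have hz' := Ioo_subset_Icc_self hz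
  have hν := P.ν_pos.ne'
  by_cases hk : k = 0
  · subst hk
    have e1 : pcoeff P ω₁ F₁ F₂ 0 = fun z => ∫ y in (0 : ℝ)..z, P.fc F₂ 0 y := by
      ext z; simp [pcoeff]
    have hc := continuousOn_fc (P := P) hF.contDiffOn_snd.continuousOn 0
    have h1 : ContinuousOn (P.fc F₂ 0) (uIcc 0 z) := by
      rw [uIcc_of_le hz.1.le]
      exact hc.mono (Icc_subset_Icc le_rfl hz.2.le)
    rw [e1]
    refine (intervalIntegral.integral_hasDerivAt_right h1.intervalIntegrable ?_
      (hc.continuousAt (Icc_mem_nhds hz.1 hz.2))).congr_deriv (by simp [fdx, wx_zero])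
    exact (hc.mono Ioo_subset_Icc_self).stronglyMeasurableAtFilter isOpen_Ioo z hz
  · have e1 : pcoeff P ω₁ F₁ F₂ k
        = fun z => (P.fc F₁ (-k) z - P.ν * ω₁ (-k) z) / P.wx k := by
      ext z; simp [pcoeff, hk]
    have hw := P.wx_ne_zero hk
    rw [e1]
    have h1 := ((hF.ode (-k)).deriv_one z hz').hasDerivAt (Icc_mem_nhds hz.1 hz.2)
    refine (((hasDerivAt_fc hF.contDiffOn_fst (-k) hz).sub (h1.const_mul P.ν)).div_const
      (P.wx k)).congr_deriv ?_
    have e2 : P.fc (P.curl F₁ F₂) (-k) z = P.fc (P.dx F₂) (-k) z - P.fc (P.dz F₁) (-k) z :=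
      fc_sub (continuous_slice (continuousOn_dx hF.contDiffOn_snd) hz')
        (continuous_slice (continuousOn_dz hF.contDiffOn_fst) hz') (-k)
    rw [e2, fc_dx_eq hF.contDiffOn_snd hF.periodic_snd _ hz', fdx, fdx, neg_neg, wx_neg]
    field_simp
    ring

/-- On interior slabs the pressure coefficients decay fast enough for a C¹ series. Up to the
boundary a weaker bound, involving the traces e, still gives uniform convergence and hence
continuity. -/
theorem exists_pressure (hF : P.IsForcedVorticity e ω ω₁ F₁ F₂)
    (h : P.IsModeExpansion c e ω ψ U Ω) :
    ∃ p : ℝ × ℝ → ℝ, ContinuousOn p P.closedStrip ∧ ContDiffOn ℝ 1 p P.strip ∧ P.PeriodicX p ∧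
      ∀ q ∈ P.strip, P.dx p q = F₁ q + P.ν * P.lap (P.uField c U) q ∧
        P.dz p q = F₂ q + P.ν * P.lap (P.wField ψ) q := by
  have hν := P.ν_pos
  obtain ⟨r, hr, hrk⟩ := P.exists_wt_le
  have hr0 : 0 < r := by linarith
  obtain ⟨D, hD⟩ : ∃ D, ∀ z ∈ Icc 0 P.h, |∫ y in (0 : ℝ)..z, P.fc F₂ 0 y| ≤ D := by
    have hc := continuousOn_fc (P := P) hF.contDiffOn_snd.continuousOn 0
    obtain ⟨C, hC⟩ := isCompact_Icc.exists_bound_of_continuousOn hc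
    have hC0 : 0 ≤ C := (norm_nonneg _).trans (hC 0 (left_mem_Icc.2 P.h_pos.le))
    refine ⟨C * P.h, fun z hz => ?_⟩
    have h1 := intervalIntegral.norm_integral_le_of_norm_le_const (a := 0) (b := z)
      (f := P.fc F₂ 0) (C := C) fun y hy => by
        rw [uIoc_of_le hz.1] at hy
        exact hC y ⟨hy.1.le, hy.2.trans hz.2⟩
    refine h1.trans ?_
    rw [sub_zero, abs_of_nonneg hz.1]
    gcongr
    exact hz.2
  have hD0 : 0 ≤ D := (abs_nonneg _).trans (hD 0 (left_mem_Icc.2 P.h_pos.le))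
  -- One estimate for both uses: R is the rate wq/wt on slabs and a cruder rate on the closed strip.
  -- Evenness of R is needed because the coefficient at k is made from data at -k.
  have hpk : ∀ {R : ℤ → ℝ} {I : Set ℝ}, (∀ k, R (-k) = R k) → 1 ≤ R 0 → (∀ k, 0 ≤ R k) → I ⊆ Icc 0 P.h →
      ∀ A B, (∀ k, ∀ z ∈ I, |P.fc F₁ k z| ≤ A * R k) → (∀ k, ∀ z ∈ I, |ω₁ k z| ≤ B * R k) →
      0 ≤ A → 0 ≤ B → ∀ k, ∀ z ∈ I, P.wt k * |pcoeff P ω₁ F₁ F₂ k z| ≤ (D + r * (A + P.ν * B)) * R k := by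
    intro R I hR hR0 hRp hI A B hA hB hA0 hB0 k z hz
    by_cases hk : k = 0
    · subst hk
      rw [pcoeff, if_pos rfl, wt_zero, one_mul]
      have h1 : 0 ≤ r * (A + P.ν * B) := by positivity
      have h2 : D + r * (A + P.ν * B) ≤ (D + r * (A + P.ν * B)) * R 0 :=
        le_mul_of_one_le_right (by positivity) hR0
      linarith [hD z (hI hz)]
    · have hw : 0 < |P.wx k| := abs_pos.2 (P.wx_ne_zero hk)
      rw [pcoeff, if_neg hk, abs_div, mul_div_assoc', div_le_iff₀ hw]
      have h1 : |P.fc F₁ (-k) z - P.ν * ω₁ (-k) z| ≤ (A + P.ν * B) * R k := by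
        refine (abs_sub _ _).trans ?_
        rw [abs_mul, abs_of_pos hν, add_mul, mul_assoc]
        have h2 := hA (-k) z hz
        have h3 := hB (-k) z hz
        rw [hR] at h2 h3
        gcongr
      have hRk := hRp k
      calc _ ≤ (r * |P.wx k|) * ((A + P.ν * B) * R k) := by gcongr; exact hrk k hk
        _ = (r * (A + P.ν * B)) * R k * |P.wx k| := by ring
        _ ≤ _ := by gcongr; linarith
  have hcont : ∀ k, ContinuousOn (pcoeff P ω₁ F₁ F₂ k) (Icc 0 P.h) := fun k => by
    by_cases hk : k = 0
    · subst hk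
      have e1 : pcoeff P ω₁ F₁ F₂ 0 = fun z => ∫ y in (0 : ℝ)..z, P.fc F₂ 0 y := by
        ext z; simp [pcoeff]
      rw [e1]
      have hc := continuousOn_fc (P := P) hF.contDiffOn_snd.continuousOn 0
      have := intervalIntegral.continuousOn_primitive_interval (a := 0) (b := P.h)
        (f := P.fc F₂ 0) (μ := volume) (by
          rw [uIcc_of_le P.h_pos.le]; exact hc.integrableOn_compact isCompact_Icc)
      rwa [uIcc_of_le P.h_pos.le] at this
    · have e1 : pcoeff P ω₁ F₁ F₂ k
          = fun z => (P.fc F₁ (-k) z - P.ν * ω₁ (-k) z) / P.wx k := by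
        ext z; simp [pcoeff, hk]
      rw [e1]
      exact ((continuousOn_fc hF.contDiffOn_fst.continuousOn (-k)).sub
        (continuousOn_const.mul (hF.ode (-k)).continuousOn_one)).div_const _
  have hslab : ∀ a b, 0 < a → a < b → b < P.h →
      ContDiffOn ℝ 1 (P.fs (pcoeff P ω₁ F₁ F₂)) (univ ×ˢ Icc a b) ∧
      ∀ q : ℝ × ℝ, q.2 ∈ Ioo a b →
        P.dx (P.fs (pcoeff P ω₁ F₁ F₂)) q = F₁ q + P.ν * P.lap (P.uField c U) q ∧
        P.dz (P.fs (pcoeff P ω₁ F₁ F₂)) q = F₂ q + P.ν * P.lap (P.wField ψ) q := by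
    intro a b ha hab hb
    have hs : Icc a b ⊆ Icc 0 P.h := Icc_subset_Icc ha.le hb.le
    have hs' : Icc a b ⊆ Ioo 0 P.h := fun z hz => ⟨ha.trans_le hz.1, hz.2.trans_lt hb⟩
    obtain ⟨hH1, hH2, -⟩ := hF.holder a b ha hab hb
    obtain ⟨A₁, hA₁, hA₁b⟩ := exists_fc_le_wq hF.contDiffOn_fst hF.periodic_fst hs hH1
    obtain ⟨A₂, hA₂, hA₂b⟩ := exists_fc_le_wq hF.contDiffOn_snd hF.periodic_snd hs hH2
    obtain ⟨C, hC, hCb⟩ := hF.exists_interior h ha hab hb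
    set E := D + r * (A₁ + P.ν * C) + (A₂ + P.ν * C) with hE
    have hR : ∀ k, 0 ≤ P.wq k / P.wt k := fun k => (div_pos (P.wq_pos k) (P.wt_pos k)).le
    have hB : Summable fun k => E * (P.wq k / P.wt k) := P.summable_wq_div_wt.mul_left _
    have b1 : ∀ k, ∀ z ∈ Icc a b, P.wt k * |pcoeff P ω₁ F₁ F₂ k z| ≤ E * (P.wq k / P.wt k) :=
      fun k z hz => by
        refine (hpk (R := fun k => P.wq k / P.wt k) (fun k => by simp only [wq_neg, wt_neg])
          (by simp only [wq_zero, wt_zero, div_one, le_refl]) hR hs A₁ C hA₁b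
          (fun k z hz => (hCb k z hz).1) hA₁ hC k z hz).trans ?_
        have := hR k
        gcongr
        rw [hE]
        linarith [mul_nonneg hν.le hC]
    have bω : ∀ k, ∀ z ∈ Icc a b, |P.fdx ω k z| ≤ C * (P.wq k / P.wt k) := fun k z hz => by
      have := abs_fdx_le (P := P) (a := ω) (z := z) (fun k => (hCb k z hz).2.1) k
      rwa [wq_neg, wt_neg] at this
    have b2 : ∀ k, ∀ z ∈ Icc a b, |P.fc F₂ k z + P.ν * P.fdx ω k z| ≤ E * (P.wq k / P.wt k) :=
      fun k z hz => by
        refine (abs_add_le _ _).trans ?_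
        rw [abs_mul, abs_of_pos hν]
        calc _ ≤ A₂ * (P.wq k / P.wt k) + P.ν * (C * (P.wq k / P.wt k)) := by
              gcongr
              · exact hA₂b k z hz
              · exact bω k z hz
          _ = (A₂ + P.ν * C) * (P.wq k / P.wt k) := by ring
          _ ≤ _ := by
            have := hR k
            gcongr
            rw [hE]
            have : 0 ≤ r * (A₁ + P.ν * C) := by positivity
            linarith
    have hd : ∀ k, ∀ z ∈ Icc a b, HasDerivWithinAt (pcoeff P ω₁ F₁ F₂ k)
        (P.fc F₂ k z + P.ν * P.fdx ω k z) (Icc a b) z := fun k z hz =>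
      (hF.hasDerivAt_pcoeff k (hs' hz)).hasDerivWithinAt
    have hc' : ∀ k, ContinuousOn (fun z => P.fc F₂ k z + P.ν * P.fdx ω k z) (Icc a b) := fun k =>
      ((continuousOn_fc hF.contDiffOn_snd.continuousOn k).mono hs).add (continuousOn_const.mul
        ((continuousOn_const.mul ((hF.ode (-k)).mono hs).continuousOn).neg))
    refine ⟨contDiffOn_one_fs (convex_Icc a b) (uniqueDiffOn_Icc hab) hB hd hc' b1 b2,
      fun q hq => ?_⟩
    have hq' := Ioo_subset_Icc_self hq
    have hq0 : q ∈ P.strip := ⟨mem_univ _, hs' hq'⟩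
    constructor
    · have h1 : P.dx (P.fs (pcoeff P ω₁ F₁ F₂)) q = P.fs (P.fdx (pcoeff P ω₁ F₁ F₂)) q :=
        (hasDerivAt_fs_fst hB (fun k => b1 k q.2 hq') q.1).deriv
      have h2 : P.fs (P.fdx (pcoeff P ω₁ F₁ F₂)) q
          = P.fs (fun k z => P.fc F₁ k z + -P.ν * ω₁ k z) q := fs_congr fun k => by
        rw [hF.fdx_pcoeff k (hs hq')]; ring
      have h3 := fs_fc (continuous_slice hF.contDiffOn_fst.continuousOn (hs hq'))
        (fun x => hF.periodic_fst x q.2 (hs hq')) (P.summable_wq_div_wt.mul_left A₁)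
        (fun k => hA₁b k q.2 hq') q.1
      rw [h1, h2, fs_add (b := fun k z => -P.ν * ω₁ k z) (P.summable_wq_div_wt.mul_left A₁)
        (fun k => hA₁b k q.2 hq') (P.summable_wq_div_wt.mul_left (P.ν * C)) (fun k => by
          rw [abs_mul, abs_neg, abs_of_pos hν, mul_assoc]
          gcongr
          exact (hCb k q.2 hq').1), fs_const_mul, (hF.regular_uField h ha hab hb).2 q hq, h3]
      ring
    · have h1 : P.dz (P.fs (pcoeff P ω₁ F₁ F₂)) q
          = P.fs (fun k z => P.fc F₂ k z + P.ν * P.fdx ω k z) q := by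
        rw [dz_eq_deriv hq0]
        exact ((hasDerivWithinAt_fs_snd (q := q) (convex_Icc a b) hB hd
          (fun k z hz => abs_le_of_wt_mul (fun k => b1 k z hz) k) b2 hq').hasDerivAt
          (Icc_mem_nhds hq.1 hq.2)).deriv
      have h3 := fs_fc (continuous_slice hF.contDiffOn_snd.continuousOn (hs hq'))
        (fun x => hF.periodic_snd x q.2 (hs hq')) (P.summable_wq_div_wt.mul_left A₂)
        (fun k => hA₂b k q.2 hq') q.1
      rw [h1, fs_add (b := fun k z => P.ν * P.fdx ω k z) (P.summable_wq_div_wt.mul_left A₂)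
        (fun k => hA₂b k q.2 hq') (P.summable_wq_div_wt.mul_left (P.ν * C)) (fun k => by
          rw [abs_mul, abs_of_pos hν, mul_assoc]
          gcongr
          exact bω k q.2 hq'), fs_const_mul, (hF.regular_wField h ha hab hb).2 q hq, h3]
  refine ⟨P.fs (pcoeff P ω₁ F₁ F₂), ?_, contDiffOn_strip_of_Icc fun a b ha hab hb =>
    (hslab a b ha hab hb).1, periodicX_fs _, fun q hq => ?_⟩
  · obtain ⟨A, hA, hAb⟩ := exists_fc_le_one_div_wt hF.contDiffOn_fst hF.periodic_fst
    obtain ⟨M, hM, hMb⟩ := hF.bound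
    -- The bound for ω' up to the boundary contains wt|e k|; the last summand makes R even. After
    -- division by wt all three parts are summable.
    set R : ℤ → ℝ := fun k => P.wq k + P.wt k * |e k| + P.wt k * |e (-k)| with hRdef
    have he : ∀ k, 0 ≤ P.wt k * |e k| := fun k => mul_nonneg (P.wt_pos k).le (abs_nonneg _)
    have he' : ∀ k, 0 ≤ P.wt k * |e (-k)| := fun k => mul_nonneg (P.wt_pos k).le (abs_nonneg _)
    have hR : ∀ k, 0 ≤ R k := fun k =>
      add_nonneg (add_nonneg (P.wq_pos k).le (he k)) (he' k)
    have hle : ∀ k, 1 / P.wt k + P.wt k * |e k| ≤ R k := fun k => by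
      simp only [hRdef]
      linarith [P.one_div_wt_le_wq k, he' k]
    have hle' : ∀ k, 1 / P.wt k ≤ R k := fun k => by linarith [hle k, he k]
    have b := hpk (R := R) (I := Icc 0 P.h)
      (fun k => by simp only [hRdef, wq_neg, wt_neg, neg_neg]; ring)
      (by simp only [hRdef, wq_zero]; linarith [he 0, he' 0]) hR Subset.rfl A M
      (fun k z hz => (hAb k z hz).trans (mul_le_mul_of_nonneg_left (hle' k) hA))
      (fun k z hz => (hMb k z hz).1.trans (mul_le_mul_of_nonneg_left (hle k) hM)) hA hM
    have se : Summable fun k => |e k| := Summable.of_nonneg_of_le (fun _ => abs_nonneg _)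
      (fun k => le_mul_of_one_le_left (abs_nonneg _) (P.one_le_wt k)) h.summable_trace
    have hs : Summable fun k => (D + r * (A + P.ν * M)) * (P.wq k / P.wt k + |e k| + |e (-k)|) :=
      ((P.summable_wq_div_wt.add se).add (summable_neg_iff.2 se)).mul_left _
    refine continuousOn_fs hs hcont fun k z hz => ?_
    have hw := P.wt_pos k
    have h1 := b k z hz
    rw [mul_comm, ← le_div_iff₀ hw] at h1
    refine h1.trans_eq ?_
    simp only [hRdef]
    field_simp
  · have hz1 : 0 < q.2 := hq.2.1
    have hz2 : q.2 < P.h := hq.2.2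
    exact (hslab (q.2 / 2) ((q.2 + P.h) / 2) (by linarith) (by linarith) (by linarith)).2 q
      ⟨by linarith, by linarith⟩

end IsForcedVorticity

end

end Params

end RotatingBoussinesq

/-! ### From a positive form to a classical growing solution of the momentum equations. -/

namespace RotatingBoussinesq

open Filter Topology MeasureTheory

namespace Params

noncomputable section

variable {P : Params}

/-- Without forcing, the coefficients are -α e k times those of the trace functional, so pairing the
trace with e k gives e k² ≤ 0 for k ≠ 0. This rules out a nonzero coefficient vector with zero
velocity field. -/
theorem IsWeakMode.eq_zero {c : Option (ℕ × ℤ) → ℝ} {e : ℤ → ℝ} {G : ℕ × ℤ → ℝ}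
    (hw : P.IsWeakMode c e G) (hG : ∀ j, G j = 0) (he : e 0 = 0) (i : Option (ℕ × ℤ)) : c i = 0 := by
  have hα := P.α_pos
  have hh := P.h_pos
  have hc : ∀ n k, c (some (n, k)) = -(P.α * √(2 / P.h) * e k * (P.wz n / P.ev n k)) := fun n k => by
    rw [hw.coeff_eq, hG]; ring
  have hek : ∀ k, e k = 0 := fun k => by
    by_cases hk : k = 0
    · rw [hk, he]
    · have h1 := (hw.trace k).mul_left (e k)
      rw [if_neg hk, sub_zero] at h1
      have h2 := hasSum_le (fun n => ?_) h1 hasSum_zero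
      · exact mul_self_eq_zero.1 (le_antisymm h2 (mul_self_nonneg _))
      · rw [hc]
        have : 0 ≤ P.α * (√(2 / P.h) * e k * (P.wz n / P.ev n k)) ^ 2 := by positivity
        nlinarith
  have hc0 : ∀ j, c (some j) = 0 := fun j => by
    rw [hc j.1 j.2, hek]; ring
  cases i with
  | some j => exact hc0 j
  | none =>
    have h1 := hw.trace 0
    simp only [hc0, mul_zero, hek, if_true, zero_sub] at h1
    have h2 := h1.unique hasSum_zero
    rw [neg_eq_zero, div_eq_zero_iff] at h2
    exact h2.resolve_right (Real.sqrt_pos.2 hh).ne'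

section Holder

variable {m n u w : ℝ × ℝ → ℝ} {a b : ℝ}

theorem holderX_linear_comb {m' n' u' w' F : ℝ × ℝ → ℝ} {I : Set ℝ} (hm : HolderX m I)
    (hn : HolderX n I) (hu : HolderX u I) (hw : HolderX w I) (hm' : HolderX m' I)
    (hn' : HolderX n' I) (hu' : HolderX u' I) (hw' : HolderX w' I)
    (h : ∀ z ∈ I, ∀ x, F (x, z) = (m' (x, z) * u (x, z) + m (x, z) * u' (x, z))
      + (n' (x, z) * w (x, z) + n (x, z) * w' (x, z))) : HolderX F I :=
  HolderX.congr (((hm'.mul hu).add (hm.mul hu')).add ((hn'.mul hw).add (hn.mul hw'))) h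

theorem holderX_dx_linear_comb (hm : ContDiffOn ℝ 2 m P.strip) (hn : ContDiffOn ℝ 2 n P.strip)
    (hu : ContDiffOn ℝ 1 u P.strip) (hw : ContDiffOn ℝ 1 w P.strip) (pm : P.PeriodicX m)
    (pn : P.PeriodicX n) (pu : P.PeriodicX u) (pw : P.PeriodicX w) (ha : 0 < a) (hb : b < P.h)
    (hu' : HolderX (P.dx u) (Icc a b)) (hw' : HolderX (P.dx w) (Icc a b)) :
    HolderX (P.dx fun q => m q * u q + n q * w q) (Icc a b) := by
  have m1 := hm.of_le (by norm_num : (1 : WithTop ℕ∞) ≤ 2)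
  have n1 := hn.of_le (by norm_num : (1 : WithTop ℕ∞) ≤ 2)
  refine holderX_linear_comb (holderX_of_contDiffOn pm m1 ha hb) (holderX_of_contDiffOn pn n1 ha hb)
    (holderX_of_contDiffOn pu hu ha hb) (holderX_of_contDiffOn pw hw ha hb)
    (holderX_of_contDiffOn pm.dx (contDiffOn_one_dx_strip hm) ha hb)
    (holderX_of_contDiffOn pn.dx (contDiffOn_one_dx_strip hn) ha hb) hu' hw' fun z hz x => ?_
  have hq : (x, z) ∈ P.strip := ⟨mem_univ _, ha.trans_le hz.1, hz.2.trans_lt hb⟩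
  exact (((hasDerivAt_dx_strip m1 hq).mul (hasDerivAt_dx_strip hu hq)).add
    ((hasDerivAt_dx_strip n1 hq).mul (hasDerivAt_dx_strip hw hq))).deriv

theorem holderX_dz_linear_comb (hm : ContDiffOn ℝ 2 m P.strip) (hn : ContDiffOn ℝ 2 n P.strip)
    (hu : ContDiffOn ℝ 1 u P.strip) (hw : ContDiffOn ℝ 1 w P.strip) (pm : P.PeriodicX m)
    (pn : P.PeriodicX n) (pu : P.PeriodicX u) (pw : P.PeriodicX w) (ha : 0 < a) (hb : b < P.h)
    (hu' : HolderX (P.dz u) (Icc a b)) (hw' : HolderX (P.dz w) (Icc a b)) :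
    HolderX (P.dz fun q => m q * u q + n q * w q) (Icc a b) := by
  have m1 := hm.of_le (by norm_num : (1 : WithTop ℕ∞) ≤ 2)
  have n1 := hn.of_le (by norm_num : (1 : WithTop ℕ∞) ≤ 2)
  refine holderX_linear_comb (holderX_of_contDiffOn pm m1 ha hb) (holderX_of_contDiffOn pn n1 ha hb)
    (holderX_of_contDiffOn pu hu ha hb) (holderX_of_contDiffOn pw hw ha hb)
    (holderX_of_contDiffOn pm.dz (contDiffOn_one_dz_strip hm) ha hb)
    (holderX_of_contDiffOn pn.dz (contDiffOn_one_dz_strip hn) ha hb) hu' hw' fun z hz x => ?_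
  have hq : (x, z) ∈ P.strip := ⟨mem_univ _, ha.trans_le hz.1, hz.2.trans_lt hb⟩
  rw [dz_eq_deriv hq]
  exact (((hasDerivAt_dz_strip m1 hq).mul (hasDerivAt_dz_strip hu hq)).add
    ((hasDerivAt_dz_strip n1 hq).mul (hasDerivAt_dz_strip hw hq))).deriv

end Holder

namespace IsModeExpansion

variable {c : Option (ℕ × ℤ) → ℝ} {e : ℤ → ℝ} {ω ψ U : ℤ → ℝ → ℝ} {Ω : ℤ → ℝ} {I : Set ℝ}

theorem summable_weight_neg (h : P.IsModeExpansion c e ω ψ U Ω) :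
    Summable fun k => P.wt k ^ (1 / 4 : ℝ) * Ω (-k) := by
  have := summable_neg_iff.2 h.summable
  simpa only [wt_neg] using this

theorem holderX_dx_uField (h : P.IsModeExpansion c e ω ψ U Ω) (hI : I ⊆ Icc 0 P.h) :
    HolderX (P.dx (P.uField c U)) I :=
  (holderX_fs (a := P.fdx U) h.summable_weight_neg fun k z hz =>
    abs_fdx_le (fun k => h.abs_U_le k z (hI hz)) k).congr fun _ hz _ => h.dx_uField ⟨mem_univ _, hI hz⟩

theorem holderX_dz_uField (h : P.IsModeExpansion c e ω ψ U Ω) (hI : I ⊆ Icc 0 P.h) :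
    HolderX (P.dz (P.uField c U)) I := by
  have hs : Summable fun k => P.wt k ^ (1 / 4 : ℝ) * (2 * Ω k) :=
    (h.summable.mul_left 2).congr fun k => by ring
  exact (holderX_fs hs fun k z hz => h.abs_uzcoeff_le k (hI hz)).congr
    fun _ hz _ => h.dz_uField ⟨mem_univ _, hI hz⟩

theorem holderX_dx_wField (h : P.IsModeExpansion c e ω ψ U Ω) (hI : I ⊆ Icc 0 P.h) :
    HolderX (P.dx (P.wField ψ)) I :=
  (holderX_fs (a := P.fdx (P.wcoeff ψ)) h.summable fun k z hz => by
    have := abs_fdx_le (P := P) (fun k => h.abs_wcoeff_le k (hI hz)) k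
    rwa [neg_neg] at this).congr fun _ hz _ => h.dx_wField ⟨mem_univ _, hI hz⟩

theorem holderX_dz_wField (h : P.IsModeExpansion c e ω ψ U Ω) (hI : I ⊆ Icc 0 P.h) :
    HolderX (P.dz (P.wField ψ)) I :=
  (holderX_fs h.summable_weight_neg fun k _ hz => h.abs_wx_mul_U_le k (hI hz)).congr
    fun _ hz _ => h.dz_wField ⟨mem_univ _, hI hz⟩

end IsModeExpansion

theorem integral_cell_mul_sB {g : ℝ × ℝ → ℝ} (hg : ContinuousOn g P.closedStrip) (n : ℕ) (k : ℤ) :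
    ∫ q in P.cell, g q * P.sB (n, k) q = ∫ z in (0 : ℝ)..P.h, P.fc g k z * P.sn n z := by
  rw [integral_cell_swap (f := fun q => g q * P.sB (n, k) q)
    (hg.mul (by fun_prop : Continuous (P.sB (n, k))).continuousOn)]
  congr 1; ext z
  rw [fc, ← intervalIntegral.integral_mul_const]
  congr 1; ext x
  simp only [sB]; ring

theorem integral_cell_mul_uB_none {g : ℝ × ℝ → ℝ} (hg : ContinuousOn g P.closedStrip) :
    ∫ q in P.cell, g q * P.uB none q = (∫ z in (0 : ℝ)..P.h, P.fc g 0 z) / √P.h := by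
  rw [integral_cell_swap (f := fun q => g q * P.uB none q)
    (hg.mul (by fun_prop : Continuous (P.uB none)).continuousOn),
    ← intervalIntegral.integral_div]
  congr 1; ext z
  rw [fc, ← intervalIntegral.integral_div]
  congr 1; ext x
  have h1 := Real.sqrt_pos.2 P.L_pos
  have h2 := Real.sqrt_pos.2 P.h_pos
  simp only [uB, τ, wx_zero, zero_mul, Real.cos_zero, Real.sin_zero, add_zero]
  rw [Real.sqrt_mul P.L_pos.le]
  field_simp

/-- The mean of the zonal momentum balance. -/
theorem mean_balance {F₁ F₂ : ℝ × ℝ → ℝ} {W W₁ : ℝ → ℝ} {e₀ : ℝ}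
    (h₁ : ContDiffOn ℝ 1 F₁ P.closedStrip) (h₂ : ContDiffOn ℝ 1 F₂ P.closedStrip)
    (p₂ : P.PeriodicX F₂)
    (hW : IsODESolution (P.wx 0) 0 P.h W W₁ fun z => -(P.fc (P.curl F₁ F₂) 0 z / P.ν))
    (hW0 : W 0 = -(P.α * e₀)) (hWh : W P.h = 0)
    (hH : ∫ z in (0 : ℝ)..P.h, P.fc F₁ 0 z = P.ν * P.α * e₀) {z : ℝ} (hz : z ∈ Icc 0 P.h) :
    P.ν * W₁ z = P.fc F₁ 0 z := by
  have hh := P.h_pos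
  have hν := P.ν_pos.ne'
  have cF := continuousOn_fc h₁.continuousOn 0
  have cD : ContinuousOn (fun z => P.ν * W₁ z - P.fc F₁ 0 z) (Icc 0 P.h) :=
    (continuousOn_const.mul hW.continuousOn_one).sub cF
  have hd : ∀ y ∈ Ioo 0 P.h, HasDerivAt (fun z => P.ν * W₁ z - P.fc F₁ 0 z) 0 y := fun y hy => by
    have hy' := Ioo_subset_Icc_self hy
    have d1 := ((hW.deriv_one y hy').hasDerivAt (Icc_mem_nhds hy.1 hy.2)).const_mul P.ν
    refine (d1.sub (hasDerivAt_fc h₁ 0 hy)).congr_deriv ?_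
    have e2 : P.fc (P.curl F₁ F₂) 0 y = P.fc (P.dx F₂) 0 y - P.fc (P.dz F₁) 0 y :=
      fc_sub (continuous_slice (continuousOn_dx h₂) hy')
        (continuous_slice (continuousOn_dz h₁) hy') 0
    rw [e2, fc_dx_eq h₂ p₂ _ hy', fdx, wx_zero]
    field_simp
    ring
  have hconst : ∀ y ∈ Icc 0 P.h, P.ν * W₁ y - P.fc F₁ 0 y = P.ν * W₁ 0 - P.fc F₁ 0 0 := by
    intro y hy
    rcases hy.1.eq_or_lt with rfl | hy0
    · rfl
    obtain ⟨t, -, ht⟩ := exists_hasDerivAt_eq_slope (fun z => P.ν * W₁ z - P.fc F₁ 0 z) (fun _ => 0)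
      hy0 (cD.mono (Icc_subset_Icc le_rfl hy.2)) fun t ht => hd t ⟨ht.1, ht.2.trans_le hy.2⟩
    have := (div_eq_zero_iff.1 ht.symm).resolve_right (by linarith)
    linarith
  -- The vorticity equation makes νW' minus the mean forcing constant in z. The boundary values of W
  -- and the weak equation tested with the uniform flow show that this constant has zero integral.
  have i1 : ∫ y in (0 : ℝ)..P.h, W₁ y = P.α * e₀ := by
    rw [intervalIntegral.integral_eq_sub_of_hasDerivAt_of_le hh.le hW.continuousOn
      (fun y hy => (hW.deriv_zero y (Ioo_subset_Icc_self hy)).hasDerivAt (Icc_mem_nhds hy.1 hy.2))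
      (hW.continuousOn_one.intervalIntegrable_of_Icc hh.le), hW0, hWh]
    ring
  have i2 : ∫ y in (0 : ℝ)..P.h, (P.ν * W₁ y - P.fc F₁ 0 y) = 0 := by
    have j1 : IntervalIntegrable (fun y => P.ν * W₁ y) volume 0 P.h :=
      (continuousOn_const.mul hW.continuousOn_one).intervalIntegrable_of_Icc hh.le
    rw [intervalIntegral.integral_sub j1 (cF.intervalIntegrable_of_Icc hh.le), intervalIntegral.integral_const_mul, i1, hH]
    ring
  rw [intervalIntegral.integral_congr (g := fun _ => P.ν * W₁ 0 - P.fc F₁ 0 0) (fun y hy => by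
    rw [uIcc_of_le hh.le] at hy
    exact hconst y hy), intervalIntegral.integral_const, smul_eq_mul, sub_zero] at i2
  have := (mul_eq_zero.1 i2).resolve_left hh.ne'
  linarith [hconst z hz]

set_option maxHeartbeats 800000 in
/-- A quadratic form that is positive on some field yields a growing mode. -/
theorem exists_regular_mode {b₁₁ b₁₂ b₂₂ : ℝ × ℝ → ℝ} (h₁₁ : ContDiffOn ℝ 1 b₁₁ P.closedStrip)
    (h₁₂ : ContDiffOn ℝ 1 b₁₂ P.closedStrip) (h₂₂ : ContDiffOn ℝ 1 b₂₂ P.closedStrip)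
    (h₁₁' : ContDiffOn ℝ 2 b₁₁ P.strip) (h₁₂' : ContDiffOn ℝ 2 b₁₂ P.strip)
    (h₂₂' : ContDiffOn ℝ 2 b₂₂ P.strip)
    (p₁₁ : P.PeriodicX b₁₁) (p₁₂ : P.PeriodicX b₁₂) (p₂₂ : P.PeriodicX b₂₂)
    {s : Finset (Option (ℕ × ℤ))} {a : Option (ℕ × ℤ) → ℝ}
    (hpos : 0 < ∫ q in P.cell, (b₁₁ q * (∑ i ∈ s, a i * P.uB i q) ^ 2
      + 2 * b₁₂ q * ((∑ i ∈ s, a i * P.uB i q) * ∑ i ∈ s, a i * P.wB i q)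
      + b₂₂ q * (∑ i ∈ s, a i * P.wB i q) ^ 2)) :
    ∃ lam : ℝ, 0 < lam ∧ ∃ u w p : ℝ × ℝ → ℝ, ContDiffOn ℝ 1 u P.closedStrip ∧
      ContDiffOn ℝ 1 w P.closedStrip ∧ ContinuousOn p P.closedStrip ∧
      ContDiffOn ℝ 2 u P.strip ∧ ContDiffOn ℝ 2 w P.strip ∧ ContDiffOn ℝ 1 p P.strip ∧
      P.PeriodicX u ∧ P.PeriodicX w ∧ P.PeriodicX p ∧ P.BoundaryConditions u w ∧
      (∀ q ∈ P.strip, P.dx u q + P.dz w q = 0) ∧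
      (∀ q ∈ P.strip, lam * u q
        = P.ν * P.lap u q - P.dx p q + (b₁₁ q * u q + b₁₂ q * w q) / lam) ∧
      (∀ q ∈ P.strip, lam * w q
        = P.ν * P.lap w q - P.dz p q + (b₁₂ q * u q + b₂₂ q * w q) / lam) ∧
      ∃ q ∈ P.strip, u q ≠ 0 ∨ w q ≠ 0 := by
  obtain ⟨lam, hlam, c, e, G, H, ⟨i₀, hi₀⟩, -, hG, htr, heq, hH, hweak⟩ :=
    exists_weak_mode h₁₁ h₁₂ h₂₂ p₁₂ p₂₂ hpos
  have hwm : P.IsWeakMode c e G := ⟨hG, htr, heq⟩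
  obtain ⟨ω, ψ, U, Ω, h, C, hC, hω₁⟩ := hwm.exists_expansion
  have hu := h.contDiffOn_uField
  have hw := h.contDiffOn_wField
  have pu := IsModeExpansion.periodicX_uField (P := P) (c := c) (U := U)
  have pw := IsModeExpansion.periodicX_wField (P := P) (ψ := ψ)
  set u := P.uField c U with hudef
  set w := P.wField ψ with hwdef
  have hid := hweak u w hu.continuousOn hw.continuousOn
    ⟨_, h.summable_coeff_bound |c none * P.uB none 0|, fun i q _ => by
      cases i with
      | none => exact le_rfl
      | some j => exact IsModeExpansion.abs_coeff_uB_le c j q⟩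
    ⟨_, h.summable_coeff_bound 0, fun i q _ => by
      cases i with
      | none => simp [wB]
      | some j => exact IsModeExpansion.abs_coeff_wB_le c j q⟩
    (fun q hq => h.hasSum_uField (P.cell_subset hq)) fun q hq => h.hasSum_wField (P.cell_subset hq)
  -- The matrix m = b/λ - λ gives the forcing F = m·(u,w) in the Stokes system; its entries inherit
  -- the regularity of b.
  set m₁₁ : ℝ × ℝ → ℝ := fun q => b₁₁ q / lam - lam with hm₁₁
  set m₁₂ : ℝ × ℝ → ℝ := fun q => b₁₂ q / lam with hm₁₂
  set m₂₂ : ℝ × ℝ → ℝ := fun q => b₂₂ q / lam - lam with hm₂₂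
  set F₁ : ℝ × ℝ → ℝ := fun q => m₁₁ q * u q + m₁₂ q * w q with hF₁
  set F₂ : ℝ × ℝ → ℝ := fun q => m₁₂ q * u q + m₂₂ q * w q with hF₂
  have e₁ : ∀ q, F₁ q = (b₁₁ q * u q + b₁₂ q * w q) / lam - lam * u q := fun q => by
    simp only [hF₁, hm₁₁, hm₁₂]; ring
  have e₂ : ∀ q, F₂ q = (b₁₂ q * u q + b₂₂ q * w q) / lam - lam * w q := fun q => by
    simp only [hF₂, hm₂₂, hm₁₂]; ring
  simp only [← e₁, ← e₂] at hid
  have cm₁₁ : ContDiffOn ℝ 1 m₁₁ P.closedStrip := (h₁₁.div_const _).sub contDiffOn_const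
  have cm₁₂ : ContDiffOn ℝ 1 m₁₂ P.closedStrip := h₁₂.div_const _
  have cm₂₂ : ContDiffOn ℝ 1 m₂₂ P.closedStrip := (h₂₂.div_const _).sub contDiffOn_const
  have cF₁ : ContDiffOn ℝ 1 F₁ P.closedStrip := (cm₁₁.mul hu).add (cm₁₂.mul hw)
  have cF₂ : ContDiffOn ℝ 1 F₂ P.closedStrip := (cm₁₂.mul hu).add (cm₂₂.mul hw)
  have pm₁₁ : P.PeriodicX m₁₁ := fun x z hz => by simp only [hm₁₁]; rw [p₁₁ x z hz]
  have pm₁₂ : P.PeriodicX m₁₂ := fun x z hz => by simp only [hm₁₂]; rw [p₁₂ x z hz]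
  have pm₂₂ : P.PeriodicX m₂₂ := fun x z hz => by simp only [hm₂₂]; rw [p₂₂ x z hz]
  have pF₁ : P.PeriodicX F₁ := fun x z hz => by
    simp only [hF₁]; rw [pm₁₁ x z hz, pm₁₂ x z hz, pu x z hz, pw x z hz]
  have pF₂ : P.PeriodicX F₂ := fun x z hz => by
    simp only [hF₂]; rw [pm₁₂ x z hz, pm₂₂ x z hz, pu x z hz, pw x z hz]
  have ccurl : ContinuousOn (P.curl F₁ F₂) P.closedStrip :=
    (continuousOn_dx cF₂).sub (continuousOn_dz cF₁)
  have hGs : ∀ n k, ∫ z in (0 : ℝ)..P.h, P.fc (P.curl F₁ F₂) k z * P.sn n z = G (n, k) := by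
    intro n k
    have h1 := hid (some (n, k))
    rw [integral_curl cF₁.continuousOn cF₂.continuousOn (continuousOn_dz cF₁) (continuousOn_dx cF₂)
      (fun q hq => hasDerivWithinAt_dz cF₁ hq) (fun q hq => hasDerivAt_dx cF₂ hq) pF₂ (n, k)] at h1
    rw [← integral_cell_mul_sB ccurl]
    have hev := P.ev_pos n k
    simp only [Option.elim_some] at h1
    rw [one_div, inv_mul_eq_div, div_left_inj' hev.ne'] at h1
    exact h1
  have hHs : ∫ z in (0 : ℝ)..P.h, P.fc F₁ 0 z = P.ν * P.α * e 0 := by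
    have h1 := hid none
    have hsq := Real.sqrt_pos.2 P.h_pos
    have h2 : (∫ q in P.cell, F₂ q * P.wB none q) = 0 := by simp [wB]
    rw [h2, add_zero, integral_cell_mul_uB_none cF₁.continuousOn, Option.elim_none, ← hH] at h1
    exact (div_left_inj' hsq.ne').1 h1
  have pcurl : P.PeriodicX (P.curl F₁ F₂) := fun x z hz => by
    simp only [curl]; rw [pF₂.dx x z hz, pF₁.dz x z hz]
  obtain ⟨M, hM, hMb⟩ := exists_bound_closedStrip pcurl ccurl
  have hL : 0 ≤ 2 * √P.L * M := by positivity
  have hex := fun k => hω₁ k (P.fc (P.curl F₁ F₂) k) (2 * √P.L * M) (continuousOn_fc ccurl k)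
    (fun z hz => abs_fc_le (fun x => hMb (x, z) ⟨mem_univ _, hz⟩) k) fun n => hGs n k
  choose ω₁ hode hbd using hex
  have hF : P.IsForcedVorticity e ω ω₁ F₁ F₂ := by
    refine ⟨cF₁, cF₂, pF₁, pF₂, fun a b ha _ hb => ?_, hode, ?_, fun z hz => ?_⟩
    · have hI : Icc a b ⊆ Icc 0 P.h := Icc_subset_Icc ha.le hb.le
      have cm₁₁' : ContDiffOn ℝ 2 m₁₁ P.strip := (h₁₁'.div_const _).sub contDiffOn_const
      have cm₁₂' : ContDiffOn ℝ 2 m₁₂ P.strip := h₁₂'.div_const _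
      have cm₂₂' : ContDiffOn ℝ 2 m₂₂ P.strip := (h₂₂'.div_const _).sub contDiffOn_const
      have hu' := hu.mono P.strip_subset
      have hw' := hw.mono P.strip_subset
      exact ⟨holderX_dx_linear_comb cm₁₁' cm₁₂' hu' hw' pm₁₁ pm₁₂ pu pw ha hb
          (h.holderX_dx_uField hI) (h.holderX_dx_wField hI),
        holderX_dx_linear_comb cm₁₂' cm₂₂' hu' hw' pm₁₂ pm₂₂ pu pw ha hb
          (h.holderX_dx_uField hI) (h.holderX_dx_wField hI),
        holderX_dz_linear_comb cm₁₁' cm₁₂' hu' hw' pm₁₁ pm₁₂ pu pw ha hb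
          (h.holderX_dz_uField hI) (h.holderX_dz_wField hI)⟩
    · refine ⟨C * (2 * √P.L * M + 1), by positivity, fun k z hz => ?_⟩
      have hwt := P.wt_pos k
      have hle : C * (2 * √P.L * M / P.wt k + P.wt k * |e k|)
          ≤ C * (2 * √P.L * M + 1) * (1 / P.wt k + P.wt k * |e k|) := by
        rw [mul_assoc C]
        refine mul_le_mul_of_nonneg_left ?_ hC.le
        have q1 : 0 ≤ 1 / P.wt k := by positivity
        have q2 : 0 ≤ 2 * √P.L * M * (P.wt k * |e k|) := by positivity
        have q3 : 2 * √P.L * M / P.wt k = 2 * √P.L * M * (1 / P.wt k) := by ring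
        rw [q3]
        linarith
      exact ⟨(hbd k z hz).1.trans hle, (hbd k z hz).2.trans hle⟩
    · exact mean_balance cF₁ cF₂ pF₂ (hode 0) (h.ω_zero 0) (h.ω_h 0) hHs hz
  obtain ⟨p, cp, cp1, pp, hp⟩ := hF.exists_pressure h
  refine ⟨lam, hlam, u, w, p, hu, hw, cp,
    contDiffOn_strip_of_Icc fun a b ha hab hb => (hF.regular_uField h ha hab hb).1,
    contDiffOn_strip_of_Icc fun a b ha hab hb => (hF.regular_wField h ha hab hb).1, cp1, pu, pw, pp,
    h.boundaryConditions, fun q hq => h.div_free (P.strip_subset hq), fun q hq => ?_,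
    fun q hq => ?_, ?_⟩
  · rw [(hp q hq).1, e₁]; ring
  · rw [(hp q hq).2, e₂]; ring
  -- If the velocity vanished, so would F, hence G and the mean term H, and then every coefficient,
  -- contrary to the choice of the kernel vector.
  · by_contra hcon
    push Not at hcon
    have zu := eqOn_closedStrip hu.continuousOn (continuousOn_const (c := (0 : ℝ)))
      fun q hq => (hcon q hq).1
    have zw := eqOn_closedStrip hw.continuousOn (continuousOn_const (c := (0 : ℝ)))
      fun q hq => (hcon q hq).2
    have zF : ∀ q ∈ P.closedStrip, F₁ q = 0 ∧ F₂ q = 0 := fun q hq => by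
      rw [e₁, e₂, zu q hq, zw q hq]; simp
    have hid0 : ∀ j : Option (ℕ × ℤ), (j.elim H fun j => G j / P.ev j.1 j.2) = 0 := fun j => by
      rw [← hid j, setIntegral_eq_zero_of_forall_eq_zero fun q hq => by
          rw [(zF q (P.cell_subset hq)).1, zero_mul],
        setIntegral_eq_zero_of_forall_eq_zero fun q hq => by
          rw [(zF q (P.cell_subset hq)).2, zero_mul], add_zero]
    refine hi₀ (hwm.eq_zero (fun j => ?_) ?_ i₀)
    · have := hid0 (some j)
      rw [Option.elim_some, div_eq_zero_iff] at this
      exact this.resolve_right (P.ev_pos j.1 j.2).ne'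
    · have h1 := hid0 none
      have hsq := (Real.sqrt_pos.2 P.h_pos).ne'
      have hνα : P.ν * P.α ≠ 0 := mul_ne_zero P.ν_pos.ne' P.α_pos.ne'
      rw [Option.elim_none, ← hH, div_eq_zero_iff] at h1
      exact (mul_eq_zero.1 (h1.resolve_right hsq)).resolve_left hνα

end

end Params

end RotatingBoussinesq

/-! ### Analyticity of the harmonic potential. -/

namespace RotatingBoussinesq

open Filter Topology MeasureTheory

namespace Params

noncomputable section

variable {P : Params}

theorem harmonicAt_of_lap {Ψ : ℝ × ℝ → ℝ} (hΨ : ContDiffOn ℝ 2 Ψ P.strip)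
    (hh : ∀ q ∈ P.strip, P.lap Ψ q = 0) {ζ : ℂ} (hζ : (ζ.re, ζ.im) ∈ P.strip) :
    InnerProductSpace.HarmonicAt (fun ζ : ℂ => Ψ (ζ.re, ζ.im)) ζ := by
  set f : ℂ → ℝ := fun ζ => Ψ (ζ.re, ζ.im) with hf
  set V : Set ℂ := {ζ | (ζ.re, ζ.im) ∈ P.strip} with hV
  have hVo : IsOpen V := P.isOpen_strip.preimage
    (f := fun ζ : ℂ => (ζ.re, ζ.im)) (by fun_prop)
  have hsm : ∀ ζ ∈ V, ContDiffAt ℝ 2 f ζ := fun ζ hζ => by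
    have h1 : ContDiffAt ℝ 2 (fun ζ : ℂ => (ζ.re, ζ.im)) ζ :=
      Complex.equivRealProdCLM.contDiff.contDiffAt
    exact (hΨ.contDiffAt (P.isOpen_strip.mem_nhds hζ)).comp ζ h1
  have hΨ1 := hΨ.of_le (by norm_num : (1 : WithTop ℕ∞) ≤ 2)
  have h1 : ∀ ζ ∈ V, fderiv ℝ f ζ 1 = P.dx Ψ (ζ.re, ζ.im) := fun ζ hζ => by
    have hd := ((hsm ζ hζ).differentiableAt two_ne_zero).hasFDerivAt
    have hl : HasDerivAt (fun x : ℝ => (⟨x, ζ.im⟩ : ℂ)) 1 ζ.re := by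
      have := (Complex.ofRealCLM.hasDerivAt (x := ζ.re)).add_const (ζ.im * Complex.I)
      refine (this.congr_deriv (by simp)).congr_of_eventuallyEq (.of_forall fun x => ?_)
      simp [Complex.mk_eq_add_mul_I]
    have := HasFDerivAt.comp_hasDerivAt (x := ζ.re) (f := fun x : ℝ => (⟨x, ζ.im⟩ : ℂ)) hd hl
    exact this.deriv.symm
  have hI : ∀ ζ ∈ V, fderiv ℝ f ζ Complex.I = P.dz Ψ (ζ.re, ζ.im) := fun ζ hζ => by
    have hd := ((hsm ζ hζ).differentiableAt two_ne_zero).hasFDerivAt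
    have hl : HasDerivAt (fun y : ℝ => (⟨ζ.re, y⟩ : ℂ)) Complex.I ζ.im := by
      have := ((Complex.ofRealCLM.hasDerivAt (x := ζ.im)).mul_const Complex.I).const_add (ζ.re : ℂ)
      refine (this.congr_deriv (by simp)).congr_of_eventuallyEq (.of_forall fun x => ?_)
      simp [Complex.mk_eq_add_mul_I]
    have := HasFDerivAt.comp_hasDerivAt (x := ζ.im) (f := fun y : ℝ => (⟨ζ.re, y⟩ : ℂ)) hd hl
    rw [dz_eq_deriv hζ]
    exact this.deriv.symm
  have hdf : ∀ ζ ∈ V, HasFDerivAt (fderiv ℝ f) (fderiv ℝ (fderiv ℝ f) ζ) ζ := fun ζ hζ =>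
    (((hsm ζ hζ).fderiv_right (m := 1) (by norm_num)).differentiableAt one_ne_zero).hasFDerivAt
  have hxx : ∀ ζ ∈ V, fderiv ℝ (fderiv ℝ f) ζ 1 1 = P.dx (P.dx Ψ) (ζ.re, ζ.im) := fun ζ hζ => by
    have hl : HasDerivAt (fun x : ℝ => (⟨x, ζ.im⟩ : ℂ)) 1 ζ.re := by
      have := (Complex.ofRealCLM.hasDerivAt (x := ζ.re)).add_const (ζ.im * Complex.I)
      refine (this.congr_deriv (by simp)).congr_of_eventuallyEq (.of_forall fun x => ?_)
      simp [Complex.mk_eq_add_mul_I]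
    have h2 := (HasFDerivAt.comp_hasDerivAt (x := ζ.re) (f := fun x : ℝ => (⟨x, ζ.im⟩ : ℂ))
      (hdf ζ hζ) hl).clm_apply (hasDerivAt_const ζ.re (1 : ℂ))
    have h3 := h2.deriv
    simp only [map_zero, add_zero] at h3
    rw [← h3]
    show deriv _ _ = deriv _ _
    congr 1
    ext x
    exact h1 ⟨x, ζ.im⟩ ⟨mem_univ _, hζ.2⟩
  have hzz : ∀ ζ ∈ V, fderiv ℝ (fderiv ℝ f) ζ Complex.I Complex.I = P.dz (P.dz Ψ) (ζ.re, ζ.im) :=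
    fun ζ hζ => by
    have hl : HasDerivAt (fun y : ℝ => (⟨ζ.re, y⟩ : ℂ)) Complex.I ζ.im := by
      have := ((Complex.ofRealCLM.hasDerivAt (x := ζ.im)).mul_const Complex.I).const_add (ζ.re : ℂ)
      refine (this.congr_deriv (by simp)).congr_of_eventuallyEq (.of_forall fun x => ?_)
      simp [Complex.mk_eq_add_mul_I]
    have h2 := (HasFDerivAt.comp_hasDerivAt (x := ζ.im) (f := fun y : ℝ => (⟨ζ.re, y⟩ : ℂ))
      (hdf ζ hζ) hl).clm_apply (hasDerivAt_const ζ.im Complex.I)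
    have h3 := h2.deriv
    simp only [map_zero, add_zero] at h3
    rw [← h3, dz_eq_deriv hζ]
    refine EventuallyEq.deriv_eq ?_
    filter_upwards [Ioo_mem_nhds hζ.2.1 hζ.2.2] with y hy
    exact hI ⟨ζ.re, y⟩ ⟨mem_univ _, hy⟩
  refine ⟨hsm ζ hζ, ?_⟩
  filter_upwards [hVo.mem_nhds hζ] with ξ hξ
  have := hh (ξ.re, ξ.im) hξ
  rw [lap, ← hxx ξ hξ, ← hzz ξ hξ] at this
  rw [InnerProductSpace.laplacian_eq_iteratedFDeriv_complexPlane]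
  simpa [iteratedFDeriv_two_apply] using this

theorem analyticOnNhd_of_lap {Ψ : ℝ × ℝ → ℝ} (hΨ : ContDiffOn ℝ 2 Ψ P.strip)
    (hh : ∀ q ∈ P.strip, P.lap Ψ q = 0) : AnalyticOnNhd ℝ Ψ P.strip := by
  intro q hq
  have h1 := HarmonicAt.analyticAt (harmonicAt_of_lap hΨ hh (ζ := ⟨q.1, q.2⟩) hq)
  exact AnalyticAt.comp (f := fun q : ℝ × ℝ => (⟨q.1, q.2⟩ : ℂ)) h1
    (Complex.equivRealProdCLM.symm.analyticAt q)

theorem analyticOnNhd_grad_of_lap {Ψ : ℝ × ℝ → ℝ} (hΨ : ContDiffOn ℝ 2 Ψ P.strip)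
    (hh : ∀ q ∈ P.strip, P.lap Ψ q = 0) :
    AnalyticOnNhd ℝ (P.dx Ψ) P.strip ∧ AnalyticOnNhd ℝ (P.dz Ψ) P.strip := by
  have h1 := (analyticOnNhd_of_lap hΨ hh).fderiv
  have hΨ1 := hΨ.of_le (by norm_num : (1 : WithTop ℕ∞) ≤ 2)
  have key : ∀ v : ℝ × ℝ, AnalyticOnNhd ℝ (fun q => fderiv ℝ Ψ q v) P.strip := fun v q hq =>
    ((ContinuousLinearMap.apply ℝ ℝ v).analyticAt _).comp (h1 q hq)
  exact ⟨(key (1, 0)).congr P.isOpen_strip fun q hq => (dx_eq_fderiv hΨ1 hq).symm,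
    (key (0, 1)).congr P.isOpen_strip fun q hq => (dz_eq_fderiv hΨ1 hq).symm⟩

/-- With ∇Ψ of class C² inside, the matrix B is C² there although Ψ is only assumed C²; the Hölder
estimates for the derivatives of Bu rely on this. -/
theorem contDiffOn_grad_of_lap {Ψ : ℝ × ℝ → ℝ} (hΨ : ContDiffOn ℝ 2 Ψ P.strip)
    (hh : ∀ q ∈ P.strip, P.lap Ψ q = 0) :
    ContDiffOn ℝ 2 (P.dx Ψ) P.strip ∧ ContDiffOn ℝ 2 (P.dz Ψ) P.strip := by
  obtain ⟨h1, h2⟩ := analyticOnNhd_grad_of_lap hΨ hh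
  exact ⟨fun q hq => (h1 q hq).contDiffAt.contDiffWithinAt,
    fun q hq => (h2 q hq).contDiffAt.contDiffWithinAt⟩

theorem isPreconnected_strip : IsPreconnected P.strip :=
  isPreconnected_univ.prod isPreconnected_Ioo

/-- The gradient of a nonconstant harmonic function does not vanish on an open set. -/
theorem exists_grad_ne_zero {Ψ : ℝ × ℝ → ℝ} (hΨ : ContDiffOn ℝ 2 Ψ P.strip)
    (hh : ∀ q ∈ P.strip, P.lap Ψ q = 0) (hne : ∃ q ∈ P.strip, P.dx Ψ q ≠ 0 ∨ P.dz Ψ q ≠ 0)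
    {V : Set (ℝ × ℝ)} {q₀ : ℝ × ℝ} (hq₀ : q₀ ∈ P.strip)
    (hVq : V ∈ 𝓝 q₀) : ∃ q ∈ V ∩ P.strip, P.dx Ψ q ≠ 0 ∨ P.dz Ψ q ≠ 0 := by
  obtain ⟨h1, h2⟩ := analyticOnNhd_grad_of_lap hΨ hh
  by_contra hcon
  push Not at hcon
  have hV' : V ∩ P.strip ∈ 𝓝 q₀ := inter_mem hVq (P.isOpen_strip.mem_nhds hq₀)
  have z1 := h1.eqOn_zero_of_preconnected_of_eventuallyEq_zero isPreconnected_strip hq₀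
    (by filter_upwards [hV'] with q hq using (hcon q hq).1)
  have z2 := h2.eqOn_zero_of_preconnected_of_eventuallyEq_zero isPreconnected_strip hq₀
    (by filter_upwards [hV'] with q hq using (hcon q hq).2)
  obtain ⟨q, hq, h⟩ := hne
  exact h.elim (fun h => h (z1 hq)) fun h => h (z2 hq)

end

end Params

end RotatingBoussinesq

/-! ### C¹ approximation by trigonometric sums. -/

namespace RotatingBoussinesq

open Filter Topology MeasureTheory

/-- Squared positive parts are the simplest C¹ cut-offs, and C¹ is all the test stream function
needs. -/
theorem hasDerivAt_sq_posPart (y : ℝ) : HasDerivAt (fun y : ℝ => max y 0 ^ 2) (2 * max y 0) y := by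
  rcases lt_trichotomy y 0 with h | rfl | h
  · rw [max_eq_right h.le, mul_zero]
    refine (hasDerivAt_const y (0 : ℝ)).congr_of_eventuallyEq ?_
    filter_upwards [Iio_mem_nhds h] with x hx
    rw [max_eq_right (le_of_lt hx)]; simp
  · rw [max_self, mul_zero, hasDerivAt_iff_isLittleO]
    have h1 : (fun x : ℝ => (x - 0) ^ 2) =o[𝓝 0] fun x => x - 0 := by
      simpa using Asymptotics.isLittleO_pow_id (𝕜 := ℝ) (n := 2) one_lt_two
    refine Asymptotics.IsBigO.trans_isLittleO (Asymptotics.IsBigO.of_bound 1 ?_) h1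
    filter_upwards with x
    simp only [max_self, sub_zero, smul_zero, one_mul]
    rw [Real.norm_eq_abs, Real.norm_eq_abs, abs_of_nonneg (sq_nonneg x)]
    rcases le_total x 0 with h | h
    · rw [max_eq_right h]; simp; positivity
    · rw [max_eq_left h]; simp
  · rw [max_eq_left h.le]
    have h1 : HasDerivAt (fun y : ℝ => y ^ 2) (2 * y) y := by simpa using hasDerivAt_pow 2 y
    refine h1.congr_of_eventuallyEq ?_
    filter_upwards [Ioi_mem_nhds h] with x hx
    rw [max_eq_left (le_of_lt hx)]

/-- Approximate derivatives determine approximate functions, up to a constant. -/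
theorem close_of_deriv_close {l η m : ℝ} (hl : 0 < l) {f f' S T : ℝ → ℝ}
    (hf : ∀ x, HasDerivAt f (f' x) x) (hS : ∀ x, HasDerivAt S (T x - m) x) (hfl : f l = f 0)
    (hSl : S l = S 0) (hT : ∀ x ∈ Icc 0 l, |T x - f' x| ≤ η) {x : ℝ} (hx : x ∈ Icc 0 l) :
    |T x - m - f' x| ≤ 2 * η ∧ |S x - S 0 - (f x - f 0)| ≤ 2 * η * l := by
  have hd : ∀ x, HasDerivAt (fun x => S x - f x) (T x - m - f' x) x := fun x => (hS x).sub (hf x)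
  have hm : |m| ≤ η := by
    obtain ⟨t, ht, h⟩ := exists_hasDerivAt_eq_slope (fun x => S x - f x) (fun x => T x - m - f' x) hl
      (fun x _ => (hd x).continuousAt.continuousWithinAt) fun x _ => hd x
    have e : m = T t - f' t := by
      rw [hfl, hSl] at h; simp at h; linarith
    rw [e]
    exact hT t (Ioo_subset_Icc_self ht)
  have hb : ∀ x ∈ Icc 0 l, |T x - m - f' x| ≤ 2 * η := fun x hx => by
    have e : T x - m - f' x = (T x - f' x) - m := by ring
    rw [e]
    refine (abs_sub _ _).trans ?_
    linarith [hT x hx]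
  refine ⟨hb x hx, ?_⟩
  have h1 := (convex_Icc 0 l).norm_image_sub_le_of_norm_hasDerivWithin_le
    (fun x _ => (hd x).hasDerivWithinAt) hb (left_mem_Icc.2 hl.le) hx
  have h2 : S x - S 0 - (f x - f 0) = S x - f x - (S 0 - f 0) := by ring
  rw [h2]
  refine h1.trans ?_
  have hη : 0 ≤ 2 * η := (abs_nonneg _).trans (hb x hx)
  rw [sub_zero, Real.norm_eq_abs, abs_of_nonneg hx.1]
  gcongr
  exact hx.2

namespace Params

noncomputable section

variable (P : Params)

/-- The only obstruction to a trigonometric primitive is the mean m. It is small when T approximates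
the derivative of a periodic function, so approximating the derivative and integrating gives C¹
approximation. -/
theorem exists_primitive_of_mem_span_τ {T : ℝ → ℝ} (hT : T ∈ Submodule.span ℝ (range P.τ)) :
    ∃ (m : ℝ) (S : ℝ → ℝ), S ∈ Submodule.span ℝ (range P.τ) ∧ ∀ x, HasDerivAt S (T x - m) x := by
  induction hT using Submodule.span_induction with
  | mem T hT =>
    obtain ⟨k, rfl⟩ := hT
    by_cases hk : k = 0
    · subst hk
      refine ⟨P.τ 0 0, 0, zero_mem _, fun x => ?_⟩
      have : P.τ 0 x = P.τ 0 0 := by simp [τ, wx_zero]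
      rw [this, sub_self]
      exact hasDerivAt_const x 0
    · refine ⟨0, (-1 / P.wx k) • P.τ (-k), Submodule.smul_mem _ _ (Submodule.subset_span ⟨_, rfl⟩),
        fun x => ?_⟩
      have hw := P.wx_ne_zero hk
      refine ((P.hasDerivAt_τ_neg k x).const_mul (-1 / P.wx k)).congr_deriv ?_
      field_simp
      ring
  | zero => exact ⟨0, 0, zero_mem _, fun x => by simp⟩
  | add T₁ T₂ _ _ h₁ h₂ =>
    obtain ⟨m₁, S₁, hS₁, hd₁⟩ := h₁
    obtain ⟨m₂, S₂, hS₂, hd₂⟩ := h₂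
    refine ⟨m₁ + m₂, S₁ + S₂, add_mem hS₁ hS₂, fun x => ((hd₁ x).add (hd₂ x)).congr_deriv ?_⟩
    simp only [Pi.add_apply]; ring
  | smul r T _ h =>
    obtain ⟨m, S, hS, hd⟩ := h
    refine ⟨r * m, r • S, Submodule.smul_mem _ _ hS, fun x => ((hd x).const_mul r).congr_deriv ?_⟩
    simp only [Pi.smul_apply, smul_eq_mul]; ring

theorem periodic_of_mem_span_τ {T : ℝ → ℝ} (hT : T ∈ Submodule.span ℝ (range P.τ)) :
    Function.Periodic T P.L := by
  induction hT using Submodule.span_induction with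
  | mem T hT =>
    obtain ⟨k, rfl⟩ := hT
    exact P.τ_periodic k
  | zero => exact fun x => rfl
  | add T₁ T₂ _ _ h₁ h₂ => exact h₁.add h₂
  | smul r T _ h => exact fun x => by simp only [Pi.smul_apply, h x]

theorem exists_primitive_of_mem_span_cos {T : ℝ → ℝ}
    (hT : T ∈ Submodule.span ℝ (range fun (n : ℕ) (θ : ℝ) => Real.cos (n * θ))) :
    ∃ (m : ℝ) (S : ℝ → ℝ), S ∈ Submodule.span ℝ (range P.sn) ∧
      ∀ z, HasDerivAt S (T (Real.pi / P.h * z) - m) z := by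
  have hh := P.h_pos
  induction hT using Submodule.span_induction with
  | mem T hT =>
    obtain ⟨n, rfl⟩ := hT
    rcases n with _ | n
    · exact ⟨1, 0, zero_mem _, fun z => by simp⟩
    · have hs : 0 < √(2 / P.h) := by positivity
      have hw := P.wz_pos n
      refine ⟨0, (1 / (√(2 / P.h) * P.wz n)) • P.sn n,
        Submodule.smul_mem _ _ (Submodule.subset_span ⟨_, rfl⟩), fun z => ?_⟩
      refine ((P.hasDerivAt_sn n z).const_mul (1 / (√(2 / P.h) * P.wz n))).congr_deriv ?_
      have : ((n + 1 : ℕ) : ℝ) * (Real.pi / P.h * z) = P.wz n * z := by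
        simp only [wz]; push_cast; ring
      show _ = Real.cos (((n + 1 : ℕ) : ℝ) * (Real.pi / P.h * z)) - 0
      rw [this, cs]
      field_simp
      ring
  | zero => exact ⟨0, 0, zero_mem _, fun x => by simp⟩
  | add T₁ T₂ _ _ h₁ h₂ =>
    obtain ⟨m₁, S₁, hS₁, hd₁⟩ := h₁
    obtain ⟨m₂, S₂, hS₂, hd₂⟩ := h₂
    refine ⟨m₁ + m₂, S₁ + S₂, add_mem hS₁ hS₂, fun x => ((hd₁ x).add (hd₂ x)).congr_deriv ?_⟩
    simp only [Pi.add_apply]; ring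
  | smul r T _ h =>
    obtain ⟨m, S, hS, hd⟩ := h
    refine ⟨r * m, r • S, Submodule.smul_mem _ _ hS, fun x => ((hd x).const_mul r).congr_deriv ?_⟩
    simp only [Pi.smul_apply, smul_eq_mul]; ring

theorem vanish_of_mem_span_sn {T : ℝ → ℝ} (hT : T ∈ Submodule.span ℝ (range P.sn)) :
    T 0 = 0 ∧ T P.h = 0 := by
  induction hT using Submodule.span_induction with
  | mem T hT =>
    obtain ⟨k, rfl⟩ := hT
    exact ⟨P.sn_zero k, P.sn_h k⟩
  | zero => exact ⟨rfl, rfl⟩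
  | add T₁ T₂ _ _ h₁ h₂ => simp [h₁.1, h₁.2, h₂.1, h₂.2]
  | smul r T _ h => simp [h.1, h.2]

/-- `C¹` approximation of periodic functions by trigonometric sums. -/
theorem exists_τ_sum_near_one {A A' : ℝ → ℝ} (hA : ∀ x, HasDerivAt A (A' x) x) (hA' : Continuous A')
    (hp : Function.Periodic A P.L) (hp' : Function.Periodic A' P.L) {ε : ℝ} (hε : 0 < ε) :
    ∃ α : ℤ →₀ ℝ, ∀ x ∈ Icc 0 P.L, |(∑ k ∈ α.support, α k * P.τ k x) - A x| ≤ ε ∧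
      |(∑ k ∈ α.support, α k * (P.wx k * P.τ (-k) x)) - A' x| ≤ ε := by
  have hL := P.L_pos
  set η := ε / (2 * (P.L + 1)) with hη
  have hη0 : 0 < η := by positivity
  have hη1 : 2 * η ≤ ε ∧ 2 * η * P.L ≤ ε := by
    have : 2 * η * (P.L + 1) = ε := by rw [hη]; field_simp
    constructor <;> nlinarith
  obtain ⟨T, hT, hTA⟩ := P.exists_τ_sum_near hA' hp' hη0
  obtain ⟨m, S, hS, hSd⟩ := P.exists_primitive_of_mem_span_τ hT
  have hS' : (fun x => S x + (A 0 - S 0)) ∈ Submodule.span ℝ (range P.τ) := by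
    have h1 : (fun _ => A 0 - S 0 : ℝ → ℝ) ∈ Submodule.span ℝ (range P.τ) := by
      have : (fun _ => A 0 - S 0 : ℝ → ℝ) = ((A 0 - S 0) * √P.L) • P.τ 0 := by
        ext x
        have := Real.sqrt_pos.2 hL
        simp only [τ, wx_zero, Pi.smul_apply, zero_mul, Real.cos_zero, Real.sin_zero, add_zero,
          smul_eq_mul]
        field_simp
      rw [this]
      exact Submodule.smul_mem _ _ (Submodule.subset_span ⟨_, rfl⟩)
    exact add_mem hS h1
  obtain ⟨α, hα⟩ := Finsupp.mem_span_range_iff_exists_finsupp.1 hS'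
  have hαx : ∀ x, ∑ k ∈ α.support, α k * P.τ k x = S x + (A 0 - S 0) := fun x => by
    have := congrFun hα x
    rw [← this, Finsupp.sum, Finset.sum_apply]
    rfl
  have hαd : ∀ x, ∑ k ∈ α.support, α k * (P.wx k * P.τ (-k) x) = T x - m := fun x => by
    have h1 : HasDerivAt (fun x => ∑ k ∈ α.support, α k * P.τ k x)
        (∑ k ∈ α.support, α k * (P.wx k * P.τ (-k) x)) x :=
      HasDerivAt.fun_sum fun k _ => (P.hasDerivAt_τ k x).const_mul (α k)
    rw [funext hαx] at h1
    exact h1.unique ((hSd x).add_const _)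
  refine ⟨α, fun x hx => ?_⟩
  have hS0 : S P.L = S 0 := by simpa using P.periodic_of_mem_span_τ hS 0
  have hA0 : A P.L = A 0 := by simpa using hp 0
  obtain ⟨h1, h2⟩ := close_of_deriv_close hL hA hSd hA0 hS0 (fun x _ => (hTA x).le) hx
  rw [hαx, hαd]
  refine ⟨?_, h1.trans hη1.1⟩
  have e : S x + (A 0 - S 0) - A x = S x - S 0 - (A x - A 0) := by ring
  rw [e]
  exact h2.trans hη1.2

/-- `C¹` approximation of functions vanishing at the ends by sine sums. -/
theorem exists_sn_sum_near_one {A A' : ℝ → ℝ} (hA : ∀ x, HasDerivAt A (A' x) x) (hA' : Continuous A')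
    (h0 : A 0 = 0) (hh : A P.h = 0) {ε : ℝ} (hε : 0 < ε) :
    ∃ β : ℕ →₀ ℝ, ∀ z ∈ Icc 0 P.h, |(∑ n ∈ β.support, β n * P.sn n z) - A z| ≤ ε ∧
      |(∑ n ∈ β.support, β n * (P.wz n * P.cs n z)) - A' z| ≤ ε := by
  have hL := P.h_pos
  set η := ε / (2 * (P.h + 1)) with hη
  have hη0 : 0 < η := by positivity
  have hη1 : 2 * η ≤ ε ∧ 2 * η * P.h ≤ ε := by
    have : 2 * η * (P.h + 1) = ε := by rw [hη]; field_simp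
    constructor <;> nlinarith
  obtain ⟨p, hTA⟩ := P.exists_cos_polynomial_near hA'.continuousOn hη0
  obtain ⟨m, S, hS, hSd⟩ := P.exists_primitive_of_mem_span_cos (cos_polynomial_mem_span p)
  obtain ⟨β, hβ⟩ := Finsupp.mem_span_range_iff_exists_finsupp.1 hS
  have hβx : ∀ x, ∑ n ∈ β.support, β n * P.sn n x = S x := fun x => by
    have := congrFun hβ x
    rw [← this, Finsupp.sum, Finset.sum_apply]
    rfl
  have hβd : ∀ x, ∑ n ∈ β.support, β n * (P.wz n * P.cs n x)
      = p.eval (Real.cos (Real.pi / P.h * x)) - m := fun x => by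
    have h1 : HasDerivAt (fun x => ∑ n ∈ β.support, β n * P.sn n x)
        (∑ n ∈ β.support, β n * (P.wz n * P.cs n x)) x :=
      HasDerivAt.fun_sum fun n _ => (P.hasDerivAt_sn n x).const_mul (β n)
    rw [funext hβx] at h1
    exact h1.unique (hSd x)
  obtain ⟨hS0, hSh⟩ := P.vanish_of_mem_span_sn hS
  refine ⟨β, fun x hx => ?_⟩
  obtain ⟨h1, h2⟩ := close_of_deriv_close hL hA hSd (hh.trans h0.symm) (hSh.trans hS0.symm)
    (fun x hx => (hTA x hx).le) hx
  rw [hβx, hβd]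
  refine ⟨?_, h1.trans hη1.1⟩
  rw [hS0, h0, sub_zero, sub_zero] at h2
  exact h2.trans hη1.2

end

end Params

end RotatingBoussinesq

/-! ### A test velocity on which the form is positive. -/

namespace RotatingBoussinesq

open Filter Topology MeasureTheory

theorem abs_quadratic_sub_le {a b c u w u' w' M K η : ℝ} (ha : |a| ≤ M) (hb : |b| ≤ M) (hc : |c| ≤ M)
    (hu : |u| ≤ K) (hw : |w| ≤ K) (hu' : |u' - u| ≤ η) (hw' : |w' - w| ≤ η) (hη : η ≤ 1) :
    |(a * u' ^ 2 + 2 * b * (u' * w') + c * w' ^ 2) - (a * u ^ 2 + 2 * b * (u * w) + c * w ^ 2)|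
      ≤ 4 * M * (2 * K + 1) * η := by
  have hM : 0 ≤ M := (abs_nonneg _).trans ha
  have hK : 0 ≤ K := (abs_nonneg _).trans hu
  have hη0 : 0 ≤ η := (abs_nonneg _).trans hu'
  have key : ∀ {d x y x' y' : ℝ}, |d| ≤ M → |x| ≤ K → |y| ≤ K → |x' - x| ≤ η → |y' - y| ≤ η →
      |d * (x' * y' - x * y)| ≤ M * ((2 * K + 1) * η) := by
    intro d x y x' y' hd hx hy hx' hy'
    rw [abs_mul]
    refine mul_le_mul hd ?_ (abs_nonneg _) hM
    have e : x' * y' - x * y = (x' - x) * (y' - y) + (x' - x) * y + x * (y' - y) := by ring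
    rw [e]
    refine (abs_add_three _ _ _).trans ?_
    rw [abs_mul, abs_mul, abs_mul]
    have h1 : |x' - x| * |y' - y| ≤ η * 1 := mul_le_mul hx' (hy'.trans hη) (abs_nonneg _) hη0
    have h2 : |x' - x| * |y| ≤ η * K := mul_le_mul hx' hy (abs_nonneg _) hη0
    have h3 : |x| * |y' - y| ≤ K * η := mul_le_mul hx hy' (abs_nonneg _) hK
    linarith
  have e : (a * u' ^ 2 + 2 * b * (u' * w') + c * w' ^ 2) - (a * u ^ 2 + 2 * b * (u * w) + c * w ^ 2)
      = a * (u' * u' - u * u) + 2 * (b * (u' * w' - u * w)) + c * (w' * w' - w * w) := by ring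
  rw [e]
  refine (abs_add_three _ _ _).trans ?_
  rw [abs_mul 2, abs_two]
  linarith [key ha hu hu hu' hu', key hb hu hw hu' hw', key hc hw hw hw' hw']

namespace Params

noncomputable section

variable {P : Params}

/-- Tensor products of finite sums are velocities of finite combinations of the basis fields. -/
theorem sum_uB_wB (α : ℤ →₀ ℝ) (β : ℕ →₀ ℝ) : ∃ (s : Finset (Option (ℕ × ℤ)))
    (a : Option (ℕ × ℤ) → ℝ), ∀ q : ℝ × ℝ,
      ∑ i ∈ s, a i * P.uB i q = (∑ k ∈ α.support, α k * P.τ k q.1)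
        * ∑ n ∈ β.support, β n * (P.wz n * P.cs n q.2) ∧
      ∑ i ∈ s, a i * P.wB i q = -((∑ k ∈ α.support, α k * (P.wx k * P.τ (-k) q.1))
        * ∑ n ∈ β.support, β n * P.sn n q.2) := by
  refine ⟨(β.support ×ˢ α.support).map Function.Embedding.some,
    -- The factor ev undoes the normalization of the basis fields, whose stream functions are
    -- divided by it; the uniform flow is not used.
    fun i => i.elim 0 fun j => α j.2 * β j.1 * P.ev j.1 j.2, fun q => ⟨?_, ?_⟩⟩
  · rw [Finset.sum_map, Finset.sum_product, mul_comm, Finset.sum_mul_sum]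
    refine Finset.sum_congr rfl fun n _ => Finset.sum_congr rfl fun k _ => ?_
    have := P.ev_pos n k
    simp only [Function.Embedding.some_apply, Option.elim_some, uB, cB]
    field_simp
  · rw [Finset.sum_map, Finset.sum_product, mul_comm, Finset.sum_mul_sum, ← Finset.sum_neg_distrib]
    refine Finset.sum_congr rfl fun n _ => ?_
    rw [← Finset.sum_neg_distrib]
    refine Finset.sum_congr rfl fun k _ => ?_
    have := P.ev_pos n k
    simp only [Function.Embedding.some_apply, Option.elim_some, wB, sB]
    field_simp

/-- A quadratic form that is positive on the velocity of a product stream function is positive on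
some finite combination of the basis fields. -/
theorem exists_finite_positive {b₁₁ b₁₂ b₂₂ : ℝ × ℝ → ℝ} (h₁₁ : ContinuousOn b₁₁ P.closedStrip)
    (h₁₂ : ContinuousOn b₁₂ P.closedStrip) (h₂₂ : ContinuousOn b₂₂ P.closedStrip)
    {A A' D D' : ℝ → ℝ} (hA : ∀ x, HasDerivAt A (A' x) x) (cA : Continuous A')
    (pA : Function.Periodic A P.L) (pA' : Function.Periodic A' P.L)
    (hD : ∀ x, HasDerivAt D (D' x) x) (cD : Continuous D') (D0 : D 0 = 0) (Dh : D P.h = 0)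
    (hpos : 0 < ∫ q in P.cell, (b₁₁ q * (A q.1 * D' q.2) ^ 2
      + 2 * b₁₂ q * ((A q.1 * D' q.2) * -(A' q.1 * D q.2)) + b₂₂ q * (-(A' q.1 * D q.2)) ^ 2)) :
    ∃ (s : Finset (Option (ℕ × ℤ))) (a : Option (ℕ × ℤ) → ℝ),
      0 < ∫ q in P.cell, (b₁₁ q * (∑ i ∈ s, a i * P.uB i q) ^ 2
        + 2 * b₁₂ q * ((∑ i ∈ s, a i * P.uB i q) * ∑ i ∈ s, a i * P.wB i q)
        + b₂₂ q * (∑ i ∈ s, a i * P.wB i q) ^ 2) := by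
  have cA0 : Continuous A := continuous_iff_continuousAt.2 fun x => (hA x).continuousAt
  have cD0 : Continuous D := continuous_iff_continuousAt.2 fun x => (hD x).continuousAt
  have bd : ∀ {f : ℝ × ℝ → ℝ}, ContinuousOn f P.closedStrip → ∃ C, ∀ q ∈ P.cell, |f q| ≤ C :=
    fun hf => P.isCompact_cell.exists_bound_of_continuousOn (hf.mono P.cell_subset)
  obtain ⟨M₁, hM₁⟩ := bd h₁₁
  obtain ⟨M₂, hM₂⟩ := bd h₁₂
  obtain ⟨M₃, hM₃⟩ := bd h₂₂
  obtain ⟨K₁, hK₁⟩ := bd (by fun_prop : Continuous fun q : ℝ × ℝ => A q.1).continuousOn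
  obtain ⟨K₂, hK₂⟩ := bd (by fun_prop : Continuous fun q : ℝ × ℝ => A' q.1).continuousOn
  obtain ⟨K₃, hK₃⟩ := bd (by fun_prop : Continuous fun q : ℝ × ℝ => D q.2).continuousOn
  obtain ⟨K₄, hK₄⟩ := bd (by fun_prop : Continuous fun q : ℝ × ℝ => D' q.2).continuousOn
  set M := max M₁ (max M₂ M₃) with hM
  set K := max (max K₁ K₂) (max (max K₃ K₄) 1) with hK
  have hK1 : 1 ≤ K := (le_max_right _ _).trans (le_max_right _ _)
  have hK0 : 0 ≤ K := by linarith
  have hM0 : 0 ≤ M := by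
    have : ((0 : ℝ), (0 : ℝ)) ∈ P.cell :=
      ⟨left_mem_Icc.2 P.L_pos.le, left_mem_Icc.2 P.h_pos.le⟩
    exact ((abs_nonneg _).trans (hM₁ _ this)).trans (le_max_left _ _)
  set I := ∫ q in P.cell, (b₁₁ q * (A q.1 * D' q.2) ^ 2
      + 2 * b₁₂ q * ((A q.1 * D' q.2) * -(A' q.1 * D q.2)) + b₂₂ q * (-(A' q.1 * D q.2)) ^ 2)
    with hI
  set V := volume.real P.cell with hV
  have hV0 : 0 ≤ V := measureReal_nonneg
  set Q := 4 * M * (2 * K ^ 2 + 1) with hQ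
  have hQ0 : 0 ≤ Q := by positivity
  obtain ⟨ε, hε0, hε1, hεI⟩ : ∃ ε : ℝ, 0 < ε ∧ (2 * K + 1) * ε ≤ 1 ∧
      Q * ((2 * K + 1) * ε) * V < I := by
    refine ⟨min (1 / (2 * K + 1)) (I / (2 * (Q * (2 * K + 1) * V + 1))), by positivity, ?_, ?_⟩
    · calc _ ≤ (2 * K + 1) * (1 / (2 * K + 1)) := by gcongr; exact min_le_left _ _
        _ = 1 := by field_simp
    · have h1 : 0 < Q * (2 * K + 1) * V + 1 := by positivity
      calc _ = (Q * (2 * K + 1) * V) * min (1 / (2 * K + 1)) (I / (2 * (Q * (2 * K + 1) * V + 1))) := by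
            ring
        _ ≤ (Q * (2 * K + 1) * V + 1) * (I / (2 * (Q * (2 * K + 1) * V + 1))) := by
            gcongr
            · linarith
            · exact min_le_right _ _
        _ = I / 2 := by field_simp
        _ < I := by linarith
  have hε1' : ε ≤ 1 := by nlinarith
  obtain ⟨α, hα⟩ := P.exists_τ_sum_near_one hA cA pA pA' hε0
  obtain ⟨β, hβ⟩ := P.exists_sn_sum_near_one hD cD D0 Dh hε0
  obtain ⟨s, a, hsa⟩ := sum_uB_wB (P := P) α β
  refine ⟨s, a, ?_⟩
  have hprod : ∀ {x y x' y' : ℝ}, |x| ≤ K → |y| ≤ K → |x' - x| ≤ ε → |y' - y| ≤ ε →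
      |x' * y' - x * y| ≤ (2 * K + 1) * ε := by
    intro x y x' y' hx hy hx' hy'
    have e : x' * y' - x * y = (x' - x) * (y' - y) + (x' - x) * y + x * (y' - y) := by ring
    rw [e]
    refine (abs_add_three _ _ _).trans ?_
    rw [abs_mul, abs_mul, abs_mul]
    have h1 : |x' - x| * |y' - y| ≤ ε * 1 := mul_le_mul hx' (hy'.trans hε1') (abs_nonneg _) hε0.le
    have h2 : |x' - x| * |y| ≤ ε * K := mul_le_mul hx' hy (abs_nonneg _) hε0.le
    have h3 : |x| * |y' - y| ≤ K * ε := mul_le_mul hx hy' (abs_nonneg _) hK0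
    linarith
  set g₀ : ℝ × ℝ → ℝ := fun q => b₁₁ q * (A q.1 * D' q.2) ^ 2
      + 2 * b₁₂ q * ((A q.1 * D' q.2) * -(A' q.1 * D q.2)) + b₂₂ q * (-(A' q.1 * D q.2)) ^ 2 with hg₀
  set g₁ : ℝ × ℝ → ℝ := fun q => b₁₁ q * (∑ i ∈ s, a i * P.uB i q) ^ 2
        + 2 * b₁₂ q * ((∑ i ∈ s, a i * P.uB i q) * ∑ i ∈ s, a i * P.wB i q)
        + b₂₂ q * (∑ i ∈ s, a i * P.wB i q) ^ 2 with hg₁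
  have hdiff : ∀ q ∈ P.cell, ‖g₁ q - g₀ q‖ ≤ Q * ((2 * K + 1) * ε) := by
    intro q hq
    obtain ⟨a1, a2⟩ := hα q.1 hq.1
    obtain ⟨d1, d2⟩ := hβ q.2 hq.2
    have k1 : |A q.1| ≤ K := (hK₁ q hq).trans ((le_max_left _ _).trans (le_max_left _ _))
    have k2 : |A' q.1| ≤ K := (hK₂ q hq).trans ((le_max_right _ _).trans (le_max_left _ _))
    have k3 : |D q.2| ≤ K := (hK₃ q hq).trans
      ((le_max_left _ _).trans ((le_max_left _ _).trans (le_max_right _ _)))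
    have k4 : |D' q.2| ≤ K := (hK₄ q hq).trans
      ((le_max_right _ _).trans ((le_max_left _ _).trans (le_max_right _ _)))
    refine abs_quadratic_sub_le (M := M) (K := K ^ 2) ((hM₁ q hq).trans (le_max_left _ _))
      ((hM₂ q hq).trans ((le_max_left _ _).trans (le_max_right _ _)))
      ((hM₃ q hq).trans ((le_max_right _ _).trans (le_max_right _ _))) ?_ ?_ ?_ ?_ hε1
    · rw [abs_mul, pow_two]; exact mul_le_mul k1 k4 (abs_nonneg _) hK0
    · rw [abs_neg, abs_mul, pow_two]; exact mul_le_mul k2 k3 (abs_nonneg _) hK0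
    · rw [(hsa q).1]; exact hprod k1 k4 a1 d2
    · rw [(hsa q).2, ← neg_sub', abs_neg]; exact hprod k2 k3 a2 d1
  have c1 : ContinuousOn g₁ P.closedStrip := by fun_prop
  have c0 : ContinuousOn g₀ P.closedStrip := by
    have e1 : Continuous fun q : ℝ × ℝ => A q.1 * D' q.2 := by fun_prop
    have e2 : Continuous fun q : ℝ × ℝ => -(A' q.1 * D q.2) := by fun_prop
    exact ((h₁₁.mul (e1.pow 2).continuousOn).add ((continuousOn_const.mul h₁₂).mul
      (e1.mul e2).continuousOn)).add (h₂₂.mul (e2.pow 2).continuousOn)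
  have i1 : IntegrableOn g₁ P.cell := (c1.mono P.cell_subset).integrableOn_compact P.isCompact_cell
  have i0 : IntegrableOn g₀ P.cell := (c0.mono P.cell_subset).integrableOn_compact P.isCompact_cell
  have h1 := norm_setIntegral_le_of_norm_le_const
    (P.isCompact_cell.measure_lt_top (μ := volume)) hdiff
  rw [integral_sub i1 i0, Real.norm_eq_abs] at h1
  have h2 := (abs_le.1 h1).1
  have h3 : (∫ q in P.cell, g₀ q) = I := rfl
  rw [h3] at h2
  linarith

/-- The form `δ (g₁ U + g₂ W)² + κ U²` is positive on some finite combination of the basis fields if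
`δ` is positive at some point. -/
theorem exists_positive_field {δ g₁ g₂ : ℝ × ℝ → ℝ} {κ : ℝ} (hκ : 0 ≤ κ)
    (cδ : ContinuousOn δ P.closedStrip) (c₁ : ContinuousOn g₁ P.closedStrip)
    (c₂ : ContinuousOn g₂ P.closedStrip) (pδ : P.PeriodicX δ) {q₀ : ℝ × ℝ}
    (hq₀ : q₀ ∈ P.strip) (hL : q₀.1 ∈ Icc 0 P.L) (hδ : 0 < δ q₀)
    (hne : κ ≠ 0 ∨ g₁ q₀ ≠ 0 ∨ g₂ q₀ ≠ 0) :
    ∃ (s : Finset (Option (ℕ × ℤ))) (a : Option (ℕ × ℤ) → ℝ),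
      0 < ∫ q in P.cell, ((δ q * g₁ q ^ 2 + κ) * (∑ i ∈ s, a i * P.uB i q) ^ 2
        + 2 * (δ q * g₁ q * g₂ q) * ((∑ i ∈ s, a i * P.uB i q) * ∑ i ∈ s, a i * P.wB i q)
        + (δ q * g₂ q ^ 2) * (∑ i ∈ s, a i * P.wB i q) ^ 2) := by
  have hLp := P.L_pos
  have hpi := Real.pi_pos
  obtain ⟨x₀, z₀⟩ := q₀
  have hV : {q | 0 < δ q} ∩ P.strip ∈ 𝓝 (x₀, z₀) := by
    have h1 : ContinuousAt δ (x₀, z₀) := (cδ.mono P.strip_subset).continuousAt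
      (P.isOpen_strip.mem_nhds hq₀)
    exact inter_mem (h1.eventually (lt_mem_nhds hδ)) (P.isOpen_strip.mem_nhds hq₀)
  obtain ⟨r₀, hr₀, hball⟩ := Metric.mem_nhds_iff.1 hV
  -- At most half a period, so that on [0, r] the cosine of 2πx/L decreases and a superlevel set of
  -- it is an interval modulo L.
  set r := min r₀ (P.L / 2) with hr
  have hr0 : 0 < r := lt_min hr₀ (by positivity)
  have hrL : r ≤ P.L / 2 := min_le_right _ _
  have hbox : ∀ x z, |x - x₀| < r → |z - z₀| < r → 0 < δ (x, z) ∧ (x, z) ∈ P.strip := by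
    intro x z hx hz
    have : (x, z) ∈ Metric.ball (x₀, z₀) r₀ := by
      rw [Metric.mem_ball, Prod.dist_eq, Real.dist_eq, Real.dist_eq]
      exact max_lt (hx.trans_le (min_le_left _ _)) (hz.trans_le (min_le_left _ _))
    exact hball this
  set μ := 2 * Real.pi / P.L with hμ
  have hμ0 : 0 < μ := by positivity
  set cr := Real.cos (μ * r) with hcr
  have hμr : 0 < μ * r := by positivity
  have hμr' : μ * r ≤ Real.pi := by
    calc μ * r ≤ μ * (P.L / 2) := by gcongr
      _ = Real.pi := by rw [hμ]; field_simp
  have hcr1 : cr < 1 := by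
    rw [← Real.cos_zero]
    exact Real.strictAntiOn_cos ⟨le_rfl, hpi.le⟩ ⟨hμr.le, hμr'⟩ hμr
  -- Up to a positive factor, (t, -σ) will be the velocity at the centre: a zonal velocity if κ ≠ 0,
  -- a velocity along (g₁, g₂) otherwise.
  obtain ⟨σ, t, hst⟩ : ∃ σ t : ℝ, κ * t ^ 2 ≠ 0 ∨ g₁ (x₀, z₀) * t - g₂ (x₀, z₀) * σ ≠ 0 := by
    rcases hne with h | h
    · exact ⟨0, 1, Or.inl (by simpa using h)⟩
    · refine ⟨-g₂ (x₀, z₀), g₁ (x₀, z₀), Or.inr ?_⟩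
      have : 0 < g₁ (x₀, z₀) ^ 2 + g₂ (x₀, z₀) ^ 2 := by rcases h with h | h <;> positivity
      nlinarith
  set s := σ / μ with hs
  -- A periodic bump supported within distance r of x₀ modulo L, times a factor producing the
  -- prescribed slope at x₀; s = σ/μ compensates the frequency of the sine.
  set A : ℝ → ℝ := fun x => max (Real.cos (μ * (x - x₀)) - cr) 0 ^ 2
    * (1 + s * Real.sin (μ * (x - x₀))) with hAdef
  set A' : ℝ → ℝ := fun x => 2 * max (Real.cos (μ * (x - x₀)) - cr) 0
      * (-Real.sin (μ * (x - x₀)) * μ) * (1 + s * Real.sin (μ * (x - x₀)))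
    + max (Real.cos (μ * (x - x₀)) - cr) 0 ^ 2 * (s * (Real.cos (μ * (x - x₀)) * μ)) with hA'def
  set D : ℝ → ℝ := fun z => max (r ^ 2 - (z - z₀) ^ 2) 0 ^ 2 * (1 + t * (z - z₀)) with hDdef
  set D' : ℝ → ℝ := fun z => 2 * max (r ^ 2 - (z - z₀) ^ 2) 0 * (-(2 * (z - z₀)))
      * (1 + t * (z - z₀)) + max (r ^ 2 - (z - z₀) ^ 2) 0 ^ 2 * t with hD'def
  have hA : ∀ x, HasDerivAt A (A' x) x := fun x => by
    have l : HasDerivAt (fun x => μ * (x - x₀)) μ x := by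
      simpa using ((hasDerivAt_id x).sub_const x₀).const_mul μ
    have h1 := HasDerivAt.comp (h := fun x => Real.cos (μ * (x - x₀)) - cr) x
      (hasDerivAt_sq_posPart _) (l.cos.sub_const cr)
    exact (h1.mul ((l.sin.const_mul s).const_add 1)).congr_deriv (by simp only [hA'def]; rfl)
  have hD : ∀ z, HasDerivAt D (D' z) z := fun z => by
    have l : HasDerivAt (fun z => z - z₀) 1 z := (hasDerivAt_id z).sub_const z₀
    have h1 := HasDerivAt.comp (h := fun z => r ^ 2 - (z - z₀) ^ 2) z
      (hasDerivAt_sq_posPart _) ((l.pow 2).const_sub (r ^ 2))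
    refine (h1.mul ((l.const_mul t).const_add 1)).congr_deriv ?_
    simp only [hD'def, Function.comp]
    ring
  have hcos : ∀ x, Real.cos (μ * (x + P.L - x₀)) = Real.cos (μ * (x - x₀)) := fun x => by
    have : μ * (x + P.L - x₀) = μ * (x - x₀) + 2 * Real.pi := by rw [hμ]; field_simp; ring
    rw [this, Real.cos_add_two_pi]
  have hsin : ∀ x, Real.sin (μ * (x + P.L - x₀)) = Real.sin (μ * (x - x₀)) := fun x => by
    have : μ * (x + P.L - x₀) = μ * (x - x₀) + 2 * Real.pi := by rw [hμ]; field_simp; ring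
    rw [this, Real.sin_add_two_pi]
  have Dzero : ∀ z, r ≤ |z - z₀| → max (r ^ 2 - (z - z₀) ^ 2) 0 = 0 := fun z hz => by
    refine max_eq_right ?_
    rw [← sq_abs (z - z₀)]
    nlinarith
  -- The box of radius r lies in the open strip, so it cannot reach either boundary, and D vanishes
  -- at z = 0 and z = h.
  have hz0 : r ≤ |0 - z₀| := by
    by_contra hcon
    exact lt_irrefl _ (hbox x₀ 0 (by simpa using hr0) (not_le.1 hcon)).2.2.1
  have hzh : r ≤ |P.h - z₀| := by
    by_contra hcon
    exact lt_irrefl _ (hbox x₀ P.h (by simpa using hr0) (not_le.1 hcon)).2.2.2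
  refine exists_finite_positive (A := A) (A' := A') (D := D) (D' := D')
    ((cδ.mul (c₁.pow 2)).add continuousOn_const) ((cδ.mul c₁).mul c₂) (cδ.mul (c₂.pow 2)) hA
    (by fun_prop) (fun x => by simp only [hAdef, hcos, hsin])
    (fun x => by simp only [hA'def, hcos, hsin]) hD (by fun_prop)
    (by simp only [hDdef]; rw [Dzero 0 hz0]; ring) (by simp only [hDdef]; rw [Dzero P.h hzh]; ring) ?_
  have cA' : Continuous A' := by fun_prop
  have cD' : Continuous D' := by fun_prop
  have cA : Continuous A := by fun_prop
  have cD : Continuous D := by fun_prop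
  set g : ℝ × ℝ → ℝ := fun q => (δ q * g₁ q ^ 2 + κ) * (A q.1 * D' q.2) ^ 2
    + 2 * (δ q * g₁ q * g₂ q) * (A q.1 * D' q.2 * -(A' q.1 * D q.2))
    + δ q * g₂ q ^ 2 * (-(A' q.1 * D q.2)) ^ 2 with hg
  have hg' : ∀ q, g q = δ q * (g₁ q * (A q.1 * D' q.2) - g₂ q * (A' q.1 * D q.2)) ^ 2
      + κ * (A q.1 * D' q.2) ^ 2 := fun q => by simp only [hg]; ring
  have cg : ContinuousOn g P.cell := by
    have e1 : Continuous fun q : ℝ × ℝ => A q.1 * D' q.2 := by fun_prop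
    have e2 : Continuous fun q : ℝ × ℝ => A' q.1 * D q.2 := by fun_prop
    rw [funext hg']
    exact ((cδ.mul (((c₁.mul e1.continuousOn).sub (c₂.mul e2.continuousOn)).pow 2)).add
      (continuousOn_const.mul (e1.continuousOn.pow 2))).mono P.cell_subset
  have hg0 : ∀ q ∈ P.cell, 0 ≤ g q := by
    rintro ⟨x, z⟩ ⟨hx, hz⟩
    rw [hg']
    have hκ' : 0 ≤ κ * (A x * D' z) ^ 2 := by positivity
    by_cases h1 : Real.cos (μ * (x - x₀)) ≤ cr
    · have : max (Real.cos (μ * (x - x₀)) - cr) 0 = 0 := max_eq_right (by linarith)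
      simp only [hAdef, hA'def, this]
      simp
    by_cases h2 : r ≤ |z - z₀|
    · simp only [hDdef, hD'def, Dzero z h2]
      simp
    push Not at h1 h2
    -- Translating x by a multiple of L brings it within half a period of x₀; the cosine condition
    -- then places it in the box where δ > 0.
    have hδx : 0 ≤ δ (x, z) := by
      set n := round ((x - x₀) / P.L) with hn
      set y := x - n * P.L with hy
      have hyL : |y - x₀| ≤ P.L / 2 := by
        have h3 := abs_sub_round ((x - x₀) / P.L)
        have e : y - x₀ = ((x - x₀) / P.L - n) * P.L := by rw [hy]; field_simp; ring
        rw [e, abs_mul, abs_of_pos hLp]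
        calc _ ≤ 1 / 2 * P.L := by gcongr
          _ = _ := by ring
      have hcy : Real.cos (μ * |y - x₀|) = Real.cos (μ * (x - x₀)) := by
        rw [← abs_of_pos hμ0, ← abs_mul, Real.cos_abs, abs_of_pos hμ0]
        have : μ * (y - x₀) = μ * (x - x₀) - n * (2 * Real.pi) := by rw [hy, hμ]; field_simp; ring
        rw [this, Real.cos_sub_int_mul_two_pi]
      have hyr : |y - x₀| < r := by
        by_contra hcon
        have h4 : μ * r ≤ μ * |y - x₀| := mul_le_mul_of_nonneg_left (not_lt.1 hcon) hμ0.le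
        have h5 : μ * |y - x₀| ≤ Real.pi := by
          calc μ * |y - x₀| ≤ μ * (P.L / 2) := by gcongr
            _ = Real.pi := by rw [hμ]; field_simp
        have h6 := Real.strictAntiOn_cos.antitoneOn ⟨hμr.le, hμr'⟩ ⟨hμr.le.trans h4, h5⟩ h4
        rw [hcy] at h6
        linarith
      have hp : Function.Periodic (fun x => δ (x, z)) P.L := fun x => pδ x z hz
      have h7 : δ (y, z) = δ (x, z) := hp.sub_int_mul_eq n
      rw [← h7]
      exact (hbox y z hyr h2).1.le
    positivity
  refine lt_of_le_of_ne (setIntegral_nonneg P.measurableSet_cell hg0) fun h0 => ?_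
  have hcell : (x₀, z₀) ∈ P.cell := ⟨hL, Ioo_subset_Icc_self hq₀.2⟩
  have h1 := eq_zero_of_integral_cell_eq_zero cg hg0 h0.symm (x₀, z₀) hcell
  have vA : A x₀ = (1 - cr) ^ 2 := by
    simp only [hAdef, sub_self, mul_zero, Real.cos_zero, Real.sin_zero, add_zero, mul_one]
    rw [max_eq_left (by linarith)]
  have vA' : A' x₀ = (1 - cr) ^ 2 * σ := by
    simp only [hA'def, sub_self, mul_zero, Real.cos_zero, Real.sin_zero, neg_zero, zero_mul, zero_add]
    rw [max_eq_left (by linarith), hs]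
    field_simp
  have vD : D z₀ = r ^ 4 := by
    simp only [hDdef, sub_self, mul_zero]
    rw [max_eq_left (by rw [zero_pow two_ne_zero, sub_zero]; positivity)]; ring
  have vD' : D' z₀ = r ^ 4 * t := by
    simp only [hD'def, sub_self, mul_zero, neg_zero, zero_mul, zero_add]
    rw [max_eq_left (by rw [zero_pow two_ne_zero, sub_zero]; positivity)]; ring
  rw [hg'] at h1
  simp only [vA, vA', vD, vD'] at h1
  have hR : 0 < ((1 - cr) ^ 2 * r ^ 4) ^ 2 := by
    have : 0 < 1 - cr := by linarith
    positivity
  have h2 : ((1 - cr) ^ 2 * r ^ 4) ^ 2 * (δ (x₀, z₀) * (g₁ (x₀, z₀) * t - g₂ (x₀, z₀) * σ) ^ 2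
      + κ * t ^ 2) = 0 := by rw [← h1]; ring
  have h3 := (mul_eq_zero.1 h2).resolve_left hR.ne'
  have h4 : 0 ≤ δ (x₀, z₀) * (g₁ (x₀, z₀) * t - g₂ (x₀, z₀) * σ) ^ 2 := by positivity
  have h5 : 0 ≤ κ * t ^ 2 := by positivity
  rcases hst with h | h
  · exact h (by linarith)
  · have : 0 < δ (x₀, z₀) * (g₁ (x₀, z₀) * t - g₂ (x₀, z₀) * σ) ^ 2 := by positivity
    linarith

end

end Params

end RotatingBoussinesq

/-! ### The growing mode and the theorem. -/

namespace RotatingBoussinesq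

open Filter Topology MeasureTheory

namespace Params

noncomputable section

variable {P : Params}

/-- Eliminating ρ and v leaves the momentum equations with the matrix δ ∇Ψ⊗∇Ψ + κ e₁⊗e₁; ρ and v are
recovered from the velocity by division by λ. -/
theorem linearlyUnstable {Ψ δ : ℝ × ℝ → ℝ} (hΨ : ContDiffOn ℝ 2 Ψ P.closedStrip)
    (hδ : ContDiffOn ℝ 2 δ P.closedStrip) (pΨ : P.PeriodicX Ψ) (pδ : P.PeriodicX δ)
    (hh : ∀ q ∈ P.strip, P.lap Ψ q = 0) {a₀ a₁ : ℝ} {ρs : ℝ × ℝ → ℝ}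
    (hρx : ∀ q ∈ P.strip, P.dx ρs q = δ q * P.dx Ψ q)
    (hρz : ∀ q ∈ P.strip, P.dz ρs q = δ q * P.dz Ψ q) (hpos : ∃ q ∈ P.strip, 0 < δ q)
    (hf : P.f + a₀ ≤ 0)
    (hne : P.f + a₀ = 0 → ∃ q ∈ P.strip, P.dx Ψ q ≠ 0 ∨ P.dz Ψ q ≠ 0) :
    P.LinearlyUnstable Ψ ρs (steadyV a₀ a₁) := by
  have hfp := P.f_pos
  set κ := -(P.f * (P.f + a₀)) with hκdef
  have hκ : 0 ≤ κ := by rw [hκdef]; nlinarith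
  have hΨs := hΨ.mono P.strip_subset
  have hle : (1 : WithTop ℕ∞) ≤ 2 := by norm_num
  have hδ1 := hδ.of_le hle
  have cx := contDiffOn_one_dx hΨ
  have cz := contDiffOn_one_dz hΨ
  obtain ⟨cx', cz'⟩ := contDiffOn_grad_of_lap hΨs hh
  have hδ' := hδ.mono P.strip_subset
  -- In the degenerate case κ = 0 the point is moved within the open set δ > 0 to one where ∇Ψ ≠ 0,
  -- which unique continuation provides.
  obtain ⟨q₁, hq₁, hδq₁, hg₁⟩ : ∃ q ∈ P.strip, 0 < δ q ∧
      (κ ≠ 0 ∨ P.dx Ψ q ≠ 0 ∨ P.dz Ψ q ≠ 0) := by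
    obtain ⟨q, hq, hδq⟩ := hpos
    by_cases h0 : P.f + a₀ = 0
    · have hV : {q | 0 < δ q} ∈ 𝓝 q := ((hδ1.mono P.strip_subset).continuousOn.continuousAt
        (P.isOpen_strip.mem_nhds hq)).eventually (lt_mem_nhds hδq)
      obtain ⟨y, hy, h⟩ := exists_grad_ne_zero hΨs hh (hne h0) hq hV
      exact ⟨y, hy.2, hy.1, Or.inr h⟩
    · exact ⟨q, hq, hδq, Or.inl (neg_ne_zero.2 (mul_ne_zero hfp.ne' h0))⟩
  -- Periodicity moves the point into the cell of integration.
  obtain ⟨q₀, hq₀, hL, hδq₀, hg₀⟩ : ∃ q ∈ P.strip, q.1 ∈ Icc 0 P.L ∧ 0 < δ q ∧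
      (κ ≠ 0 ∨ P.dx Ψ q ≠ 0 ∨ P.dz Ψ q ≠ 0) := by
    obtain ⟨x, z⟩ := q₁
    have hz : z ∈ Icc 0 P.h := Ioo_subset_Icc_self hq₁.2
    have hp : Function.Periodic (fun x => (δ (x, z), P.dx Ψ (x, z), P.dz Ψ (x, z))) P.L := fun x => by
      simp only [pδ x z hz, pΨ.dx x z hz, pΨ.dz x z hz]
    obtain ⟨y, hy, he⟩ := hp.exists_mem_Ico₀ P.L_pos x
    simp only [Prod.mk.injEq] at he
    refine ⟨(y, z), ⟨mem_univ _, hq₁.2⟩, Ico_subset_Icc_self hy, ?_⟩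
    rw [← he.1, ← he.2.1, ← he.2.2]
    exact ⟨hδq₁, hg₁⟩
  obtain ⟨s, a, hI⟩ := exists_positive_field hκ hδ1.continuousOn cx.continuousOn cz.continuousOn pδ
    hq₀ hL hδq₀ hg₀
  obtain ⟨lam, hlam, u, w, p, hu, hw, cp, hu2, hw2, cp1, pu, pw, pp, hbc, hdiv, hmu, hmw, hnz⟩ :=
    exists_regular_mode (b₁₁ := fun q => δ q * P.dx Ψ q ^ 2 + κ)
      (b₁₂ := fun q => δ q * P.dx Ψ q * P.dz Ψ q) (b₂₂ := fun q => δ q * P.dz Ψ q ^ 2)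
      ((hδ1.mul (cx.pow 2)).add contDiffOn_const) ((hδ1.mul cx).mul cz) (hδ1.mul (cz.pow 2))
      ((hδ'.mul (cx'.pow 2)).add contDiffOn_const) ((hδ'.mul cx').mul cz') (hδ'.mul (cz'.pow 2))
      (fun x z hz => by simp only [pδ x z hz, pΨ.dx x z hz])
      (fun x z hz => by simp only [pδ x z hz, pΨ.dx x z hz, pΨ.dz x z hz])
      (fun x z hz => by simp only [pδ x z hz, pΨ.dz x z hz]) hI
  have hl := hlam.ne'
  refine ⟨lam, hlam, fun q => -(δ q * (P.dx Ψ q * u q + P.dz Ψ q * w q)) / lam,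
    fun q => -((P.f + a₀) * u q) / lam, u, w, p, ?_, hnz⟩
  exact
    { ρ_smooth := ((hδ1.mul ((cx.mul hu).add (cz.mul hw))).neg).div_const _
      v_smooth := ((contDiffOn_const.mul hu).neg).div_const _
      u_smooth := hu
      w_smooth := hw
      p_cont := cp
      u_smooth_int := hu2
      w_smooth_int := hw2
      p_smooth_int := cp1
      ρ_periodic := fun x z hz => by
        simp only [pδ x z hz, pΨ.dx x z hz, pΨ.dz x z hz, pu x z hz, pw x z hz]
      v_periodic := fun x z hz => by simp only [pu x z hz]
      u_periodic := pu
      w_periodic := pw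
      p_periodic := pp
      eq_ρ := fun q hq => by
        rw [hρx q hq, hρz q hq]
        simp only [smul_eq_mul]
        field_simp
      eq_v := fun q hq => by
        rw [dx_steadyV, dz_steadyV]
        simp only [smul_eq_mul]
        field_simp
        ring
      eq_u := fun q hq => by
        rw [hmu q hq]
        simp only [smul_eq_mul, hκdef]
        field_simp
        ring
      eq_w := fun q hq => by
        rw [hmw q hq]
        simp only [smul_eq_mul]
        field_simp
        ring
      div_free := hdiv
      bc := hbc }

end

end Params

end RotatingBoussinesq

theorem theorem1p1 (P : RotatingBoussinesq.Params) (Ψ δ : ℝ × ℝ → ℝ)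
    (hΨ : ContDiffOn ℝ 2 Ψ P.closedStrip) (hδ : ContDiffOn ℝ 2 δ P.closedStrip)
    (hΨ_per : P.PeriodicX Ψ) (hδ_per : P.PeriodicX δ)
    (hΨ_harm : ∀ q ∈ P.strip, P.lap Ψ q = 0)
    (a₀ a₁ : ℝ) (ρs ps : ℝ × ℝ → ℝ) (hs : P.IsSteadyState Ψ δ a₀ a₁ ρs ps) :
    ((∃ q ∈ P.strip, 0 < δ q) → P.f + a₀ ≤ 0 →
      -- a constant potential is excluded in the degenerate case only
      (P.f + a₀ = 0 → ∃ q ∈ P.strip, P.dx Ψ q ≠ 0 ∨ P.dz Ψ q ≠ 0) →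
      P.LinearlyUnstable Ψ ρs (RotatingBoussinesq.steadyV a₀ a₁)) ∧
    ((∃ δ₀ : ℝ, δ₀ < 0 ∧ ∀ q ∈ P.strip, δ q < δ₀) → 0 < P.f + a₀ →
      P.LinearlyStable Ψ ρs (RotatingBoussinesq.steadyV a₀ a₁)) := by
  exact ⟨fun hpos hf hne => RotatingBoussinesq.Params.linearlyUnstable hΨ hδ hΨ_per hδ_per hΨ_harm
      hs.grad_ρs_x hs.grad_ρs_z hpos hf hne,
    fun ⟨_, hδ₀, hlt⟩ hf =>
      ⟨RotatingBoussinesq.Params.spectrallyStable hΨ hδ.continuousOn hs hδ₀ hlt hf,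
        RotatingBoussinesq.Params.lyapunovStable hΨ hδ.continuousOn hδ_per hs hδ₀ hlt hf⟩⟩
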